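/- **Theorem 1.4 (Deterministic Set Disjointness Hardness).** Write $[m]=\{1,\dots,m\}$. Algorithms are deterministic programs for the word RAM with words of $O(\log n)$ bits and unit-time arithmetic, comparison, bit and memory-access operations. *3SUM over $[U]$:* given a set $A\subseteq[U]$ of size $n$, decide whether there are $a,b,c\in A$ with $a+b=c$. *Deterministic 3SUM hypothesis:* for every $\varepsilon>0$ there is a constant $c$ such that no deterministic algorithm solves 3SUM over $[n^c]$ in time $O(n^{2-\varepsilon})$. *Offline Set Disjointness:* given sets $S_1,\dots,S_N\subseteq[U]$, each of size at most $s$, and a set $Q\subseteq[N]^2$ of $q$ queries, report for each query $(i,j)\in Q$ whether $S_i\cap S_j=\emptyset$. Let $0\le\alpha<1$ and assume the deterministic 3SUM hypothesis. Then for every $\varepsilon>0$ and all constants $C_1,C_2,C_3,C_4>0$ there is no deterministic algorithm that, given any $n\ge1$ and any instance of offline Set Disjointness with $$U\le C_1\,n^{2-2\alpha},\qquad N\le C_2\,n,\qquad s\le C_3\,n^{1-\alpha},\qquad q\le C_4\,n^{1+\alpha},$$ solves the instance in time $O(n^{2-\varepsilon})$. -/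

import Mathlib

/-! ## Deterministic algorithms: a word RAM with a step count

Programs are finite and are written in a structured language over a fixed finite set of registers
and a fixed finite set of random-access arrays of words. Arithmetic, comparison, bit operations and
array accesses at a computed address take unit time. -/

namespace WordRAM

/-- The unit-time operations on words. -/
inductive Op
  | add | sub | mul | div | mod
  | eq | lt | le
  | and | or | xor | shl | shr

/-- The value of an operation. Subtraction is truncated at `0`, comparisons return `0` or `1`. -/
def Op.eval : Op → ℕ → ℕ → ℕ
  | .add, a, b => a + b
  | .sub, a, b => a - b
  | .mul, a, b => a * b
  | .div, a, b => a / b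
  | .mod, a, b => a % b
  | .eq, a, b => if a = b then 1 else 0
  | .lt, a, b => if a < b then 1 else 0
  | .le, a, b => if a ≤ b then 1 else 0
  | .and, a, b => a &&& b
  | .or, a, b => a ||| b
  | .xor, a, b => a ^^^ b
  | .shl, a, b => a <<< b
  | .shr, a, b => a >>> b

/-- The contents of the registers `reg x` and of the arrays, `arr a i` being cell `i` of
array `a`. -/
structure State where
  reg : ℕ → ℕ
  arr : ℕ → ℕ → ℕ

/-- Expressions: a literal, a register, an array cell at a computed address, an operation. -/
inductive Expr
  | const (k : ℕ)
  | reg (x : ℕ)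
  | read (a : ℕ) (i : Expr)
  | op (o : Op) (e₁ e₂ : Expr)

/-- The value of an expression. -/
def Expr.eval (σ : State) : Expr → ℕ
  | .const k => k
  | .reg x => σ.reg x
  | .read a i => σ.arr a (i.eval σ)
  | .op o e₁ e₂ => o.eval (e₁.eval σ) (e₂.eval σ)

/-- The number of steps for evaluating an expression: one per node. -/
def Expr.cost : Expr → ℕ
  | .const _ => 1
  | .reg _ => 1
  | .read _ i => i.cost + 1
  | .op _ e₁ e₂ => e₁.cost + e₂.cost + 1

/-- Every value that occurs in the evaluation (array addresses included) is a word of `w` bits. -/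
def Expr.Fits (w : ℕ) (σ : State) : Expr → Prop
  | .const k => k < 2 ^ w
  | .reg x => σ.reg x < 2 ^ w
  | .read a i => i.Fits w σ ∧ σ.arr a (i.eval σ) < 2 ^ w
  | .op o e₁ e₂ => e₁.Fits w σ ∧ e₂.Fits w σ ∧ o.eval (e₁.eval σ) (e₂.eval σ) < 2 ^ w

/-- Programs. Conditions are true when they are nonzero. -/
inductive Program
  | skip
  | assign (x : ℕ) (e : Expr)
  | write (a : ℕ) (i e : Expr)
  | seq (p₁ p₂ : Program)
  | ite (e : Expr) (p₁ p₂ : Program)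
  | loop (e : Expr) (p : Program)

/-- Store `v` in register `x`. -/
def State.setReg (σ : State) (x v : ℕ) : State :=
  { σ with reg := Function.update σ.reg x v }

/-- Store `v` in cell `i` of array `a`. -/
def State.setArr (σ : State) (a i v : ℕ) : State :=
  { σ with arr := Function.update σ.arr a (Function.update (σ.arr a) i v) }

/-- `Exec w p σ t σ'`: with words of `w` bits, the program `p` started in `σ` halts after
exactly `t` steps in `σ'`. A run that overflows the word size, and a run that does not halt,
satisfies this for no `t` and no `σ'`. -/
inductive Exec (w : ℕ) : Program → State → ℕ → State → Prop
  | skip (σ : State) : Exec w .skip σ 1 σ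
  | assign (σ : State) (x : ℕ) (e : Expr) (he : e.Fits w σ) :
      Exec w (.assign x e) σ (e.cost + 1) (σ.setReg x (e.eval σ))
  | write (σ : State) (a : ℕ) (i e : Expr) (hi : i.Fits w σ) (he : e.Fits w σ) :
      Exec w (.write a i e) σ (i.cost + e.cost + 1) (σ.setArr a (i.eval σ) (e.eval σ))
  | seq {p₁ p₂ : Program} {σ σ₁ σ₂ : State} {t₁ t₂ : ℕ}
      (h₁ : Exec w p₁ σ t₁ σ₁) (h₂ : Exec w p₂ σ₁ t₂ σ₂) :
      Exec w (.seq p₁ p₂) σ (t₁ + t₂) σ₂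
  | iteTrue {e : Expr} {p₁ p₂ : Program} {σ σ' : State} {t : ℕ} (he : e.Fits w σ)
      (hc : e.eval σ ≠ 0) (h : Exec w p₁ σ t σ') :
      Exec w (.ite e p₁ p₂) σ (e.cost + 1 + t) σ'
  | iteFalse {e : Expr} {p₁ p₂ : Program} {σ σ' : State} {t : ℕ} (he : e.Fits w σ)
      (hc : e.eval σ = 0) (h : Exec w p₂ σ t σ') :
      Exec w (.ite e p₁ p₂) σ (e.cost + 1 + t) σ'
  | loopDone {e : Expr} {p : Program} {σ : State} (he : e.Fits w σ) (hc : e.eval σ = 0) :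
      Exec w (.loop e p) σ (e.cost + 1) σ
  | loopStep {e : Expr} {p : Program} {σ σ₁ σ₂ : State} {t₁ t₂ : ℕ} (he : e.Fits w σ)
      (hc : e.eval σ ≠ 0) (h₁ : Exec w p σ t₁ σ₁) (h₂ : Exec w (.loop e p) σ₁ t₂ σ₂) :
      Exec w (.loop e p) σ (e.cost + 1 + t₁ + t₂) σ₂

/-- Words of `O(log n)` bits: `κ` times the number of binary digits of `n`. -/
def wordSize (κ n : ℕ) : ℕ := κ * (Nat.log 2 n + 1)

/-- The word `v` is the answer to the yes-no question `p`: `1` for yes and `0` for no. -/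
def Answers (v : ℕ) (p : Prop) : Prop := (p ∧ v = 1) ∨ (¬ p ∧ v = 0)

end WordRAM

/-! ## 3SUM -/

namespace ThreeSum

/-- The memory at the start: register `0` holds `n = |A|`, array `0` lists the elements of `A`,
everything else is `0`. -/
def input (A : List ℕ) : WordRAM.State where
  reg x := if x = 0 then A.length else 0
  arr a i := if a = 0 then A.getD i 0 else 0

/-- There are `a, b, c ∈ A` (not necessarily distinct) with `a + b = c`. -/
def HasSolution (A : List ℕ) : Prop := ∃ a ∈ A, ∃ b ∈ A, ∃ c ∈ A, a + b = c

/-- Some deterministic algorithm decides 3SUM for all sets `A ⊆ {1, …, n ^ c}` of size `n`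
in time `O(T n)`, on words of `O(log n)` bits. The set is listed in any order, without
repetition; the answer is left in register `0`. -/
def SolvableInTime (c : ℕ) (T : ℕ → ℝ) : Prop :=
  ∃ (P : WordRAM.Program) (κ : ℕ) (K : ℝ), ∀ n : ℕ, 1 ≤ n →
    ∀ A : List ℕ, A.length = n → A.Nodup → (∀ a ∈ A, 1 ≤ a ∧ a ≤ n ^ c) →
      ∃ (t : ℕ) (σ : WordRAM.State),
        WordRAM.Exec (WordRAM.wordSize κ n) P (input A) t σ ∧
        (t : ℝ) ≤ K * T n ∧
        WordRAM.Answers (σ.reg 0) (HasSolution A)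

/-- For every `ε > 0` there is a constant `c` such that no deterministic algorithm solves 3SUM
over `{1, …, n ^ c}` in time `O(n ^ (2 - ε))`. -/
def DeterministicHypothesis : Prop :=
  ∀ ε : ℝ, 0 < ε → ∃ c : ℕ, ¬ SolvableInTime c (fun n => (n : ℝ) ^ (2 - ε))

end ThreeSum

/-! ## Offline Set Disjointness -/

namespace SetDisjointness

/-- Sets `S 0, …, S (N - 1) ⊆ {1, …, U}` of size at most `s` and a set `Q` of queries, all of them
listed in any order without repetition. -/
structure Instance where
  U : ℕ
  N : ℕ
  s : ℕ
  S : Fin N → List ℕ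
  Q : List (Fin N × Fin N)
  nodup_S : ∀ i, (S i).Nodup
  mem_S : ∀ i, ∀ x ∈ S i, 1 ≤ x ∧ x ≤ U
  length_S : ∀ i, (S i).length ≤ s
  nodup_Q : Q.Nodup

/-- The number of queries. -/
def Instance.q (I : Instance) : ℕ := I.Q.length

/-- The memory at the start. Registers `0, …, 4` hold `n, U, N, s, q`. Array `0` holds the sizes of
the sets; the `j`-th element of the `i`-th set is in cell `i * s + j` of array `1`; arrays `2`
and `3` hold the first and the second indices of the queries. Everything else is `0`. -/
def input (n : ℕ) (I : Instance) : WordRAM.State where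
  reg x :=
    if x = 0 then n
    else if x = 1 then I.U
    else if x = 2 then I.N
    else if x = 3 then I.s
    else if x = 4 then I.q
    else 0
  arr a p :=
    if a = 0 then (if h : p < I.N then (I.S ⟨p, h⟩).length else 0)
    else if a = 1 then (if h : p / I.s < I.N then (I.S ⟨p / I.s, h⟩).getD (p % I.s) 0 else 0)
    else if a = 2 then (if h : p < I.Q.length then ((I.Q[p]).1 : ℕ) else 0)
    else if a = 3 then (if h : p < I.Q.length then ((I.Q[p]).2 : ℕ) else 0)
    else 0

/-- Array `4` answers, for each query `(i, j)`, whether `S i ∩ S j = ∅`. -/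
def Correct (I : Instance) (σ : WordRAM.State) : Prop :=
  ∀ (k : ℕ) (h : k < I.Q.length),
    WordRAM.Answers (σ.arr 4 k)
      ((I.S (I.Q[k]).1).toFinset ∩ (I.S (I.Q[k]).2).toFinset = ∅)

/-- Some deterministic algorithm solves offline Set Disjointness in time `O(T n)`, on words of
`O(log n)` bits, for all `n ≥ 1` and all instances with `|U| ≤ u n`, `N ≤ m n`, set size
`s ≤ ℓ n` and `q ≤ r n`. -/
def SolvableInTime (u m ℓ r : ℕ → ℝ) (T : ℕ → ℝ) : Prop :=
  ∃ (P : WordRAM.Program) (κ : ℕ) (K : ℝ), ∀ n : ℕ, 1 ≤ n →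
    ∀ I : Instance, (I.U : ℝ) ≤ u n → (I.N : ℝ) ≤ m n → (I.s : ℝ) ≤ ℓ n → (I.q : ℝ) ≤ r n →
      ∃ (t : ℕ) (σ : WordRAM.State),
        WordRAM.Exec (WordRAM.wordSize κ n) P (input n I) t σ ∧
        (t : ℝ) ≤ K * T n ∧
        Correct I σ

end SetDisjointness

/-! ## Reasoning about word RAM programs -/

namespace WordRAM

/-! Let `A` be a 3SUM instance of size `n`, and let `W` satisfy `W ^ g ≤ n < (B * W) ^ g` for
constants `g` and `B`. The idea is to hash `A` by its residues modulo `k = r + 2 * y` numbers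
between `W / 2` and `W`. The residues modulo the first `r` moduli give the bucket, and those modulo
the other `2 * y` become elements of the universe. Triples that satisfy `a + b = c` only modulo all
moduli are false positives. The moduli must make these rare, and they must be found without
randomness.

Choice of the moduli. If `a + b ≠ c`, a modulus keeps the triple only if it divides the difference,
which has `n ^ o(1)` divisors. Averaging over the candidates, some modulus reduces the number of
surviving triples by a factor of about `W`. Hence the greedy choice leaves at most `θ * W ^ (3 * g +
1) / W ^ j` triples after `j` moduli if there is no solution (`sum_tripleCount_le`,
`exists_tripleCount_bound`); the spare factor `W` absorbs all divisor bounds. If a measured count is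
larger, there is a solution and the algorithm answers yes.

Counting. To evaluate a candidate, the number of surviving triples is computed in time about `W ^ (k
+ 2)`. The residues are written in base `B` and their digits are read in base `2 * B`, so that two
vectors add without carries. The count becomes a convolution on `(ℤ / L) ^ K` with `L = 2 * B`,
evaluated by a fast Fourier transform modulo `N = (n + 1) ^ B + 1`. There `n + 1` is a root of unity
of order dividing `L`, and `N` is large enough for the residue to determine the count
(`sum_partialDFT`, `Input.countProg_spec`).

The instance. Elements with equal residues form a class, represented by one element. The classes of
each bucket are cut into chunks of at most `s = W ^ (g - r)`, which gives `O(W ^ r)` chunks. Modulo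
the last `2 * y` moduli, split the digits of `c` into an upper half and a lower half. Then `a + b ≡
c` says that `a` minus the upper half equals the lower half minus `b`. So each chunk is stored once
for each of the `W ^ y` shifts of either kind, and the question whether a chunk `e` and a chunk `f`
contain `a` and `b` with `a + b ≡ c` is one disjointness query (`Input.disjoint_iff`). Given `c` and
`e`, the bucket of `f` is forced, and the count for the first `r` moduli bounds the number of
queries by `O(W ^ (g + r + 1))` (`Input.length_queries_le`).

Verification. For a query with nonempty intersection, all triples behind it are checked. Different
queries and different elements of the first chunk lead to disjoint sets of triples, so the work is
at most about `s` times the count for all `k` moduli, which is `O(W ^ (2 * g - 1))`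
(`Input.sum_weight_le`, `Input.tripleCount_mul_s_le`).

Exponents. With `h = ⌈α * g⌉`, `r = h + 12`, `y = g - h - 8`, the instance is admissible for the
parameter `C * W ^ (g + 16)` with a large constant `C`. If `ε * g ≥ 33`, a call costs `O(W ^ (2 * g
- 1))`, like everything else. This is `O(n ^ (2 - 1 / g))`, which contradicts the 3SUM hypothesis
for the exponent `1 / g`.

On the machine level, correctness and time are proved by a program logic for stores bounded by some
`M`, a fixed power of which fits into a word; the assumed algorithm runs as a subroutine on its own
registers and arrays. -/

instance : Add Expr := ⟨.op .add⟩
instance : Sub Expr := ⟨.op .sub⟩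
instance : Mul Expr := ⟨.op .mul⟩
instance : Div Expr := ⟨.op .div⟩
instance : Mod Expr := ⟨.op .mod⟩

@[simp] theorem eval_add (σ : State) (a b : Expr) : (a + b).eval σ = a.eval σ + b.eval σ := rfl
@[simp] theorem eval_sub (σ : State) (a b : Expr) : (a - b).eval σ = a.eval σ - b.eval σ := rfl
@[simp] theorem eval_mul (σ : State) (a b : Expr) : (a * b).eval σ = a.eval σ * b.eval σ := rfl
@[simp] theorem eval_div (σ : State) (a b : Expr) : (a / b).eval σ = a.eval σ / b.eval σ := rfl
@[simp] theorem eval_mod (σ : State) (a b : Expr) : (a % b).eval σ = a.eval σ % b.eval σ := rfl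
@[simp] theorem eval_const (σ : State) (k : ℕ) : (Expr.const k).eval σ = k := rfl
@[simp] theorem eval_reg (σ : State) (x : ℕ) : (Expr.reg x).eval σ = σ.reg x := rfl
@[simp] theorem eval_read (σ : State) (a : ℕ) (i : Expr) :
    (Expr.read a i).eval σ = σ.arr a (i.eval σ) := rfl
@[simp] theorem eval_eq (σ : State) (a b : Expr) :
    (Expr.op .eq a b).eval σ = if a.eval σ = b.eval σ then 1 else 0 := rfl
@[simp] theorem eval_lt (σ : State) (a b : Expr) :
    (Expr.op .lt a b).eval σ = if a.eval σ < b.eval σ then 1 else 0 := rfl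
@[simp] theorem eval_le (σ : State) (a b : Expr) :
    (Expr.op .le a b).eval σ = if a.eval σ ≤ b.eval σ then 1 else 0 := rfl

@[simp] theorem setReg_reg (σ : State) (x v : ℕ) : (σ.setReg x v).reg = Function.update σ.reg x v :=
  rfl
@[simp] theorem setReg_arr (σ : State) (x v : ℕ) : (σ.setReg x v).arr = σ.arr := rfl
@[simp] theorem setArr_reg (σ : State) (a i v : ℕ) : (σ.setArr a i v).reg = σ.reg := rfl
@[simp] theorem setArr_arr (σ : State) (a i v : ℕ) :
    (σ.setArr a i v).arr = Function.update σ.arr a (Function.update (σ.arr a) i v) := rfl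

@[ext] theorem State.ext' {σ τ : State} (h₁ : σ.reg = τ.reg) (h₂ : σ.arr = τ.arr) : σ = τ := by
  cases σ; cases τ; simp_all

/-- All registers and all array cells hold values below `M`. -/
def State.Bdd (M : ℕ) (σ : State) : Prop := (∀ x, σ.reg x < M) ∧ ∀ a i, σ.arr a i < M

theorem State.Bdd.setReg {M : ℕ} {σ : State} (h : σ.Bdd M) {x v : ℕ} (hv : v < M) :
    (σ.setReg x v).Bdd M := by
  refine ⟨fun z => ?_, h.2⟩
  by_cases hz : z = x
  · subst hz; simpa using hv
  · simpa [hz] using h.1 z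

theorem State.Bdd.setArr {M : ℕ} {σ : State} (h : σ.Bdd M) {a i v : ℕ} (hv : v < M) :
    (σ.setArr a i v).Bdd M := by
  refine ⟨h.1, fun b j => ?_⟩
  by_cases hb : b = a
  · subst hb
    by_cases hj : j = i
    · subst hj; simpa using hv
    · simpa [hj] using h.2 b j
  · simpa [hb] using h.2 b j

/-! ### Word length: values of expressions without bit operations -/

/-- Operations whose value is at most quadratic in the operands. -/
def Op.Tame : Op → Prop
  | .add | .sub | .mul | .div | .mod | .eq | .lt | .le => True
  | .and | .or | .xor | .shl | .shr => False

/-- Expressions built from tame operations and constants below `M`. -/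
def Expr.Tame (M : ℕ) : Expr → Prop
  | .const k => k < M
  | .reg _ => True
  | .read _ i => i.Tame M
  | .op o e₁ e₂ => o.Tame ∧ e₁.Tame M ∧ e₂.Tame M

/-- A tame operation at most multiplies the bounds of its operands, up to a factor `2 ≤ M`. Each
node of the expression therefore accounts for one factor `M`, and the number of nodes is the cost.
-/
theorem Expr.Tame.eval_lt {M : ℕ} (hM : 2 ≤ M) {σ : State} (hσ : σ.Bdd M) :
    ∀ {e : Expr}, e.Tame M → e.eval σ < M ^ e.cost
  | .const k, h => by simpa [Expr.cost, Expr.Tame] using h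
  | .reg x, _ => by simpa [Expr.cost] using hσ.1 x
  | .read a i, _ => lt_of_lt_of_le (hσ.2 a _) (Nat.le_self_pow (by simp [Expr.cost]) M)
  | .op o e₁ e₂, h => by
    have h₁ := Expr.Tame.eval_lt hM hσ h.2.1
    have h₂ := Expr.Tame.eval_lt hM hσ h.2.2
    have c₁ : 1 ≤ M ^ e₁.cost := Nat.one_le_pow _ _ (by omega)
    have c₂ : 1 ≤ M ^ e₂.cost := Nat.one_le_pow _ _ (by omega)
    have hp : M ^ (Expr.op o e₁ e₂).cost = M ^ e₁.cost * M ^ e₂.cost * M := by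
      simp [Expr.cost, pow_add]
    rw [hp]
    simp only [Expr.eval]
    generalize e₁.eval σ = u at *
    generalize e₂.eval σ = v at *
    generalize M ^ e₁.cost = X at *
    generalize M ^ e₂.cost = Y at *
    have hXY : X + Y ≤ X * Y * 2 := by nlinarith
    have hXM : X * Y * 2 ≤ X * Y * M := Nat.mul_le_mul_left _ hM
    have hX : X ≤ X * Y := Nat.le_mul_of_pos_right _ c₂
    have hY : Y ≤ X * Y := Nat.le_mul_of_pos_left _ c₁
    have hu : X * Y < X * Y * M := by nlinarith
    have ho := h.1
    cases o <;> simp only [Op.eval]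
    · omega
    · omega
    · have : u * v ≤ X * Y := Nat.mul_le_mul h₁.le h₂.le
      omega
    · have := Nat.div_le_self u v
      omega
    · have := Nat.mod_le u v
      omega
    · split_ifs <;> omega
    · split_ifs <;> omega
    · split_ifs <;> omega
    all_goals exact ho.elim

theorem Expr.Tame.fits {M w : ℕ} (hM : 2 ≤ M) {σ : State} (hσ : σ.Bdd M) :
    ∀ {e : Expr}, e.Tame M → M ^ e.cost ≤ 2 ^ w → e.Fits w σ
  | .const k, h, hw => by
    simp only [Expr.cost, pow_one] at hw
    exact lt_of_lt_of_le h hw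
  | .reg x, _, hw => by
    simp only [Expr.cost, pow_one] at hw
    exact lt_of_lt_of_le (hσ.1 x) hw
  | .read a i, h, hw => by
    have hle : M ^ i.cost ≤ 2 ^ w :=
      (Nat.pow_le_pow_right (by omega) (by simp [Expr.cost])).trans hw
    exact ⟨Expr.Tame.fits hM hσ h hle, lt_of_lt_of_le (hσ.2 a _)
      ((Nat.le_self_pow (by simp [Expr.cost]) M).trans hw)⟩
  | .op o e₁ e₂, h, hw =>
    ⟨Expr.Tame.fits hM hσ h.2.1
        ((Nat.pow_le_pow_right (by omega) (by simp [Expr.cost]; omega)).trans hw),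
      Expr.Tame.fits hM hσ h.2.2
        ((Nat.pow_le_pow_right (by omega) (by simp [Expr.cost]; omega)).trans hw),
      lt_of_lt_of_le (Expr.Tame.eval_lt (e := .op o e₁ e₂) hM hσ h) hw⟩

/-- Programs all of whose expressions are tame. -/
def Program.Tame (M : ℕ) : Program → Prop
  | .skip => True
  | .assign _ e => e.Tame M
  | .write _ i e => i.Tame M ∧ e.Tame M
  | .seq p₁ p₂ => p₁.Tame M ∧ p₂.Tame M
  | .ite e p₁ p₂ => e.Tame M ∧ p₁.Tame M ∧ p₂.Tame M
  | .loop e p => e.Tame M ∧ p.Tame M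

/-- An upper bound for the costs of the expressions of a program. -/
def Program.maxCost : Program → ℕ
  | .skip => 0
  | .assign _ e => e.cost
  | .write _ i e => i.cost + e.cost
  | .seq p₁ p₂ => p₁.maxCost + p₂.maxCost
  | .ite e p₁ p₂ => e.cost + p₁.maxCost + p₂.maxCost
  | .loop e p => e.cost + p.maxCost

/-- Expressions built from tame operations. -/
def Expr.NoBits : Expr → Prop
  | .const _ => True
  | .reg _ => True
  | .read _ i => i.NoBits
  | .op o e₁ e₂ => o.Tame ∧ e₁.NoBits ∧ e₂.NoBits

/-- Programs all of whose operations are tame. -/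
def Program.NoBits : Program → Prop
  | .skip => True
  | .assign _ e => e.NoBits
  | .write _ i e => i.NoBits ∧ e.NoBits
  | .seq p₁ p₂ => p₁.NoBits ∧ p₂.NoBits
  | .ite e p₁ p₂ => e.NoBits ∧ p₁.NoBits ∧ p₂.NoBits
  | .loop e p => e.NoBits ∧ p.NoBits

@[simp] theorem cost_add (a b : Expr) : (a + b).cost = a.cost + b.cost + 1 := rfl
@[simp] theorem cost_sub (a b : Expr) : (a - b).cost = a.cost + b.cost + 1 := rfl
@[simp] theorem cost_mul (a b : Expr) : (a * b).cost = a.cost + b.cost + 1 := rfl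
@[simp] theorem cost_div (a b : Expr) : (a / b).cost = a.cost + b.cost + 1 := rfl
@[simp] theorem cost_mod (a b : Expr) : (a % b).cost = a.cost + b.cost + 1 := rfl
@[simp] theorem noBits_add (a b : Expr) : (a + b).NoBits ↔ a.NoBits ∧ b.NoBits :=
  ⟨fun h => h.2, fun h => ⟨trivial, h⟩⟩
@[simp] theorem noBits_sub (a b : Expr) : (a - b).NoBits ↔ a.NoBits ∧ b.NoBits :=
  ⟨fun h => h.2, fun h => ⟨trivial, h⟩⟩
@[simp] theorem noBits_mul (a b : Expr) : (a * b).NoBits ↔ a.NoBits ∧ b.NoBits :=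
  ⟨fun h => h.2, fun h => ⟨trivial, h⟩⟩
@[simp] theorem noBits_div (a b : Expr) : (a / b).NoBits ↔ a.NoBits ∧ b.NoBits :=
  ⟨fun h => h.2, fun h => ⟨trivial, h⟩⟩
@[simp] theorem noBits_mod (a b : Expr) : (a % b).NoBits ↔ a.NoBits ∧ b.NoBits :=
  ⟨fun h => h.2, fun h => ⟨trivial, h⟩⟩

/-- Only the constants in the expression depend on a bound, and there are finitely many of them.
This separates a syntactic property of the program from the bound `M`, which varies with the input.
-/
theorem Expr.NoBits.tame : ∀ {e : Expr}, e.NoBits → ∃ K, ∀ M, K ≤ M → e.Tame M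
  | .const k, _ => ⟨k + 1, fun _ h => h⟩
  | .reg _, _ => ⟨0, fun _ _ => trivial⟩
  | .read _ i, h => Expr.NoBits.tame (e := i) h
  | .op _ _ _, h => by
    obtain ⟨K₁, h₁⟩ := Expr.NoBits.tame h.2.1
    obtain ⟨K₂, h₂⟩ := Expr.NoBits.tame h.2.2
    exact ⟨K₁ + K₂, fun M hM => ⟨h.1, h₁ M (by omega), h₂ M (by omega)⟩⟩

theorem Program.NoBits.tame : ∀ {p : Program}, p.NoBits → ∃ K, ∀ M, K ≤ M → p.Tame M
  | .skip, _ => ⟨0, fun _ _ => trivial⟩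
  | .assign _ _, h => Expr.NoBits.tame (e := _) h
  | .write _ _ _, h => by
    obtain ⟨K₁, h₁⟩ := Expr.NoBits.tame h.1
    obtain ⟨K₂, h₂⟩ := Expr.NoBits.tame h.2
    exact ⟨K₁ + K₂, fun M hM => ⟨h₁ M (by omega), h₂ M (by omega)⟩⟩
  | .seq _ _, h => by
    obtain ⟨K₁, h₁⟩ := Program.NoBits.tame h.1
    obtain ⟨K₂, h₂⟩ := Program.NoBits.tame h.2
    exact ⟨K₁ + K₂, fun M hM => ⟨h₁ M (by omega), h₂ M (by omega)⟩⟩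
  | .ite _ _ _, h => by
    obtain ⟨K₁, h₁⟩ := Expr.NoBits.tame h.1
    obtain ⟨K₂, h₂⟩ := Program.NoBits.tame h.2.1
    obtain ⟨K₃, h₃⟩ := Program.NoBits.tame h.2.2
    exact ⟨K₁ + K₂ + K₃, fun M hM => ⟨h₁ M (by omega), h₂ M (by omega), h₃ M (by omega)⟩⟩
  | .loop _ _, h => by
    obtain ⟨K₁, h₁⟩ := Expr.NoBits.tame h.1
    obtain ⟨K₂, h₂⟩ := Program.NoBits.tame h.2
    exact ⟨K₁ + K₂, fun M hM => ⟨h₁ M (by omega), h₂ M (by omega)⟩⟩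

/-! ### Executions with bounded stores -/

/-- `Run M p σ t σ'`: the program `p` started in `σ` halts after exactly `t` steps in `σ'`, and
all values that are stored on the way are below `M`. -/
inductive Run (M : ℕ) : Program → State → ℕ → State → Prop
  | skip (σ : State) : Run M .skip σ 1 σ
  | assign (σ : State) (x : ℕ) (e : Expr) (he : e.eval σ < M) :
      Run M (.assign x e) σ (e.cost + 1) (σ.setReg x (e.eval σ))
  | write (σ : State) (a : ℕ) (i e : Expr) (he : e.eval σ < M) :
      Run M (.write a i e) σ (i.cost + e.cost + 1) (σ.setArr a (i.eval σ) (e.eval σ))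
  | seq {p₁ p₂ : Program} {σ σ₁ σ₂ : State} {t₁ t₂ : ℕ}
      (h₁ : Run M p₁ σ t₁ σ₁) (h₂ : Run M p₂ σ₁ t₂ σ₂) :
      Run M (.seq p₁ p₂) σ (t₁ + t₂) σ₂
  | iteTrue {e : Expr} {p₁ p₂ : Program} {σ σ' : State} {t : ℕ}
      (hc : e.eval σ ≠ 0) (h : Run M p₁ σ t σ') :
      Run M (.ite e p₁ p₂) σ (e.cost + 1 + t) σ'
  | iteFalse {e : Expr} {p₁ p₂ : Program} {σ σ' : State} {t : ℕ}
      (hc : e.eval σ = 0) (h : Run M p₂ σ t σ') :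
      Run M (.ite e p₁ p₂) σ (e.cost + 1 + t) σ'
  | loopDone {e : Expr} {p : Program} {σ : State} (hc : e.eval σ = 0) :
      Run M (.loop e p) σ (e.cost + 1) σ
  | loopStep {e : Expr} {p : Program} {σ σ₁ σ₂ : State} {t₁ t₂ : ℕ}
      (hc : e.eval σ ≠ 0) (h₁ : Run M p σ t₁ σ₁) (h₂ : Run M (.loop e p) σ₁ t₂ σ₂) :
      Run M (.loop e p) σ (e.cost + 1 + t₁ + t₂) σ₂

/-- If all stored values stay below `M`, intermediate values stay below `M ^ p.maxCost`, so overflow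
never has to be considered again. `State.Bdd` is the invariant that is carried along the execution.
-/
theorem Run.exec {M w : ℕ} (hM : 2 ≤ M) {p : Program} {σ σ' : State} {t : ℕ}
    (h : Run M p σ t σ') (hp : p.Tame M) (hw : M ^ p.maxCost ≤ 2 ^ w) (hσ : σ.Bdd M) :
    Exec w p σ t σ' ∧ σ'.Bdd M := by
  have mono : ∀ {a b : ℕ}, a ≤ b → M ^ b ≤ 2 ^ w → M ^ a ≤ 2 ^ w := fun hab hb =>
    (Nat.pow_le_pow_right (by omega) hab).trans hb
  induction h with
  | skip σ => exact ⟨.skip σ, hσ⟩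
  | assign σ x e he => exact ⟨.assign σ x e (Expr.Tame.fits hM hσ hp hw), hσ.setReg he⟩
  | write σ a i e he =>
    exact ⟨.write σ a i e (Expr.Tame.fits hM hσ hp.1 (mono (Nat.le_add_right _ _) hw))
      (Expr.Tame.fits hM hσ hp.2 (mono (Nat.le_add_left _ _) hw)), hσ.setArr he⟩
  | seq _ _ ih₁ ih₂ =>
    obtain ⟨e₁, b₁⟩ := ih₁ hp.1 (mono (Nat.le_add_right _ _) hw) hσ
    obtain ⟨e₂, b₂⟩ := ih₂ hp.2 (mono (Nat.le_add_left _ _) hw) b₁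
    exact ⟨.seq e₁ e₂, b₂⟩
  | iteTrue hc _ ih =>
    simp only [Program.maxCost] at hw
    obtain ⟨e₁, b₁⟩ := ih hp.2.1 (mono (by omega) hw) hσ
    exact ⟨.iteTrue (Expr.Tame.fits hM hσ hp.1 (mono (by omega) hw)) hc e₁, b₁⟩
  | iteFalse hc _ ih =>
    simp only [Program.maxCost] at hw
    obtain ⟨e₁, b₁⟩ := ih hp.2.2 (mono (by omega) hw) hσ
    exact ⟨.iteFalse (Expr.Tame.fits hM hσ hp.1 (mono (by omega) hw)) hc e₁, b₁⟩
  | loopDone hc =>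
    exact ⟨.loopDone (Expr.Tame.fits hM hσ hp.1 (mono (Nat.le_add_right _ _) hw)) hc, hσ⟩
  | loopStep hc _ _ ih₁ ih₂ =>
    obtain ⟨e₁, b₁⟩ := ih₁ hp.2 (mono (Nat.le_add_left _ _) hw) hσ
    obtain ⟨e₂, b₂⟩ := ih₂ hp hw b₁
    exact ⟨.loopStep (Expr.Tame.fits hM hσ hp.1 (mono (Nat.le_add_right _ _) hw)) hc e₁ e₂, b₂⟩

/-- The registers that a program may change. -/
def Program.modR : Program → List ℕ
  | .skip => []
  | .assign x _ => [x]
  | .write _ _ _ => []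
  | .seq p₁ p₂ => p₁.modR ++ p₂.modR
  | .ite _ p₁ p₂ => p₁.modR ++ p₂.modR
  | .loop _ p => p.modR

/-- The arrays that a program may change. -/
def Program.modA : Program → List ℕ
  | .skip => []
  | .assign _ _ => []
  | .write a _ _ => [a]
  | .seq p₁ p₂ => p₁.modA ++ p₂.modA
  | .ite _ p₁ p₂ => p₁.modA ++ p₂.modA
  | .loop _ p => p.modA

/-- What a program cannot change is read off from its text. All later invariants survive the
programs that run in between because of this. -/
theorem Run.frame {M : ℕ} {p : Program} {σ σ' : State} {t : ℕ} (h : Run M p σ t σ') :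
    (∀ x, x ∉ p.modR → σ'.reg x = σ.reg x) ∧ ∀ a, a ∉ p.modA → σ'.arr a = σ.arr a := by
  induction h with
  | skip σ => simp
  | assign σ x e he =>
    refine ⟨fun z hz => ?_, fun _ _ => rfl⟩
    simp only [Program.modR, List.mem_singleton] at hz
    simp [hz]
  | write σ a i e he =>
    refine ⟨fun _ _ => rfl, fun z hz => ?_⟩
    simp only [Program.modA, List.mem_singleton] at hz
    simp [hz]
  | seq _ _ ih₁ ih₂ =>
    simp only [Program.modR, Program.modA, List.mem_append, not_or]
    exact ⟨fun x hx => (ih₂.1 x hx.2).trans (ih₁.1 x hx.1),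
      fun x hx => (ih₂.2 x hx.2).trans (ih₁.2 x hx.1)⟩
  | iteTrue hc _ ih =>
    simp only [Program.modR, Program.modA, List.mem_append, not_or]
    exact ⟨fun x hx => ih.1 x hx.1, fun x hx => ih.2 x hx.1⟩
  | iteFalse hc _ ih =>
    simp only [Program.modR, Program.modA, List.mem_append, not_or]
    exact ⟨fun x hx => ih.1 x hx.2, fun x hx => ih.2 x hx.2⟩
  | loopDone hc => exact ⟨fun _ _ => rfl, fun _ _ => rfl⟩
  | loopStep hc _ _ ih₁ ih₂ =>
    exact ⟨fun x hx => (ih₂.1 x hx).trans (ih₁.1 x hx),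
      fun x hx => (ih₂.2 x hx).trans (ih₁.2 x hx)⟩

/-! ### A program logic with time bounds -/

/-- The program halts within `T` steps in a state with `Q`. -/
def Runs (M : ℕ) (p : Program) (σ : State) (T : ℕ) (Q : State → Prop) : Prop :=
  ∃ t σ', Run M p σ t σ' ∧ t ≤ T ∧ Q σ'

section rules

variable {M : ℕ} {σ : State} {T T₁ T₂ : ℕ} {Q R : State → Prop} {p q : Program}

theorem Runs.mono (h : Runs M p σ T₁ Q) (hT : T₁ ≤ T) (hQ : ∀ τ, Q τ → R τ) : Runs M p σ T R := by
  obtain ⟨t, σ', h₁, h₂, h₃⟩ := h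
  exact ⟨t, σ', h₁, h₂.trans hT, hQ _ h₃⟩

theorem Runs.time (h : Runs M p σ T₁ Q) (hT : T₁ ≤ T) : Runs M p σ T Q := h.mono hT fun _ => id

theorem Runs.frame (h : Runs M p σ T Q) :
    Runs M p σ T (fun τ => Q τ ∧ (∀ x, x ∉ p.modR → τ.reg x = σ.reg x) ∧
      ∀ a, a ∉ p.modA → τ.arr a = σ.arr a) := by
  obtain ⟨t, σ', h₁, h₂, h₃⟩ := h
  exact ⟨t, σ', h₁, h₂, h₃, h₁.frame⟩

theorem Runs.skip (h : Q σ) : Runs M .skip σ 1 Q := ⟨1, σ, .skip σ, le_rfl, h⟩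

theorem Runs.assign {x : ℕ} {e : Expr} (he : e.eval σ < M) (h : Q (σ.setReg x (e.eval σ))) :
    Runs M (.assign x e) σ (e.cost + 1) Q := ⟨_, _, .assign σ x e he, le_rfl, h⟩

theorem Runs.write {a : ℕ} {i e : Expr} (he : e.eval σ < M)
    (h : Q (σ.setArr a (i.eval σ) (e.eval σ))) :
    Runs M (.write a i e) σ (i.cost + e.cost + 1) Q := ⟨_, _, .write σ a i e he, le_rfl, h⟩

theorem Runs.seq (h : Runs M p σ T₁ R) (h' : ∀ τ, R τ → Runs M q τ T₂ Q) :
    Runs M (.seq p q) σ (T₁ + T₂) Q := by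
  obtain ⟨t, σ', h₁, h₂, h₃⟩ := h
  obtain ⟨t', σ'', h₄, h₅, h₆⟩ := h' σ' h₃
  exact ⟨_, _, .seq h₁ h₄, by omega, h₆⟩

theorem Runs.ite {e : Expr} (h₁ : e.eval σ ≠ 0 → Runs M p σ T₁ Q)
    (h₂ : e.eval σ = 0 → Runs M q σ T₂ Q) :
    Runs M (.ite e p q) σ (e.cost + 1 + max T₁ T₂) Q := by
  by_cases hc : e.eval σ = 0
  · obtain ⟨t, σ', h₃, h₄, h₅⟩ := h₂ hc
    exact ⟨_, _, .iteFalse hc h₃, by omega, h₅⟩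
  · obtain ⟨t, σ', h₃, h₄, h₅⟩ := h₁ hc
    exact ⟨_, _, .iteTrue hc h₃, by omega, h₅⟩

theorem Runs.loop {e : Expr} (I : ℕ → State → Prop) (Tb : ℕ → ℕ) {lo hi : ℕ} (hlo : lo ≤ hi)
    (h0 : I lo σ)
    (step : ∀ i τ, lo ≤ i → i < hi → I i τ → e.eval τ ≠ 0 ∧ Runs M p τ (Tb i) (I (i + 1)))
    (hfin : ∀ τ, I hi τ → e.eval τ = 0) :
    Runs M (.loop e p) σ (∑ i ∈ Finset.Ico lo hi, (Tb i + e.cost + 1) + e.cost + 1) (I hi) := by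
  -- An execution of a loop unfolds at its front, so the induction runs downwards from the last
  -- iteration, for all starting states at once.
  induction hlo using Nat.decreasingInduction generalizing σ with
  | self => exact ⟨_, _, .loopDone (hfin _ h0), by simp, h0⟩
  | of_succ i hi' ih =>
    obtain ⟨hc, t, τ, h₁, h₂, h₃⟩ := step i σ le_rfl hi' h0
    obtain ⟨t', τ', h₄, h₅, h₆⟩ := ih h₃ (fun j τ hj => step j τ (by omega))
    refine ⟨_, _, .loopStep hc h₁ h₄, ?_, h₆⟩
    rw [Finset.sum_eq_sum_Ico_succ_bot hi']
    omega

end rules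

/-- `for x = lo, …, hi - 1 do p` -/
def Program.for (x : ℕ) (lo hi : Expr) (p : Program) : Program :=
  .seq (.assign x lo)
    (.loop (.op .lt (.reg x) hi) (.seq p (.assign x (.reg x + .const 1))))

/-- The invariant describes the whole state, counter included, at the moment of the test. Hence the
body has to restore the counter, and the invariant for `i + 1` is required after the increment. The
upper bound is evaluated anew in every round, so the invariant has to fix its value. -/
theorem Runs.for {M x : ℕ} {lo hi : Expr} {p : Program} {σ : State} (I : ℕ → State → Prop)
    (Tb : ℕ → ℕ) {l h : ℕ} (hl : lo.eval σ = l) (hlh : l ≤ h) (hM : h < M)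
    (h0 : I l (σ.setReg x l)) (inv : ∀ i τ, I i τ → τ.reg x = i ∧ hi.eval τ = h)
    (step : ∀ i τ, l ≤ i → i < h → I i τ →
      Runs M p τ (Tb i) (fun τ' => τ'.reg x = i ∧ I (i + 1) (τ'.setReg x (i + 1)))) :
    Runs M (.for x lo hi p) σ
      (∑ i ∈ Finset.Ico l h, (Tb i + hi.cost + 7) + lo.cost + hi.cost + 4) (I h) := by
  refine Runs.time (T₁ := (lo.cost + 1) + (∑ i ∈ Finset.Ico l h, ((Tb i + 4) +
    (Expr.op .lt (.reg x) hi).cost + 1) + (Expr.op .lt (.reg x) hi).cost + 1)) ?_ ?_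
  · refine Runs.seq (R := fun τ => I l τ) (.assign (by omega) (by rw [hl]; exact h0))
      fun τ hτ => ?_
    refine Runs.loop I (fun i => Tb i + 4) hlh hτ (fun i τ h₁ h₂ h₃ => ?_) fun τ hτ => ?_
    · have := inv i τ h₃
      refine ⟨by simp [this.1, this.2, h₂], ?_⟩
      refine Runs.seq (step i τ h₁ h₂ h₃) fun τ' h₄ => ?_
      refine Runs.assign ?_ ?_
      · simp [h₄.1]; omega
      · simpa [h₄.1] using h₄.2
    · have := inv h τ hτ
      simp [this.1, this.2]
  · simp only [Expr.cost]
    rw [show (∑ i ∈ Finset.Ico l h, ((Tb i + 4) + (1 + hi.cost + 1) + 1)) =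
      ∑ i ∈ Finset.Ico l h, (Tb i + hi.cost + 7) from Finset.sum_congr rfl fun i _ => by ring]
    omega

/-- A `for` loop whose body takes time at most `c`. -/
theorem Runs.for_const {M x : ℕ} {lo hi : Expr} {p : Program} {σ : State}
    (I : ℕ → State → Prop) (c : ℕ) {l h : ℕ} (hl : lo.eval σ = l) (hlh : l ≤ h) (hM : h < M)
    (h0 : I l (σ.setReg x l)) (inv : ∀ i τ, I i τ → τ.reg x = i ∧ hi.eval τ = h)
    (step : ∀ i τ, l ≤ i → i < h → I i τ →
      Runs M p τ c (fun τ' => τ'.reg x = i ∧ I (i + 1) (τ'.setReg x (i + 1)))) :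
    Runs M (.for x lo hi p) σ ((c + lo.cost + hi.cost + 7) * (h + 1)) (I h) := by
  refine (Runs.for I (fun _ => c) hl hlh hM h0 inv step).time ?_
  rw [Finset.sum_const, Nat.card_Ico, smul_eq_mul]
  have : (h - l) * (c + hi.cost + 7) ≤ h * (c + lo.cost + hi.cost + 7) :=
    Nat.mul_le_mul (by omega) (by omega)
  nlinarith

/-- `for x = lo, …, hi - 1 do a[x] := e` -/
def Program.fill (a x : ℕ) (lo hi e : Expr) : Program := .for x lo hi (.write a (.reg x) e)

/-- The state after a loop that has filled the cells `l, …, j - 1` of array `a` with the values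
of `f`. -/
def State.filled (σ : State) (a x l : ℕ) (f : ℕ → ℕ) (j : ℕ) : State where
  reg := Function.update σ.reg x j
  arr := Function.update σ.arr a fun i => if l ≤ i ∧ i < j then f i else σ.arr a i

/-- The expression for cell `j` is evaluated in a memory where the cells `l, …, j - 1` already
contain the values of `f`. It may read them, so any table given by a recurrence can be computed this
way. -/
theorem Runs.fill {M a x : ℕ} {lo hi e : Expr} {σ : State} (f : ℕ → ℕ) {l h : ℕ}
    (hl : lo.eval σ = l) (hlh : l ≤ h) (hM : h < M)
    (hh : ∀ j, hi.eval (σ.filled a x l f j) = h)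
    (he : ∀ j, l ≤ j → j < h → e.eval (σ.filled a x l f j) = f j ∧ f j < M) :
    Runs M (.fill a x lo hi e) σ ((e.cost + lo.cost + hi.cost + 9) * (h + 1))
      (fun τ => τ.arr a = fun i => if l ≤ i ∧ i < h then f i else σ.arr a i) := by
  refine (Runs.for_const (fun j τ => τ = σ.filled a x l f j) ((Expr.reg x).cost + e.cost + 1)
    hl hlh hM ?_ ?_ ?_).mono (Nat.mul_le_mul_right _ (by simp [Expr.cost]; omega)) ?_
  · ext z i
    · rfl
    · by_cases hz : z = a
      · subst hz
        simp only [setReg_arr, State.filled, Function.update_self]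
        rw [if_neg (by omega)]
      · simp [State.filled, hz]
  · rintro j τ rfl
    exact ⟨by simp [State.filled], hh j⟩
  · rintro j τ h₁ h₂ rfl
    obtain ⟨h₃, h₄⟩ := he j h₁ h₂
    refine Runs.write (by omega) ⟨by simp [State.filled], ?_⟩
    rw [h₃]
    ext z i
    · simp [State.filled]
    · by_cases hz : z = a
      · subst hz
        simp only [setReg_arr, setArr_arr, State.filled, Function.update_self, eval_reg]
        by_cases hi : i = j
        · subst hi; simp [h₁]
        · rw [Function.update_of_ne hi]
          congr 1
          simp only [eq_iff_iff]; omega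
      · simp [State.filled, hz]
  · rintro τ rfl
    simp [State.filled]

/-! ### Expression builders -/

/-- `e ^ k` -/
def Expr.pow (e : Expr) : ℕ → Expr
  | 0 => .const 1
  | k + 1 => e.pow k * e

@[simp] theorem eval_pow (σ : State) (e : Expr) (k : ℕ) : (e.pow k).eval σ = e.eval σ ^ k := by
  induction k with
  | zero => rfl
  | succ k ih => simp [Expr.pow, ih, pow_succ]

/-- `f 0 + ⋯ + f (k - 1)` -/
def Expr.sum (f : ℕ → Expr) : ℕ → Expr
  | 0 => .const 0
  | k + 1 => Expr.sum f k + f k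

@[simp] theorem eval_sum (σ : State) (f : ℕ → Expr) (k : ℕ) :
    (Expr.sum f k).eval σ = ∑ i ∈ Finset.range k, (f i).eval σ := by
  induction k with
  | zero => rfl
  | succ k ih => simp [Expr.sum, ih, Finset.sum_range_succ]

end WordRAM

/-- The number with the `k` digits `f 0, …, f (k - 1)` in base `W`, the most significant one
first. -/
def horner (W : ℕ) (f : ℕ → ℕ) : ℕ → ℕ
  | 0 => 0
  | k + 1 => horner W f k * W + f k

namespace WordRAM

/-- The number with digits `f 0, …, f (k - 1)` in base `e`. -/
def Expr.horner (e : Expr) (f : ℕ → Expr) : ℕ → Expr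
  | 0 => .const 0
  | k + 1 => Expr.horner e f k * e + f k

@[simp] theorem eval_horner (σ : State) (e : Expr) (f : ℕ → Expr) (k : ℕ) :
    (Expr.horner e f k).eval σ = _root_.horner (e.eval σ) (fun i => (f i).eval σ) k := by
  induction k with
  | zero => rfl
  | succ k ih => simp [Expr.horner, ih, _root_.horner]

theorem Expr.NoBits.pow {e : Expr} (he : e.NoBits) (k : ℕ) : (e.pow k).NoBits := by
  induction k with
  | zero => trivial
  | succ k ih => exact ⟨trivial, ih, he⟩

theorem Expr.NoBits.sum {f : ℕ → Expr} (hf : ∀ i, (f i).NoBits) (k : ℕ) :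
    (Expr.sum f k).NoBits := by
  induction k with
  | zero => trivial
  | succ k ih => exact ⟨trivial, ih, hf k⟩

theorem Expr.NoBits.horner {e : Expr} (he : e.NoBits) {f : ℕ → Expr} (hf : ∀ i, (f i).NoBits)
    (k : ℕ) : (Expr.horner e f k).NoBits := by
  induction k with
  | zero => trivial
  | succ k ih => exact ⟨trivial, ⟨trivial, ih, he⟩, hf k⟩

end WordRAM

/-! ## Digits -/

theorem mul_add_div_of_lt {a b c : ℕ} (h : c < b) : (a * b + c) / b = a := by
  rw [mul_comm, Nat.mul_add_div (by omega), Nat.div_eq_of_lt h, add_zero]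

theorem mul_add_mod_of_lt {a b c : ℕ} (h : c < b) : (a * b + c) % b = c := by
  rw [mul_comm, Nat.mul_add_mod, Nat.mod_eq_of_lt h]

theorem horner_congr {W : ℕ} {f g : ℕ → ℕ} {k : ℕ} (h : ∀ j < k, f j = g j) :
    horner W f k = horner W g k := by
  induction k with
  | zero => rfl
  | succ k ih => rw [horner, horner, ih fun j hj => h j (by omega), h k (by omega)]

theorem horner_lt {W : ℕ} {f : ℕ → ℕ} {k : ℕ} (h : ∀ j < k, f j < W) : horner W f k < W ^ k := by
  induction k with
  | zero => simp [horner]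
  | succ k ih =>
    have h₁ := ih fun j hj => h j (by omega)
    have h₂ := h k (by omega)
    rw [horner, pow_succ]
    nlinarith

theorem horner_add (W : ℕ) (f : ℕ → ℕ) (m n : ℕ) :
    horner W f (m + n) = horner W f m * W ^ n + horner W (fun j => f (m + j)) n := by
  induction n with
  | zero => simp [horner]
  | succ n ih => rw [← add_assoc, horner, ih, horner, pow_succ]; ring

/-- The most significant digit comes first, so digit number `j` belongs to the power `k - 1 - j`;
everything below it is smaller than that power. -/
theorem horner_digit {W : ℕ} {f : ℕ → ℕ} {k j : ℕ} (h : ∀ j < k, f j < W) (hj : j < k) :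
    horner W f k / W ^ (k - 1 - j) % W = f j := by
  obtain ⟨m, rfl⟩ : ∃ m, k = (j + 1) + m := ⟨k - (j + 1), by omega⟩
  have hW : 0 < W := by have := h j hj; omega
  rw [horner_add, show j + 1 + m - 1 - j = m by omega,
    mul_add_div_of_lt (horner_lt fun i hi => h _ (by omega)), horner]
  rw [mul_add_mod_of_lt (h j hj)]

theorem horner_inj {W : ℕ} {f g : ℕ → ℕ} {k : ℕ} (hf : ∀ j < k, f j < W) (hg : ∀ j < k, g j < W) :
    horner W f k = horner W g k ↔ ∀ j < k, f j = g j := by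
  refine ⟨fun h j hj => ?_, horner_congr⟩
  rw [← horner_digit hf hj, h, horner_digit hg hj]

/-- The number obtained from `x` by reading its digits in base `B` as digits in base `L`. -/
def rebase (B L x : ℕ) : ℕ := Nat.ofDigits L (Nat.digits B x)

theorem rebase_zero (B L : ℕ) : rebase B L 0 = 0 := by simp [rebase]

/-- The recursion on the lowest digit. It serves for the proofs below and also for computing the
tables of `rebase`. -/
theorem rebase_eq {B : ℕ} (hB : 1 < B) (L x : ℕ) :
    rebase B L x = rebase B L (x / B) * L + x % B := by
  rcases Nat.eq_zero_or_pos x with rfl | hx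
  · simp [rebase]
  · unfold rebase
    rw [Nat.digits_def' hB hx, Nat.ofDigits_cons]
    ring

theorem rebase_lt {B L : ℕ} (hB : 1 < B) (hL : B ≤ L) (l : ℕ) :
    ∀ x, x < B ^ l → rebase B L x < L ^ l := by
  induction l with
  | zero => intro x hx; simp at hx; simp [hx, rebase_zero]
  | succ l ih =>
    intro x hx
    rw [rebase_eq hB, pow_succ]
    have h₁ := ih (x / B) (Nat.div_lt_of_lt_mul (by rwa [pow_succ'] at hx))
    have h₂ : x % B < L := (Nat.mod_lt _ (by omega)).trans_le hL
    nlinarith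

theorem rebase_add_lt {B : ℕ} (hB : 1 < B) (l : ℕ) :
    ∀ x y, x < B ^ l → y < B ^ l →
      rebase B (2 * B) x + rebase B (2 * B) y < (2 * B) ^ l := by
  induction l with
  | zero => intro x y hx hy; simp at hx hy; simp [hx, hy, rebase_zero]
  | succ l ih =>
    intro x y hx hy
    rw [rebase_eq hB _ x, rebase_eq hB _ y, pow_succ (2 * B)]
    have h₁ := ih (x / B) (y / B) (Nat.div_lt_of_lt_mul (by rwa [pow_succ'] at hx))
      (Nat.div_lt_of_lt_mul (by rwa [pow_succ'] at hy))
    have h₂ : x % B < B := Nat.mod_lt _ (by omega)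
    have h₃ : y % B < B := Nat.mod_lt _ (by omega)
    nlinarith

/-- Two digits below `B` add up to less than `2 * B`, so there are no carries in base `2 * B`.
Reading the digit sums in base `B` evaluates `∑ (xᵢ + yᵢ) * B ^ i`, which is `x + y` although the
digit sums need not be digits in base `B`. -/
theorem rebase_rebase_add {B : ℕ} (hB : 1 < B) (l : ℕ) :
    ∀ x y, x < B ^ l → y < B ^ l →
      rebase (2 * B) B (rebase B (2 * B) x + rebase B (2 * B) y) = x + y := by
  induction l with
  | zero => intro x y hx hy; simp at hx hy; simp [hx, hy, rebase_zero]
  | succ l ih =>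
    intro x y hx hy
    have h₁ := ih (x / B) (y / B) (Nat.div_lt_of_lt_mul (by rwa [pow_succ'] at hx))
      (Nat.div_lt_of_lt_mul (by rwa [pow_succ'] at hy))
    have h₂ : x % B < B := Nat.mod_lt _ (by omega)
    have h₃ : y % B < B := Nat.mod_lt _ (by omega)
    have e : rebase B (2 * B) x + rebase B (2 * B) y =
        (rebase B (2 * B) (x / B) + rebase B (2 * B) (y / B)) * (2 * B) + (x % B + y % B) := by
      rw [rebase_eq hB _ x, rebase_eq hB _ y]; ring
    rw [rebase_eq (by omega : 1 < 2 * B), e,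
      mul_add_div_of_lt (by omega : x % B + y % B < 2 * B),
      mul_add_mod_of_lt (by omega : x % B + y % B < 2 * B), h₁]
    have h₄ := Nat.div_add_mod x B
    have h₅ := Nat.div_add_mod y B
    rw [add_mul]
    nlinarith

/-- All digits of `x` in base `L` are smaller than `B`. -/
def SmallDigits (L B x : ℕ) : Prop := ∀ t, x / L ^ t % L < B

theorem SmallDigits.zero {L B : ℕ} (hB : 0 < B) : SmallDigits L B 0 := by intro t; simpa

theorem SmallDigits.append {L B u v l : ℕ} (hL : 0 < L) (hu : SmallDigits L B u)
    (hv : SmallDigits L B v) (hvl : v < L ^ l) : SmallDigits L B (u * L ^ l + v) := by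
  intro t
  rcases lt_or_ge t l with h | h
  · obtain ⟨m, rfl⟩ : ∃ m, l = t + (m + 1) := ⟨l - t - 1, by omega⟩
    have : u * L ^ (t + (m + 1)) + v = L ^ t * (L * (u * L ^ m)) + v := by ring
    rw [this, Nat.mul_add_div (by positivity), Nat.mul_add_mod]
    exact hv t
  · obtain ⟨m, rfl⟩ : ∃ m, t = l + m := ⟨t - l, by omega⟩
    rw [pow_add, ← Nat.div_div_eq_div_mul, mul_add_div_of_lt hvl]
    exact hu m

theorem SmallDigits.rebase {B L : ℕ} (hB : 1 < B) (hL : B ≤ L) (x : ℕ) :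
    SmallDigits L B (rebase B L x) := by
  induction x using Nat.strong_induction_on with
  | _ x ih =>
    rcases Nat.eq_zero_or_pos x with rfl | hx
    · rw [rebase_zero]; exact .zero (by omega)
    · rw [rebase_eq hB]
      have h₁ := ih (x / B) (Nat.div_lt_self hx hB)
      have h₂ : x % B < B := Nat.mod_lt _ (by omega)
      have h₃ : SmallDigits L B (x % B) := by
        intro t
        refine lt_of_le_of_lt (Nat.mod_le _ _) (lt_of_le_of_lt (Nat.div_le_self _ _) h₂)
      simpa using SmallDigits.append (l := 1) (by omega) h₁ h₃ (by simp; omega)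

theorem SmallDigits.horner {L B l : ℕ} (hB : 0 < B) (hL : 0 < L) {f : ℕ → ℕ}
    (hf : ∀ j, SmallDigits L B (f j) ∧ f j < L ^ l) (k : ℕ) :
    SmallDigits L B (horner (L ^ l) f k) := by
  induction k with
  | zero => exact .zero hB
  | succ k ih => exact .append hL ih (hf k).1 (hf k).2

/-- No carry ever occurs, so addition of integers is addition of digit vectors. This is what turns
sums of integers into sums in the group `(ℤ / L) ^ K`. -/
theorem SmallDigits.digit_add {B x y : ℕ} (hB : 0 < B) (hx : SmallDigits (2 * B) B x)
    (hy : SmallDigits (2 * B) B y) (t : ℕ) :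
    (x + y) / (2 * B) ^ t = x / (2 * B) ^ t + y / (2 * B) ^ t ∧
    (x + y) / (2 * B) ^ t % (2 * B) = x / (2 * B) ^ t % (2 * B) + y / (2 * B) ^ t % (2 * B) := by
  have key : ∀ u v : ℕ, u % (2 * B) < B → v % (2 * B) < B →
      (u + v) % (2 * B) = u % (2 * B) + v % (2 * B) := by
    intro u v hu hv
    rw [Nat.add_mod, Nat.mod_eq_of_lt]; omega
  have h₁ : (x + y) / (2 * B) ^ t = x / (2 * B) ^ t + y / (2 * B) ^ t := by
    induction t with
    | zero => simp
    | succ t ih =>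
      have h₁ := hx t
      have h₂ := hy t
      have e : ∀ z : ℕ, z / (2 * B) ^ (t + 1) = z / (2 * B) ^ t / (2 * B) := fun z => by
        rw [pow_succ, Nat.div_div_eq_div_mul]
      rw [e, e, e, ih]
      generalize x / (2 * B) ^ t = u at *
      generalize y / (2 * B) ^ t = v at *
      rw [Nat.add_div (by omega), if_neg (by omega), add_zero]
  exact ⟨h₁, by rw [h₁]; exact key _ _ (hx t) (hy t)⟩

theorem eq_of_digits_eq {L K x y : ℕ} (hx : x < L ^ K) (hy : y < L ^ K)
    (h : ∀ t < K, x / L ^ t % L = y / L ^ t % L) : x = y := by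
  have : ∀ t ≤ K, x % L ^ t = y % L ^ t := by
    intro t ht
    induction t with
    | zero => simp [Nat.mod_one]
    | succ t ih => rw [Nat.mod_pow_succ, Nat.mod_pow_succ, ih (by omega), h t (by omega)]
  have := this K le_rfl
  rwa [Nat.mod_eq_of_lt hx, Nat.mod_eq_of_lt hy] at this

/-! ## The Fourier transform on `(ℤ / L)ᴷ` -/

section fourier

open Finset

theorem sum_range_mul_eq {R : Type*} [AddCommMonoid R] (f : ℕ → R) (m n : ℕ) :
    ∑ i ∈ range (m * n), f i = ∑ d ∈ range n, ∑ x ∈ range m, f (d * m + x) := by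
  induction n with
  | zero => simp
  | succ n ih =>
    rw [Nat.mul_succ, Finset.sum_range_add, ih, Finset.sum_range_succ]
    simp [mul_comm]

variable {R : Type*} [CommRing R]

/-- The ring may have zero divisors, so the geometric series cannot be summed by dividing by `ζ -
1`. Since the length is a power of two, the series factors as `∏ (1 + ζ ^ 2 ^ i)`, and one factor
vanishes exactly because some power of `ω` is `-1`. -/
theorem sum_root_pow {ω : R} {b e : ℕ} (hω : ω ^ 2 ^ b = -1) :
    ∑ d ∈ range (2 ^ (b + 1)), ω ^ (e * d) = if 2 ^ (b + 1) ∣ e then 2 ^ (b + 1) else 0 := by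
  have h2 : ω ^ 2 ^ (b + 1) = 1 := by rw [pow_succ, pow_mul, hω]; ring
  split_ifs with h
  · obtain ⟨c, rfl⟩ := h
    have : ∀ d ∈ range (2 ^ (b + 1)), ω ^ (2 ^ (b + 1) * c * d) = 1 := by
      intro d _; rw [mul_assoc, pow_mul, h2, one_pow]
    rw [sum_congr rfl this]; simp
  · have he : e ≠ 0 := by rintro rfl; simp at h
    have hprod : ∀ (ζ : R) (m : ℕ), ∑ d ∈ range (2 ^ m), ζ ^ d = ∏ i ∈ range m, (1 + ζ ^ 2 ^ i) := by
      intro ζ m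
      induction m with
      | zero => simp
      | succ m ih =>
        rw [pow_succ, mul_two, Finset.sum_range_add, Finset.prod_range_succ, ← ih, mul_add, mul_one,
          Finset.sum_mul]
        congr 1
        refine sum_congr rfl fun d _ => ?_
        rw [pow_add, mul_comm]
    obtain ⟨u, v, hv, rfl⟩ := Nat.exists_eq_two_pow_mul_odd he
    have hu : u ≤ b := by
      by_contra hcon
      exact h ((pow_dvd_pow 2 (by omega)).mul_right v)
    simp_rw [pow_mul]
    rw [hprod]
    -- This factor is `1 + ω ^ (2 ^ b * v) = 1 + (-1) ^ v`, and `v` is odd.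
    refine Finset.prod_eq_zero (i := b - u) (by simp) ?_
    have e : 2 ^ u * (v * 2 ^ (b - u)) = 2 ^ b * v := by
      rw [mul_left_comm, ← pow_add, mul_comm]; congr 2; omega
    rw [← pow_mul, ← pow_mul, e, pow_mul, hω, hv.neg_one_pow]
    ring

/-- A number below `L ^ K` is a vector of `K` independent digits, so the sum of products factors
over the digits. The induction splits off the top digit. -/
theorem sum_pow_digits (ω : R) (L : ℕ) (e : ℕ → ℕ) (K : ℕ) :
    ∑ i ∈ range (L ^ K), ω ^ (∑ t ∈ range K, e t * (i / L ^ t % L)) =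
      ∏ t ∈ range K, ∑ d ∈ range L, ω ^ (e t * d) := by
  induction K with
  | zero => simp
  | succ K ih =>
    rw [pow_succ, sum_range_mul_eq, prod_range_succ, ← ih, mul_comm, sum_mul]
    refine sum_congr rfl fun d hd => ?_
    rw [mul_sum]
    refine sum_congr rfl fun x hx => ?_
    rw [mem_range] at hx hd
    have hL : 0 < L := by omega
    rw [sum_range_succ, ← pow_add, mul_add_div_of_lt hx, Nat.mod_eq_of_lt hd, add_comm]
    congr 2
    refine sum_congr rfl fun t ht => ?_
    rw [mem_range] at ht
    obtain ⟨m, rfl⟩ : ∃ m, K = t + (m + 1) := ⟨K - t - 1, by omega⟩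
    rw [show d * L ^ (t + (m + 1)) + x = L ^ t * (L * (d * L ^ m)) + x by ring,
      Nat.mul_add_div (by positivity), Nat.mul_add_mod]

/-- The pairing of the lowest `K` digits in base `L`. -/
def digitPairing (L K x i : ℕ) : ℕ := ∑ t ∈ range K, (x / L ^ t % L) * (i / L ^ t % L)

/-- Orthogonality of characters. The sum factors over the digits, and each factor detects whether
the digit of `z` is the sum of the digits of `x` and `y`. The exponent `L - 1` plays the role of
`-1`. -/
theorem sum_digitPairing {ω : R} {b K x y z : ℕ} (hω : ω ^ 2 ^ b = -1)
    (hx : SmallDigits (2 ^ (b + 1)) (2 ^ b) x) (hy : SmallDigits (2 ^ (b + 1)) (2 ^ b) y)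
    (hxy : x + y < (2 ^ (b + 1)) ^ K) (hz : z < (2 ^ (b + 1)) ^ K) :
    ∑ i ∈ range ((2 ^ (b + 1)) ^ K), ω ^ (1 * digitPairing (2 ^ (b + 1)) K x i) *
      ω ^ (1 * digitPairing (2 ^ (b + 1)) K y i) *
      ω ^ ((2 ^ (b + 1) - 1) * digitPairing (2 ^ (b + 1)) K z i) =
    if z = x + y then (2 ^ (b + 1)) ^ K else 0 := by
  set L := 2 ^ (b + 1) with hL
  have hLB : L = 2 * 2 ^ b := by rw [hL, pow_succ, mul_comm]
  have hB : 0 < 2 ^ b := by positivity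
  have e₁ : ∀ i ∈ range (L ^ K), ω ^ (1 * digitPairing L K x i) * ω ^ (1 * digitPairing L K y i) *
      ω ^ ((L - 1) * digitPairing L K z i) = ω ^ (∑ t ∈ range K,
        (x / L ^ t % L + y / L ^ t % L + (L - 1) * (z / L ^ t % L)) * (i / L ^ t % L)) := by
    intro i _
    rw [← pow_add, ← pow_add]
    congr 1
    simp only [digitPairing, one_mul, mul_sum, ← sum_add_distrib]
    refine sum_congr rfl fun t _ => ?_
    ring
  rw [sum_congr rfl e₁, sum_pow_digits ω L
    (fun t => x / L ^ t % L + y / L ^ t % L + (L - 1) * (z / L ^ t % L))]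
  have e₂ : ∀ t, ∑ d ∈ range L, ω ^ ((x / L ^ t % L + y / L ^ t % L +
      (L - 1) * (z / L ^ t % L)) * d) =
      if z / L ^ t % L = (x + y) / L ^ t % L then (L : R) else 0 := by
    intro t
    have hd := (SmallDigits.digit_add (x := x) (y := y) hB (hLB ▸ hx) (hLB ▸ hy) t).2
    rw [← hLB] at hd
    rw [sum_root_pow hω, hd]
    have hx' := hx t
    have hy' := hy t
    have hz' : z / L ^ t % L < L := Nat.mod_lt _ (by omega)
    simp only [← hL]
    generalize x / L ^ t % L = u at *
    generalize y / L ^ t % L = v at *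
    generalize z / L ^ t % L = w at *
    -- Divisibility gives a congruence modulo `L`; it is an equality because `u` and `v` are below
    -- half of `L`, so that both sides are below `L`.
    have : L ∣ u + v + (L - 1) * w ↔ w = u + v := by
      have h₁ : u + v + (L - 1) * w + w = u + v + L * w := by
        obtain ⟨m, hm⟩ : ∃ m, L = m + 1 := ⟨L - 1, by omega⟩
        rw [hm]; simp; ring
      constructor
      · intro h
        have h₂ : (u + v) ≡ w [MOD L] := by
          have h₃ : u + v + (L - 1) * w + w ≡ 0 + w [MOD L] :=
            Nat.ModEq.add_right _ ((Nat.modEq_zero_iff_dvd).2 h)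
          rw [h₁, zero_add] at h₃
          exact (by simp [Nat.ModEq] : u + v ≡ u + v + L * w [MOD L]).trans h₃
        have := Nat.ModEq.eq_of_lt_of_lt h₂ (by omega) hz'
        exact this.symm
      · rintro rfl
        have : u + v + (L - 1) * (u + v) = L * (u + v) := by omega
        rw [this]; exact dvd_mul_right _ _
    simp only [this]
    congr 1
    rw [hL]; push_cast; rfl
  rw [prod_congr rfl fun t _ => e₂ t]
  split_ifs with h
  · subst h
    simp [hL]
  · have : ∃ t < K, z / L ^ t % L ≠ (x + y) / L ^ t % L := by
      by_contra hcon
      push Not at hcon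
      exact h (eq_of_digits_eq hz hxy hcon)
    obtain ⟨t, ht, hne⟩ := this
    exact prod_eq_zero (mem_range.2 ht) (if_neg hne)

/-- The transform of `f` along the lowest `t` digits. -/
def partialDFT (ω : R) (L s : ℕ) (f : ℕ → R) (t i : ℕ) : R :=
  ∑ x ∈ range (L ^ t), f (i - i % L ^ t + x) * ω ^ (s * digitPairing L t x i)

theorem partialDFT_zero (ω : R) (L s : ℕ) (f : ℕ → R) (i : ℕ) : partialDFT ω L s f 0 i = f i := by
  simp [partialDFT, digitPairing, Nat.mod_one]

/-- In the index `i` of a partial transform the lowest `t` digits are frequencies and the others are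
still positions. Transforming one more digit is a sum of `L` entries that differ in that digit only,
which makes the transform fast. -/
theorem partialDFT_succ (ω : R) {L : ℕ} (hL : 0 < L) (s : ℕ) (f : ℕ → R) (t i : ℕ) :
    partialDFT ω L s f (t + 1) i = ∑ x ∈ range L, ω ^ (s * (x * (i / L ^ t % L))) *
      partialDFT ω L s f t (i - (i / L ^ t % L) * L ^ t + x * L ^ t) := by
  unfold partialDFT
  have hS : 0 < L ^ t := by positivity
  rw [pow_succ, sum_range_mul_eq]
  refine sum_congr rfl fun d hd => ?_
  rw [mem_range] at hd
  rw [mul_sum]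
  refine sum_congr rfl fun x hx => ?_
  rw [mem_range] at hx
  have hi : i = L ^ t * (L * (i / L ^ t / L) + i / L ^ t % L) + i % L ^ t := by
    rw [Nat.div_add_mod, Nat.div_add_mod]
  have hiS : i % L ^ t < L ^ t := Nat.mod_lt _ hS
  have hmod : i % (L ^ t * L) = i % L ^ t + L ^ t * (i / L ^ t % L) := by
    rw [← pow_succ, Nat.mod_pow_succ]
  set q := i / L ^ t / L with hq
  set c := i / L ^ t % L with hc
  set ρ := i % L ^ t with hρ
  set S := L ^ t with hSdef
  have h₁ : i - c * S + d * S = S * (L * q + d) + ρ := by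
    have : i - c * S = S * (L * q) + ρ := by
      rw [hi]
      have : S * (L * q + c) + ρ = S * (L * q) + ρ + c * S := by ring
      rw [this]; simp
    rw [this]; ring
  have h₂ : (S * (L * q + d) + ρ) % S = ρ := by
    rw [Nat.mul_add_mod, Nat.mod_eq_of_lt hiS]
  have h₃ : i - i % (S * L) + (d * S + x) = S * (L * q + d) + x := by
    rw [hmod]
    have : i - (ρ + S * c) = S * (L * q) := by
      conv_lhs => rw [hi]
      rw [mul_add]; omega
    rw [this]; ring
  rw [h₁, h₂, h₃, Nat.add_sub_cancel]
  have h₄ : digitPairing L (t + 1) (d * S + x) i = digitPairing L t x (S * (L * q + d) + ρ) + d * c := by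
    rw [digitPairing, sum_range_succ, mul_add_div_of_lt hx, Nat.mod_eq_of_lt hd]
    congr 1
    refine sum_congr rfl fun τ hτ => ?_
    rw [mem_range] at hτ
    obtain ⟨m, rfl⟩ : ∃ m, t = τ + (m + 1) := ⟨t - τ - 1, by omega⟩
    have hp : 0 < L ^ τ := by positivity
    have g₁ : (d * S + x) / L ^ τ % L = x / L ^ τ % L := by
      rw [hSdef, show d * L ^ (τ + (m + 1)) + x = L ^ τ * (L * (d * L ^ m)) + x by ring,
        Nat.mul_add_div hp, Nat.mul_add_mod]
    have g₂ : ∀ w, (S * w + ρ) / L ^ τ % L = ρ / L ^ τ % L := by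
      intro w
      rw [hSdef, show L ^ (τ + (m + 1)) * w + ρ = L ^ τ * (L * (L ^ m * w)) + ρ by ring,
        Nat.mul_add_div hp, Nat.mul_add_mod]
    rw [g₁, g₂]
    conv_lhs => rw [hi, g₂]
  rw [h₄, mul_add s, pow_add ω]
  ring

theorem partialDFT_full (ω : R) (L s : ℕ) (f : ℕ → R) {K i : ℕ} (hi : i < L ^ K) :
    partialDFT ω L s f K i = ∑ x ∈ range (L ^ K), f x * ω ^ (s * digitPairing L K x i) := by
  unfold partialDFT
  rw [Nat.mod_eq_of_lt hi]
  simp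

/-- The square of the transform of the multiplicities of `X` expands over pairs, and orthogonality
with the conjugate transform of `h` selects the sum of the pair. No inverse transform is needed,
since only the total over all pairs matters. -/
theorem sum_partialDFT {ω : R} {b K : ℕ} (hω : ω ^ 2 ^ b = -1) (S : Finset ℕ) (X : ℕ → ℕ)
    (hX : ∀ a ∈ S, SmallDigits (2 ^ (b + 1)) (2 ^ b) (X a))
    (hXX : ∀ a ∈ S, ∀ b' ∈ S, X a + X b' < (2 ^ (b + 1)) ^ K) (h : ℕ → ℕ) :
    ∑ i ∈ range ((2 ^ (b + 1)) ^ K),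
      partialDFT ω (2 ^ (b + 1)) 1 (fun x => ((S.filter fun a => X a = x).card : R)) K i ^ 2 *
      partialDFT ω (2 ^ (b + 1)) (2 ^ (b + 1) - 1) (fun x => (h x : R)) K i =
    ((2 ^ (b + 1)) ^ K * ∑ a ∈ S, ∑ b' ∈ S, h (X a + X b') : ℕ) := by
  set L := 2 ^ (b + 1) with hL
  have hF : ∀ i < L ^ K, partialDFT ω L 1 (fun x => ((S.filter fun a => X a = x).card : R)) K i =
      ∑ a ∈ S, ω ^ (1 * digitPairing L K (X a) i) := by
    intro i hi
    rw [partialDFT_full _ _ _ _ hi]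
    have hmem : ∀ a ∈ S, X a ∈ range (L ^ K) := fun a ha => by
      have := hXX a ha a ha
      rw [mem_range]; omega
    rw [← sum_fiberwise_of_maps_to hmem]
    refine sum_congr rfl fun x _ => ?_
    rw [← nsmul_eq_mul, ← sum_const]
    refine sum_congr rfl fun a ha => ?_
    rw [(mem_filter.1 ha).2]
  have e₁ : ∀ i ∈ range (L ^ K),
      partialDFT ω L 1 (fun x => ((S.filter fun a => X a = x).card : R)) K i ^ 2 *
      partialDFT ω L (L - 1) (fun x => (h x : R)) K i = ∑ a ∈ S, ∑ b' ∈ S, ∑ z ∈ range (L ^ K),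
        (h z : R) * (ω ^ (1 * digitPairing L K (X a) i) * ω ^ (1 * digitPairing L K (X b') i) *
          ω ^ ((L - 1) * digitPairing L K z i)) := by
    intro i hi
    rw [mem_range] at hi
    rw [hF i hi, partialDFT_full _ _ _ _ hi, sq, sum_mul_sum, sum_mul]
    refine sum_congr rfl fun a _ => ?_
    rw [sum_mul]
    refine sum_congr rfl fun b' _ => ?_
    rw [mul_sum]
    refine sum_congr rfl fun z _ => ?_
    ring
  rw [sum_congr rfl e₁, sum_comm]
  push_cast
  rw [mul_sum]
  refine sum_congr rfl fun a ha => ?_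
  rw [sum_comm, mul_sum]
  refine sum_congr rfl fun b' hb => ?_
  rw [sum_comm]
  have e₂ : ∀ z ∈ range (L ^ K), (∑ i ∈ range (L ^ K), (h z : R) *
      (ω ^ (1 * digitPairing L K (X a) i) * ω ^ (1 * digitPairing L K (X b') i) *
          ω ^ ((L - 1) * digitPairing L K z i))) =
      if z = X a + X b' then (h z : R) * (L : R) ^ K else 0 := by
    intro z hz
    rw [← mul_sum, sum_digitPairing hω (hX a ha) (hX b' hb) (hXX a ha b' hb) (mem_range.1 hz)]
    split_ifs
    · rw [hL]; push_cast; rfl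
    · simp
  rw [sum_congr rfl e₂, sum_ite_eq' (range (L ^ K)), if_pos (mem_range.2 (hXX a ha b' hb)), mul_comm]

end fourier

/-! ## Moduli with few false positives -/

-- The divisor bound `d(n) = n ^ o(1)`, multiplicatively: a prime power `p ^ e` contributes `e + 1`,
-- and `(e + 1) ^ u` is at most `p ^ e` for `p ≥ 2 ^ u` and at most `u ^ u * p ^ e` in general.
-- Fewer than `2 ^ u` primes are exceptional.
open Finset in
theorem exists_card_divisors_pow_le (u : ℕ) :
    ∃ C : ℕ, 1 ≤ C ∧ ∀ d : ℕ, 0 < d → d.divisors.card ^ u ≤ C * d := by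
  rcases Nat.eq_zero_or_pos u with rfl | hu
  · exact ⟨1, le_rfl, fun d hd => by simp; omega⟩
  have hC₀ : ∀ e : ℕ, (e + 1) ^ u ≤ u ^ u * 2 ^ e := by
    intro e
    have h₁ : e + 1 ≤ u * 2 ^ (e / u) := by
      have h₂ : e < u * (e / u + 1) := Nat.lt_mul_div_succ e hu
      have h₃ : e / u + 1 ≤ 2 ^ (e / u) := Nat.lt_two_pow_self
      have := Nat.mul_le_mul_left u h₃
      omega
    calc (e + 1) ^ u ≤ (u * 2 ^ (e / u)) ^ u := Nat.pow_le_pow_left h₁ u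
      _ = u ^ u * 2 ^ (e / u * u) := by rw [mul_pow, ← pow_mul]
      _ ≤ u ^ u * 2 ^ e := Nat.mul_le_mul_left _
          (Nat.pow_le_pow_right (by omega) (Nat.div_mul_le_self e u))
  have hu1 : 1 ≤ u ^ u := Nat.one_le_pow _ _ hu
  refine ⟨(u ^ u) ^ 2 ^ u, Nat.one_le_pow _ _ hu1, fun d hd => ?_⟩
  have hterm : ∀ p ∈ d.primeFactors, (d.factorization p + 1) ^ u ≤
      (if p < 2 ^ u then u ^ u else 1) * p ^ d.factorization p := by
    intro p hp
    have hp2 : 2 ≤ p := (Nat.prime_of_mem_primeFactors hp).two_le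
    split_ifs with h
    · exact (hC₀ _).trans (Nat.mul_le_mul_left _ (Nat.pow_le_pow_left hp2 _))
    · rw [one_mul]
      calc (d.factorization p + 1) ^ u ≤ (2 ^ d.factorization p) ^ u :=
            Nat.pow_le_pow_left Nat.lt_two_pow_self u
        _ = (2 ^ u) ^ d.factorization p := by rw [← pow_mul, ← pow_mul, mul_comm]
        _ ≤ _ := Nat.pow_le_pow_left (by omega) _
  rw [Nat.card_divisors hd.ne', ← Finset.prod_pow]
  calc ∏ p ∈ d.primeFactors, (d.factorization p + 1) ^ u
      ≤ ∏ p ∈ d.primeFactors, (if p < 2 ^ u then u ^ u else 1) * p ^ d.factorization p :=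
        Finset.prod_le_prod' hterm
    _ = (∏ p ∈ d.primeFactors, if p < 2 ^ u then u ^ u else 1) * d := by
        rw [Finset.prod_mul_distrib]
        congr 1
        exact Nat.prod_factorization_pow_eq_self hd.ne'
    _ ≤ _ := by
        refine Nat.mul_le_mul_right _ ?_
        rw [← Finset.prod_filter, Finset.prod_const]
        refine Nat.pow_le_pow_right hu1 ?_
        refine (Finset.card_le_card (t := Finset.range (2 ^ u)) fun p hp => ?_).trans (by simp)
        simpa using (Finset.mem_filter.1 hp).2

section moduli

open Finset

/-- The number of triples in `S` that look like solutions modulo `P 0, …, P (j - 1)`. -/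
def tripleCount (S : Finset ℕ) (P : ℕ → ℕ) (j : ℕ) : ℕ :=
  ((S ×ˢ S ×ˢ S).filter fun t => ∀ i < j, t.1 + t.2.1 ≡ t.2.2 [MOD P i]).card

theorem tripleCount_congr (S : Finset ℕ) {P P' : ℕ → ℕ} {j : ℕ} (h : ∀ i < j, P i = P' i) :
    tripleCount S P j = tripleCount S P' j := by
  unfold tripleCount
  congr 1
  refine filter_congr fun t _ => ?_
  exact forall₂_congr fun i hi => by rw [h i hi]

theorem tripleCount_eq_sum (S : Finset ℕ) (P : ℕ → ℕ) (j : ℕ) :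
    tripleCount S P j =
      ∑ a ∈ S, ∑ b ∈ S, (S.filter fun c => ∀ i < j, a + b ≡ c [MOD P i]).card := by
  simp only [tripleCount, card_filter, sum_product]

theorem tripleCount_zero (S : Finset ℕ) (P : ℕ → ℕ) : tripleCount S P 0 = S.card ^ 3 := by
  simp [tripleCount]; ring

theorem tripleCount_le (S : Finset ℕ) (P : ℕ → ℕ) (j : ℕ) : tripleCount S P j ≤ S.card ^ 3 := by
  rw [← tripleCount_zero S P]
  unfold tripleCount
  refine card_le_card fun t ht => ?_
  simp only [mem_filter] at ht ⊢
  exact ⟨ht.1, by simp⟩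

/-- The candidates for the moduli. -/
def candidates (W : ℕ) : Finset ℕ := Ico (W / 2 + 1) (W + 1)

/-- Count pairs of a surviving triple and a candidate that keeps it. Without a solution, `a + b - c`
is a nonzero number of absolute value at most `2 * m`, and every candidate that keeps the triple is
one of its divisors. -/
theorem sum_tripleCount_le {S : Finset ℕ} {m D : ℕ} (hm : ∀ a ∈ S, a ≤ m)
    (hS : ¬ ∃ a ∈ S, ∃ b ∈ S, ∃ c ∈ S, a + b = c)
    (hD : ∀ d, 0 < d → d ≤ 2 * m → d.divisors.card ≤ D) (P : ℕ → ℕ) (j W : ℕ) :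
    ∑ p ∈ candidates W, tripleCount S (Function.update P j p) (j + 1) ≤
      D * tripleCount S P j := by
  have h₁ : ∀ p, tripleCount S (Function.update P j p) (j + 1) =
      ∑ t ∈ (S ×ˢ S ×ˢ S).filter fun t => ∀ i < j, t.1 + t.2.1 ≡ t.2.2 [MOD P i],
        if t.1 + t.2.1 ≡ t.2.2 [MOD p] then 1 else 0 := by
    intro p
    rw [← card_filter, filter_filter]
    unfold tripleCount
    congr 1
    refine filter_congr fun t _ => ?_
    rw [Nat.forall_lt_succ_right]
    refine and_congr (forall₂_congr fun i hi => ?_) ?_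
    · rw [Function.update_of_ne (by omega)]
    · rw [Function.update_self]
  simp_rw [h₁]
  rw [sum_comm, mul_comm]
  unfold tripleCount
  rw [← smul_eq_mul]
  refine sum_le_card_nsmul _ _ _ fun t ht => ?_
  simp only [mem_filter, mem_product] at ht
  obtain ⟨⟨ha, hb, hc⟩, -⟩ := ht
  rw [← card_filter]
  have hne : t.1 + t.2.1 ≠ t.2.2 := fun h => hS ⟨_, ha, _, hb, _, hc, h⟩
  have hma := hm _ ha
  have hmb := hm _ hb
  have hmc := hm _ hc
  rcases lt_or_gt_of_ne hne with h | h
  · refine (card_le_card fun p hp => ?_).trans (hD (t.2.2 - (t.1 + t.2.1)) (by omega) (by omega))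
    rw [Nat.mem_divisors]
    exact ⟨(Nat.modEq_iff_dvd' h.le).1 (mem_filter.1 hp).2, by omega⟩
  · refine (card_le_card fun p hp => ?_).trans (hD (t.1 + t.2.1 - t.2.2) (by omega) (by omega))
    rw [Nat.mem_divisors]
    exact ⟨(Nat.modEq_iff_dvd' h.le).1 (mem_filter.1 hp).2.symm, by omega⟩

/-- Each of the moduli `P 0, …, P (k - 1)` has been chosen, given the earlier ones, so that the
number of triples that look like solutions is as small as possible. -/
def IsGreedy (S : Finset ℕ) (W k : ℕ) (P : ℕ → ℕ) : Prop :=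
  ∀ j < k, ∀ p ∈ candidates W, tripleCount S P (j + 1) ≤ tripleCount S (Function.update P j p) (j + 1)

/-- The divisor bound in the form used for `k` moduli: `D` is the maximal number of divisors in the
relevant range, and even its `k`-th power costs only a constant times `W`, which is about `n ^ (1 /
g)`. -/
theorem exists_pow_card_divisors_le (B g c k : ℕ) (hg : 1 ≤ g) : ∃ C : ℕ, 1 ≤ C ∧
    ∀ W n : ℕ, 1 ≤ W → 1 ≤ n → n ≤ (B * W) ^ g → ∃ D : ℕ, 1 ≤ D ∧ D ^ k ≤ C * W ∧
      ∀ d, 0 < d → d ≤ 2 * n ^ c → d.divisors.card ≤ D := by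
  -- The exponent lets the `g * (c + 1)`-th root be taken at the end; `c + 1` instead of `c` keeps
  -- it positive when `c = 0`.
  obtain ⟨C, hC, h⟩ := exists_card_divisors_pow_le (k * (g * (c + 1)))
  refine ⟨2 * C * (B + 1), by nlinarith, fun W n hW hn hnW => ?_⟩
  have hn1 : 1 ≤ 2 * n ^ c := by have := Nat.one_le_pow c n hn; omega
  obtain ⟨d₀, hd₀, hmax⟩ := Finset.exists_max_image (Icc 1 (2 * n ^ c))
    (fun d => d.divisors.card) ⟨1, by simpa using hn1⟩
  rw [mem_Icc] at hd₀
  refine ⟨d₀.divisors.card, ?_, ?_, fun d h₁ h₂ => hmax d (mem_Icc.2 ⟨h₁, h₂⟩)⟩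
  · exact Finset.card_pos.2 ⟨1, by simp; omega⟩
  · have hgc : g * (c + 1) ≠ 0 := by positivity
    rw [← Nat.pow_le_pow_iff_left hgc, ← pow_mul]
    calc d₀.divisors.card ^ (k * (g * (c + 1))) ≤ C * d₀ := h d₀ (by omega)
      _ ≤ C * (2 * (B * W) ^ (g * (c + 1))) := by
        refine Nat.mul_le_mul_left _ (hd₀.2.trans (Nat.mul_le_mul_left _ ?_))
        calc n ^ c ≤ n ^ (c + 1) := Nat.pow_le_pow_right hn (by omega)
          _ ≤ ((B * W) ^ g) ^ (c + 1) := Nat.pow_le_pow_left hnW _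
          _ = _ := by rw [pow_mul]
      _ = (2 * C) * (B * W) ^ (g * (c + 1)) := by ring
      _ ≤ (2 * C) ^ (g * (c + 1)) * (B * W) ^ (g * (c + 1)) :=
        Nat.mul_le_mul_right _ (Nat.le_self_pow hgc _)
      _ = (2 * C * (B * W)) ^ (g * (c + 1)) := by rw [← mul_pow]
      _ ≤ _ := by
        refine Nat.pow_le_pow_left ?_ _
        rw [← mul_assoc]
        exact Nat.mul_le_mul_right _ (Nat.mul_le_mul_left _ (by omega))

/-- The greedy choice is at least as good as the average over at least `W / 2` candidates, so each
modulus gains a factor `W / (2 * D)`. The start is `n ^ 3 = O(W ^ (3 * g))`, and the loss `(2 * D) ^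
k = O(W)` is the additional `1` in the exponent. -/
theorem exists_tripleCount_bound (B g c k : ℕ) (hg : 1 ≤ g) : ∃ θ : ℕ, 1 ≤ θ ∧
    ∀ W n : ℕ, 1 ≤ W → 1 ≤ n → n ≤ (B * W) ^ g → ∀ S : Finset ℕ, S.card = n →
      (∀ a ∈ S, a ≤ n ^ c) → (¬ ∃ a ∈ S, ∃ b ∈ S, ∃ c ∈ S, a + b = c) →
      ∀ P, IsGreedy S W k P → ∀ j ≤ k, tripleCount S P j * W ^ j ≤ θ * W ^ (3 * g + 1) := by
  obtain ⟨C, hC, h⟩ := exists_pow_card_divisors_le B g c k hg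
  refine ⟨2 ^ k * C * (B + 1) ^ (3 * g), ?_, ?_⟩
  · have h₁ := Nat.one_le_two_pow (n := k)
    have h₂ := Nat.one_le_pow (3 * g) (B + 1) (by omega)
    exact Nat.mul_pos (Nat.mul_pos h₁ hC) h₂
  intro W n hW hn hnW S hSn hSc hS P hP j hj
  obtain ⟨D, hD1, hDk, hD⟩ := h W n hW hn hnW
  have step : ∀ j ≤ k, tripleCount S P j * W ^ j ≤ (2 * D) ^ j * n ^ 3 := by
    intro j hj
    induction j with
    | zero => simp [tripleCount_zero, hSn]
    | succ j ih =>
      have h₁ := sum_tripleCount_le hSc hS hD P j W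
      have h₂ : (candidates W).card * tripleCount S P (j + 1) ≤ D * tripleCount S P j := by
        refine le_trans ?_ h₁
        rw [← smul_eq_mul]
        exact card_nsmul_le_sum _ _ _ fun p hp => hP j (by omega) p hp
      have h₃ : W ≤ 2 * (candidates W).card := by
        rw [candidates, Nat.card_Ico]; omega
      have h₄ : tripleCount S P (j + 1) * W ≤ 2 * D * tripleCount S P j := by nlinarith
      calc tripleCount S P (j + 1) * W ^ (j + 1) = (tripleCount S P (j + 1) * W) * W ^ j := by ring
        _ ≤ (2 * D * tripleCount S P j) * W ^ j := Nat.mul_le_mul_right _ h₄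
        _ = 2 * D * (tripleCount S P j * W ^ j) := by ring
        _ ≤ 2 * D * ((2 * D) ^ j * n ^ 3) := Nat.mul_le_mul_left _ (ih (by omega))
        _ = _ := by ring
  calc tripleCount S P j * W ^ j ≤ (2 * D) ^ j * n ^ 3 := step j hj
    _ ≤ (2 * D) ^ k * ((B + 1) * W) ^ (3 * g) := by
      refine Nat.mul_le_mul (Nat.pow_le_pow_right (by omega) hj) ?_
      calc n ^ 3 ≤ ((B * W) ^ g) ^ 3 := Nat.pow_le_pow_left hnW 3
        _ = (B * W) ^ (3 * g) := by rw [← pow_mul, mul_comm g]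
        _ ≤ _ := Nat.pow_le_pow_left (Nat.mul_le_mul_right _ (by omega)) _
    _ = 2 ^ k * D ^ k * ((B + 1) ^ (3 * g) * W ^ (3 * g)) := by rw [mul_pow, mul_pow]
    _ ≤ 2 ^ k * (C * W) * ((B + 1) ^ (3 * g) * W ^ (3 * g)) :=
      Nat.mul_le_mul_right _ (Nat.mul_le_mul_left _ hDk)
    _ = _ := by ring

end moduli

open WordRAM

/-! ## Counting triples -/

/-- The constants of the reduction: elements are at most `n ^ c`, the base `W` of the digits
satisfies `W ^ g ≤ n`, there are `r` moduli for the buckets and `2 * y` for the universe, and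
`θ` bounds the number of false positives. -/
structure Params where
  c : ℕ
  g : ℕ
  r : ℕ
  y : ℕ
  θ : ℕ
  C : ℕ
  g' : ℕ
  one_le_r : 1 ≤ r
  one_le_C : 1 ≤ C
  r_le : r + 2 ≤ g
  y_lt : y + 1 ≤ g
  le_ry : g + 1 ≤ r + y
  ryy_le : r + 2 * y + 4 ≤ 2 * g

namespace Params

variable (p : Params)

/-- The number of moduli. -/
def k : ℕ := p.r + 2 * p.y
/-- The binary logarithm of `B`. -/
def b : ℕ := 2 * p.k + 3
/-- The base of which `W` is a power. -/
def B : ℕ := 2 ^ p.b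
/-- The length of the Fourier transforms. -/
def L : ℕ := 2 ^ (p.b + 1)

theorem L_eq : p.L = 2 * p.B := by rw [L, B, pow_succ, mul_comm]
theorem B_ge : p.b < p.B := Nat.lt_two_pow_self
theorem one_lt_B : 1 < p.B := by have := p.B_ge; unfold b at this; omega
theorem one_lt_L : 1 < p.L := by have := p.L_eq; have := p.one_lt_B; omega
theorem B_le_L : p.B ≤ p.L := by have := p.L_eq; omega

end Params

/-- A 3SUM instance, the number `l` of digits in base `B`, and a bound `M` for the words. -/
structure Input (p : Params) where
  A : List ℕ
  l : ℕ
  M : ℕ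
  nodup : A.Nodup
  pos : 1 ≤ A.length
  mem : ∀ a ∈ A, 1 ≤ a ∧ a ≤ A.length ^ p.c
  pow_le : (p.B ^ l) ^ p.g ≤ A.length
  lt_pow : A.length < (p.B * p.B ^ l) ^ p.g
  n_lt : A.length < M
  elem_lt : A.length ^ p.c < M
  N_lt : (A.length + 1) ^ p.B + 1 < M
  layers_lt : (p.k * l + 1) * (p.L ^ l) ^ p.k + 1 < M
  classes_lt : (p.B ^ l) ^ p.k + 1 < M
  const_lt : p.L + p.k < M
  cube_lt : A.length ^ 3 + 1 < M
  tables_lt : 4 * (p.B ^ p.g + 3) ^ 2 * A.length ^ 3 < M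
  call_lt : p.C * (p.B ^ l) ^ p.g' < M

namespace Input

variable {p : Params} (d : Input p)

/-- The number of elements. -/
def n : ℕ := d.A.length
/-- The elements. -/
def S : Finset ℕ := d.A.toFinset
/-- A bound for the moduli. -/
def W : ℕ := p.B ^ d.l
/-- `W` with the digits read in base `L`. -/
def LL : ℕ := p.L ^ d.l
/-- The number of axes of the Fourier transform. -/
def K : ℕ := p.k * d.l
/-- The size of the Fourier transform. -/
def Ts : ℕ := d.LL ^ p.k
/-- The modulus of the Fourier transform. -/
def N : ℕ := (d.n + 1) ^ p.B + 1

theorem Ts_eq : d.Ts = p.L ^ d.K := by rw [Ts, LL, ← pow_mul, K, mul_comm]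
theorem W_pos : 1 ≤ d.W := Nat.one_le_pow _ _ (by have := p.one_lt_B; omega)
theorem Ts_pos : 1 ≤ d.Ts := by
  rw [Ts_eq]; exact Nat.one_le_pow _ _ (by have := p.one_lt_L; omega)
theorem LL_pos : 1 ≤ d.LL := Nat.one_le_pow _ _ (by have := p.one_lt_L; omega)
theorem one_le_k : 1 ≤ p.k := by have := p.one_le_r; unfold Params.k; omega
theorem LL_le_Ts : d.LL ≤ d.Ts := Nat.le_self_pow (by have := one_le_k (p := p); omega) _
theorem W_le_pow : d.W ≤ d.W ^ p.k := Nat.le_self_pow (by have := one_le_k (p := p); omega) _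

theorem l_lt_W : d.l < d.W := by
  unfold W
  calc d.l < 2 ^ d.l := Nat.lt_two_pow_self
    _ ≤ _ := Nat.pow_le_pow_left (by have := p.one_lt_B; omega) _

/-- Doubling the base of the digits enlarges the domain of the transform by `2 ^ (l * k)`. As `B = 2
^ b` with `b ≥ k`, this is at most `W`. -/
theorem two_pow_l_pow_k_le : (2 ^ d.l) ^ p.k ≤ d.W := by
  unfold W Params.B
  rw [← pow_mul, ← pow_mul, mul_comm p.b]
  refine Nat.pow_le_pow_right (by omega) (Nat.mul_le_mul_left _ ?_)
  unfold Params.b; omega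

theorem LL_eq : d.LL = 2 ^ d.l * d.W := by rw [LL, W, p.L_eq, mul_pow]

theorem Ts_le : d.Ts ≤ d.W ^ (p.k + 1) := by
  rw [Ts, LL_eq, mul_pow, pow_succ, mul_comm]
  exact Nat.mul_le_mul_left _ d.two_pow_l_pow_k_le

theorem layers_le : (d.K + 1) * d.Ts ≤ (p.k + 1) * d.W ^ (p.k + 2) := by
  have h₁ : d.K + 1 ≤ (p.k + 1) * d.W := by
    have := d.l_lt_W
    unfold K
    nlinarith
  calc (d.K + 1) * d.Ts ≤ (p.k + 1) * d.W * d.W ^ (p.k + 1) := Nat.mul_le_mul h₁ d.Ts_le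
    _ = _ := by ring

theorem n_le : d.n ≤ p.B ^ p.g * d.W ^ p.g := by
  have := d.lt_pow.le
  rwa [mul_pow] at this

theorem g_le_k : p.g ≤ p.k := by have := p.le_ry; unfold Params.k; omega

theorem n_le' : d.n ≤ p.B ^ p.g * d.W ^ (p.k + 2) :=
  d.n_le.trans (Nat.mul_le_mul_left _ (Nat.pow_le_pow_right d.W_pos
    (by have := g_le_k (p := p); omega)))

theorem W_le_n : d.W ≤ d.n := by
  refine le_trans ?_ d.pow_le
  exact Nat.le_self_pow (by have := p.r_le; omega) _

/-- The quantity computed by the transform is `Ts` times a number of triples. It is smaller than the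
modulus `N`, hence determined by its residue. The choice `b = 2 * k + 3` is made for this, from `Ts
≤ n ^ (2 * k)` and `b < B`. -/
theorem Ts_mul_lt : d.Ts * d.n ^ 3 < d.N := by
  have h₁ : d.Ts ≤ d.n ^ (2 * p.k) := by
    calc d.Ts ≤ d.W ^ (p.k + 1) := d.Ts_le
      _ ≤ d.W ^ (2 * p.k) := Nat.pow_le_pow_right d.W_pos (by have := one_le_k (p := p); omega)
      _ ≤ _ := Nat.pow_le_pow_left d.W_le_n _
  unfold N
  calc d.Ts * d.n ^ 3 ≤ d.n ^ (2 * p.k) * d.n ^ 3 := Nat.mul_le_mul_right _ h₁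
    _ = d.n ^ p.b := by rw [← pow_add, Params.b]
    _ ≤ (d.n + 1) ^ p.b := Nat.pow_le_pow_left (by omega) _
    _ ≤ (d.n + 1) ^ p.B := Nat.pow_le_pow_right (by omega) p.B_ge.le
    _ < _ := by omega

theorem n_lt_N : d.n < d.N := by
  have h₁ := d.Ts_mul_lt
  have h₂ := d.Ts_pos
  have h₃ : d.n ≤ d.n ^ 3 := Nat.le_self_pow (by omega) _
  nlinarith

theorem card_S : d.S.card = d.n := List.toFinset_card_of_nodup d.nodup

theorem mem_S {a : ℕ} : a ∈ d.S ↔ a ∈ d.A := List.mem_toFinset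

theorem length_filter (q : ℕ → Prop) [DecidablePred q] :
    (d.A.filter fun a => q a).length = (d.S.filter q).card := by
  rw [S, ← List.toFinset_card_of_nodup (d.nodup.filter _)]
  congr 1
  ext a; simp

end Input

/-! ### Frame conditions and sorting into classes -/

namespace WordRAM

/-- The states agree up to the registers in `R` and the arrays in `X`. -/
def Agree (R X : List ℕ) (σ τ : State) : Prop :=
  (∀ x, x ∉ R → τ.reg x = σ.reg x) ∧ ∀ a, a ∉ X → τ.arr a = σ.arr a

theorem Runs.agree {M : ℕ} {q : Program} {σ : State} {T : ℕ} {Q : State → Prop}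
    (h : Runs M q σ T Q) (R X : List ℕ) (hR : ∀ x ∈ q.modR, x ∈ R) (hX : ∀ x ∈ q.modA, x ∈ X) :
    Runs M q σ T (fun τ => Q τ ∧ Agree R X σ τ) :=
  h.frame.mono le_rfl fun _ hτ => ⟨hτ.1, fun x hx => hτ.2.1 x fun h => hx (hR x h),
    fun x hx => hτ.2.2 x fun h => hx (hX x h)⟩

theorem Agree.trans {R X : List ℕ} {σ τ υ : State} (h : Agree R X σ τ) (h' : Agree R X τ υ) :
    Agree R X σ υ :=
  ⟨fun x hx => (h'.1 x hx).trans (h.1 x hx), fun x hx => (h'.2 x hx).trans (h.2 x hx)⟩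

theorem Agree.mono {R X R' X' : List ℕ} {σ τ : State} (h : Agree R X σ τ) (hR : R ⊆ R')
    (hX : X ⊆ X') : Agree R' X' σ τ :=
  ⟨fun x hx => h.1 x fun h => hx (hR h), fun x hx => h.2 x fun h => hx (hX h)⟩

theorem Agree.refl (R X : List ℕ) (σ : State) : Agree R X σ σ := ⟨fun _ _ => rfl, fun _ _ => rfl⟩

theorem Agree.filled (σ : State) (a x l : ℕ) (f : ℕ → ℕ) (j : ℕ) :
    Agree [x] [a] σ (σ.filled a x l f j) := by
  constructor
  · intro z hz; simp only [List.mem_singleton] at hz; simp [State.filled, hz]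
  · intro z hz; simp only [List.mem_singleton] at hz; simp [State.filled, hz]

/-- Sort the elements of array `0` into classes by the value of `key`: array `cnt` counts the
elements of the classes, array `out` lists them. -/
def groupProg (cnt out x kr : ℕ) (size key : Expr) : Program :=
  .seq (.fill cnt x (.const 0) size (.const 0))
    (.for x (.const 0) (.reg 0) (.seq (.assign kr key)
      (.seq (.write out (.reg kr * .reg 0 + .read cnt (.reg kr)) (.read 0 (.reg x)))
        (.write cnt (.reg kr) (.read cnt (.reg kr) + .const 1)))))

/-- Class `v` owns the cells from `v * A.length` on. It has at most `A.length` elements, so the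
classes cannot overlap. Only the counters are cleared beforehand, since cells beyond a counter are
never promised; thus the large list array causes no initialization cost. -/
theorem Runs.group {M cnt out x kr h : ℕ} {size key : Expr} {σ : State} {A : List ℕ} {κ : ℕ → ℕ}
    (hcnt : cnt ≠ 0) (hout : out ≠ 0) (hco : cnt ≠ out) (hx : x ≠ 0) (hkr : kr ≠ 0) (hxk : x ≠ kr)
    (hn : σ.reg 0 = A.length) (hA : ∀ i, σ.arr 0 i = A.getD i 0)
    (hnM : A.length < M) (hAM : ∀ a ∈ A, a < M) (hhM : h < M)
    (hsize : ∀ τ, Agree [x] [cnt] σ τ → size.eval τ = h)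
    (hκ : ∀ a ∈ A, κ a < h)
    (hkey : ∀ τ i (hi : i < A.length), Agree [x, kr] [cnt, out] σ τ → τ.reg x = i →
      key.eval τ = κ A[i]) :
    Runs M (groupProg cnt out x kr size key) σ
      ((size.cost + 10 + 1) * (h + 1) + (key.cost + 30) * (A.length + 1)) (fun τ =>
        (∀ v < h, τ.arr cnt v = (A.filter fun a => κ a = v).length) ∧
        ∀ v, ∀ o < (A.filter fun a => κ a = v).length,
          τ.arr out (v * A.length + o) = (A.filter fun a => κ a = v).getD o 0) := by
  have hM0 : 0 < M := by omega
  refine Runs.time (Runs.seq (R := fun τ => (∀ v < h, τ.arr cnt v = 0) ∧ Agree [x] [cnt] σ τ)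
    ((Runs.fill (fun _ => 0) (l := 0) (h := h) rfl (by omega) hhM
      (fun j => hsize _ (Agree.filled ..)) (fun j _ _ => ⟨rfl, by omega⟩)).agree [x] [cnt]
      (by simp [Program.fill, Program.for, Program.modR])
      (by simp [Program.fill, Program.for, Program.modA]) |>.mono le_rfl
      fun τ hτ => ⟨fun v hv => by simp [hτ.1, hv], hτ.2⟩)
    (Q := _) (T₂ := (key.cost + 30) * (A.length + 1)) fun σ₁ hσ₁ => ?_) (by simp [Expr.cost]; omega)
  obtain ⟨hz, hag⟩ := hσ₁
  -- After `i` rounds both arrays are correct for the prefix `A.take i`.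
  refine (Runs.for_const (fun i τ => τ.reg x = i ∧ Agree [x, kr] [cnt, out] σ τ ∧
    (∀ v < h, τ.arr cnt v = ((A.take i).filter fun a => κ a = v).length) ∧
    ∀ v, ∀ o < ((A.take i).filter fun a => κ a = v).length,
      τ.arr out (v * A.length + o) = ((A.take i).filter fun a => κ a = v).getD o 0)
    (key.cost + 17) (l := 0) (h := A.length) rfl (by omega) hnM ?_ ?_ ?_).mono ?_ ?_
  · refine ⟨by simp, ⟨fun z hz => ?_, fun z hz => ?_⟩, fun v hv => ?_, by simp⟩
    · simp only [List.mem_cons, not_or] at hz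
      rw [setReg_reg, Function.update_of_ne hz.1]
      exact hag.1 z (by simp [hz.1])
    · simp only [List.mem_cons, not_or] at hz
      exact hag.2 z (by simp [hz.1])
    · simpa using hz v hv
  · rintro i τ ⟨h₁, h₂, -⟩
    refine ⟨h₁, ?_⟩
    rw [eval_reg, h₂.1 0 (by simp [hx.symm, hkr.symm]), hn]
  · rintro i τ - hi ⟨h₁, h₂, h₃, h₄⟩
    have hAi : A.getD i 0 = A[i] := by simp [hi]
    have hmem : A[i] ∈ A := List.getElem_mem hi
    have hk := hkey τ i hi h₂ h₁
    have hkh := hκ _ hmem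
    have e0 : τ.reg 0 = A.length := by rw [h₂.1 0 (by simp [hx.symm, hkr.symm]), hn]
    have a0 : τ.arr 0 i = A[i] := by
      rw [h₂.2 0 (by simp [hcnt.symm, hout.symm]), hA, hAi]
    have hlen : ((A.take i).filter fun a => κ a = κ A[i]).length < A.length :=
      lt_of_le_of_lt (List.length_filter_le _ _) (by simp; omega)
    have hc := h₃ _ hkh
    have htake : A.take (i + 1) = A.take i ++ [A[i]] := by simp
    refine (Runs.seq (R := fun υ => υ = τ.setReg kr (κ A[i])) (T₁ := key.cost + 1) (T₂ := 16)
      (.assign (by rw [hk]; omega) (by rw [hk])) fun υ hυ => ?_).time (by omega)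
    subst hυ
    refine Runs.seq (R := fun υ => υ = (τ.setReg kr (κ A[i])).setArr out
      (κ A[i] * A.length + ((A.take i).filter fun a => κ a = κ A[i]).length) A[i]) (T₁ := 9)
      (T₂ := 7)
      (Runs.write ?_ ?_ ) fun υ hυ => ?_
    · simp [hxk, h₁, a0, hAM _ hmem]
    · simp [hxk, h₁, a0, hkr.symm, e0, hc]
    subst hυ
    refine (Runs.write ?_ ?_ ).time (by simp [Expr.cost])
    · simp [hco, hc]; omega
    have hcr : (((τ.setReg kr (κ A[i])).setArr out
      (κ A[i] * A.length + ((A.take i).filter fun a => κ a = κ A[i]).length) A[i]).setArr cnt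
        (κ A[i]) (((A.take i).filter fun a => κ a = κ A[i]).length + 1)).reg x = i := by
      simp [hxk, h₁]
    have hval : (Expr.read cnt (.reg kr) + .const 1).eval ((τ.setReg kr (κ A[i])).setArr out
      (κ A[i] * A.length + ((A.take i).filter fun a => κ a = κ A[i]).length) A[i]) =
      ((A.take i).filter fun a => κ a = κ A[i]).length + 1 := by
      simp [hco, hc]
    have hid : (Expr.reg kr).eval ((τ.setReg kr (κ A[i])).setArr out
      (κ A[i] * A.length + ((A.take i).filter fun a => κ a = κ A[i]).length) A[i]) = κ A[i] := by
      simp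
    rw [hval, hid]
    refine ⟨hcr, by simp, ⟨fun z hz => ?_, fun z hz => ?_⟩, fun v hv => ?_, fun v o ho => ?_⟩
    · simp only [List.mem_cons, List.not_mem_nil, or_false, not_or] at hz
      simp [hz.1, hz.2, h₂.1 z (by simp [hz.1, hz.2])]
    · simp only [List.mem_cons, List.not_mem_nil, or_false, not_or] at hz
      simp [hz.1, hz.2, h₂.2 z (by simp [hz.1, hz.2])]
    · rw [htake, List.filter_append, List.length_append]
      by_cases hvk : v = κ A[i]
      · subst hvk; simp
      · simp [hvk, Ne.symm hvk, Function.update_of_ne hco, h₃ v hv]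
    · rw [htake, List.filter_append] at ho ⊢
      by_cases hvk : κ A[i] = v
      · subst hvk
        simp only [decide_true, List.filter_cons_of_pos, List.filter_nil, List.length_append,
          List.length_singleton] at ho
        simp only [setReg_arr, setArr_arr, Function.update_of_ne hco.symm, Function.update_self]
        rcases Nat.lt_succ_iff_lt_or_eq.1 ho with ho' | ho'
        · rw [Function.update_of_ne (by omega), h₄ _ o ho', List.getD_append _ _ _ _ ho']
        · rw [ho', Function.update_self, List.getD_append_right _ _ _ _ le_rfl]
          simp
      · simp only [hvk, decide_false, Bool.false_eq_true, not_false_eq_true,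
          List.filter_cons_of_neg, List.filter_nil, List.append_nil] at ho ⊢
        have ho' : o < A.length :=
          ho.trans_le ((List.length_filter_le _ _).trans (by simp))
        simp only [setReg_arr, setArr_arr, Function.update_of_ne hco.symm, Function.update_self]
        rw [Function.update_of_ne, h₄ v o ho]
        intro heq
        apply hvk
        have h₅ := congrArg (· / A.length) heq
        rw [mul_add_div_of_lt ho', mul_add_div_of_lt hlen] at h₅
        exact h₅.symm
  · simp only [Expr.cost]
    exact Nat.mul_le_mul_right _ (by omega)
  · rintro τ ⟨-, -, h₃, h₄⟩
    simp only [List.take_length] at h₃ h₄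
    exact ⟨h₃, h₄⟩

end WordRAM

/-! ### The program that counts triples -/

namespace Params

variable (p : Params)

/-- The residues of `e` modulo all moduli, as the digits of a number in base `W`. -/
def packE (e : Expr) : Expr := .horner (.reg 1) (fun j => e % .read 1 (.const j)) p.k

/-- Sort the elements into the classes of elements with the same residues. -/
def classProg : Program := groupProg 8 9 9 12 ((Expr.reg 1).pow p.k) (p.packE (.read 0 (.reg 9)))

/-- Count the elements by the residues, spread to base `L`. -/
def spreadProg : Program :=
  groupProg 6 10 9 12 (.reg 10)
    (.horner (.reg 2) (fun j => .read 3 (.read 0 (.reg 9) % .read 1 (.const j))) p.k)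

/-- The number of elements with the residues that are encoded by register `9`. -/
def decodeE : Expr :=
  .read 8 (.horner (.reg 1) (fun j =>
    .read 4 ((.reg 9 / (Expr.reg 2).pow (p.k - 1 - j)) % .reg 2) % .read 1 (.const j)) p.k)

def decodeProg : Program := .fill 7 9 (.const 0) (.reg 10) p.decodeE

/-- One value of a layer of the Fourier transform in terms of the previous layer. -/
def layerE (a s : ℕ) : Expr :=
  let stride : Expr := .read 2 (.reg 9 / .reg 10 - .const 1)
  let digit : Expr := (.reg 9 % .reg 10 / stride) % .const p.L
  .sum (fun x => .read 5 ((.const s * (.const x * digit)) % .const p.L) *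
    .read a (.reg 9 - .reg 10 - digit * stride + .const x * stride)) p.L % .reg 11

/-- The layers of the transform are stored one behind the other in the same array: cell `t * Ts + i`
holds entry `i` after `t` digits have been transformed. The input is layer `0`, so filling starts at
`Ts`. -/
def dftProg (a s : ℕ) : Program :=
  .fill a 9 (.reg 10) ((.const p.k * .reg 3 + .const 1) * .reg 10) (p.layerE a s)

/-- Prefix sums modulo `N` of the products over the last layers. The comparison is a factor `0` for
cell `0` and `1` otherwise. -/
def accE : Expr :=
  let i : Expr := .const p.k * .reg 3 * .reg 10 + (.reg 9 - .const 1)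
  (.read 11 (.reg 9 - .const 1) + .read 6 i * .read 6 i * .read 7 i) % .reg 11 *
    .op .lt (.const 0) (.reg 9)

def accProg : Program := .fill 11 9 (.const 0) (.reg 10 + .const 1) p.accE

/-- Count the triples that look like solutions modulo all moduli. -/
def countProg : Program :=
  .seq p.classProg (.seq p.spreadProg (.seq p.decodeProg (.seq (p.dftProg 6 1)
    (.seq (p.dftProg 7 (p.L - 1)) (.seq p.accProg
      (.assign 8 (.read 11 (.reg 10) / .reg 10)))))))

end Params

/-! ### Correctness and time of counting -/

namespace Input

variable {p : Params} (d : Input p)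

/-- The tables that are needed for counting. -/
structure Setup (σ : State) : Prop where
  r0 : σ.reg 0 = d.n
  r1 : σ.reg 1 = d.W
  r2 : σ.reg 2 = d.LL
  r3 : σ.reg 3 = d.l
  r10 : σ.reg 10 = d.Ts
  r11 : σ.reg 11 = d.N
  a0 : ∀ i, σ.arr 0 i = d.A.getD i 0
  a2 : ∀ t ≤ d.K, σ.arr 2 t = p.L ^ t
  a3 : ∀ x < d.W, σ.arr 3 x = rebase p.B p.L x
  a4 : ∀ z < d.LL, σ.arr 4 z = rebase p.L p.B z
  a5 : ∀ t < p.L, σ.arr 5 t = (d.n + 1) ^ t % d.N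

theorem Setup.agree {d : Input p} {σ τ : State} (h : d.Setup σ) {R X : List ℕ}
    (ha : Agree R X σ τ) (hR : ∀ x ∈ R, x ∉ [0, 1, 2, 3, 10, 11])
    (hX : ∀ x ∈ X, x ∉ [0, 2, 3, 4, 5]) : d.Setup τ := by
  have hr : ∀ x, x ∈ [0, 1, 2, 3, 10, 11] → τ.reg x = σ.reg x :=
    fun x hx => ha.1 x fun h => hR x h hx
  have hr' : ∀ x, x ∈ [0, 2, 3, 4, 5] → τ.arr x = σ.arr x := fun x hx => ha.2 x fun h => hX x h hx
  constructor
  · rw [hr 0 (by simp), h.r0]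
  · rw [hr 1 (by simp), h.r1]
  · rw [hr 2 (by simp), h.r2]
  · rw [hr 3 (by simp), h.r3]
  · rw [hr 10 (by simp), h.r10]
  · rw [hr 11 (by simp), h.r11]
  · rw [hr' 0 (by simp)]; exact h.a0
  · rw [hr' 2 (by simp)]; exact h.a2
  · rw [hr' 3 (by simp)]; exact h.a3
  · rw [hr' 4 (by simp)]; exact h.a4
  · rw [hr' 5 (by simp)]; exact h.a5

/-- Array `1` holds the moduli. -/
def Moduli (P : ℕ → ℕ) (σ : State) : Prop :=
  ∀ j < p.k, σ.arr 1 j = P j ∧ 1 ≤ P j ∧ P j ≤ d.W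

theorem Moduli.agree {d : Input p} {P : ℕ → ℕ} {σ τ : State} (h : d.Moduli P σ) {R X : List ℕ}
    (ha : Agree R X σ τ) (hX : 1 ∉ X) : d.Moduli P τ := by
  unfold Moduli
  rw [ha.2 1 hX]
  exact h

/-- The residues of `a` as the digits of a number. -/
def pk (P : ℕ → ℕ) (a : ℕ) : ℕ := horner d.W (fun j => a % P j) p.k

/-- The residues of `a` as the digits of a number in base `L ^ l`, spread. -/
def spread (P : ℕ → ℕ) (a : ℕ) : ℕ := horner d.LL (fun j => rebase p.B p.L (a % P j)) p.k

/-- The number of elements with the residues that are encoded by `z`. -/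
def decoded (P : ℕ → ℕ) (z : ℕ) : ℕ :=
  (d.S.filter fun c => ∀ j < p.k,
    c % P j = rebase p.L p.B (z / d.LL ^ (p.k - 1 - j) % d.LL) % P j).card

/-- The elements of class `v`. -/
def cls (P : ℕ → ℕ) (v : ℕ) : List ℕ := d.A.filter fun a => d.pk P a = v

theorem pk_lt {P : ℕ → ℕ} (hP : ∀ j < p.k, 1 ≤ P j ∧ P j ≤ d.W) (a : ℕ) :
    d.pk P a < d.W ^ p.k :=
  horner_lt fun j hj => (Nat.mod_lt _ (hP j hj).1).trans_le (hP j hj).2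

theorem pk_eq_iff {P : ℕ → ℕ} (hP : ∀ j < p.k, 1 ≤ P j ∧ P j ≤ d.W) {f : ℕ → ℕ}
    (hf : ∀ j < p.k, f j < d.W) (a : ℕ) :
    d.pk P a = horner d.W f p.k ↔ ∀ j < p.k, a % P j = f j :=
  horner_inj (fun j hj => (Nat.mod_lt _ (hP j hj).1).trans_le (hP j hj).2) hf

theorem spread_props {P : ℕ → ℕ} (hP : ∀ j < p.k, 1 ≤ P j ∧ P j ≤ d.W) (a : ℕ) :
    SmallDigits p.L p.B (d.spread P a) := by
  -- Beyond `k` nothing is known about the moduli; the digits there are irrelevant and replaced by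
  -- `0`, so that the bound holds for all indices.
  have : d.spread P a = horner d.LL
      (fun j => if j < p.k then rebase p.B p.L (a % P j) else 0) p.k :=
    horner_congr fun j hj => by simp [hj]
  rw [this]
  refine SmallDigits.horner (by have := p.one_lt_B; omega) (by have := p.one_lt_L; omega)
    (fun j => ?_) _
  by_cases hj : j < p.k
  · simp only [hj, if_true]
    exact ⟨SmallDigits.rebase p.one_lt_B p.B_le_L _, rebase_lt p.one_lt_B p.B_le_L _ _
      ((Nat.mod_lt _ (hP j hj).1).trans_le (hP j hj).2)⟩
  · simp only [hj, if_false]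
    exact ⟨.zero (by have := p.one_lt_B; omega), d.LL_pos⟩

theorem horner_add_fun (W : ℕ) (f g : ℕ → ℕ) (k : ℕ) :
    horner W f k + horner W g k = horner W (fun j => f j + g j) k := by
  induction k with
  | zero => rfl
  | succ k ih => simp only [horner, ← ih]; ring

/-- Spread residues add without carries, neither within a block of `l` digits nor from one block to
the next. Each block of the sum therefore decodes to the sum of two residues as integers, even if it
exceeds the modulus. -/
theorem spread_add {P : ℕ → ℕ} (hP : ∀ j < p.k, 1 ≤ P j ∧ P j ≤ d.W) (a b : ℕ) :
    d.spread P a + d.spread P b < d.Ts ∧ ∀ j < p.k,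
      rebase p.L p.B ((d.spread P a + d.spread P b) / d.LL ^ (p.k - 1 - j) % d.LL) =
        a % P j + b % P j := by
  have hm : ∀ (x : ℕ) j, j < p.k → x % P j < p.B ^ d.l := fun x j hj =>
    (Nat.mod_lt _ (hP j hj).1).trans_le (hP j hj).2
  have hlt : ∀ j < p.k, rebase p.B p.L (a % P j) + rebase p.B p.L (b % P j) < d.LL := by
    intro j hj
    rw [LL, p.L_eq]
    exact rebase_add_lt p.one_lt_B _ _ _ (hm a j hj) (hm b j hj)
  unfold spread
  rw [horner_add_fun]
  refine ⟨horner_lt hlt, fun j hj => ?_⟩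
  rw [horner_digit (f := fun j => rebase p.B p.L (a % P j) + rebase p.B p.L (b % P j)) hlt hj,
    p.L_eq]
  exact rebase_rebase_add p.one_lt_B d.l _ _ (hm a j hj) (hm b j hj)

theorem spread_lt {P : ℕ → ℕ} (hP : ∀ j < p.k, 1 ≤ P j ∧ P j ≤ d.W) (a : ℕ) :
    d.spread P a < d.Ts := by have := (d.spread_add hP a a).1; omega

/-- Decoding recovers `a % P j + b % P j` for each `j`, and `decoded` reduces it modulo `P j` before
comparing with `c`. So a pair `(a, b)` contributes exactly its matching `c`, and no wrap-around has
to be enumerated. -/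
theorem decoded_spread {P : ℕ → ℕ} (hP : ∀ j < p.k, 1 ≤ P j ∧ P j ≤ d.W) :
    ∑ a ∈ d.S, ∑ b ∈ d.S, d.decoded P (d.spread P a + d.spread P b) =
      tripleCount d.S P p.k := by
  rw [tripleCount_eq_sum]
  refine Finset.sum_congr rfl fun a _ => Finset.sum_congr rfl fun b _ => ?_
  unfold decoded
  congr 1
  refine Finset.filter_congr fun c _ => forall₂_congr fun j hj => ?_
  rw [(d.spread_add hP a b).2 j hj, Nat.ModEq, Nat.add_mod a b, eq_comm]

theorem decoded_le (P : ℕ → ℕ) (z : ℕ) : d.decoded P z ≤ d.n := by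
  rw [← d.card_S]; exact Finset.card_le_card (Finset.filter_subset _ _)

theorem length_cls (P : ℕ → ℕ) (v : ℕ) :
    (d.cls P v).length = (d.S.filter fun a => d.pk P a = v).card :=
  d.length_filter fun a => d.pk P a = v

/-- Array `8` counts the elements of the classes, array `9` lists them. -/
def Classes (P : ℕ → ℕ) (σ : State) : Prop :=
  (∀ v < d.W ^ p.k, σ.arr 8 v = (d.cls P v).length) ∧
    ∀ v, ∀ o < (d.cls P v).length, σ.arr 9 (v * d.n + o) = (d.cls P v).getD o 0

theorem elem_lt' {a : ℕ} (ha : a ∈ d.A) : a < d.M := (d.mem a ha).2.trans_lt d.elem_lt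

theorem W_pow_le (p' : ℕ) (h : p' ≤ p.k + 2) : d.W ^ p' ≤ d.W ^ (p.k + 2) :=
  Nat.pow_le_pow_right d.W_pos h

theorem one_le_W_pow (e : ℕ) : 1 ≤ d.W ^ e := Nat.one_le_pow _ _ d.W_pos

theorem add_mul_le {u v a b x y X : ℕ} (hx : x ≤ a * X) (hy : y ≤ b * X) :
    u * x + v * y ≤ (u * a + v * b) * X := by
  rw [add_mul, mul_assoc, mul_assoc]
  exact Nat.add_le_add (Nat.mul_le_mul_left _ hx) (Nat.mul_le_mul_left _ hy)

/-- As in all specifications of this kind, the constant depends on the parameters `p` only. It is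
uniform in the instance, which makes it the constant of an `O`-bound. -/
theorem classProg_spec (p : Params) : ∃ c, ∀ (d : Input p) (P : ℕ → ℕ) (σ : State), d.Setup σ →
    d.Moduli P σ → Runs d.M p.classProg σ (c * d.W ^ (p.k + 2)) (d.Classes P) := by
  refine ⟨(((Expr.reg 1).pow p.k).cost + 11) * 2 + ((p.packE (.read 0 (.reg 9))).cost + 30) *
    (p.B ^ p.g + 1), fun d P σ hσ hP => ?_⟩
  have hP' : ∀ j < p.k, 1 ≤ P j ∧ P j ≤ d.W := fun j hj => (hP j hj).2
  refine (Runs.group (A := d.A) (κ := d.pk P) (h := d.W ^ p.k) (by norm_num) (by norm_num)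
    (by norm_num) (by norm_num) (by norm_num) (by norm_num) hσ.r0 hσ.a0 d.n_lt
    (fun a ha => d.elem_lt' ha) ?_ ?_ (fun a _ => d.pk_lt hP' a) ?_).mono ?_ ?_
  · have := d.classes_lt; unfold W; omega
  · intro τ hτ
    rw [eval_pow, eval_reg, hτ.1 1 (by simp), hσ.r1]
  · intro τ i hi hτ h9
    simp only [Params.packE, eval_horner, eval_reg, eval_mod, eval_read, eval_const, h9]
    rw [hτ.1 1 (by simp), hσ.r1, pk, hτ.2 0 (by simp), hτ.2 1 (by simp), hσ.a0,
      List.getD_eq_getElem _ _ hi]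
    exact horner_congr fun j hj => by rw [(hP j hj).1]
  · have h₁ : d.W ^ p.k + 1 ≤ 2 * d.W ^ (p.k + 2) := by
      have h₂ := d.W_pow_le p.k (by omega)
      have h₃ := d.one_le_W_pow (p.k + 2)
      omega
    have h₂ : d.A.length + 1 ≤ (p.B ^ p.g + 1) * d.W ^ (p.k + 2) := by
      have h₂ := d.n_le'
      have h₃ := d.one_le_W_pow (p.k + 2)
      unfold n at h₂
      rw [add_mul]; omega
    exact add_mul_le h₁ h₂
  · exact fun τ hτ => hτ

theorem spreadProg_spec (p : Params) : ∃ c, ∀ (d : Input p) (P : ℕ → ℕ) (σ : State), d.Setup σ →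
    d.Moduli P σ → Runs d.M p.spreadProg σ (c * d.W ^ (p.k + 2)) (fun τ =>
      ∀ z < d.Ts, τ.arr 6 z = (d.S.filter fun a => d.spread P a = z).card) := by
  refine ⟨((Expr.reg 10).cost + 11) * 2 + ((Expr.horner (.reg 2) (fun j => .read 3
    (.read 0 (.reg 9) % .read 1 (.const j))) p.k).cost + 30) *
    (p.B ^ p.g + 1), fun d P σ hσ hP => ?_⟩
  have hP' : ∀ j < p.k, 1 ≤ P j ∧ P j ≤ d.W := fun j hj => (hP j hj).2
  have hTsM : d.Ts < d.M := by
    have := d.layers_lt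
    have h : d.Ts ≤ (d.K + 1) * d.Ts := Nat.le_mul_of_pos_left _ (by omega)
    unfold Ts LL K at *; omega
  refine (Runs.group (A := d.A) (κ := d.spread P) (h := d.Ts) (by norm_num) (by norm_num)
    (by norm_num) (by norm_num) (by norm_num) (by norm_num) hσ.r0 hσ.a0 d.n_lt
    (fun a ha => d.elem_lt' ha) hTsM ?_ (fun a _ => d.spread_lt hP' a) ?_).mono ?_ ?_
  · intro τ hτ
    rw [eval_reg, hτ.1 10 (by simp), hσ.r10]
  · intro τ i hi hτ h9
    simp only [eval_horner, eval_reg, eval_mod, eval_read, eval_const, h9]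
    rw [hτ.1 2 (by simp), hσ.r2, spread, hτ.2 0 (by simp), hτ.2 1 (by simp), hτ.2 3 (by simp),
      hσ.a0, List.getD_eq_getElem _ _ hi]
    refine horner_congr fun j hj => ?_
    rw [(hP j hj).1, hσ.a3 _ ((Nat.mod_lt _ (hP' j hj).1).trans_le (hP' j hj).2)]
  · have h₁ : d.Ts + 1 ≤ 2 * d.W ^ (p.k + 2) := by
      have h₂ := d.Ts_le.trans (d.W_pow_le (p.k + 1) (by omega))
      have h₃ := d.one_le_W_pow (p.k + 2)
      omega
    have h₂ : d.A.length + 1 ≤ (p.B ^ p.g + 1) * d.W ^ (p.k + 2) := by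
      have h₂ := d.n_le'
      have h₃ := d.one_le_W_pow (p.k + 2)
      unfold n at h₂
      rw [add_mul]; omega
    exact add_mul_le h₁ h₂
  · intro τ hτ z hz
    rw [hτ.1 z hz]
    exact d.length_filter fun a => d.spread P a = z

theorem Ts_lt_M : (d.K + 1) * d.Ts + 1 < d.M := d.layers_lt

theorem Ts_succ_lt_M : d.Ts + 1 < d.M := by
  have := d.Ts_lt_M
  have h : d.Ts ≤ (d.K + 1) * d.Ts := Nat.le_mul_of_pos_left _ (by omega)
  omega

theorem N_lt_M : d.N < d.M := d.N_lt

/-- Prescribing all residues means prescribing the class, and the class number is obtained by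
packing the decoded residues. So each entry is one look-up in the table of class sizes. -/
theorem decodeProg_spec (p : Params) : ∃ c, ∀ (d : Input p) (P : ℕ → ℕ) (σ : State), d.Setup σ →
    d.Moduli P σ → d.Classes P σ → Runs d.M p.decodeProg σ (c * d.W ^ (p.k + 2)) (fun τ =>
      ∀ z < d.Ts, τ.arr 7 z = d.decoded P z) := by
  refine ⟨(p.decodeE.cost + 11) * 2, fun d P σ hσ hP hC => ?_⟩
  have hP' : ∀ j < p.k, 1 ≤ P j ∧ P j ≤ d.W := fun j hj => (hP j hj).2
  have hTsM := d.Ts_succ_lt_M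
  refine (Runs.fill (d.decoded P) (l := 0) (h := d.Ts) rfl (by omega) (by omega) ?_ ?_).mono ?_ ?_
  · intro j
    simp [State.filled, hσ.r10]
  · intro z _ hz
    refine ⟨?_, (d.decoded_le P z).trans_lt d.n_lt⟩
    have hag := Agree.filled σ 7 9 0 (d.decoded P) z
    have h9 : (σ.filled 7 9 0 (d.decoded P) z).reg 9 = z := by simp [State.filled]
    simp only [Params.decodeE, eval_read, eval_horner, eval_reg, eval_mod, eval_div, eval_pow,
      eval_const, h9]
    rw [hag.1 1 (by simp), hag.1 2 (by simp), hag.2 8 (by simp), hag.2 4 (by simp),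
      hag.2 1 (by simp), hσ.r1, hσ.r2]
    have hlt : ∀ j < p.k, rebase p.L p.B (z / d.LL ^ (p.k - 1 - j) % d.LL) % P j < d.W :=
      fun j hj => (Nat.mod_lt _ (hP' j hj).1).trans_le (hP' j hj).2
    rw [horner_congr (g := fun j => rebase p.L p.B (z / d.LL ^ (p.k - 1 - j) % d.LL) % P j)
      fun j hj => by rw [hσ.a4 _ (Nat.mod_lt _ d.LL_pos), (hP j hj).1], hC.1 _ (horner_lt hlt),
      length_cls, decoded]
    congr 1
    exact Finset.filter_congr fun c _ => d.pk_eq_iff hP' hlt c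
  · rw [mul_assoc]
    refine Nat.mul_le_mul (by simp [Expr.cost]) ?_
    have h₂ := d.Ts_le.trans (d.W_pow_le (p.k + 1) (by omega))
    have h₃ := d.one_le_W_pow (p.k + 2)
    omega
  · intro τ hτ z hz
    simp [hτ, hz]

/-- The root of unity. -/
def ω : ZMod d.N := (d.n + 1 : ℕ)

/-- This is the reason for the shape of `N`: `(n + 1) ^ B ≡ -1` by definition, so a root of unity is
available without any search for primes. -/
theorem ω_pow : d.ω ^ 2 ^ p.b = -1 := by
  have h : ((d.N : ℕ) : ZMod d.N) = 0 := ZMod.natCast_self _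
  rw [N, Params.B] at h
  push_cast at h
  rw [ω]
  push_cast
  exact eq_neg_of_add_eq_zero_left h

theorem ω_pow_L : d.ω ^ p.L = 1 := by
  rw [p.L_eq, mul_comm, pow_mul, Params.B, ω_pow]; ring

instance : NeZero d.N := ⟨by unfold N; omega⟩

/-- There are `K + 1` layers of `Ts` entries, and an entry costs a constant number of steps since
`L` is constant. The claim for all layers is carried through the filling of one array, each layer
reading the one before it. -/
theorem dftProg_spec (p : Params) (a s : ℕ) (ha : a ∉ [0, 2, 3, 4, 5]) :
    ∃ c, ∀ (d : Input p) (f : ℕ → ℕ) (σ : State), d.Setup σ →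
      (∀ z < d.Ts, σ.arr a z = f z ∧ f z < d.N) →
      Runs d.M (p.dftProg a s) σ (c * d.W ^ (p.k + 2)) (fun τ =>
        ∀ z < d.Ts, τ.arr a (d.K * d.Ts + z) =
          (partialDFT d.ω p.L s (fun x => (f x : ZMod d.N)) d.K z).val) := by
  refine ⟨((p.layerE a s).cost + (Expr.reg 10).cost +
    ((Expr.const p.k * .reg 3 + .const 1) * .reg 10 : Expr).cost + 9) * (p.k + 2),
    fun d f σ hσ hf => ?_⟩
  have hL := p.one_lt_L
  have hTs := d.Ts_pos
  have hM := d.Ts_lt_M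
  set v : ℕ → ℕ := fun J =>
    (partialDFT d.ω p.L s (fun x => (f x : ZMod d.N)) (J / d.Ts) (J % d.Ts)).val with hv
  have hvN : ∀ J, v J < d.N := fun J => ZMod.val_lt _
  have hv0 : ∀ z < d.Ts, v z = f z := by
    intro z hz
    simp only [hv, Nat.div_eq_of_lt hz, Nat.mod_eq_of_lt hz, partialDFT_zero]
    exact ZMod.val_cast_of_lt (hf z hz).2
  refine (Runs.fill v (l := d.Ts) (h := (d.K + 1) * d.Ts) (by simp [hσ.r10]) ?_ (by omega)
    ?_ ?_).mono ?_ ?_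
  · exact Nat.le_mul_of_pos_left _ (by omega)
  · intro j
    simp [State.filled, hσ.r10, hσ.r3, K]
  · intro J hJ₁ hJ₂
    refine ⟨?_, (hvN J).trans d.N_lt_M⟩
    have hag := Agree.filled σ a 9 d.Ts v J
    have h9 : (σ.filled a 9 d.Ts v J).reg 9 = J := by simp [State.filled]
    have harr : ∀ i < J, (σ.filled a 9 d.Ts v J).arr a i = v i := by
      intro i hi
      simp only [State.filled, Function.update_self]
      split_ifs with h
      · rfl
      · rw [(hf i (by omega)).1, hv0 i (by omega)]
    simp only [List.mem_cons, List.not_mem_nil, or_false, not_or] at ha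
    -- Every cell from `Ts` on is an entry `i` of a layer `t + 1`.
    obtain ⟨t, i, hi, rfl⟩ : ∃ t i, i < d.Ts ∧ J = (t + 1) * d.Ts + i := by
      refine ⟨J / d.Ts - 1, J % d.Ts, Nat.mod_lt _ hTs, ?_⟩
      have : 1 ≤ J / d.Ts := (Nat.one_le_div_iff hTs).2 hJ₁
      rw [Nat.sub_add_cancel this, Nat.div_add_mod']
    have ht : t < d.K := by
      by_contra hcon
      have : (d.K + 1) * d.Ts ≤ (t + 1) * d.Ts := Nat.mul_le_mul_right _ (by omega)
      omega
    have hdiv : ((t + 1) * d.Ts + i) / d.Ts = t + 1 := mul_add_div_of_lt hi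
    have hmod : ((t + 1) * d.Ts + i) % d.Ts = i := mul_add_mod_of_lt hi
    simp only [Params.layerE, eval_mod, eval_sum, eval_mul, eval_read, eval_const, eval_div,
      eval_reg, eval_sub, eval_add, h9]
    rw [hag.1 10 (by simp), hag.1 11 (by simp), hag.2 2 (by simp [Ne.symm ha.2.1]),
      hag.2 5 (by simp [Ne.symm ha.2.2.2.2]), hσ.r10, hσ.r11, hdiv, hmod, Nat.add_sub_cancel,
      hσ.a2 t ht.le]
    set S := p.L ^ t with hS
    set dg := i / S % p.L with hdg
    have hSpos : 0 < S := by positivity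
    -- Exchanging digit `t` of `i` for `x` stays within the layer. Also no truncation occurs in the
    -- subtraction.
    have hstep : ∀ x ∈ Finset.range p.L, i - dg * S + x * S < d.Ts ∧ dg * S ≤ i := by
      intro x hx
      rw [Finset.mem_range] at hx
      have hi' : i = S * (p.L * (i / S / p.L) + dg) + i % S := by
        rw [hdg, Nat.div_add_mod, Nat.div_add_mod]
      obtain ⟨m, hm⟩ : ∃ m, d.K = t + 1 + m := ⟨d.K - (t + 1), by omega⟩
      have hTsm : d.Ts = S * (p.L * p.L ^ m) := by
        rw [d.Ts_eq, hm, pow_add, pow_succ, mul_assoc]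
      have hq : i / S / p.L < p.L ^ m := by
        rw [Nat.div_div_eq_div_mul]
        refine Nat.div_lt_of_lt_mul ?_
        rw [mul_assoc, ← hTsm]; exact hi
      have hρ : i % S < S := Nat.mod_lt _ hSpos
      generalize i / S / p.L = q at *
      have e₁ : dg * S ≤ i := by
        have h₀ := hi'
        rw [mul_add] at h₀
        have : dg * S = S * dg := mul_comm _ _
        omega
      refine ⟨?_, e₁⟩
      have e₂ : i - dg * S = S * (p.L * q) + i % S := by
        rw [mul_add] at hi'
        have : dg * S = S * dg := mul_comm _ _
        omega
      rw [e₂, hTsm]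
      have e₃ : p.L * q + x + 1 ≤ p.L * p.L ^ m := by nlinarith
      have e₄ := Nat.mul_le_mul_left S e₃
      have e₅ : S * (p.L * q + x + 1) = S * (p.L * q) + x * S + S := by ring
      omega
    have hterm : ∀ x ∈ Finset.range p.L,
        σ.arr 5 (s * (x * dg) % p.L) * (σ.filled a 9 d.Ts v ((t + 1) * d.Ts + i)).arr a
          ((t + 1) * d.Ts + i - d.Ts - dg * S + x * S) =
        (d.n + 1) ^ (s * (x * dg) % p.L) % d.N * (partialDFT d.ω p.L s
          (fun x => (f x : ZMod d.N)) t (i - dg * S + x * S)).val := by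
      intro x hx
      obtain ⟨h₁, h₂⟩ := hstep x hx
      have e : (t + 1) * d.Ts + i - d.Ts - dg * S + x * S = t * d.Ts + (i - dg * S + x * S) := by
        have : (t + 1) * d.Ts = t * d.Ts + d.Ts := by ring
        omega
      rw [e, hσ.a5 _ (Nat.mod_lt _ (by omega)), harr _ (by nlinarith), hv]
      simp only
      rw [mul_add_div_of_lt h₁, mul_add_mod_of_lt h₁]
    -- The program adds natural numbers and reduces once; after casting to `ZMod N` this is the
    -- recursion of the transform. Exponents of `ω` may be reduced modulo `L`.
    rw [Finset.sum_congr rfl hterm, ← ZMod.val_natCast, hv]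
    simp only
    rw [hdiv, hmod, partialDFT_succ _ (by omega)]
    congr 1
    push_cast
    refine Finset.sum_congr rfl fun x _ => ?_
    rw [ZMod.natCast_zmod_val, ZMod.natCast_mod, pow_eq_pow_mod (s * (x * (i / p.L ^ t % p.L)))
      d.ω_pow_L]
    push_cast [ω]
    rfl
  · rw [mul_assoc]
    refine Nat.mul_le_mul le_rfl ?_
    have h₁ := d.layers_le
    have h₂ := d.one_le_W_pow (p.k + 2)
    have h₃ : (p.k + 2) * d.W ^ (p.k + 2) = (p.k + 1) * d.W ^ (p.k + 2) + d.W ^ (p.k + 2) := by ring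
    omega
  · intro τ hτ z hz
    have hlt : d.K * d.Ts + z < (d.K + 1) * d.Ts := by
      have : (d.K + 1) * d.Ts = d.K * d.Ts + d.Ts := by ring
      omega
    rw [hτ]
    simp only
    by_cases hle : d.Ts ≤ d.K * d.Ts + z
    · rw [if_pos ⟨hle, hlt⟩, hv]
      simp only
      rw [mul_add_div_of_lt hz, mul_add_mod_of_lt hz]
    -- A cell of the last layer that was not filled belongs to layer `0`, so there are no digits at
    -- all (`l = 0`) and the input is its own transform.
    · have hK : d.K = 0 := by
        by_contra hK
        have : d.Ts ≤ d.K * d.Ts := Nat.le_mul_of_pos_left _ (by omega)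
        omega
      rw [if_neg (by omega), hK, zero_mul, zero_add, (hf z hz).1, ← hv0 z hz, hv]
      simp only
      rw [Nat.div_eq_of_lt hz, Nat.mod_eq_of_lt hz]

end Input

namespace Input

variable {p : Params} (d : Input p)

theorem accProg_spec (p : Params) : ∃ c, ∀ (d : Input p) (F G : ℕ → ZMod d.N) (σ : State),
    d.Setup σ → (∀ z < d.Ts, σ.arr 6 (d.K * d.Ts + z) = (F z).val) →
    (∀ z < d.Ts, σ.arr 7 (d.K * d.Ts + z) = (G z).val) →
    Runs d.M p.accProg σ (c * d.W ^ (p.k + 2)) (fun τ =>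
      τ.arr 11 d.Ts = (∑ z ∈ Finset.range d.Ts, F z ^ 2 * G z).val) := by
  refine ⟨(p.accE.cost + (Expr.const 0).cost + (Expr.reg 10 + .const 1 : Expr).cost + 9) * 3,
    fun d F G σ hσ hF hG => ?_⟩
  have hM := d.Ts_succ_lt_M
  refine (Runs.fill (fun i => (∑ z ∈ Finset.range i, F z ^ 2 * G z).val) (l := 0) (h := d.Ts + 1)
    rfl (by omega) (by omega) ?_ ?_).mono ?_ ?_
  · intro j; simp [State.filled, hσ.r10]
  · intro i _ hi
    refine ⟨?_, (ZMod.val_lt _).trans d.N_lt_M⟩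
    have hag := Agree.filled σ 11 9 0 (fun i => (∑ z ∈ Finset.range i, F z ^ 2 * G z).val) i
    have h9 : (σ.filled 11 9 0 (fun i => (∑ z ∈ Finset.range i, F z ^ 2 * G z).val) i).reg 9 = i := by
      simp [State.filled]
    simp only [Params.accE, eval_mod, eval_mul, eval_read, eval_const, eval_reg, eval_sub, eval_add,
      eval_lt, h9]
    rw [hag.1 10 (by simp), hag.1 11 (by simp), hag.1 3 (by simp), hag.2 6 (by simp),
      hag.2 7 (by simp), hσ.r10, hσ.r11, hσ.r3]
    -- In cell `0` the truncated subtraction reads irrelevant cells, but the comparison multiplies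
    -- the result by `0`.
    rcases Nat.eq_zero_or_pos i with rfl | hi0
    · simp
    · obtain ⟨j, rfl⟩ : ∃ j, i = j + 1 := ⟨i - 1, by omega⟩
      have hj : j < d.Ts := by omega
      rw [if_pos hi0, mul_one, Nat.add_sub_cancel, show p.k * d.l = d.K from rfl, hF j hj, hG j hj]
      simp only [State.filled, Function.update_self]
      rw [if_pos ⟨by omega, by omega⟩, ← ZMod.val_natCast]
      congr 1
      push_cast
      rw [ZMod.natCast_zmod_val, ZMod.natCast_zmod_val, ZMod.natCast_zmod_val,
        Finset.sum_range_succ, sq]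
  · rw [mul_assoc]
    refine Nat.mul_le_mul le_rfl ?_
    have h₂ := d.Ts_le.trans (d.W_pow_le (p.k + 1) (by omega))
    have h₃ := d.one_le_W_pow (p.k + 2)
    omega
  · intro τ hτ
    rw [hτ]
    simp

/-- The number of triples is `∑ decoded (spread a + spread b)` over all pairs, which is a
convolution evaluated in frequency space. All auxiliary tables have size `O(Ts)` per layer, hence
the time `W ^ (k + 2)`. -/
theorem countProg_spec (p : Params) : ∃ c, ∀ (d : Input p) (P : ℕ → ℕ) (σ : State), d.Setup σ →
    d.Moduli P σ → Runs d.M p.countProg σ (c * d.W ^ (p.k + 2)) (fun τ =>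
      τ.reg 8 = tripleCount d.S P p.k) := by
  obtain ⟨c₁, h₁⟩ := classProg_spec p
  obtain ⟨c₂, h₂⟩ := spreadProg_spec p
  obtain ⟨c₃, h₃⟩ := decodeProg_spec p
  obtain ⟨c₄, h₄⟩ := dftProg_spec p 6 1 (by simp)
  obtain ⟨c₅, h₅⟩ := dftProg_spec p 7 (p.L - 1) (by simp)
  obtain ⟨c₆, h₆⟩ := accProg_spec p
  refine ⟨c₁ + (c₂ + (c₃ + (c₄ + (c₅ + (c₆ + 10))))), fun d P σ hσ hP => ?_⟩
  have hP' : ∀ j < p.k, 1 ≤ P j ∧ P j ≤ d.W := fun j hj => (hP j hj).2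
  have hone := d.one_le_W_pow (p.k + 2)
  have hN := d.N_lt_M
  simp only [add_mul]
  refine Runs.seq ((h₁ d P σ hσ hP).agree [9, 12] [8, 9]
    (by simp [Params.classProg, groupProg, Program.fill, Program.for, Program.modR])
    (by simp [Params.classProg, groupProg, Program.fill, Program.for, Program.modA]))
    fun σ₁ ⟨hC₁, ag₁⟩ => ?_
  have hσ₁ := hσ.agree ag₁ (by simp) (by simp)
  have hP₁ := hP.agree ag₁ (by simp)
  refine Runs.seq ((h₂ d P σ₁ hσ₁ hP₁).agree [9, 12] [6, 10]
    (by simp [Params.spreadProg, groupProg, Program.fill, Program.for, Program.modR])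
    (by simp [Params.spreadProg, groupProg, Program.fill, Program.for, Program.modA]))
    fun σ₂ ⟨hC₂, ag₂⟩ => ?_
  have hσ₂ := hσ₁.agree ag₂ (by simp) (by simp)
  have hP₂ := hP₁.agree ag₂ (by simp)
  have hC₂' : d.Classes P σ₂ := by
    unfold Classes; rw [ag₂.2 8 (by simp), ag₂.2 9 (by simp)]; exact hC₁
  refine Runs.seq ((h₃ d P σ₂ hσ₂ hP₂ hC₂').agree [9] [7]
    (by simp [Params.decodeProg, Program.fill, Program.for, Program.modR])
    (by simp [Params.decodeProg, Program.fill, Program.for, Program.modA]))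
    fun σ₃ ⟨hC₃, ag₃⟩ => ?_
  have hσ₃ := hσ₂.agree ag₃ (by simp) (by simp)
  refine Runs.seq ((h₄ d (fun z => (d.S.filter fun a => d.spread P a = z).card) σ₃ hσ₃
    fun z hz => ⟨?_, ?_⟩).agree [9] [6]
    (by simp [Params.dftProg, Program.fill, Program.for, Program.modR])
    (by simp [Params.dftProg, Program.fill, Program.for, Program.modA]))
    fun σ₄ ⟨hC₄, ag₄⟩ => ?_
  · rw [ag₃.2 6 (by simp)]; exact hC₂ z hz
  · refine lt_of_le_of_lt ?_ d.n_lt_N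
    rw [← d.card_S]
    exact Finset.card_le_card (Finset.filter_subset _ _)
  have hσ₄ := hσ₃.agree ag₄ (by simp) (by simp)
  refine Runs.seq ((h₅ d (d.decoded P) σ₄ hσ₄
    fun z hz => ⟨?_, ?_⟩).agree [9] [7]
    (by simp [Params.dftProg, Program.fill, Program.for, Program.modR])
    (by simp [Params.dftProg, Program.fill, Program.for, Program.modA]))
    fun σ₅ ⟨hC₅, ag₅⟩ => ?_
  · rw [ag₄.2 7 (by simp)]; exact hC₃ z hz
  · exact (d.decoded_le P z).trans_lt d.n_lt_N
  have hσ₅ := hσ₄.agree ag₅ (by simp) (by simp)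
  refine Runs.seq ((h₆ d
    (partialDFT d.ω p.L 1 (fun x => ((d.S.filter fun a => d.spread P a = x).card : ZMod d.N)) d.K)
    (partialDFT d.ω p.L (p.L - 1) (fun x => (d.decoded P x : ZMod d.N)) d.K) σ₅ hσ₅
      (fun z hz => by rw [ag₅.2 6 (by simp)]; exact hC₄ z hz)
    hC₅).agree [9] [11]
    (by simp [Params.accProg, Program.fill, Program.for, Program.modR])
    (by simp [Params.accProg, Program.fill, Program.for, Program.modA]))
    fun σ₆ ⟨hC₆, ag₆⟩ => ?_
  have hσ₆ := hσ₅.agree ag₆ (by simp) (by simp)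
  -- The identity holds in `ZMod N`. Both sides are below `N`, so it holds for natural numbers and
  -- the factor `Ts` can be divided out.
  have key : σ₆.arr 11 d.Ts = d.Ts * tripleCount d.S P p.k := by
    rw [hC₆]
    have hs := sum_partialDFT (K := d.K) d.ω_pow d.S (d.spread P)
      (fun a _ => d.spread_props hP' a)
      (fun a _ b _ => lt_of_lt_of_eq (d.spread_add hP' a b).1 d.Ts_eq) (d.decoded P)
    have hT : d.Ts = (2 ^ (p.b + 1)) ^ d.K := d.Ts_eq
    rw [← hT] at hs
    have hs' := hs
    rw [show (2 ^ (p.b + 1)) = p.L from rfl] at hs'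
    rw [hs', d.decoded_spread hP']
    refine ZMod.val_cast_of_lt (lt_of_le_of_lt (Nat.mul_le_mul_left _ ?_) d.Ts_mul_lt)
    rw [← d.card_S]
    exact tripleCount_le _ _ _
  have hval : (Expr.read 11 (.reg 10) / .reg 10 : Expr).eval σ₆ = tripleCount d.S P p.k := by
    simp [hσ₆.r10, key, Nat.mul_div_cancel_left _ d.Ts_pos]
  refine (Runs.assign ?_ ?_).time ?_
  · rw [hval]
    have h₇ := tripleCount_le d.S P p.k
    have h₈ := d.cube_lt
    rw [d.card_S, n] at h₇
    omega
  · simp only [hval]; simp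
  · simp only [cost_div, Expr.cost]
    omega

end Input

/-! ### The greedy choice of the moduli -/

/-- A congruence modulo `1` is no condition. Moduli not yet chosen are set to `1`, so the program
for all `k` moduli also evaluates the shorter prefixes. -/
theorem tripleCount_of_one {S : Finset ℕ} {P : ℕ → ℕ} {j k : ℕ} (hjk : j ≤ k)
    (h : ∀ i, j ≤ i → i < k → P i = 1) : tripleCount S P k = tripleCount S P j := by
  unfold tripleCount
  congr 1
  refine Finset.filter_congr fun t _ => ⟨fun h' i hi => h' i (by omega), fun h' i hi => ?_⟩
  rcases lt_or_ge i j with hij | hij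
  · exact h' i hij
  · rw [h i hij hi]; exact Nat.modEq_one

theorem IsGreedy.congr {S : Finset ℕ} {W m : ℕ} {P P' : ℕ → ℕ} (h : ∀ i < m, P i = P' i)
    (hP : IsGreedy S W m P) : IsGreedy S W m P' := by
  intro j hj q hq
  rw [← tripleCount_congr S (P := P) (P' := P') fun i hi => h i (by omega),
    ← tripleCount_congr S (P := Function.update P j q) (P' := Function.update P' j q)
      fun i hi => ?_]
  · exact hP j hj q hq
  · by_cases hij : i = j
    · subst hij; simp
    · simp [hij, h i (by omega)]

namespace Params

variable (p : Params)

/-- Try one candidate for the current modulus. -/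
def tryProg : Program :=
  .seq (.write 1 (.reg 4) (.reg 5)) (.seq p.countProg
    (.ite (.op .lt (.reg 8) (.reg 6)) (.seq (.assign 6 (.reg 8)) (.assign 7 (.reg 5))) .skip))

/-- Choose one modulus. -/
def chooseProg : Program :=
  .seq (.assign 6 ((Expr.reg 0).pow 3 + .const 1))
    (.seq (.for 5 (.reg 1 / .const 2 + .const 1) (.reg 1 + .const 1) p.tryProg)
      (.seq (.write 1 (.reg 4) (.reg 7)) (.write 12 (.reg 4) (.reg 6))))

/-- Choose all moduli. -/
def selectProg : Program := .for 4 (.const 0) (.const p.k) p.chooseProg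

/-- Find the base `W` of the digits. -/
def baseProg : Program :=
  .seq (.assign 1 (.const 1)) (.seq (.assign 2 (.const 1))
    (.loop (.op .le ((Expr.reg 1 * .const p.B).pow p.g) (.reg 0))
      (.seq (.assign 1 (.reg 1 * .const p.B)) (.seq (.assign 2 (.reg 2 * .const p.L))
        (.assign 3 (.reg 3 + .const 1))))))

/-- Compute the tables that are needed for counting. -/
def initProg : Program :=
  .seq p.baseProg (.seq (.assign 10 ((Expr.reg 2).pow p.k))
    (.seq (.assign 11 ((Expr.reg 0 + .const 1).pow p.B + .const 1))
    (.seq (.fill 2 9 (.const 0) (.const p.k * .reg 3 + .const 1)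
      (.read 2 (.reg 9 - .const 1) * .const p.L + .op .eq (.reg 9) (.const 0)))
    (.seq (.fill 3 9 (.const 0) (.reg 1)
      (.read 3 (.reg 9 / .const p.B) * .const p.L + .reg 9 % .const p.B))
    (.seq (.fill 4 9 (.const 0) (.reg 2)
      (.read 4 (.reg 9 / .const p.L) * .const p.B + .reg 9 % .const p.L))
    (.seq (.fill 5 9 (.const 0) (.const p.L)
      ((.read 5 (.reg 9 - .const 1) * (.reg 0 + .const 1) + .op .eq (.reg 9) (.const 0)) % .reg 11))
    (.fill 1 9 (.const 0) (.const p.k) (.const 1))))))))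

theorem modR_countProg : p.countProg.modR ⊆ [8, 9, 12] := by
  simp [countProg, classProg, spreadProg, decodeProg, dftProg, accProg, groupProg, Program.fill,
    Program.for, Program.modR]

theorem modA_countProg : p.countProg.modA ⊆ [6, 7, 8, 9, 10, 11] := by
  simp [countProg, classProg, spreadProg, decodeProg, dftProg, accProg, groupProg, Program.fill,
    Program.for, Program.modA]

end Params

namespace Input

variable {p : Params} (d : Input p)

theorem W_lt_M : d.W + 1 < d.M := by
  have h₁ := d.classes_lt
  have h₂ := d.W_le_pow
  unfold W at *; omega

theorem Moduli.update {d : Input p} {P : ℕ → ℕ} {σ : State} (h : d.Moduli P σ) {j q : ℕ}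
    {τ : State} (hτ : τ.arr 1 = Function.update (σ.arr 1) j q) (hq : 1 ≤ q ∧ q ≤ d.W) :
    d.Moduli (Function.update P j q) τ := by
  intro i hi
  rw [hτ]
  by_cases hij : i = j
  · subst hij; simpa using hq
  · simpa [hij] using h i hi

theorem mem_candidates {W q : ℕ} : q ∈ candidates W ↔ W / 2 + 1 ≤ q ∧ q < W + 1 := by
  simp [candidates]

/-- A linear search for the minimum among at most `W` candidates, each of which costs one count.
This is the source of the exponent `k + 3`. -/
theorem chooseProg_spec (p : Params) : ∃ c, ∀ (d : Input p) (P : ℕ → ℕ) (σ : State) (j : ℕ),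
    d.Setup σ → d.Moduli P σ → j < p.k → σ.reg 4 = j → (∀ i, j ≤ i → i < p.k → P i = 1) →
    Runs d.M p.chooseProg σ (c * d.W ^ (p.k + 3)) (fun τ => ∃ q ∈ candidates d.W,
      τ.arr 1 = Function.update (σ.arr 1) j q ∧
      τ.arr 12 = Function.update (σ.arr 12) j (tripleCount d.S (Function.update P j q) (j + 1)) ∧
      ∀ q' ∈ candidates d.W, tripleCount d.S (Function.update P j q) (j + 1) ≤
        tripleCount d.S (Function.update P j q') (j + 1)) := by
  obtain ⟨c, hc⟩ := countProg_spec p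
  refine ⟨((Expr.reg 0).pow 3 + .const 1 : Expr).cost + 1 + ((c + 40) * 3 + 10),
    fun d P σ j hσ hP hj h4 hone => ?_⟩
  have hcube := d.cube_lt
  have hWM := d.W_lt_M
  have hW := d.W_pos
  have hW1 := d.one_le_W_pow (p.k + 3)
  have hT := fun q => tripleCount_le d.S (Function.update P j q) (j + 1)
  simp only [d.card_S] at hT
  unfold n at hT
  set tc := fun q => tripleCount d.S (Function.update P j q) (j + 1) with htc
  have e6 : ((Expr.reg 0).pow 3 + .const 1 : Expr).eval σ = d.A.length ^ 3 + 1 := by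
    simp [hσ.r0, n]
  rw [add_mul]
  refine Runs.seq (R := fun τ => τ = σ.setReg 6 (d.A.length ^ 3 + 1))
    ((Runs.assign (by rw [e6]; omega) (by rw [e6])).time (Nat.le_mul_of_pos_right _ hW1))
    fun σ₁ hσ₁ => ?_
  rw [add_mul]
  refine Runs.seq (R := fun τ => Agree [5, 6, 7, 8, 9, 12] [1, 6, 7, 8, 9, 10, 11] σ τ ∧
      (∀ i, i ≠ j → τ.arr 1 i = σ.arr 1 i) ∧ τ.reg 7 ∈ candidates d.W ∧ τ.reg 6 = tc (τ.reg 7) ∧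
      ∀ q' ∈ candidates d.W, tc (τ.reg 7) ≤ tc q') ?_ fun τ ⟨ag, h1, h7, h6, hmin⟩ => ?_
  -- Either no candidate has been tried and the best value is `n ^ 3 + 1`, which every count beats,
  -- or register `7` holds the best candidate below `q` and register `6` its count.
  · refine (Runs.for_const (fun q τ => τ.reg 5 = q ∧
      Agree [5, 6, 7, 8, 9, 12] [1, 6, 7, 8, 9, 10, 11] σ τ ∧
      (∀ i, i ≠ j → τ.arr 1 i = σ.arr 1 i) ∧ ((q = d.W / 2 + 1 ∧ τ.reg 6 = d.A.length ^ 3 + 1) ∨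
      (d.W / 2 + 1 ≤ τ.reg 7 ∧ τ.reg 7 < q ∧ τ.reg 6 = tc (τ.reg 7) ∧
        ∀ q', d.W / 2 + 1 ≤ q' → q' < q → tc (τ.reg 7) ≤ tc q')))
      (c * d.W ^ (p.k + 2) + 15) (l := d.W / 2 + 1) (h := d.W + 1) ?_ (by omega) hWM ?_ ?_ ?_).mono
      ?_ ?_
    · simp [hσ₁, hσ.r1]
    · refine ⟨by simp, ⟨fun x hx => ?_, fun x hx => ?_⟩, fun i hi => by simp [hσ₁], Or.inl ?_⟩
      · simp only [List.mem_cons, not_or] at hx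
        simp [hσ₁, hx.1, hx.2.1]
      · simp [hσ₁]
      · simp [hσ₁]
    · rintro q τ ⟨h₁, h₂, -⟩
      exact ⟨h₁, by simp [h₂.1 1 (by simp), hσ.r1]⟩
    · rintro q τ hq₁ hq₂ ⟨h5, ag, h1, hbest⟩
      have hqc : 1 ≤ q ∧ q ≤ d.W := by omega
      have hτ4 : τ.reg 4 = j := by rw [ag.1 4 (by simp), h4]
      refine (Runs.seq (R := fun υ => υ = τ.setArr 1 j q) (T₁ := 3)
        (T₂ := c * d.W ^ (p.k + 2) + 12) (Runs.write (by simp; omega) (by simp [h5, hτ4]))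
        fun υ hυ => ?_).time (by omega)
      have hυσ : Agree [5, 6, 7, 8, 9, 12] [1, 6, 7, 8, 9, 10, 11] σ υ := by
        refine ag.trans ⟨fun x _ => by rw [hυ]; rfl, fun x hx => ?_⟩
        simp only [List.mem_cons, not_or] at hx
        simp [hυ, hx.1]
      have hυs := hσ.agree hυσ (by simp) (by simp)
      have hυP : d.Moduli (Function.update P j q) υ := by
        refine hP.update (j := j) ?_ hqc
        rw [hυ]
        ext i
        by_cases hi : i = j
        · subst hi; simp
        · simp [hi, h1 i hi]
      refine (Runs.seq (T₁ := c * d.W ^ (p.k + 2)) (T₂ := 12) ((hc d _ υ hυs hυP).agree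
        [8, 9, 12] [6, 7, 8, 9, 10, 11] (fun x hx => p.modR_countProg hx)
        (fun x hx => p.modA_countProg hx)) fun φ ⟨h8, agφ⟩ => ?_)
      have h8' : φ.reg 8 = tc q := by
        rw [h8]
        refine tripleCount_of_one hj fun i hi hik => ?_
        rw [Function.update_of_ne (by omega)]
        exact hone i (by omega) hik
      have hφσ : Agree [5, 6, 7, 8, 9, 12] [1, 6, 7, 8, 9, 10, 11] σ φ :=
        hυσ.trans (agφ.mono (by simp) (by simp))
      have hφ1 : ∀ i, i ≠ j → φ.arr 1 i = σ.arr 1 i := fun i hi => by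
        rw [agφ.2 1 (by simp), hυ]; simp [hi, h1 i hi]
      have hφ5 : φ.reg 5 = q := by rw [agφ.1 5 (by simp), hυ]; exact h5
      have hφ6 : φ.reg 6 = τ.reg 6 := by rw [agφ.1 6 (by simp), hυ]; rfl
      have hφ7 : φ.reg 7 = τ.reg 7 := by rw [agφ.1 7 (by simp), hυ]; rfl
      have hTq := hT q
      refine (Runs.ite (T₁ := 4) (T₂ := 1) (fun hne => ?_) (fun heq => ?_)).time (by simp [Expr.cost])
      · have hlt : tc q < τ.reg 6 := by
          by_contra hcon
          simp [h8', hφ6, hcon] at hne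
        refine Runs.seq (R := fun ψ => ψ = φ.setReg 6 (tc q)) (T₁ := 2) (T₂ := 2)
          (Runs.assign ?_ ?_) fun ψ hψ => ?_
        · rw [eval_reg, h8']; exact hTq.trans_lt (by omega)
        · rw [eval_reg, h8']
        · refine (Runs.assign ?_ ?_).time (by simp [Expr.cost])
          · simp [hψ, hφ5]; omega
          · refine ⟨by simp [hψ, hφ5], by simp, ⟨fun x hx => ?_, fun x hx => ?_⟩, fun i hi => ?_,
              Or.inr ⟨?_, ?_, ?_, ?_⟩⟩
            · have := hφσ.1 x hx
              simp only [List.mem_cons, not_or] at hx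
              simp [hψ, hx.1, hx.2.1, hx.2.2.1, this]
            · simpa [hψ] using hφσ.2 x hx
            · simpa [hψ] using hφ1 i hi
            · simpa [hψ, hφ5] using hq₁
            · simp [hψ, hφ5]
            · simp [hψ, hφ5]
            · intro q' h₁ h₂
              have : tc q ≤ tc q' := by
                rcases Nat.lt_succ_iff_lt_or_eq.1 h₂ with h₃ | h₃
                · rcases hbest with ⟨hb, -⟩ | ⟨-, -, hb₁, hb₂⟩
                  · omega
                  · exact (hlt.le.trans_eq hb₁).trans (hb₂ q' h₁ h₃)
                · rw [h₃]
              simpa [hψ, hφ5] using this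
      · have hle : τ.reg 6 ≤ tc q := by
          by_contra hcon
          simp only [eval_lt, eval_reg, h8', hφ6] at heq
          rw [if_pos (by omega)] at heq
          omega
        refine Runs.skip ⟨hφ5, by simp, ⟨fun x hx => ?_, fun x hx => ?_⟩, fun i hi => ?_, ?_⟩
        · have := hφσ.1 x hx
          simp only [List.mem_cons, not_or] at hx
          simp [hx.1, this]
        · simpa using hφσ.2 x hx
        · simpa using hφ1 i hi
        · rcases hbest with ⟨-, hb⟩ | ⟨hb₀, hb₁, hb₂, hb₃⟩
          · have : tc q ≤ d.A.length ^ 3 := hTq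
            omega
          · refine Or.inr ⟨by simpa [hφ7] using hb₀, by simp [hφ7]; omega,
              by simp [hφ6, hφ7, hb₂], fun q' h₁ h₂ => ?_⟩
            simp only [setReg_reg]
            rw [Function.update_of_ne (by norm_num), hφ7]
            rcases Nat.lt_succ_iff_lt_or_eq.1 h₂ with h₃ | h₃
            · exact hb₃ q' h₁ h₃
            · rw [h₃, ← hb₂]; exact hle
    · have h₁ : c * d.W ^ (p.k + 2) + 15 + (Expr.reg 1 / .const 2 + .const 1 : Expr).cost +
          (Expr.reg 1 + .const 1 : Expr).cost + 7 ≤ (c + 40) * d.W ^ (p.k + 2) := by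
        have := d.one_le_W_pow (p.k + 2)
        simp only [cost_div, Expr.cost]
        rw [add_mul]; omega
      have h₂ : d.W + 1 + 1 ≤ 3 * d.W := by omega
      calc _ ≤ (c + 40) * d.W ^ (p.k + 2) * (3 * d.W) := Nat.mul_le_mul h₁ h₂
        _ = (c + 40) * 3 * d.W ^ (p.k + 3) := by ring
    · rintro τ ⟨-, ag, h1, hbest⟩
      rcases hbest with ⟨hb, -⟩ | ⟨hb₀, hb₁, hb₂, hb₃⟩
      · omega
      · exact ⟨ag, h1, mem_candidates.2 ⟨hb₀, hb₁⟩, hb₂,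
          fun q' hq' => hb₃ q' (mem_candidates.1 hq').1 (mem_candidates.1 hq').2⟩
  · have hτ4 : τ.reg 4 = j := by rw [ag.1 4 (by simp), h4]
    have h7' := mem_candidates.1 h7
    have hT7 := hT (τ.reg 7)
    refine (Runs.seq (R := fun υ => υ = τ.setArr 1 j (τ.reg 7)) (T₁ := 3) (T₂ := 3)
      (Runs.write (by simp; omega) (by simp [hτ4])) fun υ hυ => ?_).time (by omega)
    refine (Runs.write ?_ ?_).time (by simp [Expr.cost])
    · simp only [hυ, eval_reg, setArr_reg, h6]; exact hT7.trans_lt (by omega)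
    · refine ⟨τ.reg 7, h7, ?_, ?_, hmin⟩
      · ext i
        by_cases hi : i = j
        · subst hi; simp [hυ]
        · simp [hυ, hi, h1 i hi]
      · simp [hυ, hτ4, h6, htc, ag.2 12 (by simp)]

/-- The count for every prefix of the moduli is kept in array `12`, since the later test needs it
for the first `r` moduli as well as for all `k`. -/
theorem selectProg_spec (p : Params) : ∃ c, ∀ (d : Input p) (σ : State),
    d.Setup σ → d.Moduli (fun _ => 1) σ →
    Runs d.M p.selectProg σ (c * d.W ^ (p.k + 3)) (fun τ => ∃ P, d.Setup τ ∧ d.Moduli P τ ∧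
      IsGreedy d.S d.W p.k P ∧ ∀ i < p.k, τ.arr 12 i = tripleCount d.S P (i + 1)) := by
  obtain ⟨c, hc⟩ := chooseProg_spec p
  refine ⟨(c + 9) * (p.k + 1), fun d σ hσ hP => ?_⟩
  refine (Runs.for_const (fun j τ => τ.reg 4 = j ∧ ∃ P, d.Setup τ ∧ d.Moduli P τ ∧
      IsGreedy d.S d.W j P ∧ (∀ i < j, τ.arr 12 i = tripleCount d.S P (i + 1)) ∧
      ∀ i, j ≤ i → i < p.k → P i = 1) (c * d.W ^ (p.k + 3)) (l := 0) (h := p.k) rfl (by omega)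
      (by have := d.const_lt; omega) ?_ (fun i τ hτ => ⟨hτ.1, rfl⟩) ?_).mono ?_ ?_
  · refine ⟨by simp, fun _ => 1, ?_, hP, fun j hj => by omega, fun i hi => by omega,
      fun _ _ _ => rfl⟩
    exact hσ.agree (R := [4]) (X := []) ⟨fun x hx => by
      simp only [List.mem_singleton] at hx; simp [hx], fun x _ => rfl⟩ (by simp) (by simp)
  · rintro j τ - hj ⟨h4, P, hs, hm, hg, h12, h1⟩
    refine ((hc d P τ j hs hm hj h4 h1).agree [5, 6, 7, 8, 9, 12] [1, 6, 7, 8, 9, 10, 11, 12]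
      ?_ ?_).mono le_rfl ?_
    · intro x hx
      simp only [Params.chooseProg, Params.tryProg, Program.for, Program.modR, List.mem_append,
        List.mem_singleton, List.not_mem_nil, or_false, false_or] at hx
      have h := @Params.modR_countProg p x
      simp only [List.mem_cons, List.not_mem_nil, or_false] at h ⊢
      tauto
    · intro x hx
      simp only [Params.chooseProg, Params.tryProg, Program.for, Program.modA, List.mem_append,
        List.mem_singleton, List.not_mem_nil, or_false, false_or] at hx
      have h := @Params.modA_countProg p x
      simp only [List.mem_cons, List.not_mem_nil, or_false] at h ⊢
      tauto
    · rintro υ ⟨⟨q, hq, ha1, ha12, hmin⟩, ag⟩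
      have hq' := mem_candidates.1 hq
      have hlow : ∀ i < j, P i = Function.update P j q i := fun i hi => by
        rw [Function.update_of_ne (by omega)]
      refine ⟨by rw [ag.1 4 (by simp), h4], by simp, Function.update P j q, ?_, ?_, ?_, ?_, ?_⟩
      · refine (hs.agree ag (by simp) (by simp)).agree (R := [4]) (X := []) ⟨fun x hx => by
          simp only [List.mem_singleton] at hx; simp [hx], fun x _ => rfl⟩ (by simp) (by simp)
      · exact hm.update (τ := υ.setReg 4 (j + 1)) ha1 (by omega)
      · intro i hi q' hq'
        rcases Nat.lt_succ_iff_lt_or_eq.1 hi with h | h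
        · exact (hg.congr hlow) i h q' hq'
        · subst h
          simpa using hmin q' hq'
      · intro i hi
        simp only [setReg_arr]
        rw [ha12]
        rcases Nat.lt_succ_iff_lt_or_eq.1 hi with h | h
        · rw [Function.update_of_ne (by omega), h12 i h]
          exact tripleCount_congr _ fun i' hi' => hlow i' (by omega)
        · subst h; simp
      · intro i hi hik
        rw [Function.update_of_ne (by omega)]
        exact h1 i (by omega) hik
  · have hone := d.one_le_W_pow (p.k + 3)
    calc (c * d.W ^ (p.k + 3) + (Expr.const 0).cost + (Expr.const p.k).cost + 7) * (p.k + 1)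
        ≤ ((c + 9) * d.W ^ (p.k + 3)) * (p.k + 1) := by
          refine Nat.mul_le_mul_right _ ?_
          simp only [Expr.cost]; rw [add_mul]; omega
      _ = _ := by ring
  · rintro τ ⟨-, P, hs, hm, hg, h12, -⟩
    exact ⟨P, hs, hm, hg, h12⟩

end Input

/-! ### The initial tables -/

theorem rebase_le {B L : ℕ} (hL : 1 < L) (h : B ≤ L) (z : ℕ) : rebase L B z ≤ z := by
  induction z using Nat.strong_induction_on with
  | _ z ih =>
    rcases Nat.eq_zero_or_pos z with rfl | hz
    · simp [rebase_zero]
    · rw [rebase_eq hL]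
      have h₁ := ih (z / L) (Nat.div_lt_self hz hL)
      have h₂ := Nat.div_add_mod z L
      have h₃ : rebase L B (z / L) * B ≤ z / L * L := Nat.mul_le_mul h₁ h
      have h₄ : z / L * L = L * (z / L) := mul_comm _ _
      omega

namespace Input

variable {p : Params} (d : Input p)

theorem W_pow_le_n {i : ℕ} (hi : i ≤ d.l) : (p.B ^ i) ^ p.g ≤ d.n :=
  (Nat.pow_le_pow_left (Nat.pow_le_pow_right (by have := p.one_lt_B; omega) hi) _).trans d.pow_le

/-- The loop multiplies by `B` as long as the `g`-th power of the next value is at most `n`. It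
stops after exactly `l` rounds by the two inequalities that define `l`, and `l < W`. -/
theorem baseProg_spec (p : Params) : ∃ c, ∀ (d : Input p) (σ : State),
    σ.reg 0 = d.n → σ.reg 3 = 0 → Runs d.M p.baseProg σ (c * d.W ^ (p.k + 3)) (fun τ =>
      Agree [1, 2, 3] [] σ τ ∧ τ.reg 1 = d.W ∧ τ.reg 2 = d.LL ∧ τ.reg 3 = d.l) := by
  set ce := (Expr.op .le ((Expr.reg 1 * .const p.B).pow p.g) (.reg 0)).cost with hce
  refine ⟨(ce + 40) * 2, fun d σ h0 h3 => ?_⟩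
  have hB := p.one_lt_B
  have hL := p.one_lt_L
  have hM : d.LL < d.M := lt_of_le_of_lt d.LL_le_Ts (by have := d.Ts_succ_lt_M; omega)
  have hWM := d.W_lt_M
  have hlW := d.l_lt_W
  refine Runs.time (T₁ := 2 + (2 + (∑ i ∈ Finset.Ico 0 d.l, (12 + ce + 1) + ce + 1))) ?_ ?_
  · refine Runs.seq (R := fun τ => τ = σ.setReg 1 1) (Runs.assign (by simp; omega) rfl)
      fun σ₁ hσ₁ => ?_
    refine Runs.seq (R := fun τ => τ = (σ.setReg 1 1).setReg 2 1)
      (Runs.assign (by simp; omega) (by rw [hσ₁]; rfl)) fun σ₂ hσ₂ => ?_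
    refine (Runs.loop (fun i τ => Agree [1, 2, 3] [] σ τ ∧ τ.reg 1 = p.B ^ i ∧ τ.reg 2 = p.L ^ i ∧
      τ.reg 3 = i) (fun _ => 12) (lo := 0) (hi := d.l) (by omega) ?_ ?_ ?_).mono le_rfl
      fun τ hτ => hτ
    · refine ⟨⟨fun x hx => ?_, fun x hx => by rw [hσ₂]; rfl⟩, by simp [hσ₂], by simp [hσ₂],
        by simp [hσ₂, h3]⟩
      simp only [List.mem_cons, not_or] at hx
      simp [hσ₂, hx.1, hx.2.1]
    · rintro i τ - hi ⟨ag, h₁, h₂, h₃⟩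
      have hBi : p.B ^ i * p.B ≤ d.W := by
        rw [← pow_succ]; exact Nat.pow_le_pow_right (by omega) (by omega)
      have hLi : p.L ^ i * p.L ≤ d.LL := by
        rw [← pow_succ]; exact Nat.pow_le_pow_right (by omega) (by omega)
      refine ⟨?_, ?_⟩
      · have := d.W_pow_le_n (i := i + 1) (by omega)
        rw [pow_succ] at this
        simp [h₁, ag.1 0 (by simp), h0, this]
      · refine (Runs.seq (R := fun υ => υ = τ.setReg 1 (p.B ^ i * p.B)) (T₁ := 4) (T₂ := 8)
          (Runs.assign (by simp [h₁]; omega) (by simp [h₁])) fun υ hυ => ?_).time le_rfl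
        refine (Runs.seq (R := fun φ => φ = υ.setReg 2 (p.L ^ i * p.L)) (T₁ := 4) (T₂ := 4)
          (Runs.assign (by simp [hυ, h₂]; omega) (by simp [hυ, h₂])) fun φ hφ => ?_).time le_rfl
        refine (Runs.assign (by simp [hφ, hυ, h₃]; omega) ⟨⟨fun x hx => ?_, fun x hx => ?_⟩,
          ?_, ?_, ?_⟩).time le_rfl
        · have := ag.1 x hx
          simp only [List.mem_cons, not_or] at hx
          simp [hφ, hυ, hx.1, hx.2.1, hx.2.2.1, this]
        · simpa [hφ, hυ] using ag.2 x hx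
        · simp [hφ, hυ, pow_succ]
        · simp [hφ, pow_succ]
        · simp [hφ, hυ, h₃]
    · rintro τ ⟨ag, h₁, h₂, h₃⟩
      have h := d.lt_pow
      rw [mul_comm p.B] at h
      simp only [eval_le, eval_pow, eval_mul, eval_reg, eval_const, h₁, ag.1 0 (by simp), h0]
      exact if_neg (by unfold n; omega)
  · have h₁ : d.W ≤ d.W ^ (p.k + 3) := Nat.le_self_pow (by omega) _
    simp only [Finset.sum_const, Nat.card_Ico, smul_eq_mul, Nat.sub_zero]
    nlinarith

/-- Each table obeys a recurrence in earlier entries, so one pass fills it. The initial memory is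
`0`; for the tables of powers the comparison with `0` supplies the entry `1` in cell `0`. -/
theorem initProg_spec (p : Params) : ∃ c, ∀ (d : Input p),
    Runs d.M p.initProg (ThreeSum.input d.A) (c * d.W ^ (p.k + 3)) (fun τ =>
      d.Setup τ ∧ d.Moduli (fun _ => 1) τ) := by
  obtain ⟨c, hc⟩ := baseProg_spec p
  set e₂ : Expr := .read 2 (.reg 9 - .const 1) * .const p.L + .op .eq (.reg 9) (.const 0) with he₂
  set e₃ : Expr := .read 3 (.reg 9 / .const p.B) * .const p.L + .reg 9 % .const p.B with he₃
  set e₄ : Expr := .read 4 (.reg 9 / .const p.L) * .const p.B + .reg 9 % .const p.L with he₄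
  set e₅ : Expr := (.read 5 (.reg 9 - .const 1) * (.reg 0 + .const 1) +
    .op .eq (.reg 9) (.const 0)) % .reg 11 with he₅
  have hB := p.one_lt_B
  have hL := p.one_lt_L
  refine ⟨c + (((Expr.reg 2).pow p.k).cost + 1 + ((((Expr.reg 0 + .const 1).pow p.B + .const 1 :
    Expr).cost + 1) + ((e₂.cost + 20) * (p.k + 2) + ((e₃.cost + 20) * 2 + ((e₄.cost + 20) * 2 +
    ((e₅.cost + 20) * (p.L + 1) + 20 * (p.k + 1))))))), fun d => ?_⟩
  set σ₀ := ThreeSum.input d.A with hσ₀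
  have z₀ : ∀ a, a ≠ 0 → ∀ i, σ₀.arr a i = 0 := by
    intro a ha i; simp [hσ₀, ThreeSum.input, ha]
  have a₀ : ∀ i, σ₀.arr 0 i = d.A.getD i 0 := by intro i; simp [hσ₀, ThreeSum.input]
  have eTs : d.LL ^ p.k = d.Ts := rfl
  have eN : (d.n + 1) ^ p.B + 1 = d.N := rfl
  have hTs := d.Ts_succ_lt_M
  have hLLTs := d.LL_le_Ts
  have hWM := d.W_lt_M
  have hNM := d.N_lt_M
  have hW1 := d.W_pos
  have hone := d.one_le_W_pow (p.k + 3)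
  have hWW : d.W ≤ d.W ^ (p.k + 3) := Nat.le_self_pow (by omega) _
  have hcM := d.const_lt
  have hTsW : d.Ts ≤ d.W ^ (p.k + 3) := d.Ts_le.trans (Nat.pow_le_pow_right hW1 (by omega))
  have hKTs : d.K + 1 ≤ (d.K + 1) * d.Ts := Nat.le_mul_of_pos_right _ d.Ts_pos
  have hKM := d.Ts_lt_M
  have hKW : d.K + 2 ≤ (p.k + 2) * d.W ^ (p.k + 3) := by
    have h₁ : d.K ≤ p.k * d.W := Nat.mul_le_mul_left _ d.l_lt_W.le
    nlinarith
  simp only [add_mul]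
  refine Runs.seq (hc d σ₀ (by simp [hσ₀, ThreeSum.input, n]) (by simp [hσ₀, ThreeSum.input]))
    fun σ₁ ⟨ag₁, r1, r2, r3⟩ => ?_
  have r0 : σ₁.reg 0 = d.n := by rw [ag₁.1 0 (by simp)]; simp [hσ₀, ThreeSum.input, n]
  have harr : ∀ a, σ₁.arr a = σ₀.arr a := fun a => ag₁.2 a (by simp)
  rw [← add_mul]
  refine Runs.seq (R := fun τ => τ = σ₁.setReg 10 d.Ts) ((Runs.assign (by simp [r2, eTs]; omega)
    (by simp [r2, eTs])).time (Nat.le_mul_of_pos_right _ hone)) fun σ₂ hσ₂ => ?_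
  rw [← add_mul]
  refine Runs.seq (R := fun τ => τ = (σ₁.setReg 10 d.Ts).setReg 11 d.N)
    ((Runs.assign (by simp [hσ₂, r0, eN]; omega)
    (by simp [hσ₂, r0, eN])).time (Nat.le_mul_of_pos_right _ hone)) fun σ₃ hσ₃ => ?_
  have q0 : σ₃.reg 0 = d.n := by simp [hσ₃, r0]
  have q1 : σ₃.reg 1 = d.W := by simp [hσ₃, r1]
  have q2 : σ₃.reg 2 = d.LL := by simp [hσ₃, r2]
  have q3 : σ₃.reg 3 = d.l := by simp [hσ₃, r3]
  have q10 : σ₃.reg 10 = d.Ts := by simp [hσ₃]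
  have q11 : σ₃.reg 11 = d.N := by simp [hσ₃]
  have harr3 : ∀ a, σ₃.arr a = σ₀.arr a := fun a => by simp [hσ₃, harr]
  clear hσ₂ hσ₃ harr r0 r1 r2 r3 ag₁
  rw [← add_mul]
  refine Runs.seq (((Runs.fill (fun t => p.L ^ t) (l := 0) (h := d.K + 1) rfl (by omega) (by omega)
    (fun j => by simp [State.filled, q3, K]) ?_).agree [9] [2]
    (by simp [Program.fill, Program.for, Program.modR])
    (by simp [Program.fill, Program.for, Program.modA])).time ?_)
    fun σ₄ ⟨a2, ag₄⟩ => ?_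
  · intro t _ ht
    constructor
    · rcases Nat.eq_zero_or_pos t with rfl | ht0
      · simp [State.filled, harr3, z₀]
      · obtain ⟨u, rfl⟩ : ∃ u, t = u + 1 := ⟨t - 1, by omega⟩
        simp [State.filled, pow_succ]
    · refine lt_of_le_of_lt (Nat.pow_le_pow_right (by omega) (by omega : t ≤ d.K)) ?_
      rw [← d.Ts_eq]; omega
  · rw [← add_mul, mul_assoc (e₂.cost + 20)]
    exact Nat.mul_le_mul (by simp [he₂, Expr.cost]) (by omega)
  rw [← add_mul]
  refine Runs.seq (((Runs.fill (rebase p.B p.L) (l := 0) (h := d.W) rfl (by omega) (by omega)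
    (fun j => by simp [State.filled, ag₄.1 1 (by simp), q1]) ?_).agree [9] [3]
    (by simp [Program.fill, Program.for, Program.modR])
    (by simp [Program.fill, Program.for, Program.modA])).time ?_)
    fun σ₅ ⟨a3, ag₅⟩ => ?_
  · intro x _ hx
    constructor
    · rw [rebase_eq hB]
      simp only [State.filled, eval_add, eval_mul, eval_read, eval_div, eval_reg, eval_const,
        eval_mod, Function.update_self]
      congr 2
      -- Only cell `0` refers to itself, and there the initial memory is the right value `0`.
      split_ifs with h
      · rfl
      · have hx0 : x = 0 := by
          by_contra hx0
          exact h ⟨Nat.zero_le _, Nat.div_lt_self (by omega) hB⟩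
        rw [ag₄.2 3 (by simp), harr3, z₀ _ (by simp), hx0]; simp [rebase_zero]
    · have := rebase_lt hB p.B_le_L d.l x hx
      rw [← LL] at this; omega
  · rw [← add_mul, mul_assoc (e₃.cost + 20)]
    exact Nat.mul_le_mul (by simp [he₃, Expr.cost]) (by omega)
  rw [← add_mul]
  refine Runs.seq (((Runs.fill (rebase p.L p.B) (l := 0) (h := d.LL) rfl (by omega) (by omega)
    (fun j => by simp [State.filled, ag₅.1 2 (by simp), ag₄.1 2 (by simp), q2]) ?_).agree [9] [4]
    (by simp [Program.fill, Program.for, Program.modR])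
    (by simp [Program.fill, Program.for, Program.modA])).time ?_)
    fun σ₆ ⟨a4, ag₆⟩ => ?_
  · intro x _ hx
    constructor
    · rw [rebase_eq hL]
      simp only [State.filled, eval_add, eval_mul, eval_read, eval_div, eval_reg, eval_const,
        eval_mod, Function.update_self]
      congr 2
      split_ifs with h
      · rfl
      · have hx0 : x = 0 := by
          by_contra hx0
          exact h ⟨Nat.zero_le _, Nat.div_lt_self (by omega) hL⟩
        rw [ag₅.2 4 (by simp), ag₄.2 4 (by simp), harr3, z₀ _ (by simp), hx0]; simp [rebase_zero]
    · have := rebase_le hL p.B_le_L x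
      omega
  · rw [← add_mul, mul_assoc (e₄.cost + 20)]
    exact Nat.mul_le_mul (by simp [he₄, Expr.cost]) (by omega)
  refine Runs.seq (((Runs.fill (fun t => (d.n + 1) ^ t % d.N) (l := 0) (h := p.L) rfl (by omega)
    (by omega) (fun j => rfl) ?_).agree [9] [5]
    (by simp [Program.fill, Program.for, Program.modR])
    (by simp [Program.fill, Program.for, Program.modA])).time ?_)
    fun σ₇ ⟨a5, ag₇⟩ => ?_
  · intro t _ ht
    refine ⟨?_, (Nat.mod_lt _ (by unfold N; omega)).trans hNM⟩
    have f0 : σ₆.reg 0 = d.n := by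
      rw [ag₆.1 0 (by simp), ag₅.1 0 (by simp), ag₄.1 0 (by simp), q0]
    have f11 : σ₆.reg 11 = d.N := by
      rw [ag₆.1 11 (by simp), ag₅.1 11 (by simp), ag₄.1 11 (by simp), q11]
    have f5 : σ₆.arr 5 0 = 0 := by
      rw [ag₆.2 5 (by simp), ag₅.2 5 (by simp), ag₄.2 5 (by simp), harr3, z₀ _ (by simp)]
    rcases Nat.eq_zero_or_pos t with rfl | ht0
    · simp [State.filled, f5, f11]
    · obtain ⟨u, rfl⟩ : ∃ u, t = u + 1 := ⟨t - 1, by omega⟩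
      simp [State.filled, f0, f11, pow_succ, Nat.mod_mul_mod]
  · simp only [← add_mul]
    rw [mul_assoc (e₅.cost + 20)]
    exact Nat.mul_le_mul (by simp [he₅, Expr.cost]) (by nlinarith)
  refine (((Runs.fill (fun _ => 1) (l := 0) (h := p.k) rfl (by omega)
    (by omega) (fun j => rfl) (fun j _ _ => ⟨rfl, by omega⟩)).agree [9] [1]
    (by simp [Program.fill, Program.for, Program.modR])
    (by simp [Program.fill, Program.for, Program.modA])).mono ?_ ?_)
  · rw [mul_assoc 20]
    exact Nat.mul_le_mul (by simp [Expr.cost]) (by nlinarith)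
  rintro τ ⟨a1, ag₈⟩
  have agr : ∀ x, x ≠ 9 → τ.reg x = σ₃.reg x := fun x hx => by
    rw [ag₈.1 x (by simpa), ag₇.1 x (by simpa), ag₆.1 x (by simpa), ag₅.1 x (by simpa),
      ag₄.1 x (by simpa)]
  refine ⟨⟨?_, ?_, ?_, ?_, ?_, ?_, ?_, ?_, ?_, ?_, ?_⟩, fun j hj => ?_⟩
  · rw [agr 0 (by simp), q0]
  · rw [agr 1 (by simp), q1]
  · rw [agr 2 (by simp), q2]
  · rw [agr 3 (by simp), q3]
  · rw [agr 10 (by simp), q10]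
  · rw [agr 11 (by simp), q11]
  · intro i
    rw [ag₈.2 0 (by simp), ag₇.2 0 (by simp), ag₆.2 0 (by simp), ag₅.2 0 (by simp),
      ag₄.2 0 (by simp), harr3, a₀]
  · intro t ht
    rw [ag₈.2 2 (by simp), ag₇.2 2 (by simp), ag₆.2 2 (by simp), ag₅.2 2 (by simp), a2]
    simp; omega
  · intro x hx
    rw [ag₈.2 3 (by simp), ag₇.2 3 (by simp), ag₆.2 3 (by simp), a3]
    simp [hx]
  · intro x hx
    rw [ag₈.2 4 (by simp), ag₇.2 4 (by simp), a4]
    simp [hx]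
  · intro x hx
    rw [ag₈.2 5 (by simp), a5]
    simp [hx]
  · rw [a1]
    simp [hj, hW1]

end Input

/-! ### Distributing the classes over chunks -/

namespace Input

variable {p : Params} (d : Input p)

/-- The maximal size of a chunk. -/
def s : ℕ := d.W ^ (p.g - p.r)
/-- The number of buckets. -/
def R : ℕ := d.W ^ p.r
/-- The number of classes in a bucket. -/
def V : ℕ := d.W ^ (2 * p.y)
/-- The square root of `V`. -/
def Y : ℕ := d.W ^ p.y

theorem s_pos : 0 < d.s := d.one_le_W_pow _
theorem R_pos : 0 < d.R := d.one_le_W_pow _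
theorem V_pos : 0 < d.V := d.one_le_W_pow _
theorem Y_pos : 0 < d.Y := d.one_le_W_pow _
theorem R_mul_V : d.R * d.V = d.W ^ p.k := by rw [R, V, ← pow_add, Params.k]
theorem Y_mul_Y : d.Y * d.Y = d.V := by rw [Y, V, ← pow_add, two_mul]
theorem R_mul_s : d.R * d.s = d.W ^ p.g := by
  rw [R, s, ← pow_add]; congr 1; have := p.r_le; omega
theorem W_pow_g_le : d.W ^ p.g ≤ d.n := d.pow_le

/-- Class `v` has an element. -/
def Nonempty (P : ℕ → ℕ) (v : ℕ) : Prop := 0 < (d.cls P v).length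

instance (P : ℕ → ℕ) (v : ℕ) : Decidable (d.Nonempty P v) := inferInstanceAs (Decidable (0 < _))

/-- The representative of class `v`. -/
def rep (P : ℕ → ℕ) (v : ℕ) : ℕ := (d.cls P v).getD 0 0

theorem Nonempty.rep_mem {d : Input p} {P : ℕ → ℕ} {v : ℕ} (h : d.Nonempty P v) :
    d.rep P v ∈ d.A ∧ d.pk P (d.rep P v) = v := by
  have h' : d.rep P v ∈ d.cls P v := by
    rw [rep, List.getD_eq_getElem _ _ h]; exact List.getElem_mem _
  simpa [cls] using h'

theorem nonempty_of_mem (P : ℕ → ℕ) {a : ℕ} (ha : a ∈ d.A) : d.Nonempty P (d.pk P a) :=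
  List.length_pos_of_mem (a := a) (by simp [cls, ha])

/-- The next free slot before class `v` is dealt with. -/
def next (P : ℕ → ℕ) : ℕ → ℕ
  | 0 => 0
  | v + 1 => (if v % d.V = 0 then (next P v / d.s + 1) * d.s else next P v) +
      if d.Nonempty P v then 1 else 0

/-- The slot of class `v`: the chunks have `s` slots each, and every bucket starts a new chunk. -/
def slot (P : ℕ → ℕ) (v : ℕ) : ℕ :=
  if v % d.V = 0 then (d.next P v / d.s + 1) * d.s else d.next P v

theorem next_succ (P : ℕ → ℕ) (v : ℕ) :
    d.next P (v + 1) = d.slot P v + if d.Nonempty P v then 1 else 0 := rfl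

/-- The first chunk of bucket `i`. -/
def cs (P : ℕ → ℕ) (i : ℕ) : ℕ := d.slot P (i * d.V) / d.s

/-- A bound for the numbers of the chunks. -/
def E (P : ℕ → ℕ) : ℕ := d.cs P d.R

/-- The number of classes below `m` in chunk `e`. -/
def szUpto (P : ℕ → ℕ) (m e : ℕ) : ℕ :=
  ((Finset.range m).filter fun v => d.Nonempty P v ∧ d.slot P v / d.s = e).card

/-- The number of classes in chunk `e`. -/
def sz (P : ℕ → ℕ) (e : ℕ) : ℕ := d.szUpto P (d.W ^ p.k) e

/-- The number of classes in bucket `i`. -/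
def bc (P : ℕ → ℕ) (i : ℕ) : ℕ :=
  ((Finset.range d.V).filter fun j => d.Nonempty P (i * d.V + j)).card

section chunks

variable (P : ℕ → ℕ)

theorem lt_div_succ_mul {s : ℕ} (hs : 0 < s) (z : ℕ) : z < (z / s + 1) * s := by
  have := Nat.lt_div_mul_add hs (a := z)
  rw [add_mul]; omega

theorem next_le_slot (v : ℕ) : d.next P v ≤ d.slot P v := by
  unfold slot
  split_ifs
  · exact (lt_div_succ_mul d.s_pos _).le
  · exact le_rfl

theorem slot_le_next_succ (v : ℕ) : d.slot P v ≤ d.next P (v + 1) := by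
  rw [next_succ]; omega

theorem next_mono : Monotone (d.next P) :=
  monotone_nat_of_le_succ fun v => (d.next_le_slot P v).trans (d.slot_le_next_succ P v)

theorem slot_mono : Monotone (d.slot P) :=
  monotone_nat_of_le_succ fun v => (d.slot_le_next_succ P v).trans (d.next_le_slot P _)

theorem slot_lt {v u : ℕ} (h : d.Nonempty P v) (hvu : v < u) : d.slot P v < d.slot P u := by
  have h₁ := d.next_succ P v
  rw [if_pos h] at h₁
  have h₂ := d.next_le_slot P (v + 1)
  have h₃ := d.slot_mono P (show v + 1 ≤ u from hvu)
  omega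

theorem slot_inj {v u : ℕ} (hv : d.Nonempty P v) (hu : d.Nonempty P u)
    (h : d.slot P v = d.slot P u) : v = u := by
  rcases lt_trichotomy v u with h' | h' | h'
  · have := d.slot_lt P hv h'; omega
  · exact h'
  · have := d.slot_lt P hu h'; omega

theorem slot_mul (i : ℕ) : d.slot P (i * d.V) = (d.next P (i * d.V) / d.s + 1) * d.s := by
  rw [slot, if_pos (Nat.mul_mod_left _ _)]

theorem cs_eq (i : ℕ) : d.cs P i = d.next P (i * d.V) / d.s + 1 := by
  rw [cs, slot_mul, Nat.mul_div_cancel _ d.s_pos]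

theorem slot_mul' (i : ℕ) : d.slot P (i * d.V) = d.cs P i * d.s := by rw [slot_mul, cs_eq]

theorem cs_le_div (v : ℕ) : d.cs P (v / d.V) ≤ d.slot P v / d.s :=
  Nat.div_le_div_right (d.slot_mono P (Nat.div_mul_le_self _ _))

theorem div_lt_cs (v : ℕ) : d.slot P v / d.s < d.cs P (v / d.V + 1) := by
  rw [cs_eq, Nat.lt_succ_iff]
  refine Nat.div_le_div_right ((d.slot_le_next_succ P v).trans (d.next_mono P ?_))
  have := lt_div_succ_mul d.V_pos v
  omega

/-- Passing to a new bucket always skips to the next multiple of `s`, even from a multiple of `s`.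
So every bucket has its own nonempty range of chunk numbers, also if it contains no class. In
particular chunk `0` stays empty. -/
theorem cs_lt_succ (i : ℕ) : d.cs P i < d.cs P (i + 1) := by
  have h₁ := d.cs_le_div P (i * d.V)
  have h₂ := d.div_lt_cs P (i * d.V)
  rw [Nat.mul_div_cancel _ d.V_pos] at h₁ h₂
  omega

theorem cs_strictMono : StrictMono (d.cs P) := strictMono_nat_of_lt_succ (d.cs_lt_succ P)

theorem cs_unique {e i j : ℕ} (h₁ : d.cs P i ≤ e) (h₂ : e < d.cs P (i + 1)) (h₃ : d.cs P j ≤ e)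
    (h₄ : e < d.cs P (j + 1)) : i = j := by
  by_contra hne
  rcases lt_or_gt_of_ne hne with h | h
  · have := (d.cs_strictMono P).monotone (show i + 1 ≤ j from h); omega
  · have := (d.cs_strictMono P).monotone (show j + 1 ≤ i from h); omega

theorem slot_div_lt_E {v : ℕ} (hv : v < d.W ^ p.k) : d.slot P v / d.s < d.E P := by
  refine (d.div_lt_cs P v).trans_le ((d.cs_strictMono P).monotone ?_)
  have : v / d.V < d.R := Nat.div_lt_of_lt_mul (by rwa [mul_comm, R_mul_V])
  omega

theorem next_add (i j : ℕ) (hj : j < d.V) : d.next P (i * d.V + (j + 1)) = d.cs P i * d.s +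
    ((Finset.range (j + 1)).filter fun u => d.Nonempty P (i * d.V + u)).card := by
  induction j with
  | zero =>
    rw [zero_add, next_succ, slot_mul', Finset.range_one, Finset.filter_singleton]
    simp only [add_zero]
    split_ifs <;> simp
  | succ j ih =>
    rw [← add_assoc, next_succ, slot, if_neg, ih (by omega), Finset.range_add_one (n := j + 1),
      Finset.filter_insert]
    · split_ifs
      · rw [Finset.card_insert_of_notMem (by simp), ← add_assoc]
      · rfl
    · rw [mul_add_mod_of_lt hj]; omega

/-- Classes of a bucket occupy consecutive slots, so the number of chunks of a bucket is one more
than the quotient of its number of classes by `s`. -/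
theorem cs_succ (i : ℕ) : d.cs P (i + 1) = d.cs P i + d.bc P i / d.s + 1 := by
  have hV := d.V_pos
  rw [cs_eq, add_mul, one_mul]
  have h := d.next_add P i (d.V - 1) (by omega)
  rw [Nat.sub_add_cancel hV] at h
  rw [h, bc, mul_comm, Nat.mul_add_div d.s_pos]

/-- Every slot passed over either carries a class or is lost at the start of a bucket, where at most
`s` slots are lost. -/
theorem cs_mul_le (i : ℕ) : d.cs P i * d.s ≤
    ((Finset.range (i * d.V)).filter (d.Nonempty P)).card + (i + 1) * d.s := by
  induction i with
  | zero => rw [cs_eq]; simp [next]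
  | succ i ih =>
    have h₁ : ((Finset.range ((i + 1) * d.V)).filter (d.Nonempty P)).card =
        ((Finset.range (i * d.V)).filter (d.Nonempty P)).card + d.bc P i := by
      rw [add_mul, one_mul, Finset.range_eq_Ico, ← Finset.Ico_union_Ico_eq_Ico (Nat.zero_le _)
        (Nat.le_add_right (i * d.V) d.V), Finset.filter_union, Finset.card_union_of_disjoint,
        ← Finset.range_eq_Ico, bc]
      · congr 1
        refine (Finset.card_bij (fun j _ => i * d.V + j) ?_ ?_ ?_).symm
        · intro j hj
          simp only [Finset.mem_filter, Finset.mem_range, Finset.mem_Ico] at hj ⊢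
          exact ⟨by omega, hj.2⟩
        · intro a _ b _ h; omega
        · intro b hb
          simp only [Finset.mem_filter, Finset.mem_range, Finset.mem_Ico] at hb ⊢
          refine ⟨b - i * d.V, ⟨by omega, ?_⟩, by omega⟩
          rw [Nat.add_sub_cancel' hb.1.1]; exact hb.2
      · exact Finset.disjoint_filter_filter (Finset.Ico_disjoint_Ico_consecutive _ _ _)
    have h₂ := Nat.div_mul_le_self (d.bc P i) d.s
    rw [h₁, cs_succ, add_mul, add_mul]
    have h₃ : (i + 1 + 1) * d.s = (i + 1) * d.s + d.s := by ring
    omega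

theorem card_nonempty_le (m : ℕ) : ((Finset.range m).filter (d.Nonempty P)).card ≤ d.n := by
  rw [← d.card_S]
  refine Finset.card_le_card_of_injOn (d.rep P) ?_ ?_
  · intro v hv
    simp only [Finset.coe_filter, Set.mem_ofPred_eq] at hv
    exact d.mem_S.2 hv.2.rep_mem.1
  · intro v hv u hu h
    simp only [Finset.coe_filter, Set.mem_ofPred_eq] at hv hu
    rw [← hv.2.rep_mem.2, h, hu.2.rep_mem.2]

/-- The representatives of different classes are different elements of the bucket. -/
theorem bc_le (i : ℕ) : d.bc P i ≤ (d.S.filter fun a => d.pk P a / d.V = i).card := by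
  refine Finset.card_le_card_of_injOn (fun j => d.rep P (i * d.V + j)) ?_ ?_
  · intro j hj
    simp only [Finset.coe_filter, Set.mem_ofPred_eq, Finset.mem_range] at hj ⊢
    refine ⟨d.mem_S.2 hj.2.rep_mem.1, ?_⟩
    rw [hj.2.rep_mem.2, mul_add_div_of_lt hj.1]
  · intro v hv u hu h
    simp only [Finset.coe_filter, Set.mem_ofPred_eq] at hv hu
    have h₁ := hv.2.rep_mem.2
    simp only at h
    rw [h, hu.2.rep_mem.2] at h₁
    omega

/-- There are at most `n` occupied slots and `(R + 1) * s` lost ones. Both are of order `W ^ g`,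
since `R * s = W ^ g`. -/
theorem E_mul_s_le : d.E P * d.s ≤ (p.B ^ p.g + 2) * d.W ^ p.g := by
  have h₁ := d.cs_mul_le P d.R
  have h₂ := d.card_nonempty_le P (d.R * d.V)
  have h₃ := d.n_le
  have h₄ : d.s ≤ d.W ^ p.g := Nat.pow_le_pow_right d.W_pos (by omega)
  have h₅ := d.R_mul_s
  rw [add_mul, one_mul] at h₁
  rw [E, add_mul]
  omega

theorem E_le : d.E P ≤ (p.B ^ p.g + 2) * d.R := by
  refine Nat.le_of_mul_le_mul_right ?_ d.s_pos
  rw [mul_assoc, R_mul_s]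
  exact d.E_mul_s_le P

theorem szUpto_succ (m e : ℕ) : d.szUpto P (m + 1) e =
    d.szUpto P m e + if d.Nonempty P m ∧ d.slot P m / d.s = e then 1 else 0 := by
  rw [szUpto, Finset.range_add_one, Finset.filter_insert]
  split_ifs
  · rw [Finset.card_insert_of_notMem (by simp), szUpto]
  · rfl

theorem szUpto_eq_zero {m e : ℕ} (h : d.next P m ≤ e * d.s) : d.szUpto P m e = 0 := by
  rw [szUpto, Finset.card_eq_zero, Finset.filter_eq_empty_iff]
  rintro v hv ⟨h₁, h₂⟩
  have h₃ := d.next_succ P v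
  rw [if_pos h₁] at h₃
  have h₄ := d.next_mono P (show v + 1 ≤ m from Finset.mem_range.1 hv)
  have h₅ := lt_div_succ_mul d.s_pos (d.slot P v)
  have h₆ := Nat.div_mul_le_self (d.slot P v) d.s
  have : d.slot P v < e * d.s := by omega
  have := (Nat.div_lt_iff_lt_mul d.s_pos).2 this
  omega

/-- Within a chunk the slots are filled from the left without gaps, so the number of classes already
in it is the offset of the next slot. The two parts are proved together: the first for `m + 1` needs
the second for `m`. -/
theorem szUpto_next (m : ℕ) : d.szUpto P m (d.next P m / d.s) = d.next P m % d.s ∧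
    d.szUpto P m (d.slot P m / d.s) = d.slot P m % d.s := by
  have key : ∀ m, d.szUpto P m (d.next P m / d.s) = d.next P m % d.s →
      d.szUpto P m (d.slot P m / d.s) = d.slot P m % d.s := by
    intro m h
    rw [slot]
    split_ifs
    · rw [Nat.mul_div_cancel _ d.s_pos, Nat.mul_mod_left]
      exact d.szUpto_eq_zero P (lt_div_succ_mul d.s_pos _).le
    · exact h
  have h : d.szUpto P m (d.next P m / d.s) = d.next P m % d.s := by
    induction m with
    | zero => simp [next, szUpto]
    | succ m ih =>
      have h₁ := key m ih
      have hs := d.s_pos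
      rw [szUpto_succ, next_succ]
      by_cases hne : d.Nonempty P m
      · simp only [hne, true_and, if_true]
        have h₂ := Nat.div_add_mod' (d.slot P m) d.s
        have h₃ := Nat.mod_lt (d.slot P m) hs
        generalize d.slot P m / d.s = q at *
        -- If the chunk has just become full, the next slot opens a chunk that is still empty.
        by_cases hlast : d.slot P m % d.s + 1 = d.s
        · have h₄ : d.slot P m + 1 = (q + 1) * d.s := by rw [add_mul, one_mul]; omega
          have h₅ : d.next P m ≤ (q + 1) * d.s := by have := d.next_le_slot P m; omega
          rw [h₄, Nat.mul_div_cancel _ hs, Nat.mul_mod_left, d.szUpto_eq_zero P h₅]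
          simp
        · have h₄ : d.slot P m + 1 = q * d.s + (d.slot P m % d.s + 1) := by omega
          rw [h₄, mul_add_div_of_lt (by omega), mul_add_mod_of_lt (by omega), h₁]
          simp
      · simp [hne, h₁]
  exact ⟨h, key m h⟩

/-- The converse direction of filling without gaps: every offset below the size of the chunk is
really taken by a class. So the chunk can be listed by running through the offsets. -/
theorem exists_slot_upto (m : ℕ) {e o : ℕ} (h : o < d.szUpto P m e) : ∃ v < m, d.Nonempty P v ∧
    d.slot P v = e * d.s + o ∧ o < d.s := by
  induction m with
  | zero => simp [szUpto] at h
  | succ m ih =>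
    by_cases h' : o < d.szUpto P m e
    · obtain ⟨v, hv, h₁⟩ := ih h'
      exact ⟨v, by omega, h₁⟩
    · rw [szUpto_succ] at h
      split_ifs at h with hc
      · have h₁ := (d.szUpto_next P m).2
        rw [hc.2] at h₁
        have h₂ := Nat.div_add_mod' (d.slot P m) d.s
        rw [hc.2] at h₂
        have h₃ := Nat.mod_lt (d.slot P m) d.s_pos
        exact ⟨m, by omega, hc.1, by omega, by omega⟩
      · omega

theorem exists_slot {e o : ℕ} (h : o < d.sz P e) : ∃ v < d.W ^ p.k, d.Nonempty P v ∧
    d.slot P v = e * d.s + o ∧ o < d.s := d.exists_slot_upto P _ h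

theorem sz_le (e : ℕ) : d.sz P e ≤ d.s := by
  by_contra h
  obtain ⟨v, -, -, -, h'⟩ := d.exists_slot P (e := e) (o := d.s) (by omega)
  omega

theorem slot_mod_lt_sz {v : ℕ} (hv : v < d.W ^ p.k) (h : d.Nonempty P v) :
    d.slot P v % d.s < d.sz P (d.slot P v / d.s) := by
  have h₁ := (d.szUpto_next P v).2
  have h₂ := d.szUpto_succ P v (d.slot P v / d.s)
  rw [if_pos ⟨h, rfl⟩] at h₂
  have h₃ : d.szUpto P (v + 1) (d.slot P v / d.s) ≤ d.sz P (d.slot P v / d.s) :=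
    Finset.card_le_card (Finset.filter_subset_filter _ (Finset.range_mono hv))
  omega

end chunks

end Input

/-! ### The program that forms the chunks -/

namespace Params

variable (p : Params)

/-- The size of a chunk, as an expression. -/
def sE : Expr := (Expr.reg 1).pow (p.g - p.r)
/-- The number of buckets, as an expression. -/
def RE : Expr := (Expr.reg 1).pow p.r
/-- The number of classes in a bucket, as an expression. -/
def VE : Expr := (Expr.reg 1).pow (2 * p.y)
/-- The square root of the number of classes in a bucket, as an expression. -/
def YE : Expr := (Expr.reg 1).pow p.y

/-- Deal with one class. -/
def slotProg : Program :=
  .seq (.ite (.op .eq (.reg 14 % p.VE) (.const 0))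
      (.seq (.assign 13 ((.reg 13 / p.sE + .const 1) * p.sE))
        (.write 15 (.reg 14 / p.VE) (.reg 13 / p.sE))) .skip)
    (.seq (.write 13 (.reg 14) (.reg 13))
      (.ite (.read 8 (.reg 14))
        (.seq (.write 14 (.reg 13) (.read 9 (.reg 14 * .reg 0)))
          (.seq (.write 16 (.reg 13 / p.sE) (.read 16 (.reg 13 / p.sE) + .const 1))
            (.assign 13 (.reg 13 + .const 1)))) .skip))

/-- Distribute the classes over chunks. -/
def chunkProg : Program :=
  .seq (.for 14 (.const 0) ((Expr.reg 1).pow p.k) p.slotProg)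
    (.seq (.write 15 p.RE (.reg 13 / p.sE + .const 1)) (.assign 15 (.read 15 p.RE)))

end Params

namespace Input

variable {p : Params} (d : Input p)

/-- The tables for the chunks. -/
structure Tables (P : ℕ → ℕ) (σ : State) : Prop where
  r15 : σ.reg 15 = d.E P
  sl : ∀ v < d.W ^ p.k, σ.arr 13 v = d.slot P v
  el : ∀ v < d.W ^ p.k, d.Nonempty P v → σ.arr 14 (d.slot P v) = d.rep P v
  cs : ∀ j ≤ d.R, σ.arr 15 j = d.cs P j
  sz : ∀ e, σ.arr 16 e = d.sz P e

theorem Tables.agree {d : Input p} {P : ℕ → ℕ} {σ τ : State} (h : d.Tables P σ) {R X : List ℕ}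
    (ha : Agree R X σ τ) (hR : 15 ∉ R) (hX : ∀ x ∈ X, x ∉ [13, 14, 15, 16]) : d.Tables P τ := by
  have hr' : ∀ x, x ∈ [13, 14, 15, 16] → τ.arr x = σ.arr x := fun x hx => ha.2 x fun h => hX x h hx
  constructor
  · rw [ha.1 _ hR, h.r15]
  · rw [hr' 13 (by simp)]; exact h.sl
  · rw [hr' 14 (by simp)]; exact h.el
  · rw [hr' 15 (by simp)]; exact h.cs
  · rw [hr' 16 (by simp)]; exact h.sz

theorem Classes.agree {d : Input p} {P : ℕ → ℕ} {σ τ : State} (h : d.Classes P σ) {R X : List ℕ}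
    (ha : Agree R X σ τ) (hX : ∀ x ∈ X, x ∉ [8, 9]) : d.Classes P τ := by
  have hr' : ∀ x, x ∈ [8, 9] → τ.arr x = σ.arr x := fun x hx => ha.2 x fun h => hX x h hx
  unfold Classes
  rw [hr' 8 (by simp), hr' 9 (by simp)]
  exact h

/-- The registers and the arrays from number `13` on have not been used. -/
def Fresh (σ : State) : Prop := (∀ x, 13 ≤ x → σ.reg x = 0) ∧ ∀ a, 13 ≤ a → ∀ i, σ.arr a i = 0

theorem lt_M_of_le {x : ℕ} (h : x ≤ 4 * (p.B ^ p.g + 3) ^ 2 * d.n ^ 3) : x < d.M :=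
  h.trans_lt d.tables_lt

theorem n_pos : 1 ≤ d.n := d.pos

theorem mul_n_lt_M {x : ℕ} (h : x ≤ (p.B ^ p.g + 3) * d.n) : x < d.M := by
  refine d.lt_M_of_le (h.trans ?_)
  have h₁ : d.n ≤ d.n ^ 3 := Nat.le_self_pow (by omega) _
  have h₂ : p.B ^ p.g + 3 ≤ 4 * (p.B ^ p.g + 3) ^ 2 := by nlinarith
  exact Nat.mul_le_mul h₂ h₁

theorem E_mul_s_lt_M (P : ℕ → ℕ) : d.E P * d.s + 1 < d.M := by
  refine d.mul_n_lt_M ?_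
  have h₁ := d.E_mul_s_le P
  have h₂ := Nat.mul_le_mul_left (p.B ^ p.g + 2) d.W_pow_g_le
  have := d.n_pos
  rw [show p.B ^ p.g + 3 = (p.B ^ p.g + 2) + 1 from rfl, add_mul (p.B ^ p.g + 2) 1]
  omega

theorem next_lt_M (P : ℕ → ℕ) {v : ℕ} (hv : v ≤ d.W ^ p.k) :
    d.next P v < d.E P * d.s ∧ (v < d.W ^ p.k → d.slot P v < d.E P * d.s) := by
  have h₁ := d.next_mono P hv
  have h₂ := lt_div_succ_mul d.s_pos (d.next P (d.W ^ p.k))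
  rw [E, cs_eq, R_mul_V]
  refine ⟨by omega, fun h => ?_⟩
  have h₃ := d.slot_le_next_succ P v
  have h₄ := d.next_mono P (show v + 1 ≤ d.W ^ p.k from h)
  omega

/-- The hypotheses and the conclusion are the loop invariant at `v` and `v + 1`. The start of a
bucket is recorded when its first class number is met, whether or not that class has elements. -/
theorem slotProg_spec (p : Params) : ∃ c, ∀ (d : Input p) (P : ℕ → ℕ) (σ τ : State) (v : ℕ),
    d.Setup σ → d.Classes P σ → v < d.W ^ p.k → τ.reg 14 = v →
    Agree [13, 14, 15] [13, 14, 15, 16] σ τ → τ.reg 13 = d.next P v →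
    (∀ u < v, τ.arr 13 u = d.slot P u) →
    (∀ u < v, d.Nonempty P u → τ.arr 14 (d.slot P u) = d.rep P u) →
    (∀ j, j * d.V < v → τ.arr 15 j = d.cs P j) → (∀ e, τ.arr 16 e = d.szUpto P v e) →
    Runs d.M p.slotProg τ c (fun υ => υ.reg 14 = v ∧
      Agree [13, 14, 15] [13, 14, 15, 16] σ υ ∧ υ.reg 13 = d.next P (v + 1) ∧
      (∀ u < v + 1, υ.arr 13 u = d.slot P u) ∧
      (∀ u < v + 1, d.Nonempty P u → υ.arr 14 (d.slot P u) = d.rep P u) ∧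
      (∀ j, j * d.V < v + 1 → υ.arr 15 j = d.cs P j) ∧ (∀ e, υ.arr 16 e = d.szUpto P (v + 1) e)) := by
  set c₁ := (Expr.op .eq (.reg 14 % p.VE) (.const 0)).cost with hc₁
  set c₂ := ((.reg 13 / p.sE + .const 1) * p.sE : Expr).cost with hc₂
  set c₃ := (.reg 14 / p.VE : Expr).cost + (.reg 13 / p.sE : Expr).cost with hc₃
  set c₄ := (.reg 13 / p.sE : Expr).cost + (.read 16 (.reg 13 / p.sE) + .const 1 : Expr).cost
    with hc₄
  refine ⟨(c₁ + 1 + max (c₂ + 1 + (c₃ + 1)) 1) + (3 + (3 + max (6 + (c₄ + 1 + 4)) 1)),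
    fun d P σ τ v hσ hC hv h14 ag h13 hsl hel hcs hsz => ?_⟩
  have hEM := d.E_mul_s_lt_M P
  obtain ⟨hn₁, hn₂⟩ := d.next_lt_M P hv.le
  have hn₂ := hn₂ hv
  have hn₃ := (d.next_lt_M P (show v + 1 ≤ d.W ^ p.k from hv)).1
  have hs := d.s_pos
  have eW : τ.reg 1 = d.W := by rw [ag.1 1 (by simp), hσ.r1]
  have e0 : τ.reg 0 = d.n := by rw [ag.1 0 (by simp), hσ.r0]
  have esE : ∀ υ : State, υ.reg 1 = d.W → p.sE.eval υ = d.s := fun υ h => by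
    simp [Params.sE, h, s]
  have eVE : ∀ υ : State, υ.reg 1 = d.W → p.VE.eval υ = d.V := fun υ h => by
    simp [Params.VE, h, V]
  have e8 : τ.arr 8 v = (d.cls P v).length := by rw [ag.2 8 (by simp), hC.1 v hv]
  have e9 : d.Nonempty P v → τ.arr 9 (v * d.n) = d.rep P v := fun h => by
    rw [ag.2 9 (by simp), ← add_zero (v * d.n), hC.2 v 0 h, rep]
  refine Runs.seq (R := fun υ => Agree [13] [15] τ υ ∧ υ.reg 13 = d.slot P v ∧
    (∀ j, j * d.V < v + 1 → υ.arr 15 j = d.cs P j)) ?_ ?_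
  · refine Runs.ite (fun hne => ?_) (fun heq => ?_)
    · have hmod : v % d.V = 0 := by
        by_contra hcon
        simp [h14, eVE τ eW, hcon] at hne
      have hslot : d.slot P v = (d.next P v / d.s + 1) * d.s := by rw [slot, if_pos hmod]
      have hval : ((.reg 13 / p.sE + .const 1) * p.sE : Expr).eval τ = d.slot P v := by
        simp [esE τ eW, h13, hslot]
      refine Runs.seq (R := fun υ => υ = τ.setReg 13 (d.slot P v))
        (Runs.assign (by rw [hval]; omega) (by rw [hval])) fun υ hυ => ?_
      have hυ1 : υ.reg 1 = d.W := by simp [hυ, eW]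
      have hi : (.reg 14 / p.VE : Expr).eval υ = v / d.V := by
        rw [eval_div, eVE υ hυ1]; simp [hυ, h14]
      have he : (.reg 13 / p.sE : Expr).eval υ = d.cs P (v / d.V) := by
        rw [cs, Nat.div_mul_cancel (Nat.dvd_of_mod_eq_zero hmod), eval_div, esE υ hυ1]
        simp [hυ]
      refine (Runs.write ?_ ?_).time (by omega)
      · rw [he]
        have h₁ := d.cs_le_div P v
        have h₂ := Nat.div_le_self (d.slot P v) d.s
        omega
      · rw [hi, he]
        refine ⟨⟨fun x hx => ?_, fun x hx => ?_⟩, by simp [hυ], fun j hj => ?_⟩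
        · simp only [List.mem_singleton] at hx; simp [hυ, hx]
        · simp only [List.mem_singleton] at hx; simp [hυ, hx]
        · by_cases hj' : j = v / d.V
          · simp [hj']
          · have : j * d.V < v := by
              refine lt_of_le_of_ne (by omega) fun h => hj' ?_
              rw [← h, Nat.mul_div_cancel _ d.V_pos]
            simp [hυ, hj', hcs j this]
    · have hmod : v % d.V ≠ 0 := by
        intro hcon
        simp [h14, eVE τ eW, hcon] at heq
      refine Runs.skip ⟨Agree.refl .., by rw [h13, slot, if_neg hmod], fun j hj => ?_⟩
      refine hcs j (lt_of_le_of_ne (by omega) fun h => hmod ?_)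
      rw [← h, Nat.mul_mod_left]
  · rintro υ ⟨agυ, r13, f15⟩
    have hυ1 : υ.reg 1 = d.W := by rw [agυ.1 1 (by simp), eW]
    have hυ14 : υ.reg 14 = v := by rw [agυ.1 14 (by simp), h14]
    refine Runs.seq (R := fun φ => φ = υ.setArr 13 v (d.slot P v)) (T₁ := 3)
      (Runs.write (by simp [r13]; omega) (by simp [r13, hυ14])) fun φ hφ => ?_
    have agφ : Agree [13] [13, 15] τ φ := by
      refine ⟨fun x hx => by rw [hφ]; exact agυ.1 x hx, fun x hx => ?_⟩
      simp only [List.mem_cons, List.not_mem_nil, or_false, not_or] at hx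
      simp [hφ, hx.1, agυ.2 x (by simp [hx.2])]
    have f13 : φ.reg 13 = d.slot P v := by simp [hφ, r13]
    have f14 : φ.reg 14 = v := by simp [hφ, hυ14]
    have fsl : ∀ u < v + 1, φ.arr 13 u = d.slot P u := by
      intro u hu
      by_cases huv : u = v
      · simp [hφ, huv]
      · simp [hφ, huv, agυ.2 13 (by simp), hsl u (by omega)]
    have fcs : ∀ j, j * d.V < v + 1 → φ.arr 15 j = d.cs P j := by
      intro j hj; simp [hφ, f15 j hj]
    have hφ1 : φ.reg 1 = d.W := by rw [agφ.1 1 (by simp), eW]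
    have agσ : Agree [13, 14, 15] [13, 14, 15, 16] σ φ :=
      ag.trans (agφ.mono (by simp) (by simp))
    refine (Runs.ite (T₁ := 6 + (c₄ + 1 + 4)) (T₂ := 1) (fun hne => ?_) (fun heq => ?_)).time
      (by simp [Expr.cost])
    · have hN : d.Nonempty P v := by
        simp only [eval_read, eval_reg, f14, agφ.2 8 (by simp), e8] at hne
        exact Nat.pos_of_ne_zero hne
      have h9 : (.read 9 (.reg 14 * .reg 0) : Expr).eval φ = d.rep P v := by
        simp [f14, agφ.1 0 (by simp), e0, agφ.2 9 (by simp), e9 hN]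
      have hrM := d.elem_lt' hN.rep_mem.1
      refine Runs.seq (R := fun ψ => ψ = φ.setArr 14 (d.slot P v) (d.rep P v)) (T₁ := 6)
        ((Runs.write (by rw [h9]; exact hrM) (by rw [h9]; simp [f13])).time (by simp [Expr.cost]))
        fun ψ hψ => ?_
      have hψ1 : ψ.reg 1 = d.W := by simp [hψ, hφ1]
      have hi : (.reg 13 / p.sE : Expr).eval ψ = d.slot P v / d.s := by
        rw [eval_div, esE ψ hψ1]; simp [hψ, f13]
      have he : (.read 16 (.reg 13 / p.sE) + .const 1 : Expr).eval ψ =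
          d.szUpto P v (d.slot P v / d.s) + 1 := by
        rw [eval_add, eval_read, hi]
        simp [hψ, agφ.2 16 (by simp), hsz]
      refine Runs.seq (R := fun χ => χ = ψ.setArr 16 (d.slot P v / d.s)
        (d.szUpto P v (d.slot P v / d.s) + 1)) (T₁ := c₄ + 1)
        ((Runs.write ?_ ?_).time le_rfl) fun χ hχ => ?_
      · rw [he, (d.szUpto_next P v).2]
        have := Nat.mod_le (d.slot P v) d.s
        omega
      · rw [hi, he]
      have hχ13 : χ.reg 13 = d.slot P v := by simp [hχ, hψ, f13]
      refine (Runs.assign ?_ ?_).time (by simp [Expr.cost])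
      · simp [hχ13]; omega
      have hnext : d.next P (v + 1) = d.slot P v + 1 := by rw [next_succ, if_pos hN]
      refine ⟨by simp [hχ, hψ, f14], ⟨fun x hx => ?_, fun x hx => ?_⟩, by simp [hχ13, hnext],
        fun u hu => ?_, fun u hu hu' => ?_, fun j hj => ?_, fun e => ?_⟩
      · have := agσ.1 x hx
        simp only [List.mem_cons, not_or] at hx
        simp [hx.1, hχ, hψ, this]
      · have := agσ.2 x hx
        simp only [List.mem_cons, List.not_mem_nil, or_false, not_or] at hx
        simp [hχ, hψ, hx.2.2.2, hx.2.1, this]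
      · simpa [hχ, hψ] using fsl u hu
      · by_cases huv : u = v
        · simp [hχ, hψ, huv]
        · have h₁ := d.slot_lt P hu' (show u < v by omega)
          simp [hχ, hψ, h₁.ne, agφ.2 14 (by simp), hel u (by omega) hu']
      · simpa [hχ, hψ] using fcs j hj
      · rw [szUpto_succ]
        by_cases hes : d.slot P v / d.s = e
        · simp [hχ, hes, hN]
        · simp [hχ, hψ, hes, Ne.symm hes, agφ.2 16 (by simp), hsz]
    · have hN : ¬ d.Nonempty P v := by
        simp only [eval_read, eval_reg, f14, agφ.2 8 (by simp), e8] at heq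
        unfold Nonempty; omega
      refine Runs.skip ⟨f14, agσ, by rw [f13, next_succ, if_neg hN, add_zero], fsl,
        fun u hu hu' => ?_, fcs, fun e => ?_⟩
      · have huv : u ≠ v := fun h => hN (h ▸ hu')
        rw [agφ.2 14 (by simp), hel u (by omega) hu']
      · rw [szUpto_succ, agφ.2 16 (by simp), hsz, if_neg (fun h => hN h.1), add_zero]

/-- The start of the fictitious bucket `R` is written after the loop. It bounds the last bucket and
equals the number `E`. -/
theorem chunkProg_spec (p : Params) : ∃ c, ∀ (d : Input p) (P : ℕ → ℕ) (σ : State), d.Setup σ →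
    d.Classes P σ → Fresh σ → Runs d.M p.chunkProg σ (c * d.W ^ p.k) (fun τ => d.Tables P τ ∧
      Agree [13, 14, 15] [13, 14, 15, 16] σ τ) := by
  obtain ⟨c, hc⟩ := slotProg_spec p
  set c₁ := p.RE.cost + (.reg 13 / p.sE + .const 1 : Expr).cost + 1 with hc₁
  refine ⟨(c + (Expr.const 0).cost + ((Expr.reg 1).pow p.k).cost + 7) * 2 +
    (c₁ + ((Expr.read 15 p.RE).cost + 1)), fun d P σ hσ hC hF => ?_⟩
  have hone := d.one_le_W_pow p.k
  have hEM := d.E_mul_s_lt_M P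
  rw [add_mul]
  refine Runs.seq (R := fun τ => τ.reg 14 = d.W ^ p.k ∧ Agree [13, 14, 15] [13, 14, 15, 16] σ τ ∧
    τ.reg 13 = d.next P (d.W ^ p.k) ∧ (∀ u < d.W ^ p.k, τ.arr 13 u = d.slot P u) ∧
    (∀ u < d.W ^ p.k, d.Nonempty P u → τ.arr 14 (d.slot P u) = d.rep P u) ∧
    (∀ j, j * d.V < d.W ^ p.k → τ.arr 15 j = d.cs P j) ∧
    (∀ e, τ.arr 16 e = d.szUpto P (d.W ^ p.k) e)) ?_ ?_
  · refine (Runs.for_const (fun v τ => τ.reg 14 = v ∧ Agree [13, 14, 15] [13, 14, 15, 16] σ τ ∧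
      τ.reg 13 = d.next P v ∧ (∀ u < v, τ.arr 13 u = d.slot P u) ∧
      (∀ u < v, d.Nonempty P u → τ.arr 14 (d.slot P u) = d.rep P u) ∧
      (∀ j, j * d.V < v → τ.arr 15 j = d.cs P j) ∧ (∀ e, τ.arr 16 e = d.szUpto P v e)) c (l := 0)
      (h := d.W ^ p.k) rfl (by omega) (by have := d.classes_lt; unfold W; omega) ?_ ?_ ?_).mono
      ?_ fun τ hτ => hτ
    · refine ⟨by simp, ⟨fun x hx => ?_, fun x _ => rfl⟩, ?_, by simp, by simp, by simp, fun e => ?_⟩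
      · simp only [List.mem_cons, not_or] at hx; simp [hx.2.1]
      · simp [hF.1 13, next]
      · simp [hF.2 16, szUpto]
    · rintro v τ ⟨h₁, h₂, -⟩
      exact ⟨h₁, by simp [h₂.1 1 (by simp), hσ.r1]⟩
    · rintro v τ - hv ⟨h14, ag, h13, hsl, hel, hcs, hsz⟩
      refine (hc d P σ τ v hσ hC hv h14 ag h13 hsl hel hcs hsz).mono le_rfl ?_
      rintro υ ⟨h14, ag, h13, hsl, hel, hcs, hsz⟩
      refine ⟨h14, by simp, ⟨fun x hx => ?_, ag.2⟩, by simpa using h13, hsl, hel, hcs, hsz⟩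
      have := ag.1 x hx
      simp only [List.mem_cons, not_or] at hx
      simp [hx.2.1, this]
    · rw [mul_assoc]
      exact Nat.mul_le_mul_left _ (by omega)
  · rintro τ ⟨h14, ag, h13, hsl, hel, hcs, hsz⟩
    have h1 : τ.reg 1 = d.W := by rw [ag.1 1 (by simp), hσ.r1]
    have hRE : ∀ υ : State, υ.reg 1 = d.W → p.RE.eval υ = d.R := fun υ h => by
      simp [Params.RE, h, R]
    have hval : (.reg 13 / p.sE + .const 1 : Expr).eval τ = d.E P := by
      rw [E, cs_eq, R_mul_V]; simp [Params.sE, h1, h13, s]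
    have hE : d.E P < d.M := by
      have := Nat.le_mul_of_pos_right (d.E P) d.s_pos
      omega
    refine Runs.time (T₁ := c₁ + ((Expr.read 15 p.RE).cost + 1)) ?_
      (Nat.le_mul_of_pos_right _ hone)
    refine Runs.seq (R := fun υ => υ = τ.setArr 15 d.R (d.E P))
      (Runs.write (by rw [hval]; exact hE) (by rw [hval, hRE τ h1])) fun υ hυ => ?_
    have hval' : (Expr.read 15 p.RE).eval υ = d.E P := by
      rw [eval_read, hRE υ (by simp [hυ, h1])]; simp [hυ]
    refine Runs.assign (by rw [hval']; exact hE) ?_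
    rw [hval']
    refine ⟨⟨by simp, fun v hv => ?_, fun v hv hv' => ?_, fun j hj => ?_, fun e => ?_⟩,
      fun x hx => ?_, fun x hx => ?_⟩
    · simp [hυ, hsl v hv]
    · simp [hυ, hel v hv hv']
    · by_cases hjR : j = d.R
      · simp [hυ, hjR, E]
      · have : j * d.V < d.W ^ p.k := by
          rw [← R_mul_V]; exact Nat.mul_lt_mul_of_pos_right (by omega) d.V_pos
        simp [hυ, hjR, hcs j this]
    · simp [hυ, hsz, sz]
    · have := ag.1 x hx
      simp only [List.mem_cons, List.not_mem_nil, or_false, not_or] at hx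
      simp [hυ, hx.2.2, this]
    · have := ag.2 x hx
      simp only [List.mem_cons, List.not_mem_nil, or_false, not_or] at hx
      simp [hυ, hx.2.2, this]

end Input

/-! ### The instance of Set Disjointness -/

/-- The difference `x - y` modulo `P`. -/
def modSub (P x y : ℕ) : ℕ := (x % P + P - y % P) % P

theorem modSub_lt {P : ℕ} (hP : 1 ≤ P) (x y : ℕ) : modSub P x y < P := Nat.mod_lt _ hP

theorem modSub_add {P : ℕ} (hP : 1 ≤ P) (x y : ℕ) : modSub P x y + y ≡ x [MOD P] := by
  have h : y % P < P := Nat.mod_lt _ hP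
  calc modSub P x y + y ≡ (x % P + P - y % P) + y % P [MOD P] :=
        Nat.ModEq.add (Nat.mod_modEq _ _) (Nat.mod_modEq _ _).symm
    _ = x % P + P := by omega
    _ ≡ x [MOD P] := by simp [Nat.ModEq]

/-- Moving `x` and `b` to the other sides of the congruence separates `a` and `x` from `b` and `y`.
This lets one set depend on `a` and the other on `b`; equality of the reduced differences is then
equality in the universe. -/
theorem modSub_eq_iff {P : ℕ} (hP : 1 ≤ P) (a b x y : ℕ) :
    modSub P a x = modSub P y b ↔ a + b ≡ x + y [MOD P] := by
  have h₁ := modSub_add hP a x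
  have h₂ := modSub_add hP y b
  constructor
  · intro h
    rw [h] at h₁
    calc a + b ≡ (modSub P y b + x) + b [MOD P] := (h₁.add_right b).symm
      _ = x + (modSub P y b + b) := by ring
      _ ≡ x + y [MOD P] := h₂.add_left x
  · intro h
    refine Nat.ModEq.eq_of_lt_of_lt (m := P) ?_ (modSub_lt hP _ _) (modSub_lt hP _ _)
    refine Nat.ModEq.add_right_cancel' (x + b) ?_
    calc modSub P a x + (x + b) = (modSub P a x + x) + b := by ring
      _ ≡ a + b [MOD P] := h₁.add_right b
      _ ≡ x + y [MOD P] := h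
      _ ≡ x + (modSub P y b + b) [MOD P] := (h₂.add_left x).symm
      _ = modSub P y b + (x + b) := by ring

theorem modSub_zero (P b : ℕ) : modSub P b 0 = b % P := by
  simp [modSub]

namespace Input

variable {p : Params} (d : Input p)

/-- The moduli are between `1` and `W`. -/
def Good (P : ℕ → ℕ) : Prop := ∀ j < p.k, 1 ≤ P j ∧ P j ≤ d.W

theorem Moduli.good {d : Input p} {P : ℕ → ℕ} {σ : State} (h : d.Moduli P σ) : d.Good P :=
  fun j hj => (h j hj).2

variable {d} {P : ℕ → ℕ}

theorem Good.mod_lt (hP : d.Good P) {j : ℕ} (hj : j < p.k) (x : ℕ) : x % P j < d.W :=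
  (Nat.mod_lt _ (hP j hj).1).trans_le (hP j hj).2

theorem Good.modSub_lt (hP : d.Good P) {j : ℕ} (hj : j < p.k) (x y : ℕ) :
    modSub (P j) x y < d.W :=
  (_root_.modSub_lt (hP j hj).1 x y).trans_le (hP j hj).2

variable (d) (P)

/-- The digit number `j` of `x`, as a number with `2 * y` digits. -/
def dig (x j : ℕ) : ℕ := x / d.W ^ (2 * p.y - 1 - j) % d.W

variable {d P}

theorem pk_eq (a : ℕ) : d.pk P a = horner d.W (fun j => a % P j) p.r * d.V +
    horner d.W (fun j => a % P (p.r + j)) (2 * p.y) := by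
  rw [pk, Params.k, horner_add, V]

theorem pk_eq' (a : ℕ) : d.pk P a = (horner d.W (fun j => a % P j) p.r * d.Y +
    horner d.W (fun j => a % P (p.r + j)) p.y) * d.Y +
      horner d.W (fun j => a % P (p.r + (p.y + j))) p.y := by
  rw [pk_eq, two_mul, horner_add (m := p.y), ← Y_mul_Y]
  unfold Y
  ring

theorem pk_div_V (hP : d.Good P) (a : ℕ) : d.pk P a / d.V = horner d.W (fun j => a % P j) p.r := by
  rw [pk_eq, mul_add_div_of_lt]
  exact horner_lt fun j hj => hP.mod_lt (by unfold Params.k; omega) _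

theorem pk_div_V_eq_iff (hP : d.Good P) (a b : ℕ) :
    d.pk P a / d.V = d.pk P b / d.V ↔ ∀ j < p.r, a % P j = b % P j := by
  rw [pk_div_V hP, pk_div_V hP]
  exact horner_inj (fun j hj => hP.mod_lt (by unfold Params.k; omega) _)
    (fun j hj => hP.mod_lt (by unfold Params.k; omega) _)

theorem pk_eq_pk_iff (hP : d.Good P) (a b : ℕ) :
    d.pk P a = d.pk P b ↔ ∀ j < p.k, a % P j = b % P j :=
  horner_inj (fun _ hj => hP.mod_lt hj _) fun _ hj => hP.mod_lt hj _

/-- The digits of `c` in the universe are the upper half followed by zeros plus zeros followed by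
the lower half. So `Y + Y` shifts suffice to produce all `Y * Y` values of `c`. -/
theorem dig_add_dig (hP : d.Good P) (c : ℕ) {j : ℕ} (hj : j < 2 * p.y) :
    d.dig (d.pk P c / d.Y % d.Y * d.Y) j + d.dig (d.pk P c % d.Y) j = c % P (p.r + j) := by
  set hx := horner d.W (fun j => c % P (p.r + j)) p.y with hhx
  set hy := horner d.W (fun j => c % P (p.r + (p.y + j))) p.y with hhy
  have h₁ : ∀ j < p.y, c % P (p.r + j) < d.W := fun j hj => hP.mod_lt (by unfold Params.k; omega) _
  have h₂ : ∀ j < p.y, c % P (p.r + (p.y + j)) < d.W :=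
    fun j hj => hP.mod_lt (by unfold Params.k; omega) _
  have hxY : hx < d.Y := horner_lt h₁
  have hyY : hy < d.Y := horner_lt h₂
  have e₁ : d.pk P c / d.Y % d.Y = hx := by
    rw [pk_eq', mul_add_div_of_lt hyY, mul_add_mod_of_lt hxY]
  have e₂ : d.pk P c % d.Y = hy := by rw [pk_eq', mul_add_mod_of_lt hyY]
  rw [e₁, e₂, dig, dig]
  have hW := d.W_pos
  -- In the upper half the second summand has digit `0`, in the lower half the first one.
  rcases lt_or_ge j p.y with hjy | hjy
  · have e₃ : 2 * p.y - 1 - j = (p.y - 1 - j) + p.y := by omega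
    rw [e₃, pow_add, Y, Nat.mul_div_mul_right _ _ (d.one_le_W_pow _), hhx, horner_digit h₁ hjy,
      Nat.div_eq_of_lt, Nat.zero_mod, add_zero]
    exact hyY.trans_le (Nat.le_mul_of_pos_left _ (d.one_le_W_pow _))
  · obtain ⟨i, rfl⟩ : ∃ i, j = p.y + i := ⟨j - p.y, by omega⟩
    have e₃ : 2 * p.y - 1 - (p.y + i) = p.y - 1 - i := by omega
    have e₄ : d.Y = d.W ^ i * d.W * d.W ^ (p.y - 1 - i) := by
      rw [Y, ← pow_succ, ← pow_add]; congr 1; omega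
    rw [e₃, hhy, horner_digit h₂ (by omega), e₄, ← mul_assoc, Nat.mul_div_cancel _
      (d.one_le_W_pow _), ← mul_assoc, Nat.mul_mod_left, zero_add]

variable (d P)

open Classical in
/-- The representative in slot `t`. -/
noncomputable def elem (t : ℕ) : ℕ :=
  if h : ∃ v < d.W ^ p.k, d.Nonempty P v ∧ d.slot P v = t then d.rep P h.choose else 0

/-- The bucket of `b` if `a + b = c`. -/
def third (c a : ℕ) : ℕ := horner d.W (fun j => modSub (P j) c a) p.r

/-- The shift of `a` by `x`, as an element of the universe. -/
def valA (a x : ℕ) : ℕ :=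
  horner d.W (fun j => modSub (P (p.r + j)) a (d.dig (x * d.Y) j)) (2 * p.y) + 1

/-- The shift of the negative of `b` by `x`, as an element of the universe. -/
def valB (b x : ℕ) : ℕ :=
  horner d.W (fun j => modSub (P (p.r + j)) (d.dig x j) b) (2 * p.y) + 1

/-- The elements of the set number `i`. -/
noncomputable def setList (i : ℕ) : List ℕ :=
  (List.range (d.sz P (i / d.Y % d.E P))).map fun o =>
    if i / d.Y < d.E P then d.valA P (d.elem P (i / d.Y % d.E P * d.s + o)) (i % d.Y)
    else d.valB P (d.elem P (i / d.Y % d.E P * d.s + o)) (i % d.Y)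

/-- The queries: a representative `c`, a chunk `e`, and a chunk `f` in the bucket of the elements
that could complete a solution with `c` and the elements of `e`. -/
noncomputable def queries : List (ℕ × ℕ × ℕ) :=
  (d.A.filter fun c => d.rep P (d.pk P c) = c).flatMap fun c => (List.range (d.E P)).flatMap fun e =>
    if d.sz P e = 0 then [] else
      (List.range' (d.cs P (d.third P c (d.elem P (e * d.s))))
        (d.cs P (d.third P c (d.elem P (e * d.s)) + 1) -
          d.cs P (d.third P c (d.elem P (e * d.s))))).map fun f => (c, e, f)

/-- The index of the first set of a query. -/
def fstIdx (t : ℕ × ℕ × ℕ) : ℕ := t.2.1 * d.Y + d.pk P t.1 / d.Y % d.Y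
/-- The index of the second set of a query. -/
def sndIdx (t : ℕ × ℕ × ℕ) : ℕ := (d.E P + t.2.2) * d.Y + d.pk P t.1 % d.Y

variable {d P}

theorem elem_slot {v : ℕ} (hv : v < d.W ^ p.k) (h : d.Nonempty P v) :
    d.elem P (d.slot P v) = d.rep P v := by
  have hex : ∃ u < d.W ^ p.k, d.Nonempty P u ∧ d.slot P u = d.slot P v := ⟨v, hv, h, rfl⟩
  rw [elem, dif_pos hex]
  congr 1
  exact d.slot_inj P hex.choose_spec.2.1 h hex.choose_spec.2.2

theorem elem_spec {e o : ℕ} (h : o < d.sz P e) : d.elem P (e * d.s + o) ∈ d.A ∧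
    d.slot P (d.pk P (d.elem P (e * d.s + o))) = e * d.s + o ∧
    d.rep P (d.pk P (d.elem P (e * d.s + o))) = d.elem P (e * d.s + o) ∧ o < d.s := by
  obtain ⟨v, hv, hne, hs, ho⟩ := d.exists_slot P h
  rw [← hs, elem_slot hv hne, hne.rep_mem.2]
  exact ⟨hne.rep_mem.1, rfl, rfl, ho⟩

theorem elem_chunk {e o : ℕ} (h : o < d.sz P e) :
    d.slot P (d.pk P (d.elem P (e * d.s + o))) / d.s = e := by
  obtain ⟨-, h₁, -, ho⟩ := elem_spec h
  rw [h₁, mul_add_div_of_lt ho]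

/-- The ranges of chunk numbers of different buckets are disjoint, so a chunk determines its bucket.
-/
theorem div_V_eq {u v : ℕ} (h : d.slot P u / d.s = d.slot P v / d.s) : u / d.V = v / d.V :=
  d.cs_unique P (d.cs_le_div P u) (d.div_lt_cs P u) (h ▸ d.cs_le_div P v) (h ▸ d.div_lt_cs P v)

theorem third_lt (hP : d.Good P) (c a : ℕ) : d.third P c a < d.R :=
  horner_lt fun j hj => hP.modSub_lt (by unfold Params.k; omega) _ _

theorem third_eq_iff (hP : d.Good P) (a b c : ℕ) :
    d.third P c a = d.pk P b / d.V ↔ ∀ j < p.r, a + b ≡ c [MOD P j] := by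
  rw [pk_div_V hP, third, horner_inj (fun j hj => hP.modSub_lt (by unfold Params.k; omega) _ _)
    (fun j hj => hP.mod_lt (by unfold Params.k; omega) _)]
  refine forall₂_congr fun j hj => ?_
  have h1 := (hP j (by unfold Params.k; omega)).1
  rw [← modSub_zero, modSub_eq_iff h1, add_zero]
  exact ⟨Nat.ModEq.symm, Nat.ModEq.symm⟩

theorem third_congr (hP : d.Good P) {a a' : ℕ} (c : ℕ) (h : d.pk P a / d.V = d.pk P a' / d.V) :
    d.third P c a = d.third P c a' := by
  rw [pk_div_V_eq_iff hP] at h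
  exact horner_congr fun j hj => by rw [modSub, modSub, h j hj]

/-- The bucket of `b` depends on `a` only through the bucket of `a`. All elements of a chunk share
it, so the first element of the chunk may be taken. -/
theorem third_elem (hP : d.Good P) (c : ℕ) {e o : ℕ} (h : o < d.sz P e) :
    d.third P c (d.elem P (e * d.s)) = d.third P c (d.elem P (e * d.s + o)) := by
  refine third_congr hP c (div_V_eq (P := P) ?_)
  have h₁ := elem_chunk (d := d) (P := P) (e := e) (o := 0) (by omega)
  rw [add_zero] at h₁
  rw [h₁, elem_chunk h]

theorem mem_queries {c e f : ℕ} : (c, e, f) ∈ d.queries P ↔ c ∈ d.A ∧ d.rep P (d.pk P c) = c ∧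
    e < d.E P ∧ d.sz P e ≠ 0 ∧ d.cs P (d.third P c (d.elem P (e * d.s))) ≤ f ∧
      f < d.cs P (d.third P c (d.elem P (e * d.s)) + 1) := by
  have hcs := fun i => (d.cs_lt_succ P i).le
  simp only [queries, List.mem_flatMap, List.mem_filter, decide_eq_true_eq, List.mem_range]
  constructor
  · rintro ⟨c', ⟨h₁, h₂⟩, e', h₃, h₄⟩
    split_ifs at h₄ with h₅
    · simp at h₄
    · simp only [List.mem_map, List.mem_range'_1, Prod.mk.injEq] at h₄
      obtain ⟨f', h₆, rfl, rfl, rfl⟩ := h₄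
      have := hcs (d.third P c' (d.elem P (e' * d.s)))
      exact ⟨h₁, h₂, h₃, h₅, by omega, by omega⟩
  · rintro ⟨h₁, h₂, h₃, h₄, h₅, h₆⟩
    refine ⟨c, ⟨h₁, h₂⟩, e, h₃, ?_⟩
    rw [if_neg h₄]
    simp only [List.mem_map, List.mem_range'_1, Prod.mk.injEq]
    refine ⟨f, by omega, ?_⟩
    simp

theorem query_lt (hP : d.Good P) {t : ℕ × ℕ × ℕ} (h : t ∈ d.queries P) :
    t.2.1 < d.E P ∧ t.2.2 < d.E P := by
  obtain ⟨c, e, f⟩ := t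
  obtain ⟨-, -, h₁, -, -, h₂⟩ := mem_queries.1 h
  exact ⟨h₁, h₂.trans_le ((d.cs_strictMono P).monotone (third_lt hP _ _))⟩

theorem idx_lt (hP : d.Good P) {t : ℕ × ℕ × ℕ} (h : t ∈ d.queries P) :
    d.fstIdx P t < 2 * d.E P * d.Y ∧ d.sndIdx P t < 2 * d.E P * d.Y := by
  obtain ⟨h₁, h₂⟩ := query_lt hP h
  have h₃ := Nat.mod_lt (d.pk P t.1 / d.Y) d.Y_pos
  have h₄ := Nat.mod_lt (d.pk P t.1) d.Y_pos
  unfold fstIdx sndIdx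
  have h₅ : (t.2.1 + 1) * d.Y ≤ 2 * d.E P * d.Y := Nat.mul_le_mul_right _ (by omega)
  have h₆ : (d.E P + t.2.2 + 1) * d.Y ≤ 2 * d.E P * d.Y := Nat.mul_le_mul_right _ (by omega)
  rw [add_mul _ 1, one_mul] at h₅ h₆
  omega

/-- The two set numbers reveal `e`, `f` and both halves of the universe digits of `c`. The bucket of
`c` is the sum of the buckets of `e` and `f`, since `f` lies in the bucket completing `c` and `e`.
Thus the class of `c` is known, and `c` is its representative. This is why queries use
representatives only. -/
theorem query_eq (hP : d.Good P) {t t' : ℕ × ℕ × ℕ} (h : t ∈ d.queries P) (h' : t' ∈ d.queries P)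
    (h₁ : d.fstIdx P t = d.fstIdx P t') (h₂ : d.sndIdx P t = d.sndIdx P t') : t = t' := by
  obtain ⟨c, e, f⟩ := t
  obtain ⟨c', e', f'⟩ := t'
  obtain ⟨ha, hr, -, -, h₃, h₄⟩ := mem_queries.1 h
  obtain ⟨ha', hr', -, -, h₃', h₄'⟩ := mem_queries.1 h'
  simp only [fstIdx, sndIdx] at h₁ h₂
  have hY : ∀ x, x % d.Y < d.Y := fun x => Nat.mod_lt x d.Y_pos
  have q₁ := congrArg (· / d.Y) h₁
  have q₂ := congrArg (· % d.Y) h₁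
  have q₃ := congrArg (· / d.Y) h₂
  have q₄ := congrArg (· % d.Y) h₂
  simp only [mul_add_div_of_lt (hY _)] at q₁ q₃
  simp only [mul_add_mod_of_lt (hY _)] at q₂ q₄
  subst q₁
  obtain rfl : f = f' := by omega
  have hj := d.cs_unique P h₃ h₄ h₃' h₄'
  have hr1 : ∀ j < p.r, c % P j = c' % P j := by
    intro j hj'
    have hjk : j < p.k := by unfold Params.k; omega
    have := (horner_inj (fun j hj => hP.modSub_lt (by unfold Params.k; omega) _ _)
      (fun j hj => hP.modSub_lt (by unfold Params.k; omega) _ _)).1 hj j hj'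
    rw [modSub_eq_iff (hP j hjk).1] at this
    rw [add_comm c] at this
    exact this.add_left_cancel'
  have hpk : d.pk P c = d.pk P c' := by
    rw [pk_eq_pk_iff hP]
    intro j hj'
    rcases lt_or_ge j p.r with hjr | hjr
    · exact hr1 j hjr
    · obtain ⟨i, rfl⟩ : ∃ i, j = p.r + i := ⟨j - p.r, by omega⟩
      have hi : i < 2 * p.y := by unfold Params.k at hj'; omega
      rw [← dig_add_dig hP c hi, ← dig_add_dig hP c' hi, q₂, q₄]
  rw [← hr, hpk, hr']

theorem nodup_queries : (d.queries P).Nodup := by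
  unfold queries
  refine List.nodup_flatMap.2 ⟨fun c _ => List.nodup_flatMap.2 ⟨fun e _ => ?_, ?_⟩, ?_⟩
  · split_ifs
    · exact List.nodup_nil
    · exact List.Nodup.map (fun f f' h => by simpa using h) List.nodup_range'
  · refine List.nodup_range.imp ?_
    rintro e e' hne x h₁ h₂
    beta_reduce at h₁ h₂
    split_ifs at h₁ h₂
    all_goals simp at h₁ h₂
    obtain ⟨_, _, rfl⟩ := h₁
    obtain ⟨_, _, h⟩ := h₂
    simp only [Prod.mk.injEq] at h
    exact hne h.2.1.symm
  · refine (d.nodup.filter _).imp ?_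
    rintro e e' hne x h₁ h₂
    simp only [List.mem_flatMap] at h₁ h₂
    obtain ⟨_, _, h₁⟩ := h₁
    obtain ⟨_, _, h₂⟩ := h₂
    split_ifs at h₁ h₂
    all_goals simp at h₁ h₂
    obtain ⟨_, _, rfl⟩ := h₁
    obtain ⟨_, _, h⟩ := h₂
    simp only [Prod.mk.injEq] at h
    exact hne h.1.symm

theorem val_le (hP : d.Good P) (a x : ℕ) : d.valA P a x ≤ d.V ∧ d.valB P a x ≤ d.V :=
  ⟨horner_lt fun j hj => hP.modSub_lt (by unfold Params.k; omega) _ _,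
    horner_lt fun j hj => hP.modSub_lt (by unfold Params.k; omega) _ _⟩

theorem valA_eq_valB_iff (hP : d.Good P) (a b x y : ℕ) : d.valA P a x = d.valB P b y ↔
    ∀ j < 2 * p.y, a + b ≡ d.dig (x * d.Y) j + d.dig y j [MOD P (p.r + j)] := by
  rw [valA, valB, Nat.add_right_cancel_iff,
    horner_inj (fun j hj => hP.modSub_lt (by unfold Params.k; omega) _ _)
    (fun j hj => hP.modSub_lt (by unfold Params.k; omega) _ _)]
  exact forall₂_congr fun j hj => modSub_eq_iff (hP _ (by unfold Params.k; omega)).1 _ _ _ _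

theorem valA_inj (hP : d.Good P) {a b x : ℕ} (h : d.valA P a x = d.valA P b x) :
    ∀ j < 2 * p.y, a % P (p.r + j) = b % P (p.r + j) := by
  rw [valA, valA, Nat.add_right_cancel_iff,
    horner_inj (fun j hj => hP.modSub_lt (by unfold Params.k; omega) _ _)
    (fun j hj => hP.modSub_lt (by unfold Params.k; omega) _ _)] at h
  intro j hj
  have := h j hj
  rw [modSub_eq_iff (hP _ (by unfold Params.k; omega)).1, add_comm a] at this
  exact this.add_left_cancel'

theorem valB_inj (hP : d.Good P) {a b x : ℕ} (h : d.valB P a x = d.valB P b x) :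
    ∀ j < 2 * p.y, a % P (p.r + j) = b % P (p.r + j) := by
  rw [valB, valB, Nat.add_right_cancel_iff,
    horner_inj (fun j hj => hP.modSub_lt (by unfold Params.k; omega) _ _)
    (fun j hj => hP.modSub_lt (by unfold Params.k; omega) _ _)] at h
  intro j hj
  have := h j hj
  rw [modSub_eq_iff (hP _ (by unfold Params.k; omega)).1, add_comm _ b] at this
  exact (this.add_right_cancel').symm

/-- Elements of one chunk agree modulo the first `r` moduli. If they agree modulo the others as
well, they are in the same class, and a class has only one slot. So shifting a chunk produces no
repetitions. -/
theorem elem_inj (hP : d.Good P) {e o o' : ℕ} (h : o < d.sz P e) (h' : o' < d.sz P e)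
    (hv : ∀ j < 2 * p.y, d.elem P (e * d.s + o) % P (p.r + j) =
      d.elem P (e * d.s + o') % P (p.r + j)) : o = o' := by
  have hpk : d.pk P (d.elem P (e * d.s + o)) = d.pk P (d.elem P (e * d.s + o')) := by
    rw [pk_eq_pk_iff hP]
    intro j hj
    rcases lt_or_ge j p.r with hjr | hjr
    · refine (pk_div_V_eq_iff hP _ _).1 (div_V_eq (P := P) ?_) j hjr
      rw [elem_chunk h, elem_chunk h']
    · obtain ⟨i, rfl⟩ : ∃ i, j = p.r + i := ⟨j - p.r, by omega⟩
      exact hv i (by unfold Params.k at hj; omega)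
  have h₁ := (elem_spec h).2.1
  rw [hpk, (elem_spec h').2.1] at h₁
  omega

theorem E_pos (P : ℕ → ℕ) : 0 < d.E P := by rw [E, cs_eq]; exact Nat.succ_pos _

/-- The instance of Set Disjointness. -/
noncomputable def inst (hP : d.Good P) : SetDisjointness.Instance where
  U := d.V
  N := 2 * d.E P * d.Y
  s := d.s
  S i := d.setList P i
  -- The reduction modulo the number of sets only provides membership in `Fin`; by `idx_lt` it
  -- changes nothing for actual queries.
  Q := (d.queries P).map fun t =>
    (⟨d.fstIdx P t % (2 * d.E P * d.Y), Nat.mod_lt _ (by have := E_pos (d := d) P; have := d.Y_pos; positivity)⟩,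
      ⟨d.sndIdx P t % (2 * d.E P * d.Y), Nat.mod_lt _ (by have := E_pos (d := d) P; have := d.Y_pos; positivity)⟩)
  nodup_S i := by
    refine List.Nodup.map_on (fun o ho o' ho' h => ?_) List.nodup_range
    rw [List.mem_range] at ho ho'
    split_ifs at h
    · exact elem_inj hP ho ho' (valA_inj hP h)
    · exact elem_inj hP ho ho' (valB_inj hP h)
  mem_S i x hx := by
    rw [setList, List.mem_map] at hx
    obtain ⟨o, -, rfl⟩ := hx
    split_ifs
    · exact ⟨Nat.le_add_left _ _, (val_le hP _ _).1⟩
    · exact ⟨Nat.le_add_left _ _, (val_le hP _ _).2⟩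
  length_S i := by
    rw [setList, List.length_map, List.length_range]
    exact d.sz_le P _
  nodup_Q := by
    refine List.Nodup.map_on (fun t ht t' ht' h => ?_) nodup_queries
    simp only [Prod.mk.injEq, Fin.mk.injEq] at h
    rw [Nat.mod_eq_of_lt (idx_lt hP ht).1, Nat.mod_eq_of_lt (idx_lt hP ht).2,
      Nat.mod_eq_of_lt (idx_lt hP ht').1, Nat.mod_eq_of_lt (idx_lt hP ht').2] at h
    exact query_eq hP ht ht' h.1 h.2

variable (d P)

/-- There are elements `a` and `b` of the chunks of the query that look like a solution. -/
def Positive (t : ℕ × ℕ × ℕ) : Prop :=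
  ∃ o < d.sz P t.2.1, ∃ o' < d.sz P t.2.2, ∀ j < p.k,
    d.elem P (t.2.1 * d.s + o) + d.elem P (t.2.2 * d.s + o') ≡ t.1 [MOD P j]

variable {d P}

theorem setList_fst {t : ℕ × ℕ × ℕ} (he : t.2.1 < d.E P) : d.setList P (d.fstIdx P t) =
    (List.range (d.sz P t.2.1)).map fun o =>
      d.valA P (d.elem P (t.2.1 * d.s + o)) (d.pk P t.1 / d.Y % d.Y) := by
  have h₁ := Nat.mod_lt (d.pk P t.1 / d.Y) d.Y_pos
  have h₂ : d.fstIdx P t / d.Y = t.2.1 := mul_add_div_of_lt h₁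
  have h₃ : d.fstIdx P t % d.Y = d.pk P t.1 / d.Y % d.Y := mul_add_mod_of_lt h₁
  rw [setList, h₂, h₃, Nat.mod_eq_of_lt he]
  simp only [he, if_true]

theorem setList_snd {t : ℕ × ℕ × ℕ} (hf : t.2.2 < d.E P) : d.setList P (d.sndIdx P t) =
    (List.range (d.sz P t.2.2)).map fun o =>
      d.valB P (d.elem P (t.2.2 * d.s + o)) (d.pk P t.1 % d.Y) := by
  have h₁ := Nat.mod_lt (d.pk P t.1) d.Y_pos
  have h₂ : d.sndIdx P t / d.Y = d.E P + t.2.2 := mul_add_div_of_lt h₁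
  have h₃ : d.sndIdx P t % d.Y = d.pk P t.1 % d.Y := mul_add_mod_of_lt h₁
  rw [setList, h₂, h₃, Nat.add_mod_left, Nat.mod_eq_of_lt hf]
  simp only [show ¬ d.E P + t.2.2 < d.E P by omega, if_false]

/-- A common element of the two sets is a pair with `a + b ≡ c` modulo the last `2 * y` moduli.
Modulo the first `r` moduli the congruence is automatic, because `f` was taken from the bucket that
completes `c` and `e`. -/
theorem disjoint_iff (hP : d.Good P) {t : ℕ × ℕ × ℕ} (ht : t ∈ d.queries P) :
    (d.setList P (d.fstIdx P t)).toFinset ∩ (d.setList P (d.sndIdx P t)).toFinset = ∅ ↔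
      ¬ d.Positive P t := by
  obtain ⟨he, hf⟩ := query_lt hP ht
  rw [setList_fst he, setList_snd hf, ← Finset.not_nonempty_iff_eq_empty, not_iff_not]
  obtain ⟨c, e, f⟩ := t
  obtain ⟨-, -, -, -, h₁, h₂⟩ := mem_queries.1 ht
  simp only [Finset.Nonempty, Finset.mem_inter, List.mem_toFinset, List.mem_map, List.mem_range,
    Positive]
  simp only at he hf
  have key : ∀ o < d.sz P e, ∀ o' < d.sz P f,
      d.valA P (d.elem P (e * d.s + o)) (d.pk P c / d.Y % d.Y) =
      d.valB P (d.elem P (f * d.s + o')) (d.pk P c % d.Y) ↔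
      ∀ j < p.k, d.elem P (e * d.s + o) + d.elem P (f * d.s + o') ≡ c [MOD P j] := by
    intro o ho o' ho'
    rw [valA_eq_valB_iff hP]
    have h₃ : d.third P c (d.elem P (e * d.s + o)) =
        d.pk P (d.elem P (f * d.s + o')) / d.V := by
      rw [← third_elem hP c ho]
      refine d.cs_unique P h₁ h₂ ?_ ?_
      · have := d.cs_le_div P (d.pk P (d.elem P (f * d.s + o')))
        rwa [elem_chunk ho'] at this
      · have := d.div_lt_cs P (d.pk P (d.elem P (f * d.s + o')))
        rwa [elem_chunk ho'] at this
    rw [third_eq_iff hP] at h₃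
    have h₄ : ∀ j < 2 * p.y, d.dig (d.pk P c / d.Y % d.Y * d.Y) j + d.dig (d.pk P c % d.Y) j ≡ c
        [MOD P (p.r + j)] := fun j hj => by rw [dig_add_dig hP c hj]; exact Nat.mod_modEq _ _
    constructor
    · intro h j hj
      rcases lt_or_ge j p.r with hjr | hjr
      · exact h₃ j hjr
      · obtain ⟨i, rfl⟩ : ∃ i, j = p.r + i := ⟨j - p.r, by omega⟩
        have hi : i < 2 * p.y := by unfold Params.k at hj; omega
        exact (h i hi).trans (h₄ i hi)
    · exact fun h j hj => (h _ (by unfold Params.k; omega)).trans (h₄ j hj).symm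
  constructor
  · rintro ⟨x, ⟨o, ho, rfl⟩, o', ho', h⟩
    exact ⟨o, ho, o', ho', (key o ho o' ho').1 h.symm⟩
  · rintro ⟨o, ho, o', ho', h⟩
    exact ⟨_, ⟨o, ho, rfl⟩, o', ho', ((key o ho o' ho').2 h).symm⟩

end Input

/-! ### The number of queries and of candidates for solutions -/

namespace Input

variable {p : Params} {d : Input p} {P : ℕ → ℕ}

theorem modEq_of_pk_eq (hP : d.Good P) {a b : ℕ} (h : d.pk P a = d.pk P b) {j : ℕ} (hj : j < p.k) :
    a ≡ b [MOD P j] := (pk_eq_pk_iff hP a b).1 h j hj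

/-- The chunks in question all lie in the bucket of `c - b`. Its number of classes is at most the
number of its elements, which are precisely the `a` that complete `b` and `c` modulo the first `r`
moduli. The additional `s` accounts for the incomplete chunk. -/
theorem card_chunks_mul_le (hP : d.Good P) (b c : ℕ) :
    ((Finset.range (d.E P)).filter fun e => d.sz P e ≠ 0 ∧
      d.pk P b / d.V = d.third P c (d.elem P (e * d.s))).card * d.s ≤
    d.s + (d.S.filter fun a => ∀ j < p.r, a + b ≡ c [MOD P j]).card := by
  set X := (Finset.range (d.E P)).filter fun e => d.sz P e ≠ 0 ∧
      d.pk P b / d.V = d.third P c (d.elem P (e * d.s)) with hX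
  rcases X.eq_empty_or_nonempty with h0 | ⟨e₀, he₀⟩
  · rw [h0]; simp
  have hmem : ∀ e ∈ X, ∀ j < p.r, d.elem P (e * d.s) + b ≡ c [MOD P j] := by
    intro e he
    exact (third_eq_iff hP _ _ _).1 (Finset.mem_filter.1 he).2.2.symm
  have hsz : ∀ e ∈ X, 0 < d.sz P e := fun e he => Nat.pos_of_ne_zero (Finset.mem_filter.1 he).2.1
  have hch : ∀ e ∈ X, d.slot P (d.pk P (d.elem P (e * d.s))) / d.s = e := by
    intro e he
    have := elem_chunk (hsz e he)
    rwa [add_zero] at this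
  set i := d.pk P (d.elem P (e₀ * d.s)) / d.V with hi
  have hbu : ∀ e ∈ X, d.pk P (d.elem P (e * d.s)) / d.V = i := by
    intro e he
    rw [hi, pk_div_V_eq_iff hP]
    intro j hj
    exact ((hmem e he j hj).trans (hmem e₀ he₀ j hj).symm).add_right_cancel'
  have hsub : X ⊆ Finset.Ico (d.cs P i) (d.cs P (i + 1)) := by
    intro e he
    have h₁ := d.cs_le_div P (d.pk P (d.elem P (e * d.s)))
    have h₂ := d.div_lt_cs P (d.pk P (d.elem P (e * d.s)))
    rw [hch e he, hbu e he] at h₁ h₂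
    exact Finset.mem_Ico.2 ⟨h₁, h₂⟩
  have h₁ := Finset.card_le_card hsub
  rw [Nat.card_Ico, cs_succ] at h₁
  have h₂ : X.card ≤ d.bc P i / d.s + 1 := by
    generalize d.bc P i / d.s = q at *
    omega
  have h₃ : d.bc P i ≤ (d.S.filter fun a => ∀ j < p.r, a + b ≡ c [MOD P j]).card := by
    refine (d.bc_le P i).trans (Finset.card_le_card fun a ha => ?_)
    rw [Finset.mem_filter] at ha ⊢
    refine ⟨ha.1, fun j hj => ?_⟩
    have h₄ : a ≡ d.elem P (e₀ * d.s) [MOD P j] := by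
      have := ha.2
      rw [hi, pk_div_V_eq_iff hP] at this
      exact this j hj
    exact (h₄.add_right b).trans (hmem e₀ he₀ j hj)
  calc X.card * d.s ≤ (d.bc P i / d.s + 1) * d.s := Nat.mul_le_mul_right _ h₂
    _ = d.bc P i / d.s * d.s + d.s := by ring
    _ ≤ _ := by have := Nat.div_mul_le_self (d.bc P i) d.s; omega

/-- For fixed `c` and `e`, the number of `f` is at most one plus the number of `b` in the right
bucket over `s`. Exchanging the sums, the number of `e` for fixed `c` and `b` is bounded in the same
way by the number of `a`. The main term is the number of triples over `s * s`; the other terms come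
from incomplete chunks. -/
theorem length_queries_le (hP : d.Good P) : (d.queries P).length * d.s * d.s ≤
    d.n * d.E P * d.s * d.s + d.n * d.n * d.s + tripleCount d.S P p.r := by
  set j : ℕ → ℕ → ℕ := fun c e => d.third P c (d.elem P (e * d.s)) with hj
  have hnd : (d.A.filter fun c => d.rep P (d.pk P c) = c).Nodup := d.nodup.filter _
  have h₁ : (d.queries P).length ≤ ∑ c ∈ d.S, ∑ e ∈ Finset.range (d.E P),
      if d.sz P e = 0 then 0 else d.bc P (j c e) / d.s + 1 := by
    have : (d.queries P).length = ∑ c ∈ (d.A.filter fun c => d.rep P (d.pk P c) = c).toFinset,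
        ∑ e ∈ Finset.range (d.E P), if d.sz P e = 0 then 0 else d.bc P (j c e) / d.s + 1 := by
      rw [List.sum_toFinset _ hnd, queries, List.length_flatMap]
      congr 1
      refine List.map_congr_left fun c _ => ?_
      rw [List.length_flatMap, Finset.sum_range, ← List.sum_ofFn, List.ofFn_eq_map, ← List.map_coe_finRange_eq_range,
        List.map_map]
      congr 1
      refine List.map_congr_left fun e _ => ?_
      simp only [Function.comp]
      split_ifs
      · rfl
      · rw [List.length_map, List.length_range', cs_succ]
        simp only [hj]
        generalize d.bc P _ / d.s = q
        omega
    rw [this]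
    refine Finset.sum_le_sum_of_subset fun c hc => ?_
    rw [List.mem_toFinset, List.mem_filter] at hc
    exact d.mem_S.2 hc.1
  have h₂ : ∀ c, (∑ e ∈ Finset.range (d.E P), if d.sz P e = 0 then 0 else
      d.bc P (j c e) / d.s + 1) * d.s ≤ d.E P * d.s + ∑ b ∈ d.S,
        ((Finset.range (d.E P)).filter fun e => d.sz P e ≠ 0 ∧ d.pk P b / d.V = j c e).card := by
    intro c
    have h₃ : ∑ b ∈ d.S, ((Finset.range (d.E P)).filter fun e => d.sz P e ≠ 0 ∧
        d.pk P b / d.V = j c e).card = ∑ e ∈ Finset.range (d.E P), if d.sz P e = 0 then 0 else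
          (d.S.filter fun b => d.pk P b / d.V = j c e).card := by
      simp_rw [Finset.card_filter]
      rw [Finset.sum_comm]
      refine Finset.sum_congr rfl fun e _ => ?_
      split_ifs with h <;> simp [h]
    rw [h₃, Finset.sum_mul]
    have h₄ : d.E P * d.s = ∑ e ∈ Finset.range (d.E P), d.s := by simp
    rw [h₄, ← Finset.sum_add_distrib]
    refine Finset.sum_le_sum fun e _ => ?_
    split_ifs
    · omega
    · have h₅ := d.bc_le P (j c e)
      have h₆ := Nat.div_mul_le_self (d.bc P (j c e)) d.s
      rw [add_mul, one_mul]
      omega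
  calc (d.queries P).length * d.s * d.s
      ≤ (∑ c ∈ d.S, ∑ e ∈ Finset.range (d.E P), if d.sz P e = 0 then 0 else
          d.bc P (j c e) / d.s + 1) * d.s * d.s :=
        Nat.mul_le_mul_right _ (Nat.mul_le_mul_right _ h₁)
    _ ≤ (∑ c ∈ d.S, (d.E P * d.s + ∑ b ∈ d.S, ((Finset.range (d.E P)).filter fun e =>
          d.sz P e ≠ 0 ∧ d.pk P b / d.V = j c e).card)) * d.s := by
        refine Nat.mul_le_mul_right _ ?_
        rw [Finset.sum_mul]
        exact Finset.sum_le_sum fun c _ => h₂ c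
    _ = ∑ c ∈ d.S, (d.E P * d.s * d.s + ∑ b ∈ d.S, ((Finset.range (d.E P)).filter fun e =>
          d.sz P e ≠ 0 ∧ d.pk P b / d.V = j c e).card * d.s) := by
        rw [Finset.sum_mul]
        exact Finset.sum_congr rfl fun c _ => by rw [add_mul, Finset.sum_mul]
    _ ≤ ∑ c ∈ d.S, (d.E P * d.s * d.s + ∑ b ∈ d.S,
          (d.s + (d.S.filter fun a => ∀ j < p.r, a + b ≡ c [MOD P j]).card)) :=
        Finset.sum_le_sum fun c _ => Nat.add_le_add_left
          (Finset.sum_le_sum fun b _ => card_chunks_mul_le hP b c) _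
    _ = _ := by
        have h₃ : tripleCount d.S P p.r = ∑ c ∈ d.S, ∑ b ∈ d.S,
            (d.S.filter fun a => ∀ j < p.r, a + b ≡ c [MOD P j]).card := by
          rw [tripleCount_eq_sum]
          simp_rw [Finset.card_filter]
          refine Finset.sum_comm.trans ?_
          refine Eq.trans (Finset.sum_congr rfl fun b _ => Finset.sum_comm) ?_
          exact Finset.sum_comm
        rw [h₃]
        simp only [Finset.sum_add_distrib, Finset.sum_const, smul_eq_mul, d.card_S]
        ring

variable (d P)

/-- The class of `b` if `a + b = c`. -/
def compl (c a : ℕ) : ℕ := horner d.W (fun j => modSub (P j) c a) p.k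

/-- The number of triples to be checked for a query and an element of its first chunk. -/
noncomputable def weight (t : ℕ × ℕ × ℕ) (o : ℕ) : ℕ :=
  let a := d.elem P (t.2.1 * d.s + o)
  (d.cls P (d.pk P a)).length * (d.cls P (d.compl P t.1 a)).length * (d.cls P (d.pk P t.1)).length *
    if d.slot P (d.compl P t.1 a) / d.s = t.2.2 then 1 else 0

/-- The triple number `z` for a query and an element of its first chunk is a solution. -/
def Hit (t : ℕ × ℕ × ℕ) (o z : ℕ) : Prop :=
  let a := d.elem P (t.2.1 * d.s + o)
  let l := (d.cls P (d.pk P a)).length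
  let m := (d.cls P (d.compl P t.1 a)).length
  (d.cls P (d.pk P a)).getD (z % l) 0 + (d.cls P (d.compl P t.1 a)).getD (z / l % m) 0 =
    (d.cls P (d.pk P t.1)).getD (z / l / m) 0

variable {d P}

theorem compl_lt (hP : d.Good P) (c a : ℕ) : d.compl P c a < d.W ^ p.k :=
  horner_lt fun _ hj => hP.modSub_lt hj _ _

theorem pk_eq_compl_iff (hP : d.Good P) (a b c : ℕ) :
    d.pk P b = d.compl P c a ↔ ∀ j < p.k, a + b ≡ c [MOD P j] := by
  rw [eq_comm, pk, compl, horner_inj (fun j hj => hP.modSub_lt hj _ _)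
    (fun j hj => hP.mod_lt hj _)]
  refine forall₂_congr fun j hj => ?_
  have h1 := (hP j hj).1
  rw [← modSub_zero, modSub_eq_iff h1, add_zero]
  exact ⟨Nat.ModEq.symm, Nat.ModEq.symm⟩

/-- A positive query stands for three nonempty classes. So it leads to at least one triple, against
which the overhead of treating the query can be charged. -/
theorem exists_weight {t : ℕ × ℕ × ℕ} (hP : d.Good P) (ht : t ∈ d.queries P) (h : d.Positive P t) :
    ∃ o < d.sz P t.2.1, 1 ≤ d.weight P t o := by
  obtain ⟨o, ho, o', ho', h⟩ := h
  obtain ⟨c, e, f⟩ := t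
  refine ⟨o, ho, ?_⟩
  rw [← pk_eq_compl_iff hP] at h
  simp only at h ho ho'
  simp only [weight, ← h, elem_chunk ho', if_true, mul_one]
  exact Nat.mul_pos (Nat.mul_pos (nonempty_of_mem _ _ (elem_spec ho).1)
    (nonempty_of_mem _ _ (elem_spec ho').1)) (nonempty_of_mem _ _ (mem_queries.1 ht).1)

/-- Each triple that is checked satisfies the congruences modulo all moduli. It is checked only
once, since it determines the query and the element of the first chunk from which it arises. -/
theorem sum_weight_le (hP : d.Good P) : ((d.queries P).map fun t =>
    ∑ o ∈ Finset.range (d.sz P t.2.1), d.weight P t o).sum ≤ tripleCount d.S P p.k := by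
  rw [← List.sum_toFinset _ nodup_queries, ← Finset.sum_sigma (d.queries P).toFinset
    (fun t => Finset.range (d.sz P t.2.1)) fun x => d.weight P x.1 x.2]
  set T := (d.S ×ˢ d.S ×ˢ d.S).filter fun t => ∀ i < p.k, t.1 + t.2.1 ≡ t.2.2 [MOD P i] with hT
  set F : (_ : ℕ × ℕ × ℕ) × ℕ → Finset (ℕ × ℕ × ℕ) := fun x => T.filter fun τ =>
    d.pk P τ.1 = d.pk P (d.elem P (x.1.2.1 * d.s + x.2)) ∧ d.pk P τ.2.2 = d.pk P x.1.1 ∧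
      d.slot P (d.pk P τ.2.1) / d.s = x.1.2.2 with hF
  have h₁ : ∀ x ∈ (d.queries P).toFinset.sigma (fun t => Finset.range (d.sz P t.2.1)),
      d.weight P x.1 x.2 ≤ (F x).card := by
    rintro ⟨⟨c, e, f⟩, o⟩ -
    simp only [weight]
    split_ifs with hf
    · rw [mul_one, length_cls, length_cls, length_cls, mul_assoc, ← Finset.card_product,
        ← Finset.card_product]
      refine Finset.card_le_card ?_
      rintro ⟨a', b', c'⟩ h
      simp only [Finset.mem_product, Finset.mem_filter, hF, hT] at h ⊢
      obtain ⟨⟨ha, ha'⟩, ⟨hb, hb'⟩, hc, hc'⟩ := h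
      refine ⟨⟨⟨ha, hb, hc⟩, fun i hi => ?_⟩, ha', hc', by rw [hb', hf]⟩
      have h₂ := (pk_eq_compl_iff hP _ _ _).1 hb' i hi
      exact ((modEq_of_pk_eq hP ha' hi).add_right b').trans
        (h₂.trans (modEq_of_pk_eq hP hc' hi).symm)
    · simp
  refine (Finset.sum_le_sum h₁).trans ?_
  rw [← Finset.card_biUnion]
  · refine Finset.card_le_card fun τ hτ => ?_
    obtain ⟨x, -, hx⟩ := Finset.mem_biUnion.1 hτ
    exact (Finset.mem_filter.1 hx).1
  · rintro ⟨⟨c, e, f⟩, o⟩ hx ⟨⟨c', e', f'⟩, o'⟩ hx' hne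
    rw [Function.onFun, Finset.disjoint_left]
    intro τ h h'
    apply hne
    simp only [hF, Finset.mem_filter] at h h'
    simp only [Finset.coe_sigma, Set.mem_sigma_iff, Finset.mem_coe, List.mem_toFinset,
      Finset.mem_range] at hx hx'
    obtain ⟨-, h₂, h₃, h₄⟩ := h
    obtain ⟨-, h₂', h₃', h₄'⟩ := h'
    -- The class of the third entry determines `c`, the class of the first one its slot and thereby
    -- `e` and `o`, and the class of the second one the chunk `f`.
    have hc : c = c' := by
      rw [← (mem_queries.1 hx.1).2.1, ← (mem_queries.1 hx'.1).2.1, ← h₃, h₃']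
    have hs := (elem_spec hx.2).2.1
    rw [← h₂, h₂', (elem_spec hx'.2).2.1] at hs
    have ho := (elem_spec hx.2).2.2.2
    have ho' := (elem_spec hx'.2).2.2.2
    have he := congrArg (· / d.s) hs
    simp only [mul_add_div_of_lt ho, mul_add_div_of_lt ho'] at he
    subst he hc h₄
    obtain rfl : o = o' := by omega
    rw [← h₄']

/-- A true solution satisfies all congruences, so the classes of its elements give a positive query.
The check then runs through the elements of these three classes and not only their representatives,
so it meets the solution itself. -/
theorem hasSolution_iff (hP : d.Good P) : ThreeSum.HasSolution d.A ↔ ∃ t ∈ d.queries P,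
    d.Positive P t ∧ ∃ o < d.sz P t.2.1, ∃ z < d.weight P t o, d.Hit P t o z := by
  constructor
  · rintro ⟨a, ha, b, hb, c, hc, habc⟩
    have na := nonempty_of_mem (d := d) P ha
    have nb := nonempty_of_mem (d := d) P hb
    have nc := nonempty_of_mem (d := d) P hc
    have ea := elem_slot (pk_lt d hP a) na
    have eb := elem_slot (pk_lt d hP b) nb
    have za := d.slot_mod_lt_sz P (pk_lt d hP a) na
    have zb := d.slot_mod_lt_sz P (pk_lt d hP b) nb
    rw [← Nat.div_add_mod' (d.slot P (d.pk P a)) d.s] at ea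
    rw [← Nat.div_add_mod' (d.slot P (d.pk P b)) d.s] at eb
    have fe := d.slot_div_lt_E P (pk_lt d hP a)
    set e := d.slot P (d.pk P a) / d.s with he
    set o := d.slot P (d.pk P a) % d.s with ho
    set f := d.slot P (d.pk P b) / d.s with hf
    set o' := d.slot P (d.pk P b) % d.s with ho'
    set c' := d.rep P (d.pk P c) with hc'
    have hmod : ∀ j < p.k, d.rep P (d.pk P a) + b ≡ c' [MOD P j] := by
      intro j hj
      have h₁ := modEq_of_pk_eq hP na.rep_mem.2 hj
      have h₂ := modEq_of_pk_eq hP nc.rep_mem.2 hj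
      exact ((h₁.add_right b).trans (by rw [habc])).trans h₂.symm
    have hth : d.third P c' (d.elem P (e * d.s)) = d.pk P b / d.V := by
      rw [third_elem hP c' za, ea, third_eq_iff hP]
      exact fun j hj => hmod j (by unfold Params.k; omega)
    have hcompl := (pk_eq_compl_iff hP _ _ _).2 hmod
    have ma : a ∈ d.cls P (d.pk P a) := by simp [cls, ha]
    have mb : b ∈ d.cls P (d.pk P b) := by simp [cls, hb]
    have mc : c ∈ d.cls P (d.pk P c) := by simp [cls, hc]
    -- The positions of `a`, `b`, `c` in their classes are the mixed-radix digits of the number `z`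
    -- of the triple.
    obtain ⟨i₁, hi₁, ga⟩ := List.mem_iff_getElem.1 ma
    obtain ⟨i₂, hi₂, gb⟩ := List.mem_iff_getElem.1 mb
    obtain ⟨i₃, hi₃, gc⟩ := List.mem_iff_getElem.1 mc
    refine ⟨(c', e, f), mem_queries.2 ⟨nc.rep_mem.1, by rw [hc', nc.rep_mem.2], fe, by omega, ?_, ?_⟩,
      ⟨o, za, o', zb, fun j hj => ?_⟩, o, za,
      (i₃ * (d.cls P (d.pk P b)).length + i₂) * (d.cls P (d.pk P a)).length + i₁, ?_, ?_⟩
    · rw [hth]; exact d.cs_le_div P _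
    · rw [hth]; exact d.div_lt_cs P _
    · simp only
      rw [ea, eb]
      exact ((modEq_of_pk_eq hP nb.rep_mem.2 hj).add_left _).trans (hmod j hj)
    · simp only [weight, ea, na.rep_mem.2, ← hcompl]
      rw [hc', nc.rep_mem.2, if_pos hf.symm, mul_one]
      calc _ < ((i₃ * (d.cls P (d.pk P b)).length + i₂) + 1) * (d.cls P (d.pk P a)).length := by
            rw [add_mul _ 1]; omega
        _ ≤ ((i₃ + 1) * (d.cls P (d.pk P b)).length) * (d.cls P (d.pk P a)).length := by
            refine Nat.mul_le_mul_right _ ?_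
            rw [add_mul i₃ 1]; omega
        _ ≤ ((d.cls P (d.pk P c)).length * (d.cls P (d.pk P b)).length) *
            (d.cls P (d.pk P a)).length :=
            Nat.mul_le_mul_right _ (Nat.mul_le_mul_right _ hi₃)
        _ = _ := by ring
    · simp only [Hit, ea, na.rep_mem.2, ← hcompl]
      rw [hc', nc.rep_mem.2, mul_add_mod_of_lt hi₁, mul_add_div_of_lt hi₁, mul_add_mod_of_lt hi₂,
        mul_add_div_of_lt hi₂, List.getD_eq_getElem _ _ hi₁, List.getD_eq_getElem _ _ hi₂,
        List.getD_eq_getElem _ _ hi₃, ga, gb, gc, habc]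
  · rintro ⟨⟨c, e, f⟩, -, -, o, -, z, hz, h⟩
    simp only [weight] at hz
    simp only [Hit] at h
    set l := (d.cls P (d.pk P (d.elem P (e * d.s + o)))).length
    set m := (d.cls P (d.compl P c (d.elem P (e * d.s + o)))).length
    have hz' : z < l * m * (d.cls P (d.pk P c)).length := by
      split_ifs at hz
      · simpa using hz
      · simp at hz
    have hl : 0 < l := Nat.pos_of_ne_zero fun h0 => by simp [h0] at hz'
    have hm : 0 < m := Nat.pos_of_ne_zero fun h0 => by simp [h0] at hz'
    have h₃ : z / l / m < (d.cls P (d.pk P c)).length := by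
      rw [Nat.div_div_eq_div_mul]
      exact Nat.div_lt_of_lt_mul hz'
    have hmem : ∀ v i, i < (d.cls P v).length → (d.cls P v).getD i 0 ∈ d.A := by
      intro v i hi
      rw [List.getD_eq_getElem _ _ hi]
      exact List.mem_of_mem_filter (List.getElem_mem hi)
    exact ⟨_, hmem _ _ (Nat.mod_lt _ hl), _, hmem _ _ (Nat.mod_lt _ hm), _, hmem _ _ h₃, h⟩

end Input

/-! ### Writing down the sets -/

namespace WordRAM

/-- A `for` loop the time of which is bounded by the growth of a potential. -/
theorem Runs.for_potential {M x : ℕ} {lo hi : Expr} {p : Program} {σ : State}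
    (I : ℕ → State → Prop) (c₁ c₂ : ℕ) (F : ℕ → ℕ) {l h : ℕ} (hl : lo.eval σ = l) (hlh : l ≤ h)
    (hM : h < M) (hF : ∀ i, l ≤ i → i < h → F i ≤ F (i + 1))
    (h0 : I l (σ.setReg x l)) (inv : ∀ i τ, I i τ → τ.reg x = i ∧ hi.eval τ = h)
    (step : ∀ i τ, l ≤ i → i < h → I i τ → Runs M p τ (c₁ + c₂ * (F (i + 1) - F i))
      (fun τ' => τ'.reg x = i ∧ I (i + 1) (τ'.setReg x (i + 1)))) :
    Runs M (.for x lo hi p) σ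
      ((c₁ + lo.cost + hi.cost + 7) * (h - l + 1) + c₂ * (F h - F l)) (I h) := by
  refine (Runs.for I _ hl hlh hM h0 inv step).time ?_
  have key : ∀ m, l ≤ m → m ≤ h → F l ≤ F m ∧ ∑ i ∈ Finset.Ico l m,
      (c₁ + c₂ * (F (i + 1) - F i) + hi.cost + 7) =
        (c₁ + hi.cost + 7) * (m - l) + c₂ * (F m - F l) := by
    intro m hlm
    induction m, hlm using Nat.le_induction with
    | base => simp
    | succ m hm ih =>
      intro hmh
      obtain ⟨h₁, h₂⟩ := ih (by omega)
      have h₃ := hF m hm (by omega)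
      refine ⟨h₁.trans h₃, ?_⟩
      rw [Finset.sum_Ico_succ_top hm, h₂, show m + 1 - l = (m - l) + 1 by omega,
        show F (m + 1) - F l = (F (m + 1) - F m) + (F m - F l) by omega]
      ring
  rw [(key h hlh le_rfl).2]
  have : (c₁ + lo.cost + hi.cost + 7) * (h - l + 1) =
    (c₁ + hi.cost + 7) * (h - l) + lo.cost * (h - l) + (c₁ + lo.cost + hi.cost + 7) := by ring
  omega

/-- The difference modulo `P`, as an expression. -/
def Expr.modSub (P x y : Expr) : Expr := (x % P + P - y % P) % P

@[simp] theorem eval_modSub (σ : State) (P x y : Expr) :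
    (Expr.modSub P x y).eval σ = _root_.modSub (P.eval σ) (x.eval σ) (y.eval σ) := rfl

end WordRAM

theorem List.getD_append_singleton (l : List ℕ) (x : ℕ) :
    (fun i => (l ++ [x]).getD i 0) = Function.update (fun i => l.getD i 0) l.length x := by
  ext i
  by_cases h : i = l.length
  · subst h; simp
  · rw [Function.update_of_ne h]
    rcases lt_or_gt_of_ne h with h' | h'
    · rw [List.getD_append _ _ _ _ h']
    · rw [List.getD_append_right _ _ _ _ h'.le, List.getD_eq_default, List.getD_eq_default]
      · omega
      · simp; omega

namespace Params

variable (p : Params)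

/-- A digit of `x`, as an expression. -/
def digE (x : Expr) (j : ℕ) : Expr := x / (Expr.reg 1).pow (2 * p.y - 1 - j) % .reg 1

/-- An element of a set of the first kind, as an expression. -/
def valAE (a x : Expr) : Expr :=
  .horner (.reg 1) (fun j => .modSub (.read 1 (.const (p.r + j))) a (p.digE (x * p.YE) j)) (2 * p.y)
    + .const 1

/-- An element of a set of the second kind, as an expression. -/
def valBE (b x : Expr) : Expr :=
  .horner (.reg 1) (fun j => .modSub (.read 1 (.const (p.r + j))) (p.digE x j) b) (2 * p.y)
    + .const 1

/-- The bucket that completes a solution, as an expression. -/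
def thirdE (c a : Expr) : Expr :=
  .horner (.reg 1) (fun j => .modSub (.read 1 (.const j)) c a) p.r

/-- The chunk of the set to which the entry number `reg 9` of the table of the sets belongs. -/
def chunkE : Expr := .reg 9 / p.sE / p.YE % .reg 15

/-- An entry of the table of the elements of the sets. -/
def setE : Expr :=
  .op .lt (.reg 9 % p.sE) (.read 16 p.chunkE) *
    (.op .lt (.reg 9 / p.sE / p.YE) (.reg 15) *
        p.valAE (.read 14 (p.chunkE * p.sE + .reg 9 % p.sE)) (.reg 9 / p.sE % p.YE) +
      .op .le (.reg 15) (.reg 9 / p.sE / p.YE) *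
        p.valBE (.read 14 (p.chunkE * p.sE + .reg 9 % p.sE)) (.reg 9 / p.sE % p.YE))

/-- Write down the sets. -/
def setsProg : Program :=
  .seq (.assign 200 (.const p.C * (Expr.reg 1).pow p.g')) (.seq (.assign 201 p.VE)
    (.seq (.assign 202 (.const 2 * .reg 15 * p.YE)) (.seq (.assign 203 p.sE)
      (.seq (.fill 100 9 (.const 0) (.reg 202) (.read 16 (.reg 9 / p.YE % .reg 15)))
        (.fill 101 9 (.const 0) (.reg 202 * p.sE) p.setE)))))

end Params

namespace Input

variable {p : Params} {d : Input p} {P : ℕ → ℕ}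

theorem R_le_n (d : Input p) : d.R ≤ d.n :=
  (Nat.pow_le_pow_right d.W_pos (by have := p.r_le; omega)).trans d.W_pow_g_le
theorem Y_le_n (d : Input p) : d.Y ≤ d.n :=
  (Nat.pow_le_pow_right d.W_pos (by have := p.y_lt; omega)).trans d.W_pow_g_le
theorem s_le_n (d : Input p) : d.s ≤ d.n :=
  (Nat.pow_le_pow_right d.W_pos (by omega)).trans d.W_pow_g_le

theorem E_le_n (d : Input p) (P : ℕ → ℕ) : d.E P ≤ (p.B ^ p.g + 2) * d.n :=
  (d.E_le P).trans (Nat.mul_le_mul_left _ d.R_le_n)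

theorem N_mul_s_lt_M (d : Input p) (P : ℕ → ℕ) : 2 * d.E P * d.Y * d.s < d.M := by
  refine d.lt_M_of_le ?_
  have h₁ := d.E_mul_s_le P
  have h₂ : d.n * d.n ≤ d.n ^ 3 := by rw [← sq]; exact Nat.pow_le_pow_right d.n_pos (by omega)
  calc 2 * d.E P * d.Y * d.s = 2 * (d.E P * d.s) * d.Y := by ring
    _ ≤ 2 * ((p.B ^ p.g + 2) * d.W ^ p.g) * d.n := by gcongr; exact d.Y_le_n
    _ ≤ 2 * ((p.B ^ p.g + 2) * d.n) * d.n := by gcongr; exact d.W_pow_g_le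
    _ = (2 * (p.B ^ p.g + 2)) * (d.n * d.n) := by ring
    _ ≤ _ := Nat.mul_le_mul (by nlinarith) h₂

theorem N_lt_M' (d : Input p) (P : ℕ → ℕ) : 2 * d.E P * d.Y < d.M :=
  (Nat.le_mul_of_pos_right _ d.s_pos).trans_lt (d.N_mul_s_lt_M P)

theorem E_lt_M (d : Input p) (P : ℕ → ℕ) : 2 * d.E P < d.M :=
  (Nat.le_mul_of_pos_right _ d.Y_pos).trans_lt (d.N_lt_M' P)

theorem V_lt_M (d : Input p) : d.V + 1 < d.M := by
  have h₁ := d.classes_lt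
  have h₂ : d.V ≤ d.W ^ p.k := by rw [← R_mul_V]; exact Nat.le_mul_of_pos_left _ d.R_pos
  unfold W at *; omega

/-- A crude bound that needs nothing about the quality of the moduli. It only ensures that the
number of queries fits into a word. -/
theorem length_queries_le' (hP : d.Good P) : (d.queries P).length ≤ d.n * (d.E P * d.E P) := by
  rw [← List.toFinset_card_of_nodup nodup_queries]
  refine (Finset.card_le_card (t := d.S ×ˢ Finset.range (d.E P) ×ˢ Finset.range (d.E P))
    fun t ht => ?_).trans (by simp [d.card_S])
  rw [List.mem_toFinset] at ht
  obtain ⟨h₁, h₂⟩ := query_lt hP ht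
  obtain ⟨c, e, f⟩ := t
  simp only [Finset.mem_product, Finset.mem_range]
  exact ⟨d.mem_S.2 (mem_queries.1 ht).1, h₁, h₂⟩

theorem length_queries_lt_M (hP : d.Good P) : (d.queries P).length < d.M := by
  refine d.lt_M_of_le ((length_queries_le' hP).trans ?_)
  have h := d.E_le_n P
  calc d.n * (d.E P * d.E P) ≤ d.n * (((p.B ^ p.g + 2) * d.n) * ((p.B ^ p.g + 2) * d.n)) := by gcongr
    _ = (p.B ^ p.g + 2) ^ 2 * d.n ^ 3 := by ring
    _ ≤ _ := by
      have := Nat.pow_le_pow_left (show p.B ^ p.g + 2 ≤ p.B ^ p.g + 3 by omega) 2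
      exact Nat.mul_le_mul_right _ (by omega)

theorem eval_sE {τ : State} (h : τ.reg 1 = d.W) : p.sE.eval τ = d.s := by simp [Params.sE, h, s]
theorem eval_VE {τ : State} (h : τ.reg 1 = d.W) : p.VE.eval τ = d.V := by simp [Params.VE, h, V]
theorem eval_YE {τ : State} (h : τ.reg 1 = d.W) : p.YE.eval τ = d.Y := by simp [Params.YE, h, Y]

theorem eval_packE {τ : State} (h : τ.reg 1 = d.W) (hP : d.Moduli P τ) (e : Expr) :
    (p.packE e).eval τ = d.pk P (e.eval τ) := by
  simp only [Params.packE, eval_horner, eval_reg, h, eval_mod, eval_read, eval_const]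
  exact horner_congr fun j hj => by rw [(hP j hj).1]

theorem eval_thirdE {τ : State} (h : τ.reg 1 = d.W) (hP : d.Moduli P τ) (c a : Expr) :
    (p.thirdE c a).eval τ = d.third P (c.eval τ) (a.eval τ) := by
  simp only [Params.thirdE, eval_horner, eval_reg, h, eval_modSub, eval_read, eval_const]
  exact horner_congr fun j hj => by rw [(hP j (by unfold Params.k; omega)).1]

theorem eval_valAE {τ : State} (h : τ.reg 1 = d.W) (hP : d.Moduli P τ) (a x : Expr) :
    (p.valAE a x).eval τ = d.valA P (a.eval τ) (x.eval τ) := by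
  simp only [Params.valAE, eval_add, eval_horner, eval_reg, h, eval_modSub, eval_read, eval_const,
    Params.digE, eval_mod, eval_div, eval_pow, eval_mul, eval_YE h, valA, dig]
  congr 1
  exact horner_congr fun j hj => by rw [(hP _ (by unfold Params.k; omega)).1]

theorem eval_valBE {τ : State} (h : τ.reg 1 = d.W) (hP : d.Moduli P τ) (a x : Expr) :
    (p.valBE a x).eval τ = d.valB P (a.eval τ) (x.eval τ) := by
  simp only [Params.valBE, eval_add, eval_horner, eval_reg, h, eval_modSub, eval_read, eval_const,
    Params.digE, eval_mod, eval_div, eval_pow, valB, dig]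
  congr 1
  exact horner_congr fun j hj => by rw [(hP _ (by unfold Params.k; omega)).1]

theorem Tables.elem_eq {σ : State} (h : d.Tables P σ) {e o : ℕ} (ho : o < d.sz P e) :
    σ.arr 14 (e * d.s + o) = d.elem P (e * d.s + o) := by
  obtain ⟨v, hv, hne, hs, -⟩ := d.exists_slot P ho
  rw [← hs, h.el v hv hne, elem_slot hv hne]

/-- The case distinctions of `setList` are multiplications by comparisons with values `0` and `1`.
Positions beyond the end of a list receive `0`, as the input format prescribes. -/
theorem eval_setE {τ : State} (hσ : d.Setup τ) (hP : d.Moduli P τ) (hT : d.Tables P τ) {i : ℕ}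
    (h9 : τ.reg 9 = i) :
    p.setE.eval τ = (d.setList P (i / d.s)).getD (i % d.s) 0 := by
  have h1 := hσ.r1
  have hch : p.chunkE.eval τ = i / d.s / d.Y % d.E P := by
    simp [Params.chunkE, eval_sE h1, eval_YE h1, h9, hT.r15]
  have hlt : i / d.s / d.Y % d.E P < d.E P := Nat.mod_lt _ (E_pos P)
  simp only [Params.setE, eval_mul, eval_add, eval_lt, eval_le, eval_read, eval_mod, eval_div,
    eval_reg, eval_valAE h1 hP, eval_valBE h1 hP, eval_sE h1, eval_YE h1, hch, h9, hT.r15, hT.sz,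
    setList]
  by_cases ho : i % d.s < d.sz P (i / d.s / d.Y % d.E P)
  · rw [if_pos ho, one_mul, List.getD_eq_getElem _ _ (by simpa using ho)]
    simp only [List.getElem_map, List.getElem_range, hT.elem_eq ho]
    split_ifs <;> omega
  · rw [if_neg ho, zero_mul, List.getD_eq_default _ _ (by simpa using ho)]

/-- The registers from `200` and the arrays from `100` on are the memory of the subroutine. The
table of elements has `2 * E * Y * s = O(W ^ (g + y))` cells, and each is computed in constant time.
-/
theorem setsProg_spec (p : Params) : ∃ c, ∀ (d : Input p) (P : ℕ → ℕ) (σ : State), d.Setup σ →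
    d.Moduli P σ → d.Tables P σ → (∀ i, σ.arr 100 i = 0) → (∀ i, σ.arr 101 i = 0) →
    Runs d.M p.setsProg σ (c * d.W ^ (p.g + p.y)) (fun τ =>
      (τ.reg 200 = p.C * d.W ^ p.g' ∧ τ.reg 201 = d.V ∧ τ.reg 202 = 2 * d.E P * d.Y ∧
        τ.reg 203 = d.s ∧
        (∀ i, τ.arr 100 i = if i < 2 * d.E P * d.Y then (d.setList P i).length else 0) ∧
        ∀ i, τ.arr 101 i = if i < 2 * d.E P * d.Y * d.s then
          (d.setList P (i / d.s)).getD (i % d.s) 0 else 0) ∧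
      Agree [9, 200, 201, 202, 203] [100, 101] σ τ) := by
  set e₁ : Expr := .const p.C * (Expr.reg 1).pow p.g' with he₁
  set e₃ : Expr := .const 2 * .reg 15 * p.YE with he₃
  set e₄ : Expr := .read 16 (.reg 9 / p.YE % .reg 15) with he₄
  set e₅ : Expr := .reg 202 * p.sE with he₅
  refine ⟨e₁.cost + 1 + (p.VE.cost + 1 + (e₃.cost + 1 + (p.sE.cost + 1 +
    ((e₄.cost + 11) * (2 * (p.B ^ p.g + 2) + 1) +
      (p.setE.cost + e₅.cost + 10) * (2 * (p.B ^ p.g + 2) + 1))))),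
    fun d P σ hσ hP hT z100 z101 => ?_⟩
  have hVM := d.V_lt_M
  have hNM := d.N_lt_M' P
  have hNsM := d.N_mul_s_lt_M P
  have hs := d.s_pos
  have hone := d.one_le_W_pow (p.g + p.y)
  have hNs : 2 * d.E P * d.Y * d.s + 1 ≤ (2 * (p.B ^ p.g + 2) + 1) * d.W ^ (p.g + p.y) := by
    have : 2 * d.E P * d.Y * d.s ≤ 2 * (p.B ^ p.g + 2) * d.W ^ (p.g + p.y) := by
      calc 2 * d.E P * d.Y * d.s = 2 * (d.E P * d.s) * d.Y := by ring
        _ ≤ 2 * ((p.B ^ p.g + 2) * d.W ^ p.g) * d.Y :=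
            Nat.mul_le_mul_right _ (Nat.mul_le_mul_left _ (d.E_mul_s_le P))
        _ = _ := by rw [Y, pow_add]; ring
    rw [add_mul, one_mul]; omega
  have hN : 2 * d.E P * d.Y + 1 ≤ (2 * (p.B ^ p.g + 2) + 1) * d.W ^ (p.g + p.y) :=
    le_trans (Nat.add_le_add_right (Nat.le_mul_of_pos_right _ hs) 1) hNs
  refine (Runs.agree (Q := fun τ => τ.reg 200 = p.C * d.W ^ p.g' ∧ τ.reg 201 = d.V ∧
    τ.reg 202 = 2 * d.E P * d.Y ∧ τ.reg 203 = d.s ∧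
        (∀ i, τ.arr 100 i = if i < 2 * d.E P * d.Y then (d.setList P i).length else 0) ∧
        ∀ i, τ.arr 101 i = if i < 2 * d.E P * d.Y * d.s then
          (d.setList P (i / d.s)).getD (i % d.s) 0 else 0) ?_ _ _ ?_ ?_)
  rotate_left
  · simp [Params.setsProg, Program.fill, Program.for, Program.modR]
  · simp [Params.setsProg, Program.fill, Program.for, Program.modA]
  have v₁ : e₁.eval σ = p.C * d.W ^ p.g' := by simp [he₁, hσ.r1]
  rw [add_mul]
  refine Runs.seq (R := fun τ => τ = σ.setReg 200 (p.C * d.W ^ p.g')) ((Runs.assign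
    (by rw [v₁]; exact d.call_lt) (by rw [v₁])).time (Nat.le_mul_of_pos_right _ hone))
    fun σ₁ hσ₁ => ?_
  have v₂ : p.VE.eval σ₁ = d.V := eval_VE (by simp [hσ₁, hσ.r1])
  rw [add_mul]
  refine Runs.seq (R := fun τ => τ = σ₁.setReg 201 d.V) ((Runs.assign
    (by rw [v₂]; omega) (by rw [v₂])).time (Nat.le_mul_of_pos_right _ hone))
    fun σ₂ hσ₂ => ?_
  have v₃ : e₃.eval σ₂ = 2 * d.E P * d.Y := by
    rw [he₃, eval_mul, eval_YE (d := d) (by simp [hσ₂, hσ₁, hσ.r1])]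
    simp [hσ₂, hσ₁, hT.r15]
  rw [add_mul]
  refine Runs.seq (R := fun τ => τ = σ₂.setReg 202 (2 * d.E P * d.Y)) ((Runs.assign
    (by rw [v₃]; exact hNM) (by rw [v₃])).time (Nat.le_mul_of_pos_right _ hone))
    fun σ₃ hσ₃ => ?_
  have v₄ : p.sE.eval σ₃ = d.s := eval_sE (by simp [hσ₃, hσ₂, hσ₁, hσ.r1])
  rw [add_mul]
  refine Runs.seq (R := fun τ => τ = σ₃.setReg 203 d.s) ((Runs.assign
    (by rw [v₄]; exact d.s_le_n.trans_lt d.n_lt) (by rw [v₄])).time (Nat.le_mul_of_pos_right _ hone))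
    fun σ₄ hσ₄ => ?_
  have ag₄ : Agree [200, 201, 202, 203] [] σ σ₄ := by
    refine ⟨fun x hx => ?_, fun x hx => by simp [hσ₄, hσ₃, hσ₂, hσ₁]⟩
    simp only [List.mem_cons, not_or] at hx
    simp [hσ₄, hσ₃, hσ₂, hσ₁, hx.1, hx.2.1, hx.2.2.1, hx.2.2.2.1]
  have q200 : σ₄.reg 200 = p.C * d.W ^ p.g' := by simp [hσ₄, hσ₃, hσ₂, hσ₁]
  have q201 : σ₄.reg 201 = d.V := by simp [hσ₄, hσ₃, hσ₂]
  have q202 : σ₄.reg 202 = 2 * d.E P * d.Y := by simp [hσ₄, hσ₃]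
  have q203 : σ₄.reg 203 = d.s := by simp [hσ₄]
  have S₄ := hσ.agree ag₄ (by simp) (by simp)
  have P₄ := hP.agree ag₄ (by simp)
  have T₄ := hT.agree ag₄ (by simp) (by simp)
  have w100 : ∀ i, σ₄.arr 100 i = 0 := by rw [ag₄.2 100 (by simp)]; exact z100
  have w101 : ∀ i, σ₄.arr 101 i = 0 := by rw [ag₄.2 101 (by simp)]; exact z101
  clear hσ₁ hσ₂ hσ₃ hσ₄ v₁ v₂ v₃ v₄ ag₄
  rw [add_mul]
  refine Runs.seq (((Runs.fill (fun i => (d.setList P i).length) (l := 0) (h := 2 * d.E P * d.Y)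
    rfl (by omega) hNM (fun j => by simp [State.filled, q202]) ?_).agree [9] [100]
    (by simp [Program.fill, Program.for, Program.modR])
    (by simp [Program.fill, Program.for, Program.modA])).time ?_)
    fun σ₅ ⟨f100, ag₅⟩ => ?_
  · intro i _ hi
    have hag := Agree.filled σ₄ 100 9 0 (fun i => (d.setList P i).length) i
    constructor
    · rw [eval_read, eval_mod, eval_div, eval_YE ((S₄.agree hag (by simp) (by simp)).r1),
        eval_reg, eval_reg, (T₄.agree hag (by simp) (by simp)).sz,
        (T₄.agree hag (by simp) (by simp)).r15]
      simp [State.filled, setList]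
    · rw [setList, List.length_map, List.length_range]
      exact (d.sz_le P _).trans_lt (d.s_le_n.trans_lt d.n_lt)
  · rw [mul_assoc (e₄.cost + 11)]
    exact Nat.mul_le_mul (by simp [he₄, Expr.cost]) hN
  have S₅ := S₄.agree ag₅ (by simp) (by simp)
  have P₅ := P₄.agree ag₅ (by simp)
  have T₅ := T₄.agree ag₅ (by simp) (by simp)
  refine (((Runs.fill (fun i => (d.setList P (i / d.s)).getD (i % d.s) 0) (l := 0)
    (h := 2 * d.E P * d.Y * d.s) rfl (by omega) hNsM (fun j => ?_) ?_).agree [9] [101]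
    (by simp [Program.fill, Program.for, Program.modR])
    (by simp [Program.fill, Program.for, Program.modA])).mono ?_ ?_)
  · have hag := Agree.filled σ₅ 101 9 0 (fun i => (d.setList P (i / d.s)).getD (i % d.s) 0) j
    rw [eval_mul, eval_sE ((S₅.agree hag (by simp) (by simp)).r1), eval_reg,
      hag.1 202 (by simp), ag₅.1 202 (by simp), q202]
  · intro i _ hi
    have hag := Agree.filled σ₅ 101 9 0 (fun i => (d.setList P (i / d.s)).getD (i % d.s) 0) i
    refine ⟨eval_setE (S₅.agree hag (by simp) (by simp)) (P₅.agree hag (by simp))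
      (T₅.agree hag (by simp) (by simp)) (by simp [State.filled]), ?_⟩
    rcases lt_or_ge (i % d.s) (d.setList P (i / d.s)).length with h | h
    · rw [List.getD_eq_getElem _ _ h]
      have := ((inst (d := d) hP.good).mem_S ⟨i / d.s, (Nat.div_lt_iff_lt_mul hs).2 hi⟩ _
        (List.getElem_mem h)).2
      exact this.trans_lt (by change d.V < d.M; omega)
    · rw [List.getD_eq_default _ _ h]; omega
  · rw [mul_assoc (p.setE.cost + e₅.cost + 10)]
    exact Nat.mul_le_mul (by simp [he₅, Expr.cost]; omega) hNs
  · rintro τ ⟨f101, ag₆⟩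
    refine ⟨?_, ?_, ?_, ?_, fun i => ?_, fun i => ?_⟩
    · rw [ag₆.1 200 (by simp), ag₅.1 200 (by simp), q200]
    · rw [ag₆.1 201 (by simp), ag₅.1 201 (by simp), q201]
    · rw [ag₆.1 202 (by simp), ag₅.1 202 (by simp), q202]
    · rw [ag₆.1 203 (by simp), ag₅.1 203 (by simp), q203]
    · rw [ag₆.2 100 (by simp), f100]
      simp [w100]
    · rw [f101, ag₅.2 101 (by simp)]
      simp [w101]

end Input

/-! ### Writing down the queries -/

namespace Params

variable (p : Params)

/-- Write down one query. -/
def emitProg : Program :=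
  .seq (.write 102 (.reg 204) (.reg 18 * p.YE + .reg 17 / p.YE % p.YE))
    (.seq (.write 103 (.reg 204) ((.reg 15 + .reg 20) * p.YE + .reg 17 % p.YE))
      (.seq (.write 17 (.reg 204) (.reg 16)) (.seq (.write 18 (.reg 204) (.reg 18))
        (.seq (.write 19 (.reg 204) (.reg 20)) (.assign 204 (.reg 204 + .const 1))))))

/-- Write down the queries for an element and a chunk. -/
def chunkQueriesProg : Program :=
  .ite (.read 16 (.reg 18))
    (.seq (.assign 19 (p.thirdE (.reg 16) (.read 14 (.reg 18 * p.sE))))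
      (.for 20 (.read 15 (.reg 19)) (.read 15 (.reg 19 + .const 1)) p.emitProg)) .skip

/-- Write down the queries for an element. -/
def elemQueriesProg : Program :=
  .seq (.assign 16 (.read 0 (.reg 14))) (.seq (.assign 17 (p.packE (.reg 16)))
    (.ite (.op .eq (.read 9 (.reg 17 * .reg 0)) (.reg 16))
      (.for 18 (.const 0) (.reg 15) p.chunkQueriesProg) .skip))

/-- Write down the queries. -/
def queriesProg : Program := .for 14 (.const 0) (.reg 0) p.elemQueriesProg

end Params

namespace Input

variable {p : Params}

/-- The queries have been written down. -/
structure Log (d : Input p) (P : ℕ → ℕ) (L : List (ℕ × ℕ × ℕ)) (σ : State) : Prop where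
  r204 : σ.reg 204 = L.length
  a17 : σ.arr 17 = fun i => (L.map fun t => t.1).getD i 0
  a18 : σ.arr 18 = fun i => (L.map fun t => t.2.1).getD i 0
  a19 : σ.arr 19 = fun i => (L.map fun t => t.2.2).getD i 0
  a102 : σ.arr 102 = fun i => (L.map (d.fstIdx P)).getD i 0
  a103 : σ.arr 103 = fun i => (L.map (d.sndIdx P)).getD i 0

theorem Log.agree {d : Input p} {P : ℕ → ℕ} {L : List (ℕ × ℕ × ℕ)} {σ τ : State}
    (h : d.Log P L σ) {R X : List ℕ} (ha : Agree R X σ τ) (hR : 204 ∉ R)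
    (hX : ∀ x ∈ X, x ∉ [17, 18, 19, 102, 103]) : d.Log P L τ := by
  have hr' : ∀ x, x ∈ [17, 18, 19, 102, 103] → τ.arr x = σ.arr x :=
    fun x hx => ha.2 x fun h => hX x h hx
  constructor
  · rw [ha.1 _ hR, h.r204]
  · rw [hr' 17 (by simp), h.a17]
  · rw [hr' 18 (by simp), h.a18]
  · rw [hr' 19 (by simp), h.a19]
  · rw [hr' 102 (by simp), h.a102]
  · rw [hr' 103 (by simp), h.a103]

/-- The tables for writing down the queries. -/
structure Ready (d : Input p) (P : ℕ → ℕ) (σ : State) : Prop where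
  setup : d.Setup σ
  moduli : d.Moduli P σ
  classes : d.Classes P σ
  tables : d.Tables P σ

theorem Ready.agree {d : Input p} {P : ℕ → ℕ} {σ τ : State} (h : d.Ready P σ) {R X : List ℕ}
    (ha : Agree R X σ τ) (hR : ∀ x ∈ R, x ∉ [0, 1, 2, 3, 10, 11, 15])
    (hX : ∀ x ∈ X, x ∉ [0, 1, 2, 3, 4, 5, 8, 9, 13, 14, 15, 16]) : d.Ready P τ where
  setup := h.setup.agree ha
    (fun x hx h' => hR x hx (by simp only [List.mem_cons, List.not_mem_nil, or_false] at h' ⊢; omega))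
    (fun x hx h' => hX x hx (by simp only [List.mem_cons, List.not_mem_nil, or_false] at h' ⊢; omega))
  moduli := h.moduli.agree ha fun h' => hX 1 h' (by simp)
  classes := h.classes.agree ha
    (fun x hx h' => hX x hx (by simp only [List.mem_cons, List.not_mem_nil, or_false] at h' ⊢; omega))
  tables := h.tables.agree ha (fun h' => hR 15 h' (by simp))
    (fun x hx h' => hX x hx (by simp only [List.mem_cons, List.not_mem_nil, or_false] at h' ⊢; omega))

/-- A query is written twice: as a pair of set numbers for the subroutine, and as a triple `(c, e,
f)` in arrays out of its reach, for the verification. Register `204` counts the queries and is the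
subroutine's register for their number. -/
theorem emitProg_spec (p : Params) : ∃ K, ∀ (d : Input p) (P : ℕ → ℕ) (L : List (ℕ × ℕ × ℕ))
    (τ : State) (c e f : ℕ), d.Ready P τ → d.Log P L τ → (c, e, f) ∈ d.queries P →
    L.length < (d.queries P).length → τ.reg 16 = c → τ.reg 17 = d.pk P c → τ.reg 18 = e →
    τ.reg 20 = f → Runs d.M p.emitProg τ K (fun υ => d.Log P (L ++ [(c, e, f)]) υ ∧
      Agree [204] [17, 18, 19, 102, 103] τ υ) := by
  set e₁ : Expr := .reg 18 * p.YE + .reg 17 / p.YE % p.YE with he₁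
  set e₂ : Expr := (.reg 15 + .reg 20) * p.YE + .reg 17 % p.YE with he₂
  refine ⟨_, fun d P L τ c e f hR hL hq hlt r16 r17 r18 r20 =>
    Runs.agree (T := (1 + e₁.cost + 1) + ((1 + e₂.cost + 1) + (3 + (3 + (3 + 4))))) ?_ _ _
      (by simp [Params.emitProg, Program.modR]) (by simp [Params.emitProg, Program.modA])⟩
  have hP := hR.moduli.good
  have h1 := hR.setup.r1
  obtain ⟨hi₁, hi₂⟩ := idx_lt hP hq
  have hN := d.N_lt_M' P
  obtain ⟨hee, hff⟩ := query_lt hP hq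
  simp only at hee hff
  have hE := d.E_lt_M P
  have hc := (mem_queries.1 hq).1
  have hqM := d.length_queries_lt_M hP
  have v₁ : e₁.eval τ = d.fstIdx P (c, e, f) := by
    simp [he₁, eval_YE h1, r18, r17, fstIdx]
  refine Runs.seq (R := fun υ => υ = τ.setArr 102 L.length (d.fstIdx P (c, e, f)))
    (Runs.write (by rw [v₁]; omega) (by rw [v₁, eval_reg, hL.r204])) fun υ₁ hυ₁ => ?_
  have v₂ : e₂.eval υ₁ = d.sndIdx P (c, e, f) := by
    rw [he₂, eval_add, eval_mul, eval_mod, eval_YE (d := d) (by simp [hυ₁, h1])]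
    simp [hυ₁, r17, r20, hR.tables.r15, sndIdx]
  refine Runs.seq (R := fun υ => υ = υ₁.setArr 103 L.length (d.sndIdx P (c, e, f)))
    (Runs.write (by rw [v₂]; omega) (by rw [v₂, eval_reg, hυ₁, setArr_reg, hL.r204]))
    fun υ₂ hυ₂ => ?_
  refine Runs.seq (R := fun υ => υ = υ₂.setArr 17 L.length c)
    ((Runs.write (by simp [hυ₁, hυ₂, r16]; exact d.elem_lt' hc)
      (by simp [hυ₁, hυ₂, r16, hL.r204])).time le_rfl) fun υ₃ hυ₃ => ?_
  refine Runs.seq (R := fun υ => υ = υ₃.setArr 18 L.length e)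
    ((Runs.write (by simp [hυ₁, hυ₂, hυ₃, r18]; omega)
      (by simp [hυ₁, hυ₂, hυ₃, r18, hL.r204])).time le_rfl) fun υ₄ hυ₄ => ?_
  refine Runs.seq (R := fun υ => υ = υ₄.setArr 19 L.length f)
    ((Runs.write (by simp [hυ₁, hυ₂, hυ₃, hυ₄, r20]; omega)
      (by simp [hυ₁, hυ₂, hυ₃, hυ₄, r20, hL.r204])).time le_rfl) fun υ₅ hυ₅ => ?_
  refine (Runs.assign (by simp [hυ₁, hυ₂, hυ₃, hυ₄, hυ₅, hL.r204]; omega) ?_).time le_rfl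
  constructor
  · simp [hυ₁, hυ₂, hυ₃, hυ₄, hυ₅, hL.r204]
  · rw [List.map_append, List.map_singleton, List.getD_append_singleton]
    simp [hυ₁, hυ₂, hυ₃, hυ₄, hυ₅, hL.a17]
  · rw [List.map_append, List.map_singleton, List.getD_append_singleton]
    simp [hυ₁, hυ₂, hυ₃, hυ₄, hυ₅, hL.a18]
  · rw [List.map_append, List.map_singleton, List.getD_append_singleton]
    simp [hυ₁, hυ₂, hυ₃, hυ₄, hυ₅, hL.a19]
  · rw [List.map_append, List.map_singleton, List.getD_append_singleton]
    simp [hυ₁, hυ₂, hυ₃, hυ₄, hυ₅, hL.a102]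
  · rw [List.map_append, List.map_singleton, List.getD_append_singleton]
    simp [hυ₁, hυ₂, hυ₃, hυ₄, hυ₅, hL.a103]

/-- The queries for an element and a chunk. -/
noncomputable def chunkQueries (d : Input p) (P : ℕ → ℕ) (c e : ℕ) : List (ℕ × ℕ × ℕ) :=
  if d.sz P e = 0 then [] else
    (List.range' (d.cs P (d.third P c (d.elem P (e * d.s))))
      (d.cs P (d.third P c (d.elem P (e * d.s)) + 1) -
        d.cs P (d.third P c (d.elem P (e * d.s))))).map fun f => (c, e, f)

/-- The queries for an element. -/
noncomputable def elemQueries (d : Input p) (P : ℕ → ℕ) (c : ℕ) : List (ℕ × ℕ × ℕ) :=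
  if d.rep P (d.pk P c) = c then (List.range (d.E P)).flatMap (d.chunkQueries P c) else []

/-- The program runs through all elements and skips those that are not representatives. Filtering
first or producing the empty list is the same. -/
theorem queries_eq (d : Input p) (P : ℕ → ℕ) : d.queries P = d.A.flatMap (d.elemQueries P) := by
  unfold queries
  induction d.A with
  | nil => rfl
  | cons a A ih =>
    rw [List.filter_cons, List.flatMap_cons, ← ih, elemQueries]
    split_ifs with h h' h'
    · rfl
    · simp at h; exact absurd h h'
    · simp at h; exact absurd h' h
    · rfl

/-- The time is a constant plus a constant for each query produced. The bound on the length of the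
log says that the queries to come still fit into the complete list, which keeps the counter small.
-/
theorem chunkQueriesProg_spec (p : Params) : ∃ K, ∀ (d : Input p) (P : ℕ → ℕ)
    (L : List (ℕ × ℕ × ℕ)) (τ : State) (c e : ℕ), d.Ready P τ → d.Log P L τ → c ∈ d.A →
    d.rep P (d.pk P c) = c → e < d.E P →
    L.length + (d.chunkQueries P c e).length ≤ (d.queries P).length →
    τ.reg 16 = c → τ.reg 17 = d.pk P c → τ.reg 18 = e →
    Runs d.M p.chunkQueriesProg τ (K + K * (d.chunkQueries P c e).length) (fun υ =>
      d.Log P (L ++ d.chunkQueries P c e) υ ∧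
      Agree [19, 20, 204] [17, 18, 19, 102, 103] τ υ) := by
  obtain ⟨K, hK⟩ := emitProg_spec p
  set e₁ := p.thirdE (.reg 16) (.read 14 (.reg 18 * p.sE)) with he₁
  refine ⟨K + e₁.cost + 40, fun d P L τ c e hR hL hc hrep he hlen r16 r17 r18 =>
    Runs.agree ?_ _ _
      (by simp [Params.chunkQueriesProg, Params.emitProg, Program.for, Program.modR])
      (by simp [Params.chunkQueriesProg, Params.emitProg, Program.for, Program.modA])⟩
  have hP := hR.moduli.good
  have h1 := hR.setup.r1
  have e16 : (Expr.read 16 (.reg 18)).eval τ = d.sz P e := by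
    rw [eval_read, eval_reg, r18, hR.tables.sz]
  set Lc := (d.chunkQueries P c e).length with hLc
  refine (Runs.ite (T₁ := (e₁.cost + 1) + (K + 6 + 7) * (Lc + 1)) (T₂ := 1)
    (fun hne => ?_) (fun heq => ?_)).time ?_
  · rw [e16] at hne
    have v₁ : e₁.eval τ = d.third P c (d.elem P (e * d.s)) := by
      rw [he₁, eval_thirdE h1 hR.moduli, eval_reg, r16, eval_read, eval_mul, eval_reg, r18,
        eval_sE h1]
      have := hR.tables.elem_eq (Nat.pos_of_ne_zero hne)
      rw [add_zero] at this
      rw [this]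
    set j := d.third P c (d.elem P (e * d.s)) with hj
    have hjR : j < d.R := third_lt hP _ _
    have hcs : d.cs P j < d.cs P (j + 1) := d.cs_lt_succ P j
    have hcE : d.cs P (j + 1) ≤ d.E P := (d.cs_strictMono P).monotone hjR
    have hEM := d.E_lt_M P
    have hRM : d.R < d.M := d.R_le_n.trans_lt d.n_lt
    have hQ : d.chunkQueries P c e = (List.range' (d.cs P j) (d.cs P (j + 1) - d.cs P j)).map
        fun f => (c, e, f) := by rw [chunkQueries, if_neg hne]
    have hLc' : Lc = d.cs P (j + 1) - d.cs P j := by rw [hLc, hQ]; simp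
    refine Runs.seq (R := fun υ => υ = τ.setReg 19 j)
      (Runs.assign (by rw [v₁]; omega) (by rw [v₁])) fun υ hυ => ?_
    have agυ : Agree [19] [] τ υ := by
      refine ⟨fun x hx => ?_, fun x hx => by rw [hυ]; rfl⟩
      simp only [List.mem_singleton] at hx
      simp [hυ, hx]
    have hRυ := hR.agree agυ (by simp) (by simp)
    refine (Runs.for_potential (fun f φ => φ.reg 20 = f ∧ Agree [19, 20, 204] [17, 18, 19, 102, 103]
      τ φ ∧ φ.reg 19 = j ∧ d.Log P (L ++ (List.range' (d.cs P j) (f - d.cs P j)).map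
        fun f => (c, e, f)) φ) K 0 (fun f => 0) (l := d.cs P j) (h := d.cs P (j + 1)) ?_ hcs.le
      (by omega) (fun _ _ _ => le_rfl) ?_ ?_ ?_).mono ?_ ?_
    · rw [eval_read, eval_reg, hυ]
      simp [hR.tables.cs j hjR.le]
    · refine ⟨by simp, ⟨fun x hx => ?_, fun x hx => by rw [hυ]; rfl⟩, by simp [hυ], ?_⟩
      · simp only [List.mem_cons, List.not_mem_nil, or_false, not_or] at hx
        simp [hυ, hx.1, hx.2.1]
      · rw [Nat.sub_self]
        simp only [List.range'_zero, List.map_nil, List.append_nil]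
        refine hL.agree (R := [19, 20]) (X := []) ⟨fun x hx => ?_, fun x hx => by rw [hυ]; rfl⟩
          (by simp) (by simp)
        simp only [List.mem_cons, List.not_mem_nil, or_false, not_or] at hx
        simp [hυ, hx.1, hx.2]
    · rintro f φ ⟨h₁, h₂, h₃, -⟩
      refine ⟨h₁, ?_⟩
      rw [eval_read, eval_add, eval_reg, eval_const, h₃, h₂.2 15 (by simp),
        hR.tables.cs (j + 1) hjR]
    · rintro f φ hf₁ hf₂ ⟨h20, ag, h19, hLog⟩
      refine ((hK d P _ φ c e f (hR.agree ag (by simp) (by simp)) hLog (mem_queries.2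
        ⟨hc, hrep, he, hne, hf₁, hf₂⟩) ?_ ?_ ?_ ?_ h20).mono (by simp) ?_)
      · rw [List.length_append, List.length_map, List.length_range']
        omega
      · rw [ag.1 16 (by simp), r16]
      · rw [ag.1 17 (by simp), r17]
      · rw [ag.1 18 (by simp), r18]
      · rintro ψ ⟨hψ, agψ⟩
        have agτ := ag.trans (agψ.mono (R' := [19, 20, 204]) (by simp) (List.Subset.refl _))
        refine ⟨by rw [agψ.1 20 (by simp), h20], by simp, ⟨fun x hx => ?_, agτ.2⟩, ?_, ?_⟩
        · rw [← agτ.1 x hx]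
          simp only [List.mem_cons, List.not_mem_nil, or_false, not_or] at hx
          simp [hx.2.1]
        · simp [agψ.1 19 (by simp), h19]
        · refine Log.agree (R := [20]) (X := []) (σ := ψ) ?_ ⟨fun x hx => ?_, fun x _ => rfl⟩
            (by simp) (by simp)
          · rw [show f + 1 - d.cs P j = (f - d.cs P j) + 1 by omega, List.range'_concat,
              List.map_append, ← List.append_assoc]
            simpa [Nat.add_sub_cancel' hf₁] using hψ
          · simp only [List.mem_singleton] at hx
            simp [hx]
    · rw [zero_mul, add_zero, hLc']
      exact Nat.mul_le_mul_right _ (by simp [Expr.cost])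
    · rintro φ ⟨-, -, -, h⟩
      rw [hQ]; exact h
  · rw [e16] at heq
    refine Runs.skip ?_
    rw [chunkQueries, if_pos heq, List.append_nil]
    exact hL
  · simp only [Expr.cost]
    have : (K + 6 + 7) * (Lc + 1) = K + 13 + (K + 13) * Lc := by ring
    have : (K + 13) * Lc ≤ (K + e₁.cost + 40) * Lc := Nat.mul_le_mul_right _ (by omega)
    rw [max_eq_left (by omega)]
    omega

theorem length_chunkQueries_le (d : Input p) (P : ℕ → ℕ) {c e : ℕ} (he : e < d.E P)
    (hc : d.rep P (d.pk P c) = c) : ((List.range e).flatMap (d.chunkQueries P c)).length +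
      (d.chunkQueries P c e).length ≤ (d.elemQueries P c).length := by
  obtain ⟨m, hm⟩ : ∃ m, d.E P = (e + 1) + m := ⟨d.E P - (e + 1), by omega⟩
  rw [elemQueries, if_pos hc, hm, List.range_add, List.range_succ]
  simp only [List.flatMap_append, List.length_append, List.flatMap_singleton]
  omega

theorem elemQueriesProg_spec (p : Params) : ∃ K, ∀ (d : Input p) (P : ℕ → ℕ)
    (L : List (ℕ × ℕ × ℕ)) (τ : State) (t c : ℕ), d.Ready P τ → d.Log P L τ → c ∈ d.A →
    L.length + (d.elemQueries P c).length ≤ (d.queries P).length →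
    τ.reg 14 = t → τ.arr 0 t = c →
    Runs d.M p.elemQueriesProg τ (K * d.E P + K * (d.elemQueries P c).length) (fun υ =>
      d.Log P (L ++ d.elemQueries P c) υ ∧
      Agree [16, 17, 18, 19, 20, 204] [17, 18, 19, 102, 103] τ υ) := by
  obtain ⟨K, hK⟩ := chunkQueriesProg_spec p
  set e₁ := p.packE (.reg 16) with he₁
  refine ⟨2 * K + e₁.cost + 60, fun d P L τ t c hR hL hc hlen r14 a0 =>
    Runs.agree ?_ _ _
      (by simp [Params.elemQueriesProg, Params.chunkQueriesProg, Params.emitProg, Program.for,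
        Program.modR])
      (by simp [Params.elemQueriesProg, Params.chunkQueriesProg, Params.emitProg, Program.for,
        Program.modA])⟩
  have hP := hR.moduli.good
  have hE := E_pos (d := d) P
  have hEM := d.E_lt_M P
  have hcM := d.elem_lt' hc
  have hpk := pk_lt d hP c
  have hpkM : d.pk P c < d.M := by have := d.classes_lt; unfold W at *; omega
  set Lc := (d.elemQueries P c).length with hLc
  refine (Runs.seq (R := fun υ => υ = τ.setReg 16 c) (T₁ := 3) (T₂ := (e₁.cost + 1) + ((6 + 1 +
    max ((K + 9) * (d.E P + 1) + K * Lc) 1)))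
    (Runs.assign (by simp [r14, a0]; exact hcM) (by simp [r14, a0])) fun υ hυ => ?_).time ?_
  swap
  · rw [max_eq_left (by nlinarith)]
    have h₁ : (K + 9) * (d.E P + 1) ≤ (2 * K + 18) * d.E P := by nlinarith
    have h₂ : K * Lc ≤ (2 * K + e₁.cost + 60) * Lc := Nat.mul_le_mul_right _ (by omega)
    have h₃ : (2 * K + e₁.cost + 60) * d.E P = (2 * K + 18) * d.E P + (e₁.cost + 42) * d.E P := by
      ring
    have h₄ : e₁.cost + 42 ≤ (e₁.cost + 42) * d.E P := Nat.le_mul_of_pos_right _ hE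
    omega
  have agυ : Agree [16] [] τ υ := by
    refine ⟨fun x hx => ?_, fun x hx => by rw [hυ]; rfl⟩
    simp only [List.mem_singleton] at hx
    simp [hυ, hx]
  have hRυ := hR.agree agυ (by simp) (by simp)
  have q16 : υ.reg 16 = c := by simp [hυ]
  have v₁ : e₁.eval υ = d.pk P c := by
    rw [he₁, eval_packE hRυ.setup.r1 hRυ.moduli, eval_reg, q16]
  refine Runs.seq (R := fun φ => φ = υ.setReg 17 (d.pk P c))
    (Runs.assign (by rw [v₁]; exact hpkM) (by rw [v₁])) fun φ hφ => ?_
  have agφ : Agree [16, 17] [] τ φ := by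
    refine (agυ.mono (by simp) (by simp)).trans ⟨fun x hx => ?_, fun x hx => by rw [hφ]; rfl⟩
    simp only [List.mem_cons, List.not_mem_nil, or_false, not_or] at hx
    simp [hφ, hx.2]
  have hRφ := hR.agree agφ (by simp) (by simp)
  have s16 : φ.reg 16 = c := by simp [hφ, q16]
  have s17 : φ.reg 17 = d.pk P c := by simp [hφ]
  have hrep : (Expr.read 9 (.reg 17 * .reg 0)).eval φ = d.rep P (d.pk P c) := by
    rw [eval_read, eval_mul, eval_reg, eval_reg, s17, hRφ.setup.r0, ← add_zero (_ * _),
      hRφ.classes.2 _ 0 (nonempty_of_mem _ P hc), rep]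
  refine Runs.ite (fun hne => ?_) (fun heq => ?_)
  · have hcr : d.rep P (d.pk P c) = c := by
      by_contra hcon
      rw [eval_eq, hrep, eval_reg, s16, if_neg hcon] at hne
      exact hne rfl
    have hQ : d.elemQueries P c = (List.range (d.E P)).flatMap (d.chunkQueries P c) := by
      rw [elemQueries, if_pos hcr]
    refine (Runs.for_potential (fun e ψ => ψ.reg 18 = e ∧
      Agree [16, 17, 18, 19, 20, 204] [17, 18, 19, 102, 103] τ ψ ∧ ψ.reg 16 = c ∧
      ψ.reg 17 = d.pk P c ∧ d.Log P (L ++ (List.range e).flatMap (d.chunkQueries P c)) ψ) K K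
      (fun e => ((List.range e).flatMap (d.chunkQueries P c)).length) (l := 0) (h := d.E P) rfl
      hE.le (by omega) ?_ ?_ ?_ ?_).mono ?_ ?_
    · intro e _ _
      simp [List.range_succ]
    · refine ⟨by simp, ⟨fun x hx => ?_, fun x hx => by rw [setReg_arr, agφ.2 x (by simp)]⟩,
        by simp [s16], by simp [s17], ?_⟩
      · simp only [List.mem_cons, List.not_mem_nil, or_false, not_or] at hx
        simp [hx.2.2.1, agφ.1 x (by simp [hx.1, hx.2.1])]
      · simp only [List.range_zero, List.flatMap_nil, List.append_nil]
        refine hL.agree (R := [16, 17, 18]) (X := []) ⟨fun x hx => ?_, fun x hx => by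
          rw [setReg_arr, agφ.2 x (by simp)]⟩ (by simp) (by simp)
        simp only [List.mem_cons, List.not_mem_nil, or_false, not_or] at hx
        simp [hx.2.2, agφ.1 x (by simp [hx.1, hx.2.1])]
    · rintro e ψ ⟨h₁, h₂, -⟩
      refine ⟨h₁, ?_⟩
      rw [eval_reg, h₂.1 15 (by simp), hR.tables.r15]
    · rintro e ψ - he ⟨h18, ag, h16, h17, hLog⟩
      have hle := length_chunkQueries_le d P he hcr
      refine ((hK d P _ ψ c e (hR.agree ag (by simp) (by simp)) hLog hc hcr he ?_ h16 h17
        h18).mono ?_ ?_)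
      · rw [List.length_append]; omega
      · refine Nat.add_le_add_left (Nat.mul_le_mul_left _ ?_) _
        simp [List.range_succ]
      · rintro χ ⟨hχ, agχ⟩
        have agτ := ag.trans (agχ.mono (R' := [16, 17, 18, 19, 20, 204]) (by simp)
          (List.Subset.refl _))
        refine ⟨by rw [agχ.1 18 (by simp), h18], by simp, ⟨fun x hx => ?_, agτ.2⟩, ?_, ?_, ?_⟩
        · rw [← agτ.1 x hx]
          simp only [List.mem_cons, List.not_mem_nil, or_false, not_or] at hx
          simp [hx.2.2.1]
        · simp [agχ.1 16 (by simp), h16]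
        · simp [agχ.1 17 (by simp), h17]
        · refine Log.agree (R := [18]) (X := []) (σ := χ) ?_ ⟨fun x hx => ?_, fun x _ => rfl⟩
            (by simp) (by simp)
          · rw [List.range_succ, List.flatMap_append, ← List.append_assoc, List.flatMap_singleton]
            exact hχ
          · simp only [List.mem_singleton] at hx
            simp [hx]
    · simp only [List.range_zero, List.flatMap_nil, List.length_nil, Nat.sub_zero]
      rw [← hQ]
      exact Nat.add_le_add_right (Nat.mul_le_mul_right _ (by simp [Expr.cost])) _
    · rintro ψ ⟨-, -, -, -, h⟩
      rw [hQ]; exact h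
  · have hcr : d.rep P (d.pk P c) ≠ c := by
      intro hcon
      rw [eval_eq, hrep, eval_reg, s16, if_pos hcon] at heq
      exact one_ne_zero heq
    refine Runs.skip ?_
    rw [elemQueries, if_neg hcr, List.append_nil]
    exact hL.agree agφ (by simp) (by simp)

/-- Each pair of an element and a chunk costs constant time even if it yields no query, hence the
term `n * E`. Otherwise the cost is proportional to the output, with the length of the log as
potential. -/
theorem queriesProg_spec (p : Params) : ∃ K, ∀ (d : Input p) (P : ℕ → ℕ) (σ : State),
    d.Ready P σ → d.Log P [] σ → Runs d.M p.queriesProg σ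
      (K * (d.n * d.E P) + K * (d.queries P).length) (fun τ => d.Log P (d.queries P) τ ∧
        Agree [14, 16, 17, 18, 19, 20, 204] [17, 18, 19, 102, 103] σ τ) := by
  obtain ⟨K, hK⟩ := elemQueriesProg_spec p
  refine ⟨2 * K + 20, fun d P σ hR hL => Runs.agree ?_ _ _
      (by simp [Params.queriesProg, Params.elemQueriesProg, Params.chunkQueriesProg,
        Params.emitProg, Program.for, Program.modR])
      (by simp [Params.queriesProg, Params.elemQueriesProg, Params.chunkQueriesProg,
        Params.emitProg, Program.for, Program.modA])⟩
  have hstep : ∀ t, t < d.A.length → (d.A.take (t + 1)).flatMap (d.elemQueries P) =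
      (d.A.take t).flatMap (d.elemQueries P) ++ d.elemQueries P (d.A.getD t 0) := by
    intro t ht
    have : d.A.take (t + 1) = d.A.take t ++ [d.A[t]] := by simp
    rw [this, List.flatMap_append, List.flatMap_singleton, List.getD_eq_getElem _ _ ht]
  have hle : ∀ t, ((d.A.take t).flatMap (d.elemQueries P)).length ≤ (d.queries P).length := by
    intro t
    conv_rhs => rw [queries_eq, ← List.take_append_drop t d.A, List.flatMap_append,
      List.length_append]
    omega
  have hn := d.n_pos
  have hE := E_pos (d := d) P
  refine (Runs.for_potential (fun t τ => τ.reg 14 = t ∧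
      Agree [14, 16, 17, 18, 19, 20, 204] [17, 18, 19, 102, 103] σ τ ∧
      d.Log P ((d.A.take t).flatMap (d.elemQueries P)) τ) (K * d.E P) K
      (fun t => ((d.A.take t).flatMap (d.elemQueries P)).length) (l := 0) (h := d.n) rfl
      (Nat.zero_le _) d.n_lt ?_ ?_ ?_ ?_).mono ?_ ?_
  · intro t _ ht
    rw [hstep t ht, List.length_append]; omega
  · refine ⟨by simp, ⟨fun x hx => ?_, fun x hx => rfl⟩, ?_⟩
    · simp only [List.mem_cons, not_or] at hx
      simp [hx.1]
    · refine Log.agree (R := [14]) (X := []) (σ := σ) (by simpa using hL) ⟨fun x hx => ?_,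
        fun x _ => rfl⟩ (by simp) (by simp)
      simp only [List.mem_singleton] at hx
      simp [hx]
  · rintro t τ ⟨h₁, h₂, -⟩
    refine ⟨h₁, ?_⟩
    rw [eval_reg, h₂.1 0 (by simp), hR.setup.r0]
  · rintro t τ - ht ⟨h14, ag, hLog⟩
    have hst := hstep t ht
    have hl := hle (t + 1)
    rw [hst, List.length_append] at hl
    have hmem : d.A.getD t 0 ∈ d.A := by
      rw [List.getD_eq_getElem _ _ ht]; exact List.getElem_mem _
    have hRτ := hR.agree ag (by simp) (by simp)
    refine ((hK d P _ τ t (d.A.getD t 0) hRτ hLog hmem hl h14 (hRτ.setup.a0 t)).mono ?_ ?_)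
    · refine Nat.add_le_add_left (Nat.mul_le_mul_left _ ?_) _
      simp only [hst, List.length_append]
      omega
    · rintro υ ⟨hυ, agυ⟩
      have agσ := ag.trans (agυ.mono (R' := [14, 16, 17, 18, 19, 20, 204]) (by simp)
        (List.Subset.refl _))
      refine ⟨by rw [agυ.1 14 (by simp), h14], by simp, ⟨fun x hx => ?_, agσ.2⟩, ?_⟩
      · rw [← agσ.1 x hx]
        simp only [List.mem_cons, not_or] at hx
        simp [hx.1]
      · rw [hst]
        refine hυ.agree (R := [14]) (X := []) ⟨fun x hx => ?_, fun x _ => rfl⟩ (by simp) (by simp)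
        simp only [List.mem_singleton] at hx
        simp [hx]
  · have e₁ : (d.A.take d.n).flatMap (d.elemQueries P) = d.queries P := by
      rw [queries_eq, n, List.take_length]
    simp only [e₁, List.take_zero, List.flatMap_nil, List.length_nil, Nat.sub_zero, Expr.cost]
    refine Nat.add_le_add ?_ (Nat.mul_le_mul_right _ (by omega))
    have h₁ : K * d.E P + 1 + 1 + 7 ≤ (K + 9) * d.E P := by nlinarith
    calc _ ≤ ((K + 9) * d.E P) * (2 * d.n) := Nat.mul_le_mul h₁ (by omega)
      _ = (2 * K + 18) * (d.n * d.E P) := by ring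
      _ ≤ _ := Nat.mul_le_mul_right _ (by omega)
  · rintro τ ⟨-, -, h⟩
    have e₁ : (d.A.take d.n).flatMap (d.elemQueries P) = d.queries P := by
      rw [queries_eq, n, List.take_length]
    rw [e₁] at h
    exact h

end Input

/-! ### Checking the positive queries -/

namespace Params

variable (p : Params)

/-- The class that completes a solution, as an expression. -/
def complE (c a : Expr) : Expr :=
  .horner (.reg 1) (fun j => .modSub (.read 1 (.const j)) c a) p.k

/-- The number of triples to be checked. -/
def weightE : Expr :=
  .read 8 (.reg 20) * .read 8 (.reg 23) * .read 8 (.reg 17) *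
    .op .eq (.read 13 (.reg 23) / p.sE) (.read 19 (.reg 14))

/-- Whether the current triple is a solution. -/
def hitE : Expr :=
  .op .eq (.read 9 (.reg 20 * .reg 0 + .reg 25 % .read 8 (.reg 20)) +
      .read 9 (.reg 23 * .reg 0 + .reg 25 / .read 8 (.reg 20) % .read 8 (.reg 23)))
    (.read 9 (.reg 17 * .reg 0 + .reg 25 / .read 8 (.reg 20) / .read 8 (.reg 23)))

/-- Look for a solution that belongs to an element of the first chunk of a query. -/
def checkElemProg : Program :=
  .seq (.assign 19 (.read 14 (.read 18 (.reg 14) * p.sE + .reg 18)))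
    (.seq (.assign 20 (p.packE (.reg 19))) (.seq (.assign 23 (p.complE (.reg 16) (.reg 19)))
      (.seq (.assign 24 p.weightE)
        (.for 25 (.const 0) (.reg 24) (.ite hitE (.assign 22 (.const 1)) .skip)))))

/-- Look for a solution that belongs to a query. -/
def checkQueryProg : Program :=
  .ite (.read 104 (.reg 14)) .skip
    (.seq (.assign 16 (.read 17 (.reg 14))) (.seq (.assign 17 (p.packE (.reg 16)))
      (.for 18 (.const 0) (.read 16 (.read 18 (.reg 14))) p.checkElemProg)))

/-- Look for a solution that belongs to one of the queries with a nonempty intersection. -/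
def verifyProg : Program :=
  .seq (.assign 22 (.const 0)) (.seq (.for 14 (.const 0) (.reg 21) p.checkQueryProg)
    (.assign 0 (.reg 22)))

end Params

theorem WordRAM.Answers.congr {v : ℕ} {p q : Prop} (h : Answers v p) (hpq : p ↔ q) : Answers v q := by
  unfold Answers at *; rwa [← hpq]

namespace Input

variable {p : Params}

theorem eval_complE {d : Input p} {P : ℕ → ℕ} {τ : State} (h : τ.reg 1 = d.W) (hP : d.Moduli P τ)
    (c a : Expr) : (p.complE c a).eval τ = d.compl P (c.eval τ) (a.eval τ) := by
  simp only [Params.complE, eval_horner, eval_reg, h, eval_modSub, eval_read, eval_const]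
  exact horner_congr fun j hj => by rw [(hP j hj).1]

theorem length_cls_le (d : Input p) (P : ℕ → ℕ) (v : ℕ) : (d.cls P v).length ≤ d.n :=
  List.length_filter_le _ _

theorem weight_lt_M (d : Input p) (P : ℕ → ℕ) (t : ℕ × ℕ × ℕ) (o : ℕ) : d.weight P t o < d.M := by
  have h : d.weight P t o ≤ d.n * d.n * d.n * 1 := by
    refine Nat.mul_le_mul (Nat.mul_le_mul (Nat.mul_le_mul ?_ ?_) ?_) (by split_ifs <;> simp)
    all_goals exact d.length_cls_le P _
  have h' := d.cube_lt
  have : d.n * d.n * d.n * 1 = d.A.length ^ 3 := by unfold n; ring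
  omega

/-- The bound `z < weight` guarantees that the three classes are nonempty and that the digits of `z`
are valid positions, so the cells read are those described by `Classes`. -/
theorem eval_hitE {d : Input p} {P : ℕ → ℕ} {τ : State} (hR : d.Ready P τ) {c e f o z : ℕ}
    (h17 : τ.reg 17 = d.pk P c)
    (h20 : τ.reg 20 = d.pk P (d.elem P (e * d.s + o)))
    (h23 : τ.reg 23 = d.compl P c (d.elem P (e * d.s + o))) (h25 : τ.reg 25 = z)
    (hz : z < d.weight P (c, e, f) o) : Params.hitE.eval τ ≠ 0 ↔ d.Hit P (c, e, f) o z := by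
  have hP := hR.moduli.good
  simp only [weight] at hz
  set v := d.pk P (d.elem P (e * d.s + o)) with hv
  set w := d.compl P c (d.elem P (e * d.s + o)) with hw
  have hz' : z < (d.cls P v).length * (d.cls P w).length * (d.cls P (d.pk P c)).length := by
    split_ifs at hz
    · simpa using hz
    · simp at hz
  have hl : 0 < (d.cls P v).length := Nat.pos_of_ne_zero fun h0 => by simp [h0] at hz'
  have hm : 0 < (d.cls P w).length := Nat.pos_of_ne_zero fun h0 => by simp [h0] at hz'
  have h₃ : z / (d.cls P v).length / (d.cls P w).length < (d.cls P (d.pk P c)).length := by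
    rw [Nat.div_div_eq_div_mul]
    exact Nat.div_lt_of_lt_mul hz'
  have hv8 := hR.classes.1 v (pk_lt d hP _)
  have hw8 := hR.classes.1 w (compl_lt hP _ _)
  simp only [Params.hitE, eval_eq, eval_add, eval_read, eval_mul, eval_mod, eval_div, eval_reg,
    h17, h20, h23, h25, hR.setup.r0, hv8, hw8]
  rw [hR.classes.2 _ _ (Nat.mod_lt _ hl), hR.classes.2 _ _ (Nat.mod_lt _ hm), hR.classes.2 _ _ h₃]
  simp only [Hit, ← hv, ← hw]
  split_ifs with h
  · exact ⟨fun _ => h, fun _ => one_ne_zero⟩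
  · exact ⟨fun h' => absurd rfl h', fun h' => absurd h' h⟩

/-- Given `c` and `a`, the class of `b` is computed directly, so no search through the second chunk
is necessary. The weight is `0` if this class is not in chunk `f`, and the loop is then empty. -/
theorem checkElemProg_spec (p : Params) : ∃ K, ∀ (d : Input p) (P : ℕ → ℕ) (τ : State)
    (k c e f o : ℕ) (X : Prop), d.Ready P τ → τ.arr 18 k = e → τ.arr 19 k = f → c ∈ d.A →
    o < d.sz P e → τ.reg 14 = k → τ.reg 16 = c → τ.reg 17 = d.pk P c → τ.reg 18 = o →
    Answers (τ.reg 22) X → Runs d.M p.checkElemProg τ (K + K * d.weight P (c, e, f) o) (fun υ =>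
      Answers (υ.reg 22) (X ∨ ∃ z < d.weight P (c, e, f) o, d.Hit P (c, e, f) o z) ∧
      Agree [19, 20, 22, 23, 24, 25] [] τ υ) := by
  set e₁ : Expr := .read 14 (.read 18 (.reg 14) * p.sE + .reg 18) with he₁
  set e₂ := p.packE (.reg 19) with he₂
  set e₃ := p.complE (.reg 16) (.reg 19) with he₃
  set e₄ := p.weightE with he₄
  set h₀ := Params.hitE.cost with hh₀
  refine ⟨e₁.cost + e₂.cost + e₃.cost + e₄.cost + h₀ + 40,
    fun d P τ k c e f o X hR a18 a19 hc ho r14 r16 r17 r18 r22 => Runs.agree ?_ _ _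
      (by simp [Params.checkElemProg, Program.for, Program.modR])
      (by simp [Params.checkElemProg, Program.for, Program.modA])⟩
  have hP := hR.moduli.good
  set a := d.elem P (e * d.s + o) with ha
  have haA : a ∈ d.A := (elem_spec ho).1
  have hM1 := d.W_lt_M
  have hkM := d.classes_lt
  have hpk := pk_lt d hP a
  have hco := compl_lt hP c a
  have hwM := d.weight_lt_M P (c, e, f) o
  have v₁ : e₁.eval τ = a := by
    rw [he₁, eval_read, eval_add, eval_mul, eval_read, eval_reg, eval_reg, r14, a18, r18,
      eval_sE hR.setup.r1, hR.tables.elem_eq ho]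
  set m := d.weight P (c, e, f) o with hm
  refine (Runs.seq (R := fun υ => υ = τ.setReg 19 a) (T₁ := e₁.cost + 1)
    (T₂ := (e₂.cost + 1) + ((e₃.cost + 1) + ((e₄.cost + 1) + (h₀ + 3 + 2 + 7) * (m + 1))))
    ((Runs.assign (by rw [v₁]; exact d.elem_lt' haA) (by rw [v₁])).time le_rfl) fun υ₁ hυ₁ => ?_).time ?_
  swap
  · have h₁ : (h₀ + 3 + 2 + 7) * m ≤ (e₁.cost + e₂.cost + e₃.cost + e₄.cost + h₀ + 40) * m :=
      Nat.mul_le_mul_right _ (by omega)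
    have h₂ : (h₀ + 3 + 2 + 7) * (m + 1) = (h₀ + 3 + 2 + 7) * m + (h₀ + 3 + 2 + 7) := by ring
    omega
  have ag₁ : Agree [19] [] τ υ₁ := by
    refine ⟨fun x hx => ?_, fun x hx => by rw [hυ₁]; rfl⟩
    simp only [List.mem_singleton] at hx
    simp [hυ₁, hx]
  have R₁ := hR.agree ag₁ (by simp) (by simp)
  have v₂ : e₂.eval υ₁ = d.pk P a := by
    rw [he₂, eval_packE R₁.setup.r1 R₁.moduli, eval_reg, hυ₁]; simp
  refine Runs.seq (R := fun υ => υ = υ₁.setReg 20 (d.pk P a))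
    (Runs.assign (by rw [v₂]; unfold W at *; omega) (by rw [v₂])) fun υ₂ hυ₂ => ?_
  have ag₂ : Agree [19, 20] [] τ υ₂ := by
    refine (ag₁.mono (by simp) (by simp)).trans ⟨fun x hx => ?_, fun x hx => by rw [hυ₂]; rfl⟩
    simp only [List.mem_cons, not_or] at hx
    simp [hυ₂, hx.2.1]
  have R₂ := hR.agree ag₂ (by simp) (by simp)
  have v₃ : e₃.eval υ₂ = d.compl P c a := by
    rw [he₃, eval_complE R₂.setup.r1 R₂.moduli, eval_reg, eval_reg, ag₂.1 16 (by simp), r16, hυ₂,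
      hυ₁]
    simp
  refine Runs.seq (R := fun υ => υ = υ₂.setReg 23 (d.compl P c a))
    (Runs.assign (by rw [v₃]; unfold W at *; omega) (by rw [v₃])) fun υ₃ hυ₃ => ?_
  have ag₃ : Agree [19, 20, 23] [] τ υ₃ := by
    refine (ag₂.mono (by simp) (by simp)).trans ⟨fun x hx => ?_, fun x hx => by rw [hυ₃]; rfl⟩
    simp only [List.mem_cons, not_or] at hx
    simp [hυ₃, hx.2.2.1]
  have R₃ := hR.agree ag₃ (by simp) (by simp)
  have v₄ : e₄.eval υ₃ = m := by
    have q17 : υ₃.reg 17 = d.pk P c := by rw [ag₃.1 17 (by simp), r17]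
    have q20 : υ₃.reg 20 = d.pk P a := by simp [hυ₃, hυ₂]
    have q23 : υ₃.reg 23 = d.compl P c a := by simp [hυ₃]
    simp only [he₄, Params.weightE, eval_mul, eval_read, eval_reg, eval_eq, eval_div,
      eval_sE R₃.setup.r1, q17, q20, q23, ag₃.1 14 (by simp : 14 ∉ [19, 20, 23]), r14,
      ag₃.2 19 (by simp), a19]
    rw [R₃.classes.1 _ hpk, R₃.classes.1 _ hco, R₃.classes.1 _ (pk_lt d hP c),
      R₃.tables.sl _ hco, hm, weight]
  refine Runs.seq (R := fun υ => υ = υ₃.setReg 24 m)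
    (Runs.assign (by rw [v₄]; exact hwM) (by rw [v₄])) fun υ₄ hυ₄ => ?_
  have ag₄ : Agree [19, 20, 23, 24] [] τ υ₄ := by
    refine (ag₃.mono (by simp) (by simp)).trans ⟨fun x hx => ?_, fun x hx => by rw [hυ₄]; rfl⟩
    simp only [List.mem_cons, not_or] at hx
    simp [hυ₄, hx.2.2.2.1]
  have q17 : υ₄.reg 17 = d.pk P c := by rw [ag₄.1 17 (by simp), r17]
  have q20 : υ₄.reg 20 = d.pk P a := by simp [hυ₄, hυ₃, hυ₂]
  have q23 : υ₄.reg 23 = d.compl P c a := by simp [hυ₄, hυ₃]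
  have q24 : υ₄.reg 24 = m := by simp [hυ₄]
  have q22 : υ₄.reg 22 = τ.reg 22 := ag₄.1 22 (by simp)
  have R₄ := hR.agree ag₄ (by simp) (by simp)
  clear hυ₁ hυ₂ hυ₃ hυ₄
  refine (Runs.for_const (fun z υ => υ.reg 25 = z ∧ Agree [22, 25] [] υ₄ υ ∧
    Answers (υ.reg 22) (X ∨ ∃ z' < z, d.Hit P (c, e, f) o z')) (h₀ + 3) (l := 0) (h := m) rfl
    (Nat.zero_le _) hwM ?_ ?_ ?_).mono le_rfl ?_
  · refine ⟨by simp, ⟨fun x hx => ?_, fun x hx => rfl⟩, ?_⟩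
    · simp only [List.mem_cons, not_or] at hx
      simp [hx.2.1]
    · simp only [setReg_reg]
      rw [Function.update_of_ne (by norm_num), q22]
      exact r22.congr (by simp)
  · rintro z υ ⟨h₁, h₂, -⟩
    exact ⟨h₁, by rw [eval_reg, h₂.1 24 (by simp), q24]⟩
  · rintro z υ - hz ⟨h25, ag, h22⟩
    have hhit := eval_hitE (R₄.agree ag (by simp) (by simp)) (by rw [ag.1 17 (by simp), q17])
      (by rw [ag.1 20 (by simp), q20]) (by rw [ag.1 23 (by simp), q23]) h25 hz
    refine (Runs.ite (T₁ := 2) (T₂ := 1) (fun hne => ?_) (fun heq => ?_)).time (by omega)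
    · refine (Runs.assign (by rw [eval_const]; omega) ?_).time le_rfl
      refine ⟨by simp [h25], by simp, ⟨fun x hx => ?_, fun x hx => by simp [ag.2 x hx]⟩, ?_⟩
      · have := ag.1 x hx
        simp only [List.mem_cons, not_or] at hx
        simp [hx.1, hx.2.1, this]
      · simp only [setReg_reg, eval_const]
        rw [Function.update_of_ne (by norm_num), Function.update_self]
        exact Or.inl ⟨Or.inr ⟨z, by omega, hhit.1 hne⟩, rfl⟩
    · refine Runs.skip ⟨h25, by simp, ⟨fun x hx => ?_, ag.2⟩, ?_⟩
      · have := ag.1 x hx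
        simp only [List.mem_cons, not_or] at hx
        simp [hx.2.1, this]
      · simp only [setReg_reg]
        rw [Function.update_of_ne (by norm_num)]
        refine h22.congr (or_congr_right ⟨fun ⟨z', h, h'⟩ => ⟨z', by omega, h'⟩, fun ⟨z', h, h'⟩ =>
          ⟨z', lt_of_le_of_ne (by omega) fun hzz => ?_, h'⟩⟩)
        subst hzz
        exact hhit.2 h' heq
  · rintro υ ⟨-, -, h⟩
    exact h

-- A negative query costs a constant. A positive one costs up to `s + 1` rounds besides the triples
-- checked, and this overhead is absorbed by the factor `s + 1` because the sum of the weights is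
-- not `0`.
open Classical in
theorem checkQueryProg_spec (p : Params) : ∃ K, ∀ (d : Input p) (P : ℕ → ℕ) (τ : State)
    (k c e f : ℕ) (X : Prop), d.Ready P τ → τ.arr 17 k = c → τ.arr 18 k = e → τ.arr 19 k = f →
    (c, e, f) ∈ d.queries P → τ.reg 14 = k → Answers (τ.arr 104 k) (¬ d.Positive P (c, e, f)) →
    Answers (τ.reg 22) X → Runs d.M p.checkQueryProg τ
      (K + K * ((d.s + 1) * ∑ o ∈ Finset.range (d.sz P e), d.weight P (c, e, f) o)) (fun υ =>
      Answers (υ.reg 22) (X ∨ (d.Positive P (c, e, f) ∧ ∃ o < d.sz P e,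
        ∃ z < d.weight P (c, e, f) o, d.Hit P (c, e, f) o z)) ∧
      Agree [16, 17, 18, 19, 20, 22, 23, 24, 25] [] τ υ) := by
  obtain ⟨K, hK⟩ := checkElemProg_spec p
  set e₁ := p.packE (.reg 16) with he₁
  refine ⟨3 * K + e₁.cost + 60, fun d P τ k c e f X hR a17 a18 a19 hq r14 a104 r22 => Runs.agree ?_ _ _
      (by simp [Params.checkQueryProg, Params.checkElemProg, Program.for, Program.modR])
      (by simp [Params.checkQueryProg, Params.checkElemProg, Program.for, Program.modA])⟩
  have hP := hR.moduli.good
  have hcA := (mem_queries.1 hq).1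
  set S := ∑ o ∈ Finset.range (d.sz P e), d.weight P (c, e, f) o with hS
  have hsz := d.sz_le P e
  have hsM := d.s_le_n.trans_lt d.n_lt
  refine (Runs.ite (T₁ := 1) (T₂ := if d.Positive P (c, e, f) then 3 + ((e₁.cost + 1) +
    ((K + 1 + 4 + 7) * (d.sz P e + 1) + K * S)) else 0) (fun hne => ?_) (fun heq => ?_)).time ?_
  · refine Runs.skip ?_
    rw [eval_read, eval_reg, r14] at hne
    have hpos : ¬ d.Positive P (c, e, f) := by
      rcases a104 with ⟨h, -⟩ | ⟨-, h⟩
      · exact h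
      · exact absurd h hne
    exact r22.congr ⟨Or.inl, fun h => h.resolve_right fun h => hpos h.1⟩
  · rw [eval_read, eval_reg, r14] at heq
    have hpos : d.Positive P (c, e, f) := by
      rcases a104 with ⟨-, h⟩ | ⟨h, -⟩
      · omega
      · exact not_not.1 h
    rw [if_pos hpos]
    refine Runs.seq (R := fun υ => υ = τ.setReg 16 c)
      ((Runs.assign (by simp [r14, a17]; exact d.elem_lt' hcA) (by simp [r14, a17])).time le_rfl)
      fun υ hυ => ?_
    have agυ : Agree [16] [] τ υ := by
      refine ⟨fun x hx => ?_, fun x hx => by rw [hυ]; rfl⟩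
      simp only [List.mem_singleton] at hx
      simp [hυ, hx]
    have hRυ := hR.agree agυ (by simp) (by simp)
    have q16 : υ.reg 16 = c := by simp [hυ]
    have v₁ : e₁.eval υ = d.pk P c := by
      rw [he₁, eval_packE hRυ.setup.r1 hRυ.moduli, eval_reg, q16]
    have hpkM : d.pk P c < d.M := by
      have := pk_lt d hP c; have := d.classes_lt; unfold W at *; omega
    refine Runs.seq (R := fun φ => φ = υ.setReg 17 (d.pk P c))
      (Runs.assign (by rw [v₁]; exact hpkM) (by rw [v₁])) fun φ hφ => ?_
    have agφ : Agree [16, 17] [] τ φ := by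
      refine (agυ.mono (by simp) (by simp)).trans ⟨fun x hx => ?_, fun x hx => by rw [hφ]; rfl⟩
      simp only [List.mem_cons, List.not_mem_nil, or_false, not_or] at hx
      simp [hφ, hx.2]
    have s16 : φ.reg 16 = c := by simp [hφ, q16]
    have s17 : φ.reg 17 = d.pk P c := by simp [hφ]
    refine (Runs.for_potential (fun o ψ => ψ.reg 18 = o ∧
      Agree [16, 17, 18, 19, 20, 22, 23, 24, 25] [] τ ψ ∧ ψ.reg 16 = c ∧
      ψ.reg 17 = d.pk P c ∧ Answers (ψ.reg 22) (X ∨ ∃ o' < o, ∃ z < d.weight P (c, e, f) o',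
        d.Hit P (c, e, f) o' z)) K K
      (fun o => ∑ o' ∈ Finset.range o, d.weight P (c, e, f) o') (l := 0) (h := d.sz P e) rfl
      (Nat.zero_le _) (by omega) ?_ ?_ ?_ ?_).mono ?_ ?_
    · intro o _ _
      rw [Finset.sum_range_succ]; omega
    · refine ⟨by simp, ⟨fun x hx => ?_, fun x hx => by rw [setReg_arr, agφ.2 x (by simp)]⟩,
        by simp [s16], by simp [s17], ?_⟩
      · simp only [List.mem_cons, List.not_mem_nil, or_false, not_or] at hx
        simp [hx.2.2.1, agφ.1 x (by simp [hx.1, hx.2.1])]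
      · simp only [setReg_reg]
        rw [Function.update_of_ne (by norm_num), agφ.1 22 (by simp)]
        exact r22.congr (by simp)
    · rintro o ψ ⟨h₁, h₂, -⟩
      refine ⟨h₁, ?_⟩
      rw [eval_read, eval_read, eval_reg, h₂.1 14 (by simp), h₂.2 18 (by simp), r14, a18,
        h₂.2 16 (by simp), hR.tables.sz]
    · rintro o ψ - ho ⟨h18, ag, h16, h17, h22⟩
      refine ((hK d P ψ k c e f o _ (hR.agree ag (by simp) (by simp)) (by rw [ag.2 18 (by simp), a18])
        (by rw [ag.2 19 (by simp), a19]) hcA ho (by rw [ag.1 14 (by simp), r14]) h16 h17 h18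
        h22).mono ?_ ?_)
      · simp only [Finset.sum_range_succ, Nat.add_sub_cancel_left]
        exact le_rfl
      · rintro χ ⟨hχ, agχ⟩
        have agτ := ag.trans (agχ.mono (R' := [16, 17, 18, 19, 20, 22, 23, 24, 25]) (by simp)
          (List.Subset.refl _))
        refine ⟨by rw [agχ.1 18 (by simp), h18], by simp, ⟨fun x hx => ?_, agτ.2⟩, ?_, ?_, ?_⟩
        · rw [← agτ.1 x hx]
          simp only [List.mem_cons, List.not_mem_nil, or_false, not_or] at hx
          simp [hx.2.2.1]
        · simp [agχ.1 16 (by simp), h16]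
        · simp [agχ.1 17 (by simp), h17]
        · simp only [setReg_reg]
          rw [Function.update_of_ne (by norm_num)]
          refine hχ.congr ?_
          rw [or_assoc]
          refine or_congr_right ⟨?_, ?_⟩
          · rintro (⟨o', h, h'⟩ | h)
            · exact ⟨o', by omega, h'⟩
            · exact ⟨o, by omega, h⟩
          · rintro ⟨o', h, h'⟩
            by_cases hoo : o' = o
            · subst hoo; exact Or.inr h'
            · exact Or.inl ⟨o', by omega, h'⟩
    · simp only [Finset.range_zero, Finset.sum_empty, Nat.sub_zero]
      exact Nat.add_le_add_right (Nat.mul_le_mul_right _ (by simp [Expr.cost])) _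
    · rintro ψ ⟨-, -, -, -, h⟩
      exact h.congr (or_congr_right ⟨fun h => ⟨hpos, h⟩, fun h => h.2⟩)
  · split_ifs with hpos
    -- Here the loop overhead is paid for by a triple.
    · obtain ⟨o, ho, hw⟩ := exists_weight hP hq hpos
      have hS1 : 1 ≤ S := hw.trans (Finset.single_le_sum (f := fun o => d.weight P (c, e, f) o)
        (fun _ _ => Nat.zero_le _) (Finset.mem_range.2 ho))
      have h₁ : d.s + 1 ≤ (d.s + 1) * S := Nat.le_mul_of_pos_right _ hS1
      have h₂ : S ≤ (d.s + 1) * S := Nat.le_mul_of_pos_left _ (by omega)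
      have h₃ : (K + 1 + 4 + 7) * (d.sz P e + 1) ≤ (K + 12) * ((d.s + 1) * S) :=
        Nat.mul_le_mul_left _ (by omega)
      have h₄ : K * S ≤ K * ((d.s + 1) * S) := Nat.mul_le_mul_left _ h₂
      have h₅ : (K + 12) * ((d.s + 1) * S) + K * ((d.s + 1) * S) = (2 * K + 12) * ((d.s + 1) * S) := by
        ring
      have h₆ : (2 * K + 12) * ((d.s + 1) * S) ≤ (3 * K + e₁.cost + 60) * ((d.s + 1) * S) :=
        Nat.mul_le_mul_right _ (by omega)
      simp only [Expr.cost]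
      rw [max_eq_right (by omega)]
      omega
    · simp [Expr.cost]; omega

/-- The costs of the positive queries add up to at most `s + 1` times the number of triples that
satisfy all congruences, by the disjointness in `sum_weight_le`. Everything else is constant per
query. -/
theorem verifyProg_spec (p : Params) : ∃ K, ∀ (d : Input p) (P : ℕ → ℕ) (σ : State), d.Ready P σ →
    σ.arr 17 = (fun i => ((d.queries P).map fun t => t.1).getD i 0) →
    σ.arr 18 = (fun i => ((d.queries P).map fun t => t.2.1).getD i 0) →
    σ.arr 19 = (fun i => ((d.queries P).map fun t => t.2.2).getD i 0) →
    σ.reg 21 = (d.queries P).length →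
    (∀ k (h : k < (d.queries P).length), Answers (σ.arr 104 k) (¬ d.Positive P (d.queries P)[k])) →
    Runs d.M p.verifyProg σ (K * (1 + (d.queries P).length) + K * ((d.s + 1) * tripleCount d.S P p.k))
      (fun τ => Answers (τ.reg 0) (ThreeSum.HasSolution d.A)) := by
  obtain ⟨K, hK⟩ := checkQueryProg_spec p
  refine ⟨2 * K + 30, fun d P σ hR a17 a18 a19 r21 a104 => ?_⟩
  have hP := hR.moduli.good
  set q := (d.queries P).length with hq
  have hqM := d.length_queries_lt_M hP
  have hM := d.W_lt_M
  set g : ℕ × ℕ × ℕ → ℕ := fun t =>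
    (d.s + 1) * ∑ o ∈ Finset.range (d.sz P t.2.1), d.weight P t o with hg
  have hgsum : ((d.queries P).map g).sum ≤ (d.s + 1) * tripleCount d.S P p.k := by
    rw [hg, List.sum_map_mul_left]
    exact Nat.mul_le_mul_left _ (sum_weight_le hP)
  refine (Runs.seq (R := fun υ => υ = σ.setReg 22 0) (T₁ := 2)
    (T₂ := ((K + 1 + 1 + 7) * (q + 1) + K * ((d.queries P).map g).sum) + 2)
    ((Runs.assign (by rw [eval_const]; omega) (by rw [eval_const])).time le_rfl) fun υ hυ => ?_).time ?_
  swap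
  · have h₁ : K * ((d.queries P).map g).sum ≤
        (2 * K + 30) * ((d.s + 1) * tripleCount d.S P p.k) := Nat.mul_le_mul (by omega) hgsum
    nlinarith
  have agυ : Agree [22] [] σ υ := by
    refine ⟨fun x hx => ?_, fun x hx => by rw [hυ]; rfl⟩
    simp only [List.mem_singleton] at hx
    simp [hυ, hx]
  refine Runs.seq (R := fun ψ => Answers (ψ.reg 22) (ThreeSum.HasSolution d.A)) ?_ fun ψ hψ => ?_
  · refine (Runs.for_potential (fun i ψ => ψ.reg 14 = i ∧
      Agree [14, 16, 17, 18, 19, 20, 22, 23, 24, 25] [] σ ψ ∧ Answers (ψ.reg 22)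
        (∃ t ∈ (d.queries P).take i, d.Positive P t ∧ ∃ o < d.sz P t.2.1,
        ∃ z < d.weight P t o, d.Hit P t o z)) K K
      (fun i => (((d.queries P).take i).map g).sum) (l := 0) (h := q) rfl
      (Nat.zero_le _) (by omega) ?_ ?_ ?_ ?_).mono ?_ ?_
    · intro i _ hi
      have : (d.queries P).take (i + 1) = (d.queries P).take i ++ [(d.queries P)[i]] := by simp
      rw [this, List.map_append, List.sum_append]; omega
    · refine ⟨by simp, ⟨fun x hx => ?_, fun x hx => by rw [setReg_arr, agυ.2 x hx]⟩, ?_⟩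
      · simp only [List.mem_cons, not_or] at hx
        simp [hx.1, agυ.1 x (by simp [hx.2.2.2.2.2.2.1])]
      · simp [hυ, Answers]
    · rintro i ψ ⟨h₁, h₂, -⟩
      refine ⟨h₁, ?_⟩
      rw [eval_reg, h₂.1 21 (by simp), r21]
    · rintro i ψ - hi ⟨h14, ag, h22⟩
      have htake : (d.queries P).take (i + 1) = (d.queries P).take i ++ [(d.queries P)[i]] := by simp
      have hmem : (d.queries P)[i] ∈ d.queries P := List.getElem_mem _
      have b17 : ψ.arr 17 i = (d.queries P)[i].1 := by
        rw [ag.2 17 (by simp), a17]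
        simp only
        rw [List.getD_eq_getElem _ _ (by simpa using hi), List.getElem_map]
      have b18 : ψ.arr 18 i = (d.queries P)[i].2.1 := by
        rw [ag.2 18 (by simp), a18]
        simp only
        rw [List.getD_eq_getElem _ _ (by simpa using hi), List.getElem_map]
      have b19 : ψ.arr 19 i = (d.queries P)[i].2.2 := by
        rw [ag.2 19 (by simp), a19]
        simp only
        rw [List.getD_eq_getElem _ _ (by simpa using hi), List.getElem_map]
      refine ((hK d P ψ i _ _ _ _ (hR.agree ag (by simp) (by simp)) b17 b18 b19 hmem h14
        (by rw [ag.2 104 (by simp)]; exact a104 i hi) h22).mono ?_ ?_)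
      · simp only [htake, List.map_append, List.sum_append, Nat.add_sub_cancel_left, List.map_singleton,
          List.sum_singleton]
        exact le_rfl
      · rintro χ ⟨hχ, agχ⟩
        have agτ := ag.trans (agχ.mono (R' := [14, 16, 17, 18, 19, 20, 22, 23, 24, 25]) (by simp)
          (List.Subset.refl _))
        refine ⟨by rw [agχ.1 14 (by simp), h14], by simp, ⟨fun x hx => ?_, agτ.2⟩, ?_⟩
        · rw [← agτ.1 x hx]
          simp only [List.mem_cons, not_or] at hx
          simp [hx.1]
        · simp only [setReg_reg]
          rw [Function.update_of_ne (by norm_num)]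
          refine hχ.congr ?_
          rw [htake]
          simp only [List.mem_append, List.mem_singleton, or_and_right, exists_or, exists_eq_left]
    · simp only [List.take_zero, List.map_nil, List.sum_nil, Nat.sub_zero, Expr.cost]
      rw [hq, List.take_length]
    · rintro ψ ⟨-, -, h⟩
      rw [hq, List.take_length] at h
      exact h.congr (hasSolution_iff hP).symm
  · refine (Runs.assign ?_ ?_).time le_rfl
    · rw [eval_reg]
      rcases hψ with ⟨-, h⟩ | ⟨-, h⟩ <;> omega
    · simpa using hψ

end Input

/-! ## Calling a program as a subroutine -/

namespace WordRAM

/-- The expression with the registers moved by `u` and the arrays moved by `v`. -/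
def Expr.shift (u v : ℕ) : Expr → Expr
  | .const k => .const k
  | .reg x => .reg (u + x)
  | .read a i => .read (v + a) (i.shift u v)
  | .op o e₁ e₂ => .op o (e₁.shift u v) (e₂.shift u v)

/-- The program with the registers moved by `u` and the arrays moved by `v`. -/
def Program.shift (u v : ℕ) : Program → Program
  | .skip => .skip
  | .assign x e => .assign (u + x) (e.shift u v)
  | .write a i e => .write (v + a) (i.shift u v) (e.shift u v)
  | .seq p₁ p₂ => .seq (p₁.shift u v) (p₂.shift u v)
  | .ite e p₁ p₂ => .ite (e.shift u v) (p₁.shift u v) (p₂.shift u v)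
  | .loop e p => .loop (e.shift u v) (p.shift u v)

/-- The registers from `u` on and the arrays from `v` on. -/
def State.view (u v : ℕ) (σ : State) : State where
  reg x := σ.reg (u + x)
  arr a := σ.arr (v + a)

theorem Expr.eval_shift (u v : ℕ) (σ : State) :
    ∀ e : Expr, (e.shift u v).eval σ = e.eval (σ.view u v)
  | .const _ => rfl
  | .reg _ => rfl
  | .read a i => by simp only [Expr.shift, Expr.eval, Expr.eval_shift u v σ i]; rfl
  | .op o e₁ e₂ => by
    simp only [Expr.shift, Expr.eval, Expr.eval_shift u v σ e₁, Expr.eval_shift u v σ e₂]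

theorem Expr.cost_shift (u v : ℕ) : ∀ e : Expr, (e.shift u v).cost = e.cost
  | .const _ => rfl
  | .reg _ => rfl
  | .read a i => by simp only [Expr.shift, Expr.cost, Expr.cost_shift u v i]
  | .op o e₁ e₂ => by
    simp only [Expr.shift, Expr.cost, Expr.cost_shift u v e₁, Expr.cost_shift u v e₂]

theorem Expr.fits_shift (u v w : ℕ) (σ : State) :
    ∀ e : Expr, (e.shift u v).Fits w σ ↔ e.Fits w (σ.view u v)
  | .const _ => Iff.rfl
  | .reg _ => Iff.rfl
  | .read a i => by
    simp only [Expr.shift, Expr.Fits, Expr.fits_shift u v w σ i, Expr.eval_shift]; rfl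
  | .op o e₁ e₂ => by
    simp only [Expr.shift, Expr.Fits, Expr.fits_shift u v w σ e₁, Expr.fits_shift u v w σ e₂,
      Expr.eval_shift]

theorem State.view_setReg (u v : ℕ) (σ : State) (x k : ℕ) :
    (σ.setReg (u + x) k).view u v = (σ.view u v).setReg x k := by
  ext y i
  · simp [State.view, Function.update_apply]
  · rfl

theorem State.view_setArr (u v : ℕ) (σ : State) (a i k : ℕ) :
    (σ.setArr (v + a) i k).view u v = (σ.view u v).setArr a i k := by
  ext y j
  · rfl
  · simp only [State.view, setArr_arr, Function.update_apply, Nat.add_left_cancel_iff]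

/-- A program that has been moved acts on its own part of the memory only. -/
theorem Exec.shift {w : ℕ} (u v : ℕ) {p : Program} {τ τ' : State} {t : ℕ} (h : Exec w p τ t τ') :
    ∀ σ : State, σ.view u v = τ → ∃ σ', Exec w (p.shift u v) σ t σ' ∧ σ'.view u v = τ' ∧
      (∀ x < u, σ'.reg x = σ.reg x) ∧ ∀ a < v, σ'.arr a = σ.arr a := by
  induction h with
  | skip τ => exact fun σ hσ => ⟨σ, .skip σ, hσ, fun _ _ => rfl, fun _ _ => rfl⟩
  | assign τ x e he =>
    rintro σ rfl
    refine ⟨σ.setReg (u + x) (e.eval (σ.view u v)), ?_, State.view_setReg .., fun y hy => ?_,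
      fun _ _ => rfl⟩
    · have := Exec.assign (w := w) σ (u + x) (e.shift u v) ((e.fits_shift u v w σ).2 he)
      rwa [e.eval_shift, e.cost_shift] at this
    · rw [setReg_reg, Function.update_of_ne (by omega)]
  | write τ a i e hi he =>
    rintro σ rfl
    refine ⟨σ.setArr (v + a) (i.eval (σ.view u v)) (e.eval (σ.view u v)), ?_,
      State.view_setArr .., fun _ _ => rfl, fun y hy => ?_⟩
    · have := Exec.write (w := w) σ (v + a) (i.shift u v) (e.shift u v)
        ((i.fits_shift u v w σ).2 hi) ((e.fits_shift u v w σ).2 he)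
      rwa [e.eval_shift, e.cost_shift, i.eval_shift, i.cost_shift] at this
    · rw [setArr_arr, Function.update_of_ne (by omega)]
  | seq _ _ ih₁ ih₂ =>
    intro σ hσ
    obtain ⟨σ₁, e₁, v₁, r₁, a₁⟩ := ih₁ σ hσ
    obtain ⟨σ₂, e₂, v₂, r₂, a₂⟩ := ih₂ σ₁ v₁
    exact ⟨σ₂, .seq e₁ e₂, v₂, fun x hx => (r₂ x hx).trans (r₁ x hx),
      fun x hx => (a₂ x hx).trans (a₁ x hx)⟩
  | @iteTrue e _ _ _ _ _ he hc _ ih =>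
    rintro σ rfl
    obtain ⟨σ₁, e₁, v₁, r₁, a₁⟩ := ih σ rfl
    refine ⟨σ₁, ?_, v₁, r₁, a₁⟩
    rw [← e.cost_shift u v]
    exact .iteTrue ((e.fits_shift u v w σ).2 he) (by rwa [e.eval_shift]) e₁
  | @iteFalse e _ _ _ _ _ he hc _ ih =>
    rintro σ rfl
    obtain ⟨σ₁, e₁, v₁, r₁, a₁⟩ := ih σ rfl
    refine ⟨σ₁, ?_, v₁, r₁, a₁⟩
    rw [← e.cost_shift u v]
    exact .iteFalse ((e.fits_shift u v w σ).2 he) (by rwa [e.eval_shift]) e₁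
  | @loopDone e _ _ he hc =>
    rintro σ rfl
    refine ⟨σ, ?_, rfl, fun _ _ => rfl, fun _ _ => rfl⟩
    rw [← e.cost_shift u v]
    exact .loopDone ((e.fits_shift u v w σ).2 he) (by rwa [e.eval_shift])
  | @loopStep e _ _ _ _ _ _ he hc _ _ ih₁ ih₂ =>
    rintro σ rfl
    obtain ⟨σ₁, e₁, v₁, r₁, a₁⟩ := ih₁ σ rfl
    obtain ⟨σ₂, e₂, v₂, r₂, a₂⟩ := ih₂ σ₁ v₁
    refine ⟨σ₂, ?_, v₂, fun x hx => (r₂ x hx).trans (r₁ x hx),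
      fun x hx => (a₂ x hx).trans (a₁ x hx)⟩
    rw [← e.cost_shift u v]
    exact .loopStep ((e.fits_shift u v w σ).2 he) (by rwa [e.eval_shift]) e₁ e₂

theorem Expr.Fits.mono {w w' : ℕ} (hw : w ≤ w') {σ : State} :
    ∀ {e : Expr}, e.Fits w σ → e.Fits w' σ
  | .const _, h => lt_of_lt_of_le h (Nat.pow_le_pow_right (by omega) hw)
  | .reg _, h => lt_of_lt_of_le h (Nat.pow_le_pow_right (by omega) hw)
  | .read _ _, h => ⟨Expr.Fits.mono hw h.1, h.2.trans_le (Nat.pow_le_pow_right (by omega) hw)⟩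
  | .op _ _ _, h => ⟨Expr.Fits.mono hw h.1, Expr.Fits.mono hw h.2.1,
      h.2.2.trans_le (Nat.pow_le_pow_right (by omega) hw)⟩

theorem Expr.Fits.eval_lt {w : ℕ} {σ : State} : ∀ {e : Expr}, e.Fits w σ → e.eval σ < 2 ^ w
  | .const _, h => h
  | .reg _, h => h
  | .read _ _, h => h.2
  | .op _ _ _, h => h.2.2

/-- The subroutine is known to work on words for its own input size; the calling program has longer
words. -/
theorem Exec.mono {w w' : ℕ} (hw : w ≤ w') {p : Program} {σ σ' : State} {t : ℕ}
    (h : Exec w p σ t σ') : Exec w' p σ t σ' := by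
  induction h with
  | skip σ => exact .skip σ
  | assign σ x e he => exact .assign σ x e (he.mono hw)
  | write σ a i e hi he => exact .write σ a i e (hi.mono hw) (he.mono hw)
  | seq _ _ ih₁ ih₂ => exact .seq ih₁ ih₂
  | iteTrue he hc _ ih => exact .iteTrue (he.mono hw) hc ih
  | iteFalse he hc _ ih => exact .iteFalse (he.mono hw) hc ih
  | loopDone he hc => exact .loopDone (he.mono hw) hc
  | loopStep he hc _ _ ih₁ ih₂ => exact .loopStep (he.mono hw) hc ih₁ ih₂

/-- Nothing is known about the subroutine beyond its specification, but whatever it stores is a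
word. So the memory is still bounded when the verification starts. -/
theorem Exec.bdd {w : ℕ} {p : Program} {σ σ' : State} {t : ℕ} (h : Exec w p σ t σ')
    (hσ : σ.Bdd (2 ^ w)) : σ'.Bdd (2 ^ w) := by
  induction h with
  | skip σ => exact hσ
  | assign σ x e he => exact hσ.setReg he.eval_lt
  | write σ a i e hi he => exact hσ.setArr he.eval_lt
  | seq _ _ ih₁ ih₂ => exact ih₂ (ih₁ hσ)
  | iteTrue he hc _ ih => exact ih hσ
  | iteFalse he hc _ ih => exact ih hσ
  | loopDone he hc => exact hσ
  | loopStep he hc _ _ ih₁ ih₂ => exact ih₂ (ih₁ hσ)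

end WordRAM

/-! ### The complete instance -/

namespace Params

variable (p : Params)

/-- Write down the instance of Set Disjointness. -/
def buildProg : Program :=
  .seq p.classProg (.seq p.chunkProg (.seq p.setsProg (.seq p.queriesProg
    (.assign 21 (.reg 204)))))

end Params

namespace Input

variable {p : Params}

/-- The queries and their number have been saved for later. -/
structure Saved (d : Input p) (P : ℕ → ℕ) (σ : State) : Prop where
  ready : d.Ready P σ
  a17 : σ.arr 17 = fun i => ((d.queries P).map fun t => t.1).getD i 0
  a18 : σ.arr 18 = fun i => ((d.queries P).map fun t => t.2.1).getD i 0
  a19 : σ.arr 19 = fun i => ((d.queries P).map fun t => t.2.2).getD i 0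
  r21 : σ.reg 21 = (d.queries P).length

/-- The subroutine's specification starts from an exact memory, so besides the tables all its other
registers and arrays must still be `0`. -/
theorem view_eq_input {d : Input p} {P : ℕ → ℕ} (hP : d.Good P) {σ : State}
    (hL : d.Log P (d.queries P) σ) (r200 : σ.reg 200 = p.C * d.W ^ p.g') (r201 : σ.reg 201 = d.V)
    (r202 : σ.reg 202 = 2 * d.E P * d.Y) (r203 : σ.reg 203 = d.s)
    (a100 : ∀ i, σ.arr 100 i = if i < 2 * d.E P * d.Y then (d.setList P i).length else 0)
    (a101 : ∀ i, σ.arr 101 i = if i < 2 * d.E P * d.Y * d.s then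
      (d.setList P (i / d.s)).getD (i % d.s) 0 else 0)
    (hr : ∀ x, 205 ≤ x → σ.reg x = 0) (ha : ∀ a, 104 ≤ a → ∀ i, σ.arr a i = 0) :
    σ.view 200 100 = SetDisjointness.input (p.C * d.W ^ p.g') (inst hP) := by
  ext x i
  · simp only [State.view, SetDisjointness.input]
    split_ifs with h₀ h₁ h₂ h₃ h₄
    · rw [h₀, r200]
    · rw [h₁, r201]; rfl
    · rw [h₂, r202]; rfl
    · rw [h₃, r203]; rfl
    · rw [h₄, hL.r204]; simp [SetDisjointness.Instance.q, inst]
    · exact hr _ (by omega)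
  · simp only [State.view, SetDisjointness.input]
    have hs := d.s_pos
    rcases Nat.lt_or_ge x 4 with hx | hx
    · interval_cases x
      · by_cases h : i < 2 * d.E P * d.Y <;> simp [a100, inst, h]
      · simp [a101, inst, Nat.div_lt_iff_lt_mul hs]
      · simp only [hL.a102, inst, List.length_map, List.getElem_map]
        by_cases h : i < (d.queries P).length
        · have h' := (idx_lt hP (List.getElem_mem h)).1
          simp [h, Nat.mod_eq_of_lt h']
        · simp [h]
      · simp only [hL.a103, inst, List.length_map, List.getElem_map]
        by_cases h : i < (d.queries P).length
        · have h' := (idx_lt hP (List.getElem_mem h)).2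
          simp [h, Nat.mod_eq_of_lt h']
        · simp [h]
    · rw [ha _ (by omega), if_neg (by omega), if_neg (by omega), if_neg (by omega),
        if_neg (by omega)]

/-- The classes are computed afresh for the final moduli, as the tables left by the search belong to
the last candidate tried. The number of queries is copied to register `21`, since the subroutine may
overwrite its own input. -/
theorem buildProg_spec (p : Params) : ∃ K, ∀ (d : Input p) (P : ℕ → ℕ) (σ : State), d.Setup σ →
    d.Moduli P σ → Fresh σ → ∀ hP : d.Good P, Runs d.M p.buildProg σ
      (K * d.W ^ (p.k + 2) + K * d.W ^ (p.g + p.y) + K * (d.n * d.E P) +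
        K * (d.queries P).length) (fun τ => d.Saved P τ ∧
        τ.view 200 100 = SetDisjointness.input (p.C * d.W ^ p.g') (inst hP)) := by
  obtain ⟨K₁, h₁⟩ := classProg_spec p
  obtain ⟨K₂, h₂⟩ := chunkProg_spec p
  obtain ⟨K₃, h₃⟩ := setsProg_spec p
  obtain ⟨K₄, h₄⟩ := queriesProg_spec p
  refine ⟨K₁ + K₂ + K₃ + K₄ + 2, fun d P σ hσ hM hF hP => ?_⟩
  refine (Runs.seq (R := fun τ => d.Classes P τ ∧ Agree [9, 12] [8, 9] σ τ)
    (T₂ := K₂ * d.W ^ p.k + (K₃ * d.W ^ (p.g + p.y) +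
      ((K₄ * (d.n * d.E P) + K₄ * (d.queries P).length) + 2)))
    ((h₁ d P σ hσ hM).agree [9, 12] [8, 9]
      (by simp [Params.classProg, groupProg, Program.fill, Program.for, Program.modR])
      (by simp [Params.classProg, groupProg, Program.fill, Program.for, Program.modA]))
    fun τ ⟨hC, ag⟩ => ?_).time ?_
  swap
  · have e₁ : d.W ^ p.k ≤ d.W ^ (p.k + 2) := Nat.pow_le_pow_right d.W_pos (by omega)
    have e₂ : 1 ≤ d.W ^ (p.k + 2) := Nat.one_le_pow _ _ d.W_pos
    have e₃ := Nat.mul_le_mul_left K₂ e₁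
    have e₄ := Nat.mul_le_mul_left K₁ e₂
    generalize d.W ^ (p.k + 2) = a at *
    generalize d.W ^ p.k = a' at *
    generalize d.W ^ (p.g + p.y) = b at *
    generalize d.n * d.E P = u at *
    generalize (d.queries P).length = v at *
    nlinarith [Nat.zero_le (K₁ * b), Nat.zero_le (K₂ * b), Nat.zero_le (K₄ * b),
      Nat.zero_le (K₁ * u), Nat.zero_le (K₂ * u), Nat.zero_le (K₃ * u), Nat.zero_le (K₁ * v),
      Nat.zero_le (K₂ * v), Nat.zero_le (K₃ * v), Nat.zero_le (K₃ * a), Nat.zero_le (K₄ * a)]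
  have s₁ : d.Setup τ := hσ.agree ag (by simp) (by simp)
  have m₁ : d.Moduli P τ := hM.agree ag (by simp)
  have f₁ : Fresh τ := by
    refine ⟨fun x hx => ?_, fun a ha i => ?_⟩
    · rw [ag.1 x (by simp; omega), hF.1 x hx]
    · rw [ag.2 a (by simp; omega), hF.2 a ha]
  refine Runs.seq (h₂ d P τ s₁ hC f₁) fun τ₂ ⟨hT, ag₂⟩ => ?_
  have R₂ : d.Ready P τ₂ := ⟨s₁.agree ag₂ (by simp) (by simp), m₁.agree ag₂ (by simp),
    hC.agree ag₂ (by simp), hT⟩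
  refine Runs.seq (h₃ d P τ₂ R₂.setup R₂.moduli hT
    (fun i => by rw [ag₂.2 100 (by simp), f₁.2 _ (by norm_num)])
    (fun i => by rw [ag₂.2 101 (by simp), f₁.2 _ (by norm_num)]))
    fun τ₃ ⟨⟨r200, r201, r202, r203, a100, a101⟩, ag₃⟩ => ?_
  have R₃ := R₂.agree ag₃ (by simp) (by simp)
  have hr₃ : ∀ x, 204 ≤ x → τ₃.reg x = 0 := fun x hx => by
    rw [ag₃.1 x (by simp; omega), ag₂.1 x (by simp; omega), f₁.1 x (by omega)]
  have ha₃ : ∀ a, a = 17 ∨ a = 18 ∨ a = 19 ∨ 102 ≤ a → ∀ i, τ₃.arr a i = 0 := fun a ha i => by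
    rw [ag₃.2 a (by simp; omega), ag₂.2 a (by simp; omega), f₁.2 a (by omega)]
  have hL : d.Log P [] τ₃ :=
    ⟨hr₃ 204 le_rfl, funext fun i => by simp [ha₃], funext fun i => by simp [ha₃],
      funext fun i => by simp [ha₃], funext fun i => by simp [ha₃],
      funext fun i => by simp [ha₃]⟩
  refine Runs.seq (h₄ d P τ₃ R₃ hL) fun τ₄ ⟨hL₄, ag₄⟩ => ?_
  have R₄ := R₃.agree ag₄ (by simp) (by simp)
  refine Runs.assign (by rw [eval_reg, hL₄.r204]; exact d.length_queries_lt_M hP) ?_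
  rw [eval_reg, hL₄.r204]
  have ag₅ : Agree [21] [] τ₄ (τ₄.setReg 21 (d.queries P).length) := by
    refine ⟨fun x hx => ?_, fun x hx => rfl⟩
    simp only [List.mem_singleton] at hx
    simp [hx]
  have hL₅ := hL₄.agree ag₅ (by simp) (by simp)
  refine ⟨⟨R₄.agree ag₅ (by simp) (by simp), hL₅.a17, hL₅.a18, hL₅.a19, by simp⟩,
    view_eq_input hP hL₅ ?_ ?_ ?_ ?_ ?_ ?_ ?_ ?_⟩
  · rw [ag₅.1 _ (by simp), ag₄.1 _ (by simp), r200]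
  · rw [ag₅.1 _ (by simp), ag₄.1 _ (by simp), r201]
  · rw [ag₅.1 _ (by simp), ag₄.1 _ (by simp), r202]
  · rw [ag₅.1 _ (by simp), ag₄.1 _ (by simp), r203]
  · rwa [ag₅.2 _ (by simp), ag₄.2 _ (by simp)]
  · rwa [ag₅.2 _ (by simp), ag₄.2 _ (by simp)]
  · intro x hx
    rw [ag₅.1 _ (by simp; omega), ag₄.1 _ (by simp; omega), hr₃ x (by omega)]
  · intro x hx i
    rw [ag₅.2 _ (by simp), ag₄.2 _ (by simp; omega), ha₃ x (by omega)]

end Input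

/-! ### The programs contain no bit operations -/

namespace WordRAM

theorem Expr.NoBits.modSub {m x y : Expr} (hm : m.NoBits) (hx : x.NoBits) (hy : y.NoBits) :
    (Expr.modSub m x y).NoBits := by
  simp [Expr.modSub, hm, hx, hy]

theorem Program.NoBits.for {x : ℕ} {lo hi : Expr} {q : Program} (hlo : lo.NoBits) (hhi : hi.NoBits)
    (hq : q.NoBits) : (Program.for x lo hi q).NoBits :=
  ⟨hlo, ⟨trivial, trivial, hhi⟩, hq, trivial, trivial, trivial⟩

theorem Program.NoBits.fill {a x : ℕ} {lo hi e : Expr} (hlo : lo.NoBits) (hhi : hi.NoBits)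
    (he : e.NoBits) : (Program.fill a x lo hi e).NoBits :=
  .for hlo hhi ⟨trivial, he⟩

@[simp] theorem noBits_reg (x : ℕ) : (Expr.reg x).NoBits := trivial
@[simp] theorem noBits_const (x : ℕ) : (Expr.const x).NoBits := trivial
@[simp] theorem noBits_read (a : ℕ) (i : Expr) : (Expr.read a i).NoBits ↔ i.NoBits := Iff.rfl
@[simp] theorem noBits_eq (a b : Expr) : (Expr.op .eq a b).NoBits ↔ a.NoBits ∧ b.NoBits :=
  ⟨fun h => h.2, fun h => ⟨trivial, h⟩⟩
@[simp] theorem noBits_lt (a b : Expr) : (Expr.op .lt a b).NoBits ↔ a.NoBits ∧ b.NoBits :=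
  ⟨fun h => h.2, fun h => ⟨trivial, h⟩⟩
@[simp] theorem noBits_le (a b : Expr) : (Expr.op .le a b).NoBits ↔ a.NoBits ∧ b.NoBits :=
  ⟨fun h => h.2, fun h => ⟨trivial, h⟩⟩

theorem Program.NoBits.group {cnt out x kr : ℕ} {size key : Expr} (hs : size.NoBits)
    (hk : key.NoBits) : (groupProg cnt out x kr size key).NoBits :=
  ⟨.fill trivial hs trivial, .for trivial trivial ⟨hk, by simp [Program.NoBits]⟩⟩

end WordRAM

namespace Params

variable (p : Params)

theorem noBits_packE {e : Expr} (he : e.NoBits) : (p.packE e).NoBits :=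
  .horner (noBits_reg 1) (fun _ => by simp [he]) _

theorem noBits_complE {c a : Expr} (hc : c.NoBits) (ha : a.NoBits) : (p.complE c a).NoBits :=
  .horner (noBits_reg 1) (fun _ => .modSub (by simp) hc ha) _

theorem noBits_thirdE {c a : Expr} (hc : c.NoBits) (ha : a.NoBits) : (p.thirdE c a).NoBits :=
  .horner (noBits_reg 1) (fun _ => .modSub (by simp) hc ha) _

theorem noBits_sE : p.sE.NoBits := (noBits_reg 1).pow _
theorem noBits_RE : p.RE.NoBits := (noBits_reg 1).pow _
theorem noBits_VE : p.VE.NoBits := (noBits_reg 1).pow _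
theorem noBits_YE : p.YE.NoBits := (noBits_reg 1).pow _

theorem noBits_digE {x : Expr} (hx : x.NoBits) (j : ℕ) : (p.digE x j).NoBits := by
  simp [digE, hx, Expr.NoBits.pow]

theorem noBits_valAE {a x : Expr} (ha : a.NoBits) (hx : x.NoBits) : (p.valAE a x).NoBits := by
  rw [valAE, noBits_add]
  exact ⟨.horner (noBits_reg 1) (fun _ => .modSub (by simp) ha
    (p.noBits_digE (by simp [hx, noBits_YE]) _)) _, trivial⟩

theorem noBits_valBE {b x : Expr} (hb : b.NoBits) (hx : x.NoBits) : (p.valBE b x).NoBits := by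
  rw [valBE, noBits_add]
  exact ⟨.horner (noBits_reg 1) (fun _ => .modSub (by simp) (p.noBits_digE hx _) hb) _, trivial⟩

theorem noBits_classProg : p.classProg.NoBits :=
  .group ((noBits_reg 1).pow _) (p.noBits_packE (by simp))

theorem noBits_layerE (a s : ℕ) : (p.layerE a s).NoBits := by
  rw [layerE, noBits_mod]
  exact ⟨.sum (fun _ => by simp) _, trivial⟩

theorem noBits_countProg : p.countProg.NoBits := by
  refine ⟨p.noBits_classProg, .group trivial (.horner (noBits_reg 2) (fun _ => by simp) _), ?_, ?_,
    ?_, ?_, by simp [Program.NoBits]⟩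
  · exact .fill trivial trivial (.horner (noBits_reg 1) (fun _ => by simp [Expr.NoBits.pow]) _)
  · exact .fill trivial (by simp) (p.noBits_layerE _ _)
  · exact .fill trivial (by simp) (p.noBits_layerE _ _)
  · exact .fill trivial (by simp) (by simp [accE])

theorem noBits_selectProg : p.selectProg.NoBits := by
  refine .for trivial trivial ⟨by simp [Program.NoBits, Expr.NoBits.pow],
    .for (by simp) (by simp) ⟨by simp [Program.NoBits], p.noBits_countProg,
      by simp [Program.NoBits]⟩, by simp [Program.NoBits]⟩

theorem noBits_initProg : p.initProg.NoBits := by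
  simp [initProg, baseProg, Program.NoBits, Expr.NoBits.pow, Program.NoBits.fill]

theorem noBits_buildProg : p.buildProg.NoBits := by
  have h₁ := p.noBits_sE
  have h₂ := p.noBits_RE
  have h₃ := p.noBits_VE
  have h₄ := p.noBits_YE
  refine ⟨p.noBits_classProg, ⟨.for trivial ((noBits_reg 1).pow _) ?_, ?_⟩, ?_, ?_, trivial⟩
  · simp [slotProg, Program.NoBits, h₁, h₃]
  · simp [Program.NoBits, h₁, h₂]
  · have : p.chunkE.NoBits := by simp [chunkE, h₁, h₄]
    have h₅ : p.setE.NoBits := by simp [setE, this, h₁, h₄, noBits_valAE, noBits_valBE]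
    simp [setsProg, Program.NoBits, Program.NoBits.fill, h₁, h₃, h₄, h₅, Expr.NoBits.pow]
  · refine .for trivial trivial ⟨trivial, p.noBits_packE trivial, by simp, ?_, trivial⟩
    refine .for trivial trivial ⟨trivial, ⟨p.noBits_thirdE trivial (by simp [h₁]), ?_⟩, trivial⟩
    exact .for trivial (by simp) (by simp [emitProg, Program.NoBits, h₄])

theorem noBits_verifyProg : p.verifyProg.NoBits := by
  have h₁ := p.noBits_sE
  refine ⟨trivial, .for trivial trivial ⟨trivial, trivial, trivial, p.noBits_packE trivial,
    .for trivial trivial ⟨by simp [Program.NoBits, h₁], p.noBits_packE trivial,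
      p.noBits_complE trivial trivial, ?_, .for trivial trivial ?_⟩⟩, trivial⟩
  · simp [weightE, h₁, Program.NoBits]
  · simp [hitE, Program.NoBits]

end Params

/-! ### The algorithm for 3SUM -/

namespace Params

variable (p : Params)

/-- Whether there are more false positives than the greedy choice allows without a solution. -/
def testE : Expr :=
  .op .lt (.const p.θ * (Expr.reg 1).pow (3 * p.g + 1))
      (.read 12 (.const (p.r - 1)) * (Expr.reg 1).pow p.r) +
    .op .lt (.const p.θ * (Expr.reg 1).pow (3 * p.g + 1))
      (.read 12 (.const (p.k - 1)) * (Expr.reg 1).pow p.k)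

/-- The algorithm for 3SUM that calls the algorithm `q` for Set Disjointness. -/
def mainProg (q : Program) : Program :=
  .seq (.seq p.initProg p.selectProg) (.ite p.testE (.assign 0 (.const 1))
    (.seq p.buildProg (.seq (q.shift 200 100) p.verifyProg)))

theorem noBits_testE : p.testE.NoBits := by simp [testE, Expr.NoBits.pow]

end Params

namespace Input

variable {p : Params}

/-- The number of triples that look like solutions is as small as it is without a solution. -/
def Few (d : Input p) (P : ℕ → ℕ) (j : ℕ) : Prop :=
  tripleCount d.S P j * d.W ^ j ≤ p.θ * d.W ^ (3 * p.g + 1)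

/-- After multiplication by `s * s * R`, with `s * R = W ^ g`, the two terms from incomplete chunks
are `O(W ^ (3 * g))` and the main term is `O(W ^ (3 * g + 1))` by the test for `r` moduli. The
right-hand power times `s * s * R` is exactly `W ^ (3 * g + 1)`. -/
theorem length_queries_le_pow {d : Input p} {P : ℕ → ℕ} (hP : d.Good P) (h : d.Few P p.r) :
    (d.queries P).length ≤
      (p.B ^ p.g * (p.B ^ p.g + 2) + p.B ^ (2 * p.g) + p.θ) * d.W ^ (p.g + p.r + 1) := by
  have hr := p.r_le
  have h₁ := length_queries_le hP
  have h₂ := d.n_le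
  have h₃ := d.E_le P
  have hs : d.s * d.R = d.W ^ p.g := by rw [mul_comm, R_mul_s]
  set G := d.W ^ p.g with hG
  have hW := d.W_pos
  refine Nat.le_of_mul_le_mul_right (c := d.s * d.s * d.R) ?_
    (Nat.mul_pos (Nat.mul_pos d.s_pos d.s_pos) (Nat.one_le_pow _ _ hW))
  have e₁ : d.W ^ (p.g + p.r + 1) * (d.s * d.s * d.R) = G * G * G * d.W := by
    have : d.W ^ (p.g + p.r + 1) = G * d.R * d.W := by rw [hG, R, pow_add, pow_add, pow_one]
    rw [this, show G * d.R * d.W * (d.s * d.s * d.R) = G * (d.s * d.R) * (d.s * d.R) * d.W by ring, hs]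
  have e₂ : d.W ^ (3 * p.g + 1) = G * G * G * d.W := by rw [hG]; ring
  have h₄ : d.n * d.E P * d.s * d.s * d.R ≤ p.B ^ p.g * (p.B ^ p.g + 2) * (G * G * G * d.W) := by
    calc d.n * d.E P * d.s * d.s * d.R
        ≤ (p.B ^ p.g * G) * ((p.B ^ p.g + 2) * d.R) * d.s * d.s * d.R := by gcongr
      _ = p.B ^ p.g * (p.B ^ p.g + 2) * (G * (d.s * d.R) * (d.s * d.R)) := by ring
      _ = p.B ^ p.g * (p.B ^ p.g + 2) * (G * G * G) := by rw [hs]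
      _ ≤ _ := Nat.mul_le_mul_left _ (Nat.le_mul_of_pos_right _ hW)
  have h₅ : d.n * d.n * d.s * d.R ≤ p.B ^ (2 * p.g) * (G * G * G * d.W) := by
    calc d.n * d.n * d.s * d.R ≤ (p.B ^ p.g * G) * (p.B ^ p.g * G) * d.s * d.R := by gcongr
      _ = p.B ^ (2 * p.g) * (G * G * (d.s * d.R)) := by ring
      _ = p.B ^ (2 * p.g) * (G * G * G) := by rw [hs]
      _ ≤ _ := Nat.mul_le_mul_left _ (Nat.le_mul_of_pos_right _ hW)
  rw [Few, e₂] at h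
  calc (d.queries P).length * (d.s * d.s * d.R) = (d.queries P).length * d.s * d.s * d.R := by ring
    _ ≤ (d.n * d.E P * d.s * d.s + d.n * d.n * d.s + tripleCount d.S P p.r) * d.R :=
      Nat.mul_le_mul_right _ h₁
    _ = d.n * d.E P * d.s * d.s * d.R + d.n * d.n * d.s * d.R + tripleCount d.S P p.r * d.R := by
      ring
    _ ≤ p.B ^ p.g * (p.B ^ p.g + 2) * (G * G * G * d.W) + p.B ^ (2 * p.g) * (G * G * G * d.W) +
        p.θ * (G * G * G * d.W) := Nat.add_le_add (Nat.add_le_add h₄ h₅) h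
    _ = (p.B ^ p.g * (p.B ^ p.g + 2) + p.B ^ (2 * p.g) + p.θ) * (G * G * G * d.W) := by ring
    _ = _ := by rw [← e₁, mul_assoc _ (d.W ^ _)]

/-- The exponent on the left is at most `(g - r) + (3 * g + 1) - k`. It is at most `2 * g - 1`
because `g + 1 ≤ r + y`; this is where that condition on the parameters comes from. -/
theorem tripleCount_mul_s_le {d : Input p} {P : ℕ → ℕ} (h : d.Few P p.k) :
    (d.s + 1) * tripleCount d.S P p.k ≤ 2 * p.θ * d.W ^ (2 * p.g - 1) := by
  have hr := p.r_le
  have hry := p.le_ry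
  have hW := d.W_pos
  have hs := d.s_pos
  refine Nat.le_of_mul_le_mul_right (c := d.W ^ p.k) ?_ (Nat.one_le_pow _ _ hW)
  rw [Few] at h
  calc (d.s + 1) * tripleCount d.S P p.k * d.W ^ p.k
      ≤ (2 * d.s) * tripleCount d.S P p.k * d.W ^ p.k := by gcongr; omega
    _ = 2 * d.s * (tripleCount d.S P p.k * d.W ^ p.k) := by ring
    _ ≤ 2 * d.s * (p.θ * d.W ^ (3 * p.g + 1)) := Nat.mul_le_mul_left _ h
    _ = 2 * p.θ * d.W ^ ((p.g - p.r) + (3 * p.g + 1)) := by rw [pow_add, s]; ring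
    _ ≤ 2 * p.θ * d.W ^ ((2 * p.g - 1) + p.k) :=
      Nat.mul_le_mul_left _ (Nat.pow_le_pow_right hW (by unfold Params.k; omega))
    _ = _ := by rw [pow_add]; ring

theorem input_bdd (d : Input p) : (ThreeSum.input d.A).Bdd d.M := by
  have := d.n_lt
  refine ⟨fun x => ?_, fun a i => ?_⟩
  · simp only [ThreeSum.input]; split_ifs <;> omega
  · simp only [ThreeSum.input]
    split_ifs
    · rcases Nat.lt_or_ge i d.A.length with h | h
      · rw [List.getD_eq_getElem _ _ h]
        exact (d.mem _ (List.getElem_mem h)).2.trans_lt d.elem_lt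
      · rw [List.getD_eq_default _ _ h]; omega
    · omega

theorem eval_testE {d : Input p} {P : ℕ → ℕ} {σ : State} (h1 : σ.reg 1 = d.W)
    (h12 : ∀ i < p.k, σ.arr 12 i = tripleCount d.S P (i + 1)) :
    p.testE.eval σ = 0 ↔ d.Few P p.r ∧ d.Few P p.k := by
  have hr := p.one_le_r
  have e₁ := h12 (p.r - 1) (by unfold Params.k; omega)
  have e₂ := h12 (p.k - 1) (by have := one_le_k (p := p); omega)
  rw [Nat.sub_add_cancel hr] at e₁
  rw [Nat.sub_add_cancel (one_le_k (p := p))] at e₂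
  simp only [Params.testE, eval_add, eval_lt, eval_mul, eval_const, eval_pow, eval_reg, eval_read,
    h1, e₁, e₂, Few, Nat.add_eq_zero_iff, ite_eq_right_iff, one_ne_zero, imp_false, not_lt]

/-- Counting and searching use only registers and arrays below `13`. Everything above is still in
its initial state, in particular the memory of the subroutine. -/
theorem selected_spec (p : Params) : ∃ c, ∀ d : Input p,
    Runs d.M (.seq p.initProg p.selectProg) (ThreeSum.input d.A) (c * d.W ^ (p.k + 3)) (fun τ =>
      ∃ P, d.Setup τ ∧ d.Moduli P τ ∧ Fresh τ ∧ IsGreedy d.S d.W p.k P ∧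
        ∀ i < p.k, τ.arr 12 i = tripleCount d.S P (i + 1)) := by
  obtain ⟨c₁, h₁⟩ := initProg_spec p
  obtain ⟨c₂, h₂⟩ := selectProg_spec p
  refine ⟨c₁ + c₂, fun d => ?_⟩
  rw [add_mul]
  have hR : ∀ x ∈ (Program.seq p.initProg p.selectProg).modR, x ∈ List.range 13 := by
    have := p.modR_countProg
    simp only [List.subset_def, List.mem_cons, List.not_mem_nil, or_false] at this
    simp only [Params.initProg, Params.baseProg, Params.selectProg, Params.chooseProg,
      Params.tryProg, Program.fill, Program.for, Program.modR, List.mem_append, List.mem_range,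
      List.mem_cons, List.not_mem_nil, or_false, false_or]
    intro x hx
    by_cases hc : x ∈ p.countProg.modR
    · have := this hc; omega
    · simp only [hc, false_or] at hx; omega
  have hA : ∀ x ∈ (Program.seq p.initProg p.selectProg).modA, x ∈ List.range 13 := by
    have := p.modA_countProg
    simp only [List.subset_def, List.mem_cons, List.not_mem_nil, or_false] at this
    simp only [Params.initProg, Params.baseProg, Params.selectProg, Params.chooseProg,
      Params.tryProg, Program.fill, Program.for, Program.modA, List.mem_append, List.mem_range,
      List.mem_cons, List.not_mem_nil, or_false, false_or]
    intro x hx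
    by_cases hc : x ∈ p.countProg.modA
    · have := this hc; omega
    · simp only [hc, or_false] at hx; omega
  refine ((Runs.seq (h₁ d) fun τ hτ => h₂ d τ hτ.1 hτ.2).agree _ _ hR hA).mono le_rfl ?_
  rintro τ ⟨⟨P, hS, hM, hG, h12⟩, ag⟩
  refine ⟨P, hS, hM, ⟨fun x hx => ?_, fun a ha i => ?_⟩, hG, h12⟩
  · rw [ag.1 x (by simpa using hx)]
    simp only [ThreeSum.input]
    rw [if_neg (by omega)]
  · rw [ag.2 a (by simpa using ha)]
    simp only [ThreeSum.input]
    rw [if_neg (by omega)]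

/-- All data for the verification lie below register `200` and array `100`, out of the reach of the
subroutine. -/
theorem Saved.congr {d : Input p} {P : ℕ → ℕ} {σ τ : State} (h : d.Saved P σ)
    (hr : ∀ x < 200, τ.reg x = σ.reg x) (ha : ∀ a < 100, τ.arr a = σ.arr a) : d.Saved P τ := by
  have hS := h.ready.setup
  have hT := h.ready.tables
  refine ⟨⟨⟨?_, ?_, ?_, ?_, ?_, ?_, ?_, ?_, ?_, ?_, ?_⟩, ?_, ?_, ⟨?_, ?_, ?_, ?_, ?_⟩⟩,
    ?_, ?_, ?_, ?_⟩
  · simpa [hr] using hS.r0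
  · simpa [hr] using hS.r1
  · simpa [hr] using hS.r2
  · simpa [hr] using hS.r3
  · simpa [hr] using hS.r10
  · simpa [hr] using hS.r11
  · simpa only [ha 0 (by norm_num)] using hS.a0
  · simpa only [ha 2 (by norm_num)] using hS.a2
  · simpa only [ha 3 (by norm_num)] using hS.a3
  · simpa only [ha 4 (by norm_num)] using hS.a4
  · simpa only [ha 5 (by norm_num)] using hS.a5
  · simpa only [Moduli, ha 1 (by norm_num)] using h.ready.moduli
  · simpa only [Classes, ha 8 (by norm_num), ha 9 (by norm_num)] using h.ready.classes
  · simpa [hr] using hT.r15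
  · simpa only [ha 13 (by norm_num)] using hT.sl
  · simpa only [ha 14 (by norm_num)] using hT.el
  · simpa only [ha 15 (by norm_num)] using hT.cs
  · simpa only [ha 16 (by norm_num)] using hT.sz
  · simpa only [ha 17 (by norm_num)] using h.a17
  · simpa only [ha 18 (by norm_num)] using h.a18
  · simpa only [ha 19 (by norm_num)] using h.a19
  · simpa [hr] using h.r21

theorem correct_inst {d : Input p} {P : ℕ → ℕ} (hP : d.Good P) {σ : State}
    (h : SetDisjointness.Correct (inst hP) σ) (k : ℕ) (hk : k < (d.queries P).length) :
    Answers (σ.arr 4 k) (¬ d.Positive P (d.queries P)[k]) := by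
  have hk' : k < (inst hP).Q.length := by simpa [inst] using hk
  have hmem : (d.queries P)[k] ∈ d.queries P := List.getElem_mem hk
  refine (h k hk').congr ?_
  rw [← disjoint_iff hP hmem]
  obtain ⟨h₁, h₂⟩ := idx_lt hP hmem
  simp [inst, Nat.mod_eq_of_lt h₁, Nat.mod_eq_of_lt h₂]

/-- The reduction: time `O(W ^ (2 * g - 1))` apart from the call. -/
theorem mainProg_spec (p : Params) : ∃ K c₀ : ℕ, ∀ (d : Input p) (q : Program) (w w' : ℕ) (T : ℝ),
    d.M = 2 ^ w' → K ≤ d.M → d.M ^ c₀ ≤ 2 ^ w →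
    (¬ ThreeSum.HasSolution d.A → ∀ P, IsGreedy d.S d.W p.k P → ∀ j ≤ p.k, d.Few P j) →
    0 ≤ T →
    (∀ P (hP : d.Good P), d.Few P p.r → ∃ (t : ℕ) (σ : State),
      Exec w' q (SetDisjointness.input (p.C * d.W ^ p.g') (inst hP)) t σ ∧ (t : ℝ) ≤ T ∧
        SetDisjointness.Correct (inst hP) σ) →
    ∃ (t : ℕ) (σ : State), Exec w (p.mainProg q) (ThreeSum.input d.A) t σ ∧
      (t : ℝ) ≤ K * (d.W : ℝ) ^ (2 * p.g - 1) + T ∧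
      Answers (σ.reg 0) (ThreeSum.HasSolution d.A) := by
  obtain ⟨c₁, h₁⟩ := selected_spec p
  obtain ⟨c₂, h₂⟩ := buildProg_spec p
  obtain ⟨c₃, h₃⟩ := verifyProg_spec p
  obtain ⟨K₁, t₁⟩ := Program.NoBits.tame (p := .seq p.initProg p.selectProg)
    ⟨p.noBits_initProg, p.noBits_selectProg⟩
  obtain ⟨K₂, t₂⟩ := p.noBits_buildProg.tame
  obtain ⟨K₃, t₃⟩ := p.noBits_verifyProg.tame
  obtain ⟨K₄, t₄⟩ := p.noBits_testE.tame
  set cq := p.B ^ p.g * (p.B ^ p.g + 2) + p.B ^ (2 * p.g) + p.θ with hcq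
  set m₁ := (Program.seq p.initProg p.selectProg).maxCost with hm₁
  set m₂ := p.buildProg.maxCost with hm₂
  set m₃ := p.verifyProg.maxCost with hm₃
  refine ⟨K₁ + K₂ + K₃ + K₄ + 2 + c₁ + p.testE.cost + 3 + c₂ * 2 +
    c₂ * (p.B ^ p.g * (p.B ^ p.g + 2)) + c₂ * cq + c₃ + c₃ * cq + c₃ * (2 * p.θ),
    m₁ + m₂ + m₃ + p.testE.cost + 1, fun d q w w' T hMw hK hw hfew hT hq => ?_⟩
  set Z := d.W ^ (2 * p.g - 1) with hZ
  have hW := d.W_pos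
  have hZ1 : 1 ≤ Z := Nat.one_le_pow _ _ hW
  have hM2 : 2 ≤ d.M := by omega
  have mono : ∀ {a : ℕ}, a ≤ m₁ + m₂ + m₃ + p.testE.cost + 1 → d.M ^ a ≤ 2 ^ w := fun ha =>
    (Nat.pow_le_pow_right (by omega) ha).trans hw
  have hww : w' ≤ w := by
    have := mono (a := 1) (by omega)
    rw [pow_one, hMw] at this
    exact (Nat.pow_le_pow_iff_right (by norm_num)).1 this
  have pw : ∀ {a : ℕ}, a ≤ 2 * p.g - 1 → d.W ^ a ≤ Z := fun ha => Nat.pow_le_pow_right hW ha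
  obtain ⟨a₁, σ₁, r₁, l₁, P, hS, hMod, hF, hG, h12⟩ := h₁ d
  obtain ⟨x₁, b₁⟩ := r₁.exec hM2 (t₁ _ (by omega)) (mono (by omega)) d.input_bdd
  have hP := hMod.good
  have fits := Expr.Tame.fits (w := w) hM2 b₁ (t₄ _ (by omega)) (mono (by omega))
  have htest := eval_testE hS.r1 h12
  -- The search for the moduli takes `W ^ (k + 3)`, and `k + 3 ≤ 2 * g - 1` is the condition
  -- `ryy_le`.
  have l₁' : a₁ ≤ c₁ * Z := l₁.trans (Nat.mul_le_mul_left _ (pw (by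
    have := p.ryy_le; unfold Params.k; omega)))
  by_cases hc : p.testE.eval σ₁ = 0
  · obtain ⟨few₁, few₂⟩ := htest.1 hc
    obtain ⟨a₂, σ₂, r₂, l₂, hsav, hview⟩ := h₂ d P σ₁ hS hMod hF hP
    obtain ⟨x₂, b₂⟩ := r₂.exec hM2 (t₂ _ (by omega)) (mono (by omega)) b₁
    obtain ⟨a₃, τ, x₃, l₃, hcor⟩ := hq P hP few₁
    obtain ⟨σ₃, x₃', hv₃, hr₃, ha₃⟩ := x₃.shift 200 100 σ₂ hview
    -- The bound `M` is exactly the number of words of the subroutine, so the same `M` remains valid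
    -- after the call.
    have b₃ : σ₃.Bdd d.M := by rw [hMw] at b₂ ⊢; exact x₃'.bdd b₂
    have hsav₃ := hsav.congr hr₃ ha₃
    obtain ⟨a₄, σ₄, r₄, l₄, hans⟩ := h₃ d P σ₃ hsav₃.ready hsav₃.a17 hsav₃.a18 hsav₃.a19 hsav₃.r21
      (fun k hk => by
        have := correct_inst hP hcor k hk
        rw [← hv₃] at this
        exact this)
    obtain ⟨x₄, -⟩ := r₄.exec hM2 (t₃ _ (by omega)) (mono (by omega)) b₃
    refine ⟨_, σ₄, .seq x₁ (.iteFalse fits hc (.seq x₂ (.seq (x₃'.mono hww) x₄))), ?_, hans⟩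
    have hqle : (d.queries P).length ≤ cq * Z := (length_queries_le_pow hP few₁).trans
      (Nat.mul_le_mul_left _ (pw (by have := p.r_le; omega)))
    have hnE : d.n * d.E P ≤ (p.B ^ p.g * (p.B ^ p.g + 2)) * Z := by
      calc d.n * d.E P ≤ (p.B ^ p.g * d.W ^ p.g) * ((p.B ^ p.g + 2) * d.W ^ p.r) :=
            Nat.mul_le_mul d.n_le (d.E_le P)
        _ = (p.B ^ p.g * (p.B ^ p.g + 2)) * d.W ^ (p.g + p.r) := by rw [pow_add]; ring
        _ ≤ _ := Nat.mul_le_mul_left _ (pw (by have := p.r_le; omega))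
    have l₂' : a₂ ≤ (c₂ * 2 + c₂ * (p.B ^ p.g * (p.B ^ p.g + 2)) + c₂ * cq) * Z := by
      have e₁ := Nat.mul_le_mul_left c₂ (pw (a := p.k + 2) (by
        have := p.ryy_le; unfold Params.k; omega))
      have e₂ := Nat.mul_le_mul_left c₂ (pw (a := p.g + p.y) (by have := p.y_lt; omega))
      have e₃ := Nat.mul_le_mul_left c₂ hnE
      have e₄ := Nat.mul_le_mul_left c₂ hqle
      calc a₂ ≤ _ := l₂
        _ ≤ c₂ * Z + c₂ * Z + c₂ * (p.B ^ p.g * (p.B ^ p.g + 2) * Z) + c₂ * (cq * Z) := by omega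
        _ = _ := by ring
    have l₄' : a₄ ≤ (c₃ + c₃ * cq + c₃ * (2 * p.θ)) * Z := by
      have e₁ := Nat.mul_le_mul_left c₃ (tripleCount_mul_s_le few₂)
      rw [← hZ] at e₁
      have e₂ := Nat.mul_le_mul_left c₃ hqle
      have e₃ := Nat.mul_le_mul_left c₃ hZ1
      calc a₄ ≤ _ := l₄
        _ = c₃ * 1 + c₃ * (d.queries P).length + c₃ * ((d.s + 1) * tripleCount d.S P p.k) := by ring
        _ ≤ c₃ * Z + c₃ * (cq * Z) + c₃ * (2 * p.θ * Z) := by omega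
        _ = _ := by ring
    have l₅ : p.testE.cost + 1 ≤ (p.testE.cost + 1) * Z := Nat.le_mul_of_pos_right _ hZ1
    have hsum : a₁ + (p.testE.cost + 1 + (a₂ + a₄)) ≤ (K₁ + K₂ + K₃ + K₄ + 2 + c₁ + p.testE.cost + 3
        + c₂ * 2 + c₂ * (p.B ^ p.g * (p.B ^ p.g + 2)) + c₂ * cq + c₃ + c₃ * cq + c₃ * (2 * p.θ)) * Z := by
      refine (Nat.add_le_add l₁' (Nat.add_le_add l₅ (Nat.add_le_add l₂' l₄'))).trans ?_
      rw [← add_mul, ← add_mul, ← add_mul]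
      exact Nat.mul_le_mul_right _ (by omega)
    have hsum' : ((a₁ + (p.testE.cost + 1 + (a₂ + a₄)) : ℕ) : ℝ) ≤ _ := Nat.cast_le.2 hsum
    rw [Nat.cast_mul, hZ, Nat.cast_pow] at hsum'
    refine le_trans (le_of_eq ?_) (add_le_add hsum' l₃)
    push_cast
    ring
  -- Too many triples survive although the choice was greedy; this is impossible without a solution.
  · have hsol : ThreeSum.HasSolution d.A := by
      by_contra hno
      have hf := hfew hno P hG
      exact hc (htest.2 ⟨hf _ (by unfold Params.k; omega), hf _ le_rfl⟩)
    have x₂ : Exec w (.assign 0 (.const 1)) σ₁ _ _ := .assign σ₁ 0 (.const 1) (by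
      have := mono (a := 1) (by omega)
      rw [pow_one] at this
      exact lt_of_lt_of_le (by omega : 1 < d.M) this)
    refine ⟨_, _, .seq x₁ (.iteTrue fits hc x₂), ?_, Or.inl ⟨hsol, by simp⟩⟩
    have l₅ : p.testE.cost + 1 + 2 ≤ (p.testE.cost + 3) * Z := Nat.le_mul_of_pos_right _ hZ1
    have hsum : a₁ + (p.testE.cost + 1 + 2) ≤ (K₁ + K₂ + K₃ + K₄ + 2 + c₁ + p.testE.cost + 3
        + c₂ * 2 + c₂ * (p.B ^ p.g * (p.B ^ p.g + 2)) + c₂ * cq + c₃ + c₃ * cq + c₃ * (2 * p.θ)) * Z := by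
      refine (Nat.add_le_add l₁' l₅).trans ?_
      rw [← add_mul]
      exact Nat.mul_le_mul_right _ (by omega)
    have hsum' : ((a₁ + (p.testE.cost + 1 + 2) : ℕ) : ℝ) ≤ _ := Nat.cast_le.2 hsum
    rw [Nat.cast_mul, hZ, Nat.cast_pow] at hsum'
    exact hsum'.trans (le_add_of_nonneg_right hT)

end Input

/-! ## The choice of the constants -/

/-- The size conditions compare a constant times a power of `W` with a real power of `C * W ^ g`.
They split into one condition on the constants, met by a large `C`, and one on the exponents of `W`.
-/
theorem mul_pow_le_mul_rpow {W C c D x : ℝ} {a g : ℕ} (hW : 1 ≤ W) (hC : 1 ≤ C) (hc : 0 ≤ c)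
    (h : c ≤ D * C ^ x) (ha : (a : ℝ) ≤ g * x) : c * W ^ a ≤ D * (C * W ^ g) ^ x := by
  have hW0 : 0 ≤ W := by linarith
  rw [Real.mul_rpow (by linarith) (by positivity), ← mul_assoc, ← Real.rpow_natCast W g,
    ← Real.rpow_mul hW0, ← Real.rpow_natCast W a]
  exact mul_le_mul h (Real.rpow_le_rpow_of_exponent_le hW ha) (by positivity) (hc.trans h)

theorem mul_pow_rpow_le {W C x : ℝ} {a g : ℕ} (hW : 1 ≤ W) (hC : 1 ≤ C)
    (ha : (g : ℝ) * x ≤ a) : (C * W ^ g) ^ x ≤ C ^ x * W ^ a := by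
  have hW0 : 0 ≤ W := by linarith
  rw [Real.mul_rpow (by linarith) (by positivity), ← Real.rpow_natCast W g,
    ← Real.rpow_mul hW0, ← Real.rpow_natCast W a]
  exact mul_le_mul_of_nonneg_left (Real.rpow_le_rpow_of_exponent_le hW ha) (by positivity)

theorem exists_nat_le_mul_rpow {D x : ℝ} (hD : 0 < D) (hx : 0 < x) (b : ℝ) :
    ∀ᶠ n : ℕ in Filter.atTop, b ≤ D * (n : ℝ) ^ x :=
  (((tendsto_rpow_atTop hx).comp tendsto_natCast_atTop_atTop).const_mul_atTop hD).eventually_ge_atTop b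

/-- Polynomially bounded numbers are words of `O(log n)` bits: `n ^ j` uses `j` units of word
length, and the constant `c` uses at most `c` more. -/
theorem lt_two_pow_log {c j m n x : ℕ} (hn : 1 ≤ n) (hx : x ≤ c * n ^ j) (hm : c + j ≤ m) :
    x < 2 ^ (m * (Nat.log 2 n + 1)) := by
  have h₁ : n ≤ 2 ^ (Nat.log 2 n + 1) := (Nat.lt_pow_succ_log_self (by norm_num) n).le
  have h₂ : c < 2 ^ (c * (Nat.log 2 n + 1)) :=
    Nat.lt_two_pow_self.trans_le (Nat.pow_le_pow_right (by norm_num) (Nat.le_mul_of_pos_right _ (by omega)))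
  calc x ≤ c * n ^ j := hx
    _ < 2 ^ (c * (Nat.log 2 n + 1)) * n ^ j := Nat.mul_lt_mul_of_pos_right h₂ (Nat.one_le_pow _ _ hn)
    _ ≤ 2 ^ (c * (Nat.log 2 n + 1)) * (2 ^ (Nat.log 2 n + 1)) ^ j :=
      Nat.mul_le_mul_left _ (Nat.pow_le_pow_left h₁ j)
    _ = 2 ^ ((c + j) * (Nat.log 2 n + 1)) := by rw [← pow_mul, ← pow_add]; congr 1; ring
    _ ≤ _ := Nat.pow_le_pow_right (by norm_num) (Nat.mul_le_mul_right _ hm)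

namespace Input

/-- With words of length a large multiple of `log n`, every 3SUM instance is an input. -/
theorem exists_input (p : Params) : ∃ m₀ : ℕ, ∀ m, m₀ ≤ m → ∀ A : List ℕ, 1 ≤ A.length → A.Nodup →
    (∀ a ∈ A, 1 ≤ a ∧ a ≤ A.length ^ p.c) →
      ∃ d : Input p, d.A = A ∧ d.M = 2 ^ (m * (Nat.log 2 A.length + 1)) := by
  obtain ⟨c₁, hc₁⟩ : ∃ x, x = 2 ^ p.B + 1 := ⟨_, rfl⟩
  obtain ⟨c₂, hc₂⟩ : ∃ x, x = p.k + 2 := ⟨_, rfl⟩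
  obtain ⟨c₃, hc₃⟩ : ∃ x, x = p.L + p.k := ⟨_, rfl⟩
  obtain ⟨c₄, hc₄⟩ : ∃ x, x = 4 * (p.B ^ p.g + 3) ^ 2 := ⟨_, rfl⟩
  refine ⟨1 + p.c + c₁ + p.B + c₂ + (2 * p.k + 1) + 5 + c₃ + c₄ + p.C + p.g',
    fun m hm A hn hnd hA => ?_⟩
  set n := A.length with hn'
  set l := Nat.log (p.B ^ p.g) n with hl
  have hB := p.one_lt_B
  have hg : p.g ≠ 0 := by have := p.r_le; omega
  have hpow : (p.B ^ l) ^ p.g ≤ n := by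
    rw [← pow_mul, mul_comm, pow_mul]
    exact Nat.pow_log_le_self _ (by omega)
  have hlt : n < (p.B * p.B ^ l) ^ p.g := by
    rw [mul_pow, ← pow_mul, mul_comm l, pow_mul, ← pow_succ']
    exact Nat.lt_pow_succ_log_self (Nat.one_lt_pow hg hB) _
  have hW1 : 1 ≤ p.B ^ l := Nat.one_le_pow _ _ (by omega)
  have hW : p.B ^ l ≤ n := (Nat.le_self_pow hg _).trans hpow
  have hln : l ≤ n := (Nat.lt_pow_self hB).le.trans hW
  -- The base `L = 2 * B` is at most `B ^ 2`, so the spread of `W` is at most `W ^ 2`.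
  have hL : p.L ^ l ≤ n ^ 2 := by
    calc p.L ^ l ≤ (p.B ^ 2) ^ l :=
          Nat.pow_le_pow_left (by rw [p.L_eq, sq]; exact Nat.mul_le_mul_right _ hB) _
      _ = (p.B ^ l) ^ 2 := by rw [← pow_mul, ← pow_mul, mul_comm]
      _ ≤ n ^ 2 := Nat.pow_le_pow_left hW 2
  have one : ∀ j, 1 ≤ n ^ j := fun j => Nat.one_le_pow _ _ hn
  refine ⟨⟨A, l, 2 ^ (m * (Nat.log 2 n + 1)), hnd, hn, hA, hpow, hlt, ?_, ?_, ?_, ?_, ?_, ?_, ?_, ?_,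
    ?_⟩, rfl, rfl⟩
  · exact lt_two_pow_log (c := 1) (j := 1) hn (by simp [hn']) (by omega)
  · exact lt_two_pow_log (c := 1) (j := p.c) hn (by simp [hn']) (by omega)
  · refine lt_two_pow_log (c := c₁) (j := p.B) hn ?_ (by omega)
    have : (n + 1) ^ p.B ≤ (2 * n) ^ p.B := Nat.pow_le_pow_left (by omega) _
    rw [mul_pow] at this
    rw [hc₁, add_mul, one_mul]
    exact Nat.add_le_add this (one _)
  · refine lt_two_pow_log (c := c₂) (j := 2 * p.k + 1) hn ?_ (by omega)
    have h₁ : (p.L ^ l) ^ p.k ≤ n ^ (2 * p.k) := by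
      rw [pow_mul]; exact Nat.pow_le_pow_left hL _
    have h₂ : p.k * l + 1 ≤ (p.k + 1) * n := by nlinarith
    calc (p.k * l + 1) * (p.L ^ l) ^ p.k + 1 ≤ (p.k + 1) * n * n ^ (2 * p.k) + n ^ (2 * p.k + 1) :=
          Nat.add_le_add (Nat.mul_le_mul h₂ h₁) (one _)
      _ = _ := by rw [hc₂, pow_succ]; ring
  · refine lt_two_pow_log (c := 2) (j := p.k) hn ?_ (by omega)
    have := Nat.pow_le_pow_left hW p.k
    have := one p.k
    omega
  · exact lt_two_pow_log (c := c₃) (j := 0) hn (by simp [hc₃]) (by omega)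
  · refine lt_two_pow_log (c := 2) (j := 3) hn ?_ (by omega)
    have := one 3
    change n ^ 3 + 1 ≤ 2 * n ^ 3
    omega
  · exact lt_two_pow_log (c := c₄) (j := 3) hn (le_of_eq (by rw [hc₄])) (by omega)
  · exact lt_two_pow_log (c := p.C) (j := p.g') hn
      (Nat.mul_le_mul_left _ (Nat.pow_le_pow_left hW _)) (by omega)

end Input

/-- The constants that are used for the threshold `h`. -/
theorem exists_params {g h : ℕ} (hg : h + 14 ≤ g) (c θ C : ℕ) (hC : 1 ≤ C) : ∃ p : Params,
    p.c = c ∧ p.g = g ∧ p.r = h + 12 ∧ p.y = g - h - 8 ∧ p.θ = θ ∧ p.C = C ∧ p.g' = g + 16 :=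
  ⟨⟨c, g, h + 12, g - h - 8, θ, C, g + 16, by omega, hC, by omega, by omega, by omega,
    by omega⟩, rfl, rfl, rfl, rfl, rfl, rfl, rfl⟩

theorem theorem1p4 (α : ℝ) (hα₀ : 0 ≤ α) (hα₁ : α < 1)
    (h3SUM : ThreeSum.DeterministicHypothesis)
    (C₁ C₂ C₃ C₄ : ℝ) (hC₁ : 0 < C₁) (hC₂ : 0 < C₂) (hC₃ : 0 < C₃) (hC₄ : 0 < C₄)
    (ε : ℝ) (hε : 0 < ε) :
    ¬ SetDisjointness.SolvableInTime
        (fun n => C₁ * (n : ℝ) ^ (2 - 2 * α))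
        (fun n => C₂ * (n : ℝ))
        (fun n => C₃ * (n : ℝ) ^ (1 - α))
        (fun n => C₄ * (n : ℝ) ^ (1 + α))
        (fun n => (n : ℝ) ^ (2 - ε)) := by
  rintro ⟨q, κ', K', hq⟩
  obtain ⟨ε₁, hε₁, hε₁', hε₂⟩ : ∃ ε₁ : ℝ, 0 < ε₁ ∧ ε₁ ≤ ε ∧ ε₁ ≤ 1 :=
    ⟨min ε 1, lt_min hε one_pos, min_le_left _ _, min_le_right _ _⟩
  -- The exponents.
  obtain ⟨g, hgα, hgε⟩ : ∃ g : ℕ, 15 ≤ (1 - α) * g ∧ 33 ≤ ε₁ * g := by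
    obtain ⟨g₁, h₁⟩ := exists_nat_ge (15 / (1 - α))
    obtain ⟨g₂, h₂⟩ := exists_nat_ge (33 / ε₁)
    rw [div_le_iff₀ (by linarith)] at h₁
    rw [div_le_iff₀ hε₁] at h₂
    refine ⟨g₁ + g₂, ?_, ?_⟩
    · push_cast; nlinarith [(Nat.cast_nonneg g₂ : (0 : ℝ) ≤ g₂)]
    · push_cast; nlinarith [(Nat.cast_nonneg g₁ : (0 : ℝ) ≤ g₁)]
  -- Up to rounding, `W ^ h` is `n ^ α`. The bound `15` above leaves room for `h + 14 ≤ g`. The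
  -- bound `33` pays for the factor `W ^ 32` that a call with `W ^ (g + 16)` costs beyond `W ^ (2 *
  -- g)`, and saves one further `W`.
  set h := ⌈α * g⌉₊ with hh
  have hh₁ : α * g ≤ h := Nat.le_ceil _
  have hh₂ : (h : ℝ) < α * g + 1 := Nat.ceil_lt_add_one (by positivity)
  have hgh : h + 14 ≤ g := by
    have : ((h + 14 : ℕ) : ℝ) ≤ g := by push_cast; linarith
    exact_mod_cast this
  have hg0 : (0 : ℝ) < g := by
    have : 0 < g := by omega
    exact_mod_cast this
  -- The total time will be `W ^ (2 * g - 1)`, which is at most `n ^ (2 - 1 / g)`.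
  obtain ⟨c, hc⟩ := h3SUM (1 / g) (by positivity)
  refine hc ?_
  -- The constants.
  set k := h + 12 + 2 * (g - h - 8) with hk
  set B := 2 ^ (2 * k + 3) with hB
  obtain ⟨θ, -, hθ⟩ := exists_tripleCount_bound B g c k (by omega)
  set cq := B ^ g * (B ^ g + 2) + B ^ (2 * g) + θ with hcq
  -- All four size bounds grow with a positive power of the parameter of the call, since `0 ≤ α <
  -- 1`. So a constant factor `C` in it compensates for small `C₁, …, C₄` and for the constants of
  -- the reduction.
  obtain ⟨C, hCge, hCU, hCN, hCs, hCq⟩ : ∃ C : ℕ, 1 ≤ C ∧ 1 ≤ C₁ * (C : ℝ) ^ (2 - 2 * α) ∧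
      ((2 * (B ^ g + 2) : ℕ) : ℝ) ≤ C₂ * (C : ℝ) ^ (1 : ℝ) ∧ 1 ≤ C₃ * (C : ℝ) ^ (1 - α) ∧
      (cq : ℝ) ≤ C₄ * (C : ℝ) ^ (1 + α) :=
    ((Filter.eventually_ge_atTop 1).and ((exists_nat_le_mul_rpow hC₁ (by linarith) 1).and
      ((exists_nat_le_mul_rpow hC₂ one_pos _).and ((exists_nat_le_mul_rpow hC₃ (by linarith) 1).and
        (exists_nat_le_mul_rpow hC₄ (by linarith) _))))).exists
  obtain ⟨p, pc, pg, pr, py, pθ, pC, pg'⟩ := exists_params hgh c θ C hCge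
  have pk : p.k = k := by rw [Params.k, pr, py]
  have pB : p.B = B := by rw [Params.B, Params.b, pk]
  have hg' : (p.g' : ℝ) = g + 16 := by rw [pg']; push_cast; rfl
  have hr : (p.r : ℝ) = h + 12 := by rw [pr]; push_cast; rfl
  have hy : (p.y : ℝ) = g - h - 8 := by
    rw [py, Nat.cast_sub (by omega), Nat.cast_sub (by omega)]; norm_num
  obtain ⟨K, c₀, hmain⟩ := Input.mainProg_spec p
  obtain ⟨m₀, hm₀⟩ := Input.exists_input p
  -- Words are long enough for the tables, for the constants of the programs and for the words of
  -- the subroutine on the parameter `C * W ^ g'`.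
  set m := m₀ + K + κ' * (C + p.g') with hm
  set K₂ := max K' 0 * (C : ℝ) ^ (2 - ε₁) with hK₂
  have hK₂0 : 0 ≤ K₂ := by positivity
  refine ⟨p.mainProg q, m * c₀, K + K₂, fun n hn A hAn hnd hA => ?_⟩
  subst hAn
  obtain ⟨d, rfl, hM⟩ := hm₀ m (by omega) A hn hnd (by rwa [pc])
  have hC1 : (1 : ℝ) ≤ C := by exact_mod_cast hCge
  have hW1 : (1 : ℝ) ≤ d.W := by exact_mod_cast d.W_pos
  set n' := p.C * d.W ^ p.g' with hn'
  have hn'1 : 1 ≤ n' := Nat.mul_pos p.one_le_C (Nat.one_le_pow _ _ d.W_pos)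
  have hn'r : (n' : ℝ) = (C : ℝ) * (d.W : ℝ) ^ p.g' := by rw [hn', pC]; push_cast; rfl
  have hword : wordSize κ' n' ≤ m * (Nat.log 2 d.A.length + 1) := by
    have h₁ : n' < 2 ^ ((C + p.g') * (Nat.log 2 d.A.length + 1)) :=
      lt_two_pow_log hn (Nat.mul_le_mul (le_of_eq pC) (Nat.pow_le_pow_left d.W_le_n _)) le_rfl
    have h₂ := Nat.log_lt_of_lt_pow (by omega) h₁
    calc wordSize κ' n' ≤ κ' * ((C + p.g') * (Nat.log 2 d.A.length + 1)) := Nat.mul_le_mul_left _ h₂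
      _ = κ' * (C + p.g') * (Nat.log 2 d.A.length + 1) := by ring
      _ ≤ _ := Nat.mul_le_mul_right _ (by omega)
  have hWn : (d.W : ℝ) ^ (2 * g - 1) ≤ (d.A.length : ℝ) ^ (2 - 1 / (g : ℝ)) := by
    have h₁ : ((d.W : ℝ) ^ g) ≤ d.A.length := by
      have := d.W_pow_g_le
      rw [pg] at this
      exact_mod_cast this
    calc (d.W : ℝ) ^ (2 * g - 1) = ((d.W : ℝ) ^ g) ^ (2 - 1 / (g : ℝ)) := by
          rw [← Real.rpow_natCast, ← Real.rpow_natCast, ← Real.rpow_mul (by positivity)]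
          congr 1
          rw [Nat.cast_sub (by omega)]
          push_cast
          field_simp
      _ ≤ _ := Real.rpow_le_rpow (by positivity) h₁ (by
          have : 1 / (g : ℝ) ≤ 1 := by
            rw [div_le_one hg0]
            have : 1 ≤ g := by omega
            exact_mod_cast this
          linarith)
  -- The exponent `(g + 16) * (2 - ε₁)` is at most `2 * g - 1` because `ε₁ * g ≥ 33`. The maximum
  -- with `0` covers a negative constant `K'`.
  have hT : max K' 0 * (n' : ℝ) ^ (2 - ε₁) ≤ K₂ * (d.W : ℝ) ^ (2 * g - 1) := by
    rw [hK₂, mul_assoc, hn'r]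
    refine mul_le_mul_of_nonneg_left (mul_pow_rpow_le hW1 hC1 ?_) (le_max_right _ _)
    rw [pg', Nat.cast_sub (by omega)]
    push_cast
    rw [show ((g : ℝ) + 16) * (2 - ε₁) = 2 * g + 32 - ε₁ * g - 16 * ε₁ by ring]
    linarith
  obtain ⟨t, σ, hx, ht, hans⟩ := hmain d q (wordSize (m * c₀) d.A.length)
    (m * (Nat.log 2 d.A.length + 1)) (K₂ * (d.W : ℝ) ^ (2 * g - 1)) hM
    (by
      rw [hM]
      exact (lt_two_pow_log (c := K) (j := 0) hn (by simp) (by omega)).le)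
    (by
      rw [hM, ← pow_mul]
      exact Nat.pow_le_pow_right (by norm_num) (le_of_eq (by unfold wordSize; ring)))
    (fun hno P hP j hj => by
      rw [Input.Few, pθ, pg]
      refine hθ d.W d.n d.W_pos d.n_pos ?_ d.S d.card_S (fun a ha => ?_) ?_ P (by rwa [← pk]) j
        (by rwa [← pk])
      · rw [← pB, ← pg]; exact d.lt_pow.le
      · rw [← pc]; exact (d.mem a (d.mem_S.1 ha)).2
      · simpa only [Input.mem_S, ThreeSum.HasSolution] using hno)
    (by positivity)
    (fun P hP hfew => by
      have hlen := Input.length_queries_le_pow hP hfew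
      rw [pB, pg, pθ, pr] at hlen
      -- The four conditions are inequalities between exponents of `W`: `2 * y`, `r + y`, `g - r`
      -- and `g + r + 1` against `g + 16` times `2 - 2 * α`, `1`, `1 - α` and `1 + α`. They follow
      -- from `α * g ≤ h < α * g + 1`.
      have hU : (d.V : ℝ) ≤ C₁ * (n' : ℝ) ^ (2 - 2 * α) := by
        have := mul_pow_le_mul_rpow (a := 2 * p.y) (g := p.g') hW1 hC1 zero_le_one hCU (by
          push_cast
          rw [hy, hg', show ((g : ℝ) + 16) * (2 - 2 * α) = 2 * g - 2 * (α * g) + 32 * (1 - α) by ring]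
          linarith)
        rwa [one_mul, ← hn'r, ← Nat.cast_pow] at this
      have hN : ((2 * d.E P * d.Y : ℕ) : ℝ) ≤ C₂ * (n' : ℝ) := by
        have h₁ : 2 * d.E P * d.Y ≤ 2 * (B ^ g + 2) * d.W ^ (p.r + p.y) := by
          have := d.E_le P
          rw [pB, pg] at this
          calc 2 * d.E P * d.Y ≤ 2 * ((B ^ g + 2) * d.R) * d.Y :=
                Nat.mul_le_mul_right _ (Nat.mul_le_mul_left _ this)
            _ = _ := by rw [pow_add, Input.R, Input.Y]; ring
        have h₂ := mul_pow_le_mul_rpow (a := p.r + p.y) (g := p.g') hW1 hC1 (Nat.cast_nonneg _) hCN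
          (by push_cast; rw [hy, hg', hr]; linarith)
        rw [← hn'r, Real.rpow_one] at h₂
        refine le_trans ?_ h₂
        exact_mod_cast h₁
      have hs : (d.s : ℝ) ≤ C₃ * (n' : ℝ) ^ (1 - α) := by
        have := mul_pow_le_mul_rpow (a := p.g - p.r) (g := p.g') hW1 hC1 zero_le_one hCs (by
          rw [Nat.cast_sub (by have := p.r_le; omega), hg', hr, pg,
            show ((g : ℝ) + 16) * (1 - α) = g - α * g + 16 * (1 - α) by ring]
          linarith)
        rwa [one_mul, ← hn'r, ← Nat.cast_pow] at this
      have hQ : ((d.queries P).length : ℝ) ≤ C₄ * (n' : ℝ) ^ (1 + α) := by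
        have := mul_pow_le_mul_rpow (a := g + (h + 12) + 1) (g := p.g') hW1 hC1 (Nat.cast_nonneg _)
          hCq (by
            push_cast
            rw [hg', show ((g : ℝ) + 16) * (1 + α) = g + α * g + 16 + 16 * α by ring]
            linarith)
        rw [← hn'r] at this
        refine le_trans ?_ this
        exact_mod_cast hlen
      obtain ⟨t, σ, hx, ht, hcor⟩ := hq n' hn'1 (d.inst hP) hU hN hs
        (by simpa only [SetDisjointness.Instance.q, Input.inst, List.length_map] using hQ)
      refine ⟨t, σ, hx.mono hword, ht.trans (le_trans ?_ hT), hcor⟩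
      have h1 : (1 : ℝ) ≤ n' := by exact_mod_cast hn'1
      exact mul_le_mul (le_max_left _ _)
        (Real.rpow_le_rpow_of_exponent_le h1 (by linarith)) (by positivity) (le_max_right _ _))
  refine ⟨t, σ, hx, ht.trans ?_, hans⟩
  rw [pg, ← add_mul]
  exact mul_le_mul_of_nonneg_left hWn (by positivity)
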